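/- Let $0<\alpha\le 1$ and let $D\subset\mathbb R^2$ be a bounded simply connected domain whose boundary is a closed Jordan curve of class $C^{1,\alpha}$, with arc length $\sigma$ and outward unit normal $\nu=(\nu_1,\nu_2)$. Let $L^2(\partial D)$ be the complex $L^2$ space of $\sigma$, let $L^2_0(\partial D)=\{\phi\in L^2(\partial D):\int_{\partial D}\phi\,d\sigma=0\}$, and put $$\mathcal S[\phi](x)=\frac1{2\pi}\int_{\partial D}\log|x-y|\,\phi(y)\,d\sigma(y),\qquad \mathcal K^*[\phi](x)=\frac1{2\pi}\int_{\partial D}\frac{\langle x-y,\nu_x\rangle}{|x-y|^2}\,\phi(y)\,d\sigma(y),$$ $$M(\lambda,D)_{jk}=\int_{\partial D}y_j\,(\lambda I-\mathcal K^*)^{-1}[\nu_k](y)\,d\sigma(y)\qquad(\lambda\in\mathbb C\setminus\sigma(\mathcal K^*),\ 1\le j,k\le 2),$$ where $\sigma(\mathcal K^*)$ is the spectrum of $\mathcal K^*$ on $L^2(\partial D)$. Then $\mathcal S$ and $\mathcal K^*$ are bounded operators on $L^2(\partial D)$, $\mathcal K^*$ maps $L^2_0(\partial D)$ into itself, and $\langle\phi,\psi\rangle_{\mathcal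 H}=-\langle\phi,\mathcal S\psi\rangle_{L^2(\partial D)}$ is an inner product on $L^2_0(\partial D)$. Let $\mathcal H$ be the completion of $L^2_0(\partial D)$ for this inner product. The operator $\mathcal K^*$ and the functionals $\phi\mapsto\langle\phi,y_j\rangle=\int_{\partial D}y_j\,\phi(y)\,d\sigma(y)$ extend from $L^2_0(\partial D)$ to bounded maps on $\mathcal H$, denoted in the same way, and there are numbers $0\le\lambda_i<\frac12$ with $\lambda_i\to0$ and a complete orthonormal set $\{\phi_i^+,\phi_i^-\}_{i\ge1}$ of $\mathcal H$ with $\mathcal K^*\phi_i^\pm=\pm\lambda_i\phi_i^\pm$ for all $i\ge 1$. Fix any such system. Let $f$ be holomorphic on an open set $U\subset\mathbb C$ that contains $\sigma(\mathcal K^*)$. Let $\gamma$ be a piecewise $C^1$ closed curve in $U\setminus\sigma(\mathcal K^*)$ whose winding number is $1$ about every point of $\sigma(\mathcal K^*)$ and $0$ about every point outside $U$ (for instance a positively oriented simple closed curve in $U$ whose interior lies in $U$ and contains $\sigma(\mathcal K^*)$). Then the series $$f(\mathcal K^*)[h]=\sum_{i=1}^\infty\Big[f(\lambda_i)\,\langle\phi_i^+,h\rangle_{\mathcal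 H}\,\phi_i^++f(-\lambda_i)\,\langle\phi_i^-,h\rangle_{\mathcal H}\,\phi_i^-\Big]$$ converges unconditionally in $\mathcal H$ for every $h\in\mathcal H$, the elements $f(\mathcal K^*)[\nu_k]$ belong to $L^2_0(\partial D)$, and for all $j,k\in\{1,2\}$ $$\frac1{2\pi i}\int_\gamma f(\lambda)\,M(\lambda,D)_{jk}\,d\lambda=\int_{\partial D}y_j\,f(\mathcal K^*)[\nu_k](y)\,d\sigma(y)=\sum_{i=1}^\infty\Big[c_{i,jk}^+\,f(\lambda_i)+c_{i,jk}^-\,f(-\lambda_i)\Big],$$ where $c_{i,jk}^\pm=\langle\phi_i^\pm,\nu_k\rangle_{\mathcal H}\,\langle\phi_i^\pm,y_j\rangle$ (inner products are conjugate linear in the first variable, the pairing $\langle\cdot,y_j\rangle$ is linear) and the last series converges unconditionally. -/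

import Mathlib

open MeasureTheory Filter Topology Set

noncomputable section

/-- A bounded simply connected domain of class `C^{1,a}` in the plane `ℝ² = ℂ`: a bounded domain
whose boundary is a closed Jordan curve with a regular `1`-periodic parametrization `z` whose
derivative is `a`-Hölder.  The domain lies to the left of the curve. -/
structure PlanarDomain (a : ℝ) where
  carrier : Set ℂ
  z : ℝ → ℂ
  isOpen : IsOpen carrier
  isConnected : IsConnected carrier
  isBounded : Bornology.IsBounded carrier
  periodic : Function.Periodic z 1
  injOn : InjOn z (Ioc 0 1)
  contDiff : ContDiff ℝ 1 z
  regular : ∀ t, deriv z t ≠ 0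
  holder : ∃ C : ℝ, ∀ s t : ℝ, ‖deriv z s - deriv z t‖ ≤ C * |s - t| ^ a
  frontier_eq : frontier carrier = range z
  leftOf : ∀ t, ∀ᶠ s : ℝ in 𝓝[>] (0 : ℝ), z t + (s : ℂ) * (Complex.I * deriv z t) ∈ carrier

/-- The Cartesian coordinates `y₁, y₂` of a point of the plane. -/
def coord (j : Fin 2) (y : ℂ) : ℝ := ![y.re, y.im] j

namespace PlanarDomain

variable {a : ℝ} (D : PlanarDomain a)

/-- Arc length `σ` on `∂D`. -/
def arcLength : Measure ℂ :=
  ((volume.restrict (Ioc (0 : ℝ) 1)).withDensity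
    (fun t => ENNReal.ofReal ‖deriv D.z t‖)).map D.z

/-- The outward unit normal at `z t`. -/
def normalAt (t : ℝ) : ℂ := -Complex.I * (deriv D.z t / (‖deriv D.z t‖ : ℂ))

/-- The outward unit normal `ν` as a function on `∂D` (and zero off `∂D`). -/
def normal : ℂ → ℂ :=
  Function.extend (fun t : Ioc (0 : ℝ) 1 => D.z t) (fun t => D.normalAt t) 0

theorem continuous_deriv : Continuous (deriv D.z) := D.contDiff.continuous_deriv le_rfl

theorem measurableEmbedding : MeasurableEmbedding (fun t : Ioc (0 : ℝ) 1 => D.z t) := by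
  have := (measurableSet_Ioc : MeasurableSet (Ioc (0 : ℝ) 1)).standardBorel
  exact (D.contDiff.continuous.comp continuous_subtype_val).measurable.measurableEmbedding
    (fun s t h => Subtype.ext (D.injOn s.2 t.2 h))

theorem continuous_normalAt : Continuous D.normalAt := by
  unfold normalAt
  exact continuous_const.mul (D.continuous_deriv.div
    (Complex.continuous_ofReal.comp D.continuous_deriv.norm)
    (fun t => by simpa using D.regular t))

theorem measurable_normal : Measurable D.normal :=
  D.measurableEmbedding.measurable_extend
    (D.continuous_normalAt.measurable.comp measurable_subtype_coe) measurable_const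

theorem normal_z {t : ℝ} (ht : t ∈ Ioc (0 : ℝ) 1) : D.normal (D.z t) = D.normalAt t :=
  D.measurableEmbedding.injective.extend_apply (fun t : Ioc (0 : ℝ) 1 => D.normalAt t) 0 ⟨t, ht⟩

theorem norm_normalAt (t : ℝ) : ‖D.normalAt t‖ = 1 := by
  have := D.regular t
  simp [normalAt, this]

theorem norm_normal_le (x : ℂ) : ‖D.normal x‖ ≤ 1 := by
  by_cases h : ∃ t : Ioc (0 : ℝ) 1, D.z t = x
  · obtain ⟨t, rfl⟩ := h
    rw [D.normal_z t.2, D.norm_normalAt]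
  · rw [normal, Function.extend_apply' _ _ _ h]
    simp

theorem integral_arcLength (g : ℂ → ℂ) (hg : Measurable g) :
    ∫ x, g x ∂D.arcLength = ∫ t in (0 : ℝ)..1, (‖deriv D.z t‖ : ℂ) * g (D.z t) := by
  rw [arcLength, integral_map D.contDiff.continuous.measurable.aemeasurable
    hg.aestronglyMeasurable, intervalIntegral.integral_of_le zero_le_one]
  rw [integral_withDensity_eq_integral_toReal_smul
    (by exact (D.continuous_deriv.norm.measurable).ennreal_ofReal) (by simp)]
  simp

instance : IsFiniteMeasure D.arcLength := by
  unfold arcLength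
  have : IsFiniteMeasure ((volume.restrict (Ioc (0 : ℝ) 1)).withDensity
      (fun t => ENNReal.ofReal ‖deriv D.z t‖)) :=
    isFiniteMeasure_withDensity_ofReal
      ((D.continuous_deriv.norm.integrableOn_Icc (a := 0) (b := 1)).mono_set
        Ioc_subset_Icc_self).2
  infer_instance

/-- Complex `L²(∂D)`. -/
abbrev L2 : Type := Lp ℂ 2 D.arcLength

theorem integrable_L2 (φ : D.L2) : Integrable φ D.arcLength :=
  (Lp.memLp φ).integrable (by norm_num)

/-- `L²₀(∂D)`, the functions in `L²(∂D)` with zero mean. -/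
def L20 : Submodule ℂ D.L2 where
  carrier := {φ | ∫ x, φ x ∂D.arcLength = 0}
  zero_mem' := by
    rw [mem_ofPred_eq, integral_congr_ae (Lp.coeFn_zero ℂ 2 D.arcLength)]
    simp
  add_mem' {φ ψ} hφ hψ := by
    rw [mem_ofPred_eq] at *
    rw [integral_congr_ae (Lp.coeFn_add φ ψ)]
    simp only [Pi.add_apply]
    rw [integral_add (D.integrable_L2 φ) (D.integrable_L2 ψ), hφ, hψ, add_zero]
  smul_mem' c φ hφ := by
    rw [mem_ofPred_eq] at *
    rw [integral_congr_ae (Lp.coeFn_smul c φ)]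
    simp only [Pi.smul_apply]
    rw [integral_smul, hφ, smul_zero]

/-- The component `ν_k` of the outward normal as a complex valued function. -/
def normalComp (k : Fin 2) (x : ℂ) : ℂ := (coord k (D.normal x) : ℂ)

theorem measurable_normalComp (k : Fin 2) : Measurable (D.normalComp k) := by
  have h := D.measurable_normal
  unfold normalComp coord
  fin_cases k
  · exact Complex.measurable_ofReal.comp (Complex.measurable_re.comp h)
  · exact Complex.measurable_ofReal.comp (Complex.measurable_im.comp h)

theorem memLp_normalComp (k : Fin 2) : MemLp (D.normalComp k) 2 D.arcLength := by
  refine MemLp.of_bound (D.measurable_normalComp k).aestronglyMeasurable 1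
    (Eventually.of_forall fun x => ?_)
  refine le_trans ?_ (D.norm_normal_le x)
  unfold normalComp coord
  fin_cases k
  · simpa using Complex.abs_re_le_norm (D.normal x)
  · simpa using Complex.abs_im_le_norm (D.normal x)

theorem integral_normalComp (k : Fin 2) : ∫ x, D.normalComp k x ∂D.arcLength = 0 := by
  have hz : ∫ t in (0 : ℝ)..1, deriv D.z t = 0 := by
    rw [intervalIntegral.integral_deriv_eq_sub
      (fun t _ => (D.contDiff.differentiable (by norm_num)) t)
      (D.continuous_deriv.intervalIntegrable _ _)]
    have := D.periodic 0
    rw [zero_add] at this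
    rw [this, sub_self]
  have hi := D.continuous_deriv.intervalIntegrable (μ := volume) 0 1
  have hre : ∫ t in (0 : ℝ)..1, (deriv D.z t).re = 0 := by
    have := Complex.reCLM.intervalIntegral_comp_comm hi
    simpa [hz] using this
  have him : ∫ t in (0 : ℝ)..1, (deriv D.z t).im = 0 := by
    have := Complex.imCLM.intervalIntegral_comp_comm hi
    simpa [hz] using this
  rw [D.integral_arcLength _ (D.measurable_normalComp k)]
  have key : ∀ t ∈ Ioc (0 : ℝ) 1, (‖deriv D.z t‖ : ℂ) * D.normalComp k (D.z t)
      = ((![(deriv D.z t).im, -(deriv D.z t).re] k : ℝ) : ℂ) := by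
    intro t ht
    have hn : ‖deriv D.z t‖ ≠ 0 := by simpa using D.regular t
    unfold normalComp
    rw [D.normal_z ht, normalAt, ← Complex.ofReal_mul]
    congr 1
    fin_cases k
    · simp [coord, Complex.div_ofReal_im]
      field_simp
    · simp [coord, Complex.div_ofReal_re]
      field_simp
  rw [intervalIntegral.integral_of_le zero_le_one,
    setIntegral_congr_fun measurableSet_Ioc key,
    ← intervalIntegral.integral_of_le zero_le_one, intervalIntegral.integral_ofReal]
  fin_cases k
  · simpa using him
  · simpa using hre

/-- `ν_k` as an element of `L²₀(∂D)`. -/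
def nu (k : Fin 2) : D.L20 :=
  ⟨(D.memLp_normalComp k).toLp, by
    change ∫ x, _ ∂D.arcLength = 0
    rw [integral_congr_ae (D.memLp_normalComp k).coeFn_toLp]
    exact D.integral_normalComp k⟩

/-- The bounded operator `T` on `L²(∂D)` is the integral operator with kernel `k`:
`T φ (x) = ∫ k(x, y) φ(y) dσ(y)`, the integral converging absolutely for almost every `x`. -/
def IsIntegralOperator (k : ℂ → ℂ → ℝ) (T : D.L2 →L[ℂ] D.L2) : Prop :=
  ∀ φ : D.L2, ∀ᵐ x ∂D.arcLength,
    Integrable (fun y => (k x y : ℂ) * φ y) D.arcLength ∧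
      T φ x = ∫ y, (k x y : ℂ) * φ y ∂D.arcLength

open Classical in
/-- The bounded operator on `L²(∂D)` with kernel `k` (zero if there is none). -/
def integralOperator (k : ℂ → ℂ → ℝ) : D.L2 →L[ℂ] D.L2 :=
  if h : ∃ T, D.IsIntegralOperator k T then h.choose else 0

/-- The kernel `Γ(x - y) = (2π)⁻¹ log |x - y|` of the single layer potential. -/
def singleLayerKernel (x y : ℂ) : ℝ := 1 / (2 * Real.pi) * Real.log ‖x - y‖

/-- The Neumann-Poincaré kernel `(2π)⁻¹ ⟨x - y, ν_x⟩ / |x - y|²`. -/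
def npKernel (x y : ℂ) : ℝ :=
  1 / (2 * Real.pi) * (inner ℝ (x - y) (D.normal x) / ‖x - y‖ ^ 2)

/-- The single layer potential `𝒮` on `∂D`. -/
def singleLayer : D.L2 →L[ℂ] D.L2 := D.integralOperator singleLayerKernel

/-- The Neumann-Poincaré operator `𝒦*` on `L²(∂D)`. -/
def npOperator : D.L2 →L[ℂ] D.L2 := D.integralOperator D.npKernel

/-- The polarization tensor `M(l, D)_{jk} = ∫ y_j (l I - 𝒦*)⁻¹[ν_k](y) dσ(y)`. -/
def polarizationTensor (l : ℂ) : Matrix (Fin 2) (Fin 2) ℂ := Matrix.of fun j k =>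
  ∫ y, (coord j y : ℂ) * resolvent D.npOperator l (D.nu k : D.L2) y ∂D.arcLength

/-- The form `-⟨φ, 𝒮 φ⟩` is Hermitian and positive definite on `L²₀(∂D)`. -/
def EnergyPosDef : Prop :=
  (∀ φ ψ : D.L20, inner ℂ (D.singleLayer φ) (ψ : D.L2) = inner ℂ (φ : D.L2) (D.singleLayer ψ)) ∧
    ∀ φ : D.L20, φ ≠ 0 → 0 < (-inner ℂ (φ : D.L2) (D.singleLayer φ)).re

/-- The space `L²₀(∂D)`, to carry the inner product `-⟨φ, 𝒮 ψ⟩` instead of that of `L²`. -/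
def PreEnergy : Type := D.L20

instance : AddCommGroup D.PreEnergy := inferInstanceAs (AddCommGroup D.L20)

instance : Module ℂ D.PreEnergy := inferInstanceAs (Module ℂ D.L20)

open Classical in
/-- The inner product `-⟨φ, 𝒮 ψ⟩_{L²}`, conjugate linear in `φ`. (The value `0` is used only if this
failed to be an inner product.) -/
def energyInner (φ ψ : D.L20) : ℂ :=
  if D.EnergyPosDef then -inner ℂ (φ : D.L2) (D.singleLayer ψ) else 0

theorem energyInner_conj (φ ψ : D.L20) :
    starRingEnd ℂ (D.energyInner ψ φ) = D.energyInner φ ψ := by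
  unfold energyInner
  split_ifs with h
  · rw [map_neg, inner_conj_symm, h.1 φ ψ]
  · simp

theorem energyInner_nonneg (φ : D.L20) : 0 ≤ (D.energyInner φ φ).re := by
  unfold energyInner
  split_ifs with h
  · by_cases h0 : φ = 0
    · simp [h0]
    · exact (h.2 φ h0).le
  · simp

theorem energyInner_add (φ ψ χ : D.L20) :
    D.energyInner (φ + ψ) χ = D.energyInner φ χ + D.energyInner ψ χ := by
  unfold energyInner
  split_ifs with h
  · rw [Submodule.coe_add, inner_add_left]; ring
  · simp

theorem energyInner_smul (φ ψ : D.L20) (c : ℂ) :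
    D.energyInner (c • φ) ψ = starRingEnd ℂ c * D.energyInner φ ψ := by
  unfold energyInner
  split_ifs with h
  · rw [Submodule.coe_smul, inner_smul_left]; ring
  · simp

instance energyCore : PreInnerProductSpace.Core ℂ D.PreEnergy where
  inner := D.energyInner
  conj_inner_symm := D.energyInner_conj
  re_inner_nonneg := D.energyInner_nonneg
  add_left := D.energyInner_add
  smul_left := D.energyInner_smul

instance : SeminormedAddCommGroup D.PreEnergy :=
  InnerProductSpace.Core.toSeminormedAddCommGroup (𝕜 := ℂ)

instance : InnerProductSpace ℂ D.PreEnergy := InnerProductSpace.ofCore D.energyCore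

/-- The Hilbert space `ℋ`: the completion of `L²₀(∂D)` for the inner product `-⟨φ, 𝒮 ψ⟩`. -/
abbrev Energy : Type := UniformSpace.Completion D.PreEnergy

/-- The inclusion of `L²₀(∂D)` in `ℋ`. -/
def toEnergy : D.L20 →ₗ[ℂ] D.Energy :=
  (UniformSpace.Completion.toComplₗᵢ : D.PreEnergy →ₗᵢ[ℂ] D.Energy).toLinearMap

/-- `T` is the bounded extension of `𝒦*` from `L²₀(∂D)` to `ℋ`. -/
def IsNPExtension (T : D.Energy →L[ℂ] D.Energy) : Prop :=
  ∀ φ : D.L20, ∃ ψ : D.L20, (ψ : D.L2) = D.npOperator φ ∧ T (D.toEnergy φ) = D.toEnergy ψ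

open Classical in
/-- The Neumann-Poincaré operator on `ℋ` (zero if it had no bounded extension). -/
def npEnergy : D.Energy →L[ℂ] D.Energy :=
  if h : ∃ T, D.IsNPExtension T then h.choose else 0

/-- `Y` is the bounded extension to `ℋ` of the functional `φ ↦ ⟨φ, y_j⟩ = ∫ y_j φ(y) dσ(y)`. -/
def IsPairing (j : Fin 2) (Y : D.Energy →L[ℂ] ℂ) : Prop :=
  ∀ φ : D.L20, Y (D.toEnergy φ) = ∫ y, (coord j y : ℂ) * (φ : D.L2) y ∂D.arcLength

open Classical in
/-- The pairing `⟨φ, y_j⟩` for `φ` in `ℋ` (zero if there were no bounded extension). -/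
def pairing (j : Fin 2) : D.Energy →L[ℂ] ℂ :=
  if h : ∃ Y, D.IsPairing j Y then h.choose else 0

/-- All objects above are well defined: no default value has been used. -/
structure WellDefined : Prop where
  singleLayer : D.IsIntegralOperator singleLayerKernel D.singleLayer
  npOperator : D.IsIntegralOperator D.npKernel D.npOperator
  energy : D.EnergyPosDef
  npEnergy : D.IsNPExtension D.npEnergy
  pairing : ∀ j, D.IsPairing j (D.pairing j)

/-- A complete orthonormal set `{φ_i⁺, φ_i⁻}` of `ℋ` with `𝒦* φ_i^± = ± λ_i φ_i^±`, where
`0 ≤ λ_i < 1/2` and `λ_i → 0`. -/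
structure Eigensystem where
  ev : ℕ → ℝ
  plus : ℕ → D.Energy
  minus : ℕ → D.Energy
  ev_nonneg : ∀ i, 0 ≤ ev i
  ev_lt : ∀ i, ev i < 1 / 2
  ev_tendsto : Tendsto ev atTop (𝓝 0)
  np_plus : ∀ i, D.npEnergy (plus i) = (ev i : ℂ) • plus i
  np_minus : ∀ i, D.npEnergy (minus i) = (-(ev i) : ℂ) • minus i
  orthonormal : Orthonormal ℂ (Sum.elim plus minus)
  complete : (Submodule.span ℂ (range (Sum.elim plus minus))).topologicalClosure = ⊤

namespace Eigensystem

variable {D} (e : D.Eigensystem)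

/-- The `i`-th term of the series that defines `f(𝒦*) h`:
`f(λ_i) ⟨φ_i⁺, h⟩ φ_i⁺ + f(-λ_i) ⟨φ_i⁻, h⟩ φ_i⁻`. -/
def calcTerm (f : ℂ → ℂ) (h : D.Energy) (i : ℕ) : D.Energy :=
  (f (e.ev i) * inner ℂ (e.plus i) h) • e.plus i +
    (f (-(e.ev i)) * inner ℂ (e.minus i) h) • e.minus i

/-- `f(𝒦*)`. -/
def funCalc (f : ℂ → ℂ) (h : D.Energy) : D.Energy := ∑' i, e.calcTerm f h i

/-- `c_i⁺`, the matrix with entries `⟨φ_i⁺, ν_k⟩_ℋ ⟨φ_i⁺, y_j⟩`. -/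
def cPlus (i : ℕ) : Matrix (Fin 2) (Fin 2) ℂ := Matrix.of fun j k =>
  inner ℂ (e.plus i) (D.toEnergy (D.nu k)) * D.pairing j (e.plus i)

/-- `c_i⁻`, the matrix with entries `⟨φ_i⁻, ν_k⟩_ℋ ⟨φ_i⁻, y_j⟩`. -/
def cMinus (i : ℕ) : Matrix (Fin 2) (Fin 2) ℂ := Matrix.of fun j k =>
  inner ℂ (e.minus i) (D.toEnergy (D.nu k)) * D.pairing j (e.minus i)

end Eigensystem

end PlanarDomain

/-- Piecewise `C¹` closed curves `γ : [0,1] → ℂ`. -/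
structure IsClosedCurve (γ : ℝ → ℂ) : Prop where
  continuousOn : ContinuousOn γ (Icc 0 1)
  closed : γ 0 = γ 1
  piecewise : ∃ P : Finset ℝ, (∀ t ∈ Ioo (0 : ℝ) 1 \ P, DifferentiableAt ℝ γ t) ∧
    ContinuousOn (deriv γ) (Ioo (0 : ℝ) 1 \ P) ∧
    ∃ C : ℝ, ∀ t ∈ Ioo (0 : ℝ) 1 \ P, ‖deriv γ t‖ ≤ C

/-- The winding number of `γ` about `w`. -/
def windingNumber (γ : ℝ → ℂ) (w : ℂ) : ℂ :=
  1 / (2 * Real.pi * Complex.I) * ∫ t in (0 : ℝ)..1, (γ t - w)⁻¹ * deriv γ t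

/-- `γ` is a closed curve in `U` that encloses `K` (once, in the positive sense) and does not
enclose any point outside `U`.  For a simple closed curve this says that `γ` is positively oriented,
that its interior contains `K`, and that its interior lies in `U`. -/
structure EnclosesIn (γ : ℝ → ℂ) (K U : Set ℂ) : Prop where
  isClosedCurve : IsClosedCurve γ
  mem : ∀ t ∈ Icc (0 : ℝ) 1, γ t ∈ U \ K
  inside : ∀ w ∈ K, windingNumber γ w = 1
  outside : ∀ w, w ∉ U → windingNumber γ w = 0

end

/-! ### Diagonalization of compact symmetric operators. -/

section Hilbert

variable {E : Type*} [NormedAddCommGroup E] [InnerProductSpace ℂ E]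

/-! Everything rests on the Cauchy singular integral C (`cauchyTransform`) on Hölder functions of
the boundary. Regularizing its kernel and exchanging variables shows that C is antisymmetric for the
form ∫ F H τ dσ, where τ is the unit tangent. Partial fractions show that (y - v)⁻¹ and (y - v)⁻²
are eigenfunctions of C, with eigenvalue -1 for v inside and 1 for v outside (`side`). A function on
the curve is determined by its Cauchy integrals off the curve, so C is an involution. The
Neumann-Poincaré kernel is the imaginary part of the Cauchy kernel, hence the transpose 𝒦 of 𝒦*
equals (C + conj C conj) / 4 (`IsHolder.doubleLayerFun_eq`).

Carried over to ℋ this reads 𝒦* = (Q + J Q J) / 4, with J the complex conjugation and Q an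
orthogonal reflection. The dipoles (y - v)⁻² τ span a dense subspace of L²₀, dipoles with poles on
opposite sides of the curve are orthogonal for the energy, and Q is 1 on the inner and -1 on the
outer ones (`exists_energyReflection`, `average_toEnergy`). So 𝒦* extends to a bounded symmetric
operator A on ℋ. It is compact there because it is compact on L²₀: an operator that is symmetric for
a weaker inner product is no larger in the weaker norm (`IsCompactOperator.of_symmetrizable`).

An eigenvalue ±1/2 on L²₀ would be a case of equality in ‖Q + J Q J‖ ≤ 2. It makes the potential u =
𝒮φ and its conjugate, up to constants, traces of holomorphic functions on one side of the curve. The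
traces form an algebra, evaluation at a point is a character bounded by the supremum on the curve,
and such a character is real on real functions; so u is constant and φ = 0. The symmetry of the
spectrum is pure algebra of two involutions: A² commutes with Q, and from the eigenvectors of A²
fixed by Q one builds pairs for ±λ (`exists_symmetric_eigensystem`).

That the energy is an inner product follows from Frullani's integral: on functions of mean zero,
-log |x - y| is a superposition of Gaussian kernels, which are positive definite (`energyPosDef`).
The coordinate functionals are bounded on ℋ because (1/2 - 𝒦) y_j = -𝒮 ν_j, which turns ⟨φ, y_j⟩
into ⟨ν_j, (1/2 - A)⁻¹ φ⟩ in ℋ (`exists_isPairing`).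

Finally, the resolvent of 𝒦* off its spectrum preserves L²₀, so the contour integral g of f(λ) (λ -
𝒦*)⁻¹ ν_k is an element of L²₀. By Cauchy's formula in its homology version
(`EnclosesIn.cauchyFormula`) its coefficient at an eigenvector for μ is f(μ) times that of ν_k.
Hence the series f(𝒦*)[ν_k] sums to g, and applying the coordinate functional gives both identities.
-/

theorem Orthonormal.norm_sub_sq_of_ne {ι : Type*} {v : ι → E} (hv : Orthonormal ℂ v) {i j : ι}
    (h : i ≠ j) (a b : ℂ) : ‖a • v i - b • v j‖ ^ 2 = ‖a‖ ^ 2 + ‖b‖ ^ 2 := by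
  rw [@norm_sub_sq ℂ, inner_smul_left, inner_smul_right, hv.2 h]
  simp [norm_smul, hv.1]

/-- Orthonormal vectors are at mutual distance √2, so the balls of radius 1/2 around them are
disjoint. -/
theorem Orthonormal.countable_of_separable [TopologicalSpace.SeparableSpace E] {ι : Type*}
    {v : ι → E} (hv : Orthonormal ℂ v) : Countable ι := by
  have hd : (univ : Set ι).PairwiseDisjoint (fun i => Metric.ball (v i) (1 / 2)) := by
    intro i _ j _ hij
    refine Metric.ball_disjoint_ball ?_
    have := hv.norm_sub_sq_of_ne hij 1 1
    rw [dist_eq_norm]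
    simp only [one_smul, norm_one] at this
    nlinarith [norm_nonneg (v i - v j)]
  have := hd.countable_of_isOpen (fun i _ => Metric.isOpen_ball)
    (fun i _ => ⟨v i, Metric.mem_ball_self (by norm_num)⟩)
  exact countable_univ_iff.mp this

/-- If infinitely many eigenvalues had modulus at least ε, the images of the corresponding vectors
would be at mutual distance at least ε by Pythagoras, and no subsequence of them could converge. -/
theorem IsCompactOperator.tendsto_eigenvalues [CompleteSpace E] {A : E →L[ℂ] E}
    (hA : IsCompactOperator A)
    {v : ℕ → E} (hv : Orthonormal ℂ v) {μ : ℕ → ℝ} (h : ∀ i, A (v i) = (μ i : ℂ) • v i) :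
    Tendsto μ atTop (𝓝 0) := by
  by_contra hcon
  rw [Metric.tendsto_atTop] at hcon
  push Not at hcon
  obtain ⟨ε, hε, hN⟩ := hcon
  obtain ⟨φ, hφ, hφ2⟩ := extraction_of_frequently_atTop (P := fun n => ε ≤ dist (μ n) 0)
    (frequently_atTop.mpr fun a => (hN a))
  obtain ⟨K, hK, hK'⟩ := hA.image_closedBall_subset_compact 1
  obtain ⟨y, -, ψ, hψ, hy⟩ := hK.tendsto_subseq
    (x := fun n => A (v (φ n))) (fun n => hK' ⟨v (φ n), by simp [hv.1], rfl⟩)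
  obtain ⟨N, hN⟩ := Metric.cauchySeq_iff'.mp hy.cauchySeq ε hε
  have h1 := hN (N + 1) (Nat.le_succ N)
  have hne : φ (ψ (N + 1)) ≠ φ (ψ N) := fun hh => by
    have := hψ.injective (hφ.injective hh)
    omega
  simp only [Function.comp, dist_eq_norm, h] at h1
  have h2 := hv.norm_sub_sq_of_ne hne (μ (φ (ψ (N + 1)))) (μ (φ (ψ N)))
  have h3 := hφ2 (ψ N)
  rw [Real.dist_eq, sub_zero] at h3
  simp only [Complex.norm_real, Real.norm_eq_abs] at h2
  nlinarith [norm_nonneg ((μ (φ (ψ (N + 1))) : ℂ) • v (φ (ψ (N + 1))) - (μ (φ (ψ N)) : ℂ) • v (φ (ψ N))),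
    sq_nonneg |μ (φ (ψ (N + 1)))|]

/-- Diagonalization of compact symmetric operators on separable Hilbert spaces. -/
theorem IsCompactOperator.exists_hilbertBasis_eigenvectors [CompleteSpace E]
    [TopologicalSpace.SeparableSpace E] (hinf : ¬ FiniteDimensional ℂ E) {A : E →L[ℂ] E}
    (hA : IsCompactOperator A) (hs : A.toLinearMap.IsSymmetric) :
    ∃ (b : HilbertBasis ℕ ℂ E) (μ : ℕ → ℝ), (∀ i, A (b i) = (μ i : ℂ) • b i) ∧
      Tendsto μ atTop (𝓝 0) := by
  classical
  set V : ℂ → Submodule ℂ E := fun μ => Module.End.eigenspace (A : Module.End ℂ E) μ with hV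
  have hcomp : ∀ μ, CompleteSpace (V μ) := fun μ => by
    have : IsClosed ((V μ : Submodule ℂ E) : Set E) := by
      have : ((V μ : Submodule ℂ E) : Set E) = {x | A x = μ • x} := by
        ext x; exact Module.End.mem_eigenspace_iff
      rw [this]
      exact isClosed_eq A.continuous (continuous_const_smul μ)
    exact this.completeSpace_coe
  choose w b hb using fun μ => exists_hilbertBasis ℂ (V μ)
  have hort : Orthonormal ℂ (fun p : Σ μ, w μ => ((b p.1 p.2 : V p.1) : E)) := by
    have := hs.orthogonalFamily_eigenspaces.orthonormal_sigma_orthonormal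
      (v_family := fun μ => b μ) (fun μ => (b μ).orthonormal)
    exact this
  -- The eigenspaces, the kernel included, have trivial common orthogonal complement, and each one
  -- lies in the closed span of its own basis.
  have hspan : (Submodule.span ℂ (range fun p : Σ μ, w μ => ((b p.1 p.2 : V p.1) : E)))ᗮ = ⊥ := by
    rw [← Submodule.orthogonal_closure, eq_bot_iff, ← ContinuousLinearMap.orthogonalComplement_iSup_eigenspaces_eq_bot hA hs]
    refine Submodule.orthogonal_le (iSup_le fun μ => ?_)
    have h1 := (b μ).dense_span
    intro x hx
    have h2 : (⟨x, hx⟩ : V μ) ∈ (Submodule.span ℂ (range (b μ))).topologicalClosure := by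
      rw [h1]; trivial
    have h3 : MapsTo (Subtype.val : V μ → E) (Submodule.span ℂ (range (b μ)))
        (Submodule.span ℂ (range fun p : Σ μ, w μ => ((b p.1 p.2 : V p.1) : E))) := by
      intro y hy
      have := Submodule.apply_mem_span_image_of_mem_span (V μ).subtype hy
      refine Submodule.span_mono ?_ this
      rintro _ ⟨_, ⟨i, rfl⟩, rfl⟩
      exact ⟨⟨μ, i⟩, rfl⟩
    exact h3.closure continuous_subtype_val h2
  -- Separability makes the index set countable and infinite dimension makes it infinite, so that ℕ
  -- can index it.
  have hcount := hort.countable_of_separable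
  have hinf' : Infinite (Σ μ, w μ) := by
    by_contra hfin
    rw [not_infinite_iff_finite] at hfin
    apply hinf
    have hf : FiniteDimensional ℂ
        (Submodule.span ℂ (range fun p : Σ μ, w μ => ((b p.1 p.2 : V p.1) : E))) :=
      FiniteDimensional.span_of_finite ℂ (finite_range _)
    rw [Submodule.orthogonal_eq_bot_iff] at hspan
    rw [hspan] at hf
    exact Module.Finite.equiv (Submodule.topEquiv (R := ℂ) (M := E))
  obtain ⟨e⟩ := nonempty_equiv_of_countable (α := ℕ) (β := Σ μ, w μ)
  have hreal : ∀ p : Σ μ, w μ, ((p.1.re : ℝ) : ℂ) = p.1 := by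
    intro p
    have : Module.End.HasEigenvalue (A : Module.End ℂ E) p.1 := by
      refine Module.End.hasEigenvalue_of_hasEigenvector (x := ((b p.1 p.2 : V p.1) : E)) ⟨(b p.1 p.2).2, ?_⟩
      exact hort.ne_zero p
    exact Complex.conj_eq_iff_real.mp (hs.conj_eigenvalue_eq_self this) |>.elim fun r hr => by
      rw [hr]; simp
  have hort2 := hort.comp e e.injective
  have hspan2 : (Submodule.span ℂ (range ((fun p : Σ μ, w μ => ((b p.1 p.2 : V p.1) : E)) ∘ e)))ᗮ = ⊥ := by
    rw [e.surjective.range_comp]; exact hspan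
  have heig : ∀ i, A (((b (e i).1 (e i).2 : V (e i).1) : E)) = (((e i).1.re : ℝ) : ℂ) • ((b (e i).1 (e i).2 : V (e i).1) : E) := by
    intro i
    rw [hreal]
    exact Module.End.mem_eigenspace_iff.mp (b (e i).1 (e i).2).2
  refine ⟨HilbertBasis.mkOfOrthogonalEqBot hort2 hspan2, fun i => (e i).1.re, ?_, ?_⟩
  · intro i
    rw [HilbertBasis.coe_mkOfOrthogonalEqBot]
    exact heig i
  · exact hA.tendsto_eigenvalues hort2 heig

end Hilbert

/-! ### Operators symmetric for a weaker inner product. -/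

section Hilbert

variable {X H : Type*} [NormedAddCommGroup X] [InnerProductSpace ℂ X]
  [NormedAddCommGroup H] [InnerProductSpace ℂ H]

/-- Symmetry gives ‖B y‖² ≤ ‖y‖ ‖B² y‖, and iteration bounds ‖B y‖ by the growth rate of the powers
of B on y. On the range of `ι` that rate is at most ‖G‖; the norms of `ι` and of x enter only as a
factor that disappears in the 2ᵏ-th root. -/
theorem norm_le_of_intertwines_symmetric {ι : X →L[ℂ] H} (hd : DenseRange ι) {B : H →L[ℂ] H}
    (hB : ∀ x y, inner ℂ (B x) y = inner ℂ x (B y)) {G : X →L[ℂ] X}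
    (h : ∀ x, B (ι x) = ι (G x)) : ‖B‖ ≤ ‖G‖ := by
  have hpow : ∀ n x, (B ^ n) (ι x) = ι ((G ^ n) x) := by
    intro n
    induction n with
    | zero => intro x; simp
    | succ n ih => intro x; rw [pow_succ', pow_succ', mul_apply_eq_comp,
        mul_apply_eq_comp, ih, h]
  have hsym : ∀ n x y, inner ℂ ((B ^ n) x) y = inner ℂ x ((B ^ n) y) := by
    intro n
    induction n with
    | zero => intro x y; simp
    | succ n ih => intro x y; rw [pow_succ', mul_apply_eq_comp, hB, ih, ← pow_succ' B n,
        pow_succ, mul_apply_eq_comp]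
  have key : ∀ x, ‖B (ι x)‖ ≤ ‖G‖ * ‖ι x‖ := by
    intro x
    by_contra hcon
    push Not at hcon
    -- Cauchy-Schwarz iterated along the exponents 2ᵏ, written without division.
    have hstep : ∀ k : ℕ, ‖B (ι x)‖ ^ 2 ^ k * ‖ι x‖ ≤ ‖ι x‖ ^ 2 ^ k * ‖(B ^ 2 ^ k) (ι x)‖ := by
      intro k
      induction k with
      | zero => simp [mul_comm]
      | succ k ih =>
        have h1 : ‖(B ^ 2 ^ k) (ι x)‖ ^ 2 ≤ ‖ι x‖ * ‖(B ^ 2 ^ (k + 1)) (ι x)‖ := by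
          have e1 : ((‖(B ^ 2 ^ k) (ι x)‖ ^ 2 : ℝ) : ℂ) = inner ℂ (ι x) ((B ^ 2 ^ (k + 1)) (ι x)) := by
            rw [pow_succ 2 k, mul_two, pow_add, mul_apply_eq_comp, ← hsym,
              inner_self_eq_norm_sq_to_K]
            simp
          have e2 := norm_inner_le_norm (𝕜 := ℂ) (ι x) ((B ^ 2 ^ (k + 1)) (ι x))
          rw [← e1, Complex.norm_real, Real.norm_of_nonneg (sq_nonneg _)] at e2
          exact e2
        rcases (norm_nonneg (ι x)).eq_or_lt with h0 | h0
        · rw [← h0]; simp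
        · have h2 : (‖B (ι x)‖ ^ 2 ^ k * ‖ι x‖) ^ 2 ≤ (‖ι x‖ ^ 2 ^ k * ‖(B ^ 2 ^ k) (ι x)‖) ^ 2 := by
            gcongr
          have h3 : ‖B (ι x)‖ ^ 2 ^ (k + 1) * ‖ι x‖ * ‖ι x‖ ≤
              (‖ι x‖ ^ 2 ^ (k + 1) * ‖(B ^ 2 ^ (k + 1)) (ι x)‖) * ‖ι x‖ := by
            calc ‖B (ι x)‖ ^ 2 ^ (k + 1) * ‖ι x‖ * ‖ι x‖
                = (‖B (ι x)‖ ^ 2 ^ k * ‖ι x‖) ^ 2 := by rw [pow_succ 2 k, pow_mul]; ring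
              _ ≤ (‖ι x‖ ^ 2 ^ k * ‖(B ^ 2 ^ k) (ι x)‖) ^ 2 := h2
              _ = ‖ι x‖ ^ 2 ^ (k + 1) * ‖(B ^ 2 ^ k) (ι x)‖ ^ 2 := by
                rw [pow_succ 2 k, pow_mul]; ring
              _ ≤ ‖ι x‖ ^ 2 ^ (k + 1) * (‖ι x‖ * ‖(B ^ 2 ^ (k + 1)) (ι x)‖) := by gcongr
              _ = _ := by ring
          exact le_of_mul_le_mul_right h3 h0
    have hb : 0 < ‖B (ι x)‖ := lt_of_le_of_lt (by positivity) hcon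
    have ha : 0 < ‖ι x‖ := by
      by_contra h0
      have : ι x = 0 := by simpa using h0
      rw [this] at hb
      simp at hb
    set q := ‖G‖ * ‖ι x‖ / ‖B (ι x)‖ with hq
    have hq0 : 0 ≤ q := by positivity
    have hq1 : q < 1 := (div_lt_one hb).mpr hcon
    -- The ratio `q` is less than 1 under the assumption to be refuted, so letting k tend to
    -- infinity contradicts ‖ι x‖ > 0.
    have hbound : ∀ k : ℕ, ‖ι x‖ ≤ q ^ 2 ^ k * (‖ι‖ * ‖x‖) := by
      intro k
      have h1 : ‖(B ^ 2 ^ k) (ι x)‖ ≤ ‖ι‖ * (‖G‖ ^ 2 ^ k * ‖x‖) := by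
        rw [hpow]
        refine (ι.le_opNorm _).trans ?_
        gcongr
        exact ((G ^ 2 ^ k).le_opNorm x).trans (by gcongr; exact norm_pow_le' _ (by positivity))
      have h2 := (hstep k).trans (mul_le_mul_of_nonneg_left h1 (by positivity))
      rw [hq, div_pow, mul_pow, div_mul_eq_mul_div, le_div_iff₀ (by positivity)]
      linarith
    have hlim : Tendsto (fun k : ℕ => q ^ 2 ^ k * (‖ι‖ * ‖x‖)) atTop (𝓝 (0 * (‖ι‖ * ‖x‖))) :=
      (((tendsto_pow_atTop_nhds_zero_of_lt_one hq0 hq1).comp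
        (tendsto_pow_atTop_atTop_of_one_lt (by norm_num : 1 < 2)))).mul_const _
    rw [zero_mul] at hlim
    exact absurd (ge_of_tendsto' hlim hbound) (not_le.mpr ha)
  refine B.opNorm_le_bound (norm_nonneg _) fun y => ?_
  exact hd.induction_on (p := fun y => ‖B y‖ ≤ ‖G‖ * ‖y‖) y
    (isClosed_le (by fun_prop) (by fun_prop)) key

/-- Bounded pointwise convergence to zero is uniform on compact sets, here on a compact set
containing the image of the unit ball under `T`. -/
theorem IsCompactOperator.exists_norm_comp_le {T : X →L[ℂ] X} (hT : IsCompactOperator T)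
    {q : ℕ → X →L[ℂ] X} {C : ℝ} (hq : ∀ n, ‖q n‖ ≤ C) (hlim : ∀ x, Tendsto (fun n => q n x) atTop (𝓝 0))
    {ε : ℝ} (hε : 0 < ε) : ∃ n, ‖q n * T‖ ≤ ε := by
  have hC : 0 ≤ C := (norm_nonneg _).trans (hq 0)
  obtain ⟨K, hK, hK'⟩ := hT.image_closedBall_subset_compact 1
  have hδ : 0 < ε / (2 * (C + 1)) := by positivity
  obtain ⟨s, -, hs, hcov⟩ := hK.finite_cover_balls hδ
  have hev : ∀ᶠ n in atTop, ∀ c ∈ s, ‖q n c‖ < ε / 2 := by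
    refine (eventually_all_finite hs).mpr fun c _ => ?_
    have := (hlim c).norm
    rw [norm_zero] at this
    exact this.eventually_lt_const (by positivity)
  obtain ⟨n, hn⟩ := hev.exists
  refine ⟨n, ContinuousLinearMap.opNorm_le_of_unit_norm (𝕜 := ℂ) hε.le fun x hx => ?_⟩
  have hy : T x ∈ K := hK' ⟨x, by simp [hx], rfl⟩
  obtain ⟨c, hc, hyc⟩ := mem_iUnion₂.mp (hcov hy)
  rw [mem_ball_iff_norm] at hyc
  have h1 : q n (T x) = q n (T x - c) + q n c := by rw [map_sub]; abel
  rw [mul_apply_eq_comp, h1]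
  refine (norm_add_le _ _).trans ?_
  have h2 : ‖q n (T x - c)‖ ≤ C * (ε / (2 * (C + 1))) :=
    ((q n).le_opNorm _).trans (mul_le_mul (hq n) hyc.le (norm_nonneg _) hC)
  have h3 : C * (ε / (2 * (C + 1))) ≤ ε / 2 := by
    rw [mul_div_assoc', div_le_div_iff₀ (by positivity) (by positivity)]
    nlinarith
  linarith [hn c hc]

/-- A compact operator on `X` that is symmetric for a weaker inner product extends to a compact
operator on the completion. -/
theorem IsCompactOperator.of_symmetrizable [CompleteSpace X] [CompleteSpace H]
    [TopologicalSpace.SeparableSpace X]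
    (hinf : ¬ FiniteDimensional ℂ X) {ι : X →L[ℂ] H} (hinj : Function.Injective ι)
    (hd : DenseRange ι) {T : X →L[ℂ] X} (hT : IsCompactOperator T) {S : X →L[ℂ] X}
    (hS : IsCompactOperator S) (hι : ∀ x y, inner ℂ (ι x) (ι y) = inner ℂ x (S y))
    {A : H →L[ℂ] H} (hA : ∀ x y, inner ℂ (A x) y = inner ℂ x (A y))
    (hAT : ∀ x, A (ι x) = ι (T x)) : IsCompactOperator A := by
  have hSs : ∀ x y, inner ℂ (S x) y = inner ℂ x (S y) := by
    intro x y
    rw [← hι, ← inner_conj_symm, ← hι, inner_conj_symm]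
  obtain ⟨b, m, hb, -⟩ := hS.exists_hilbertBasis_eigenvectors hinf hSs
  -- An eigenvector of `S` for the eigenvalue 0 would have length zero in the weaker norm, against
  -- injectivity of `ι`.
  have hm : ∀ i, (m i : ℂ) ≠ 0 := by
    intro i hi
    have h1 : inner ℂ (ι (b i)) (ι (b i)) = 0 := by rw [hι, hb, hi]; simp
    rw [inner_self_eq_zero] at h1
    have : b i = 0 := hinj (by rw [h1, map_zero])
    exact b.orthonormal.ne_zero i this
  -- The vectors ι (b i) are orthogonal in H with squared length m i. So `p n` and `P n` are the
  -- orthogonal projections, in X and in H, onto the first n eigenvectors of `S`, and they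
  -- correspond under `ι`.
  let p : ℕ → X →L[ℂ] X := fun n => ∑ i ∈ Finset.range n, (innerSL ℂ (b i)).smulRight (b i)
  let P : ℕ → H →L[ℂ] H := fun n =>
    ∑ i ∈ Finset.range n, (innerSL ℂ (ι (b i))).smulRight ((m i : ℂ)⁻¹ • ι (b i))
  have hp : ∀ n x, p n x = ∑ i ∈ Finset.range n, inner ℂ (b i) x • b i := by
    intro n x; simp [p]
  have hP : ∀ n y, P n y = ∑ i ∈ Finset.range n, inner ℂ (ι (b i)) y • ((m i : ℂ)⁻¹ • ι (b i)) := by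
    intro n x; simp [P]
  have hpP : ∀ n x, P n (ι x) = ι (p n x) := by
    intro n x
    rw [hP, hp, map_sum]
    refine Finset.sum_congr rfl fun i _ => ?_
    rw [hι, ← hSs, hb, inner_smul_left, map_smul, smul_smul, Complex.conj_ofReal, mul_comm (m i : ℂ),
      mul_assoc, mul_inv_cancel₀ (hm i), mul_one]
  have hPs : ∀ n x y, inner ℂ (P n x) y = inner ℂ x (P n y) := by
    intro n x y
    rw [hP, hP, sum_inner, inner_sum]
    refine Finset.sum_congr rfl fun i _ => ?_
    simp only [inner_smul_left, inner_smul_right, map_inv₀, Complex.conj_ofReal, inner_conj_symm]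
    ring
  have hps : ∀ n x y, inner ℂ (p n x) y = inner ℂ x (p n y) := by
    intro n x y
    rw [hp, hp, sum_inner, inner_sum]
    refine Finset.sum_congr rfl fun i _ => ?_
    simp only [inner_smul_left, inner_smul_right, inner_conj_symm]
    ring
  have hpp : ∀ n x, p n (p n x) = p n x := by
    intro n x
    rw [hp n (p n x), hp n x]
    refine Finset.sum_congr rfl fun i hi => ?_
    congr 1
    rw [inner_sum, Finset.sum_eq_single i]
    · rw [inner_smul_right, inner_self_eq_norm_sq_to_K, b.orthonormal.1]; simp
    · intro j _ hj
      rw [inner_smul_right, b.orthonormal.2 hj.symm, mul_zero]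
    · exact fun h => absurd hi h
  have hpn : ∀ n, ‖p n‖ ≤ 1 := by
    intro n
    refine (p n).opNorm_le_bound zero_le_one fun x => ?_
    have h1 : ((‖p n x‖ ^ 2 : ℝ) : ℂ) = inner ℂ x (p n x) := by
      rw [← hpp n x, ← hps, hpp, inner_self_eq_norm_sq_to_K]; simp
    have h2 := norm_inner_le_norm (𝕜 := ℂ) x (p n x)
    rw [← h1, Complex.norm_real, Real.norm_of_nonneg (sq_nonneg _), pow_two] at h2
    rw [one_mul]
    rcases (norm_nonneg (p n x)).eq_or_lt with h0 | h0
    · rw [← h0]; positivity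
    · exact le_of_mul_le_mul_right h2 h0
  have hlim : ∀ x, Tendsto (fun n => (1 - p n) x) atTop (𝓝 0) := by
    intro x
    have := (b.hasSum_repr x).tendsto_sum_nat
    have h2 : Tendsto (fun n => x - p n x) atTop (𝓝 (x - x)) := by
      refine tendsto_const_nhds.sub ?_
      refine this.congr fun n => ?_
      rw [hp]
      simp [HilbertBasis.repr_apply_apply]
    rw [sub_self] at h2
    exact h2
  have hqn : ∀ n, ‖1 - p n‖ ≤ 2 := fun n => by
    have := ContinuousLinearMap.norm_id_le (𝕜 := ℂ) (E := X)
    calc ‖1 - p n‖ ≤ ‖(1 : X →L[ℂ] X)‖ + ‖p n‖ := norm_sub_le _ _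
      _ ≤ 1 + 1 := add_le_add this (hpn n)
      _ = 2 := by norm_num
  have hcl : IsClosed {f : H →L[ℂ] H | IsCompactOperator f} := isClosed_setOfPred_isCompactOperator
  have hmem : A ∈ closure {f : H →L[ℂ] H | IsCompactOperator f} := by
    rw [Metric.mem_closure_iff]
    intro ε hε
    -- Chosen so that ‖T‖ · 2 · η ≤ (ε/2)², where 2 bounds ‖1 - p n‖.
    have hη : 0 < (ε / 2) ^ 2 / (2 * (‖T‖ + 1)) := by positivity
    obtain ⟨n, hn⟩ := hT.exists_norm_comp_le hqn hlim hη
    refine ⟨P n * A, ?_, ?_⟩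
    · have : IsCompactOperator (P n) := by
        have h1 : ∀ s : Finset ℕ, IsCompactOperator
            (∑ i ∈ s, (innerSL ℂ (ι (b i))).smulRight ((m i : ℂ)⁻¹ • ι (b i)) : H →L[ℂ] H) := by
          intro s
          induction s using Finset.induction_on with
          | empty => simpa using isCompactOperator_zero
          | insert i s hi ih =>
            rw [Finset.sum_insert hi]
            refine IsCompactOperator.add ?_ ih
            have : IsCompactOperator (innerSL ℂ (ι (b i)) : H →L[ℂ] ℂ) :=
              isCompactOperator_of_locallyCompactSpace_dom _
            exact this.clm_comp
              ((1 : ℂ →L[ℂ] ℂ).smulRight ((m i : ℂ)⁻¹ • ι (b i)))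
        exact h1 _
      exact this.comp_clm A
    · have hsymA := hA
      have hQs : ∀ x y, inner ℂ ((1 - P n) x) y = inner ℂ x ((1 - P n) y) := by
        intro x y
        simp only [sub_apply, one_apply_eq_self, inner_sub_left, inner_sub_right, hPs]
      -- The squared norm of (1 - P)A is governed by the symmetric operator A(1 - P)²A. It
      -- corresponds to T(1 - p)²T on X, which is small because (1 - p)T is.
      have hB := norm_le_of_intertwines_symmetric hd (B := A * ((1 - P n) * ((1 - P n) * A)))
        (G := T * ((1 - p n) * ((1 - p n) * T)))
        (by
          intro x y
          simp only [mul_apply_eq_comp]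
          rw [hA, hQs, hQs, hA])
        (by
          intro x
          simp only [mul_apply_eq_comp]
          simp [hAT, hpP])
      have hG : ‖T * ((1 - p n) * ((1 - p n) * T))‖ ≤ (ε / 2) ^ 2 := by
        calc ‖T * ((1 - p n) * ((1 - p n) * T))‖ ≤ ‖T‖ * (2 * ((ε / 2) ^ 2 / (2 * (‖T‖ + 1)))) := by
              refine (norm_mul_le _ _).trans ?_
              gcongr
              refine (norm_mul_le _ _).trans ?_
              gcongr
              exact hqn n
          _ ≤ (ε / 2) ^ 2 := by
              rw [mul_div_assoc', mul_div_assoc', div_le_iff₀ (by positivity)]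
              nlinarith [sq_nonneg (ε / 2), norm_nonneg T]
      rw [dist_eq_norm]
      have : A - P n * A = (1 - P n) * A := by rw [sub_mul, one_mul]
      rw [this]
      refine lt_of_le_of_lt (ContinuousLinearMap.opNorm_le_bound _ (by positivity : 0 ≤ ε / 2)
        fun y => ?_) (half_lt_self hε)
      refine abs_le_of_sq_le_sq' ?_ (by positivity) |>.2
      have h1 : ((‖((1 - P n) * A) y‖ ^ 2 : ℝ) : ℂ)
          = inner ℂ y ((A * ((1 - P n) * ((1 - P n) * A))) y) := by
        simp only [mul_apply_eq_comp]
        rw [← hA, ← hQs, inner_self_eq_norm_sq_to_K]; simp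
      have h2 := norm_inner_le_norm (𝕜 := ℂ) y ((A * ((1 - P n) * ((1 - P n) * A))) y)
      rw [← h1, Complex.norm_real, Real.norm_of_nonneg (sq_nonneg _)] at h2
      refine h2.trans ?_
      have h3 := (A * ((1 - P n) * ((1 - P n) * A))).le_opNorm y
      calc ‖y‖ * ‖(A * ((1 - P n) * ((1 - P n) * A))) y‖ ≤ ‖y‖ * ((ε / 2) ^ 2 * ‖y‖) := by
            gcongr
            exact h3.trans (by gcongr; exact hB.trans hG)
        _ = (ε / 2 * ‖y‖) ^ 2 := by ring
  rwa [hcl.closure_eq] at hmem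

end Hilbert

/-! ### Two involutions and the symmetry of the spectrum. -/

section Hilbert

variable {H : Type*} [NormedAddCommGroup H] [InnerProductSpace ℂ H]

/-- Spectral theory of the mean `(Q + J Q J) / 4` of a symmetric involution `Q` and its conjugate
by a conjugation `J`: the spectrum is symmetric about the origin. -/
theorem exists_symmetric_eigensystem [CompleteSpace H] [TopologicalSpace.SeparableSpace H]
    (hinf : ¬ FiniteDimensional ℂ H) {Q : H →L[ℂ] H}
    (hQs : ∀ x y, inner ℂ (Q x) y = inner ℂ x (Q y)) (hQQ : ∀ x, Q (Q x) = x) {J : H → H}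
    (hJa : ∀ x y, J (x + y) = J x + J y) (hJc : ∀ (c : ℂ) x, J (c • x) = starRingEnd ℂ c • J x)
    (hJJ : ∀ x, J (J x) = x) (hJi : ∀ x y, inner ℂ (J x) (J y) = inner ℂ y x) {A : H →L[ℂ] H}
    (hA : ∀ x, (4 : ℂ) • A x = Q x + J (Q (J x))) (hc : IsCompactOperator A)
    (hp : ∀ x, A x = (1 / 2 : ℂ) • x → x = 0) (hm : ∀ x, A x = (-(1 / 2) : ℂ) • x → x = 0) :
    ∃ (ev : ℕ → ℝ) (plus minus : ℕ → H), (∀ i, 0 ≤ ev i) ∧ (∀ i, ev i < 1 / 2) ∧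
      Tendsto ev atTop (𝓝 0) ∧ (∀ i, A (plus i) = (ev i : ℂ) • plus i) ∧
      (∀ i, A (minus i) = (-(ev i) : ℂ) • minus i) ∧ Orthonormal ℂ (Sum.elim plus minus) ∧
      (Submodule.span ℂ (range (Sum.elim plus minus))).topologicalClosure = ⊤ := by
  have hJ0 : J 0 = 0 := by simpa using hJc 0 0
  have hJneg : ∀ x, J (-x) = -J x := fun x => by simpa using hJc (-1) x
  have hJsub : ∀ x y, J (x - y) = J x - J y := fun x y => by
    rw [sub_eq_add_neg, hJa, hJneg, sub_eq_add_neg]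
  have hJn : ∀ x, ‖J x‖ = ‖x‖ := fun x => by
    have h1 := hJi x x
    rw [inner_self_eq_norm_sq_to_K, inner_self_eq_norm_sq_to_K] at h1
    have h2 : ‖J x‖ ^ 2 = ‖x‖ ^ 2 := by exact_mod_cast h1
    exact (pow_left_inj₀ (norm_nonneg _) (norm_nonneg _) two_ne_zero).mp h2
  have hJcont : Continuous J := by
    refine (Isometry.of_dist_eq fun x y => ?_).continuous
    rw [dist_eq_norm, dist_eq_norm, ← hJsub, hJn]
  have hQn : ∀ x, ‖Q x‖ = ‖x‖ := fun x => by
    have h1 := hQs x (Q x)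
    rw [hQQ, inner_self_eq_norm_sq_to_K, inner_self_eq_norm_sq_to_K] at h1
    have h2 : ‖Q x‖ ^ 2 = ‖x‖ ^ 2 := by exact_mod_cast h1
    exact (pow_left_inj₀ (norm_nonneg _) (norm_nonneg _) two_ne_zero).mp h2
  -- R = J Q J is a second symmetric involution, and 4A = Q + R.
  obtain ⟨R, hR⟩ : ∃ R : H → H, ∀ x, R x = J (Q (J x)) := ⟨_, fun _ => rfl⟩
  have hRR : ∀ x, R (R x) = x := fun x => by simp [hR, hJJ, hQQ]
  have hRs : ∀ x y, inner ℂ (R x) y = inner ℂ x (R y) := fun x y => by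
    rw [hR, hR, ← hJJ y, hJi, hJJ, ← hQs, ← hJi, hJJ]
  have hRn : ∀ x, ‖R x‖ = ‖x‖ := fun x => by rw [hR, hJn, hQn, hJn]
  have hQJ : ∀ x, Q (J x) = J (R x) := fun x => by rw [hR, hJJ]
  simp only [← hR] at hA
  have hAs : ∀ x y, inner ℂ (A x) y = inner ℂ x (A y) := fun x y => by
    have h1 : inner ℂ ((4 : ℂ) • A x) y = inner ℂ x ((4 : ℂ) • A y) := by
      rw [hA, hA, inner_add_left, inner_add_right, hQs, hRs]
    rw [inner_smul_left, inner_smul_right, map_ofNat] at h1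
    exact mul_left_cancel₀ (by norm_num) h1
  have hAn : ∀ x, ‖A x‖ ≤ 1 / 2 * ‖x‖ := fun x => by
    have h1 : ‖(4 : ℂ) • A x‖ ≤ ‖x‖ + ‖x‖ := by
      rw [hA]; exact (norm_add_le _ _).trans (by rw [hQn, hRn])
    rw [norm_smul] at h1
    norm_num at h1
    linarith
  have hRadd : ∀ x y, R (x + y) = R x + R y := fun x y => by simp [hR, hJa]
  have hAJ : ∀ x, A (J x) = J (A x) := fun x => by
    have h1 : (4 : ℂ) • A (J x) = (4 : ℂ) • J (A x) := by
      have : (4 : ℂ) • J (A x) = J ((4 : ℂ) • A x) := by rw [hJc, map_ofNat]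
      rw [this, hA, hA, hJa, hQJ, hR (J x), hJJ, add_comm]
    exact smul_right_injective H (by norm_num : (4 : ℂ) ≠ 0) h1
  have hAA : ∀ x, (16 : ℂ) • A (A x) = (2 : ℂ) • x + (Q (R x) + R (Q x)) := fun x => by
    have : (16 : ℂ) • A (A x) = (4 : ℂ) • A ((4 : ℂ) • A x) := by
      rw [map_smul, smul_smul]; norm_num
    rw [this, hA, hA, map_add, hRadd, hQQ, hRR, two_smul]
    abel
  -- 16A² = 2 + QR + RQ, and conjugation by Q merely exchanges QR and RQ.
  have hcomm : ∀ x, Q (A (A x)) = A (A (Q x)) := fun x => by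
    have h1 : (16 : ℂ) • Q (A (A x)) = (16 : ℂ) • A (A (Q x)) := by
      rw [← map_smul, hAA, hAA, map_add, map_add, map_smul, hQQ, hQQ]
      abel
    exact smul_right_injective H (by norm_num : (16 : ℂ) ≠ 0) h1
  set V : Submodule ℂ H := LinearMap.ker ((Q - 1 : H →L[ℂ] H) : H →ₗ[ℂ] H) with hV
  have hVmem : ∀ x, x ∈ V ↔ Q x = x := fun x => by
    rw [hV, LinearMap.mem_ker]
    simp [sub_eq_zero]
  have hVclosed : IsClosed (V : Set H) := ContinuousLinearMap.isClosed_ker (Q - 1)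
  have : CompleteSpace V := hVclosed.completeSpace_coe
  have hsec : SecondCountableTopology H := UniformSpace.secondCountable_of_separable H
  -- With P = (1 + Q)/2 one has P + J P J - 2A = 1. If the range of P had finite dimension, the
  -- identity would be compact.
  have hVinf : ¬ FiniteDimensional ℂ V := by
    intro hf
    apply hinf
    have hPmem : ∀ x, (1 / 2 : ℂ) • (x + Q x) ∈ V := fun x => by
      rw [hVmem, map_smul, map_add, hQQ, add_comm]
    obtain ⟨P, hP⟩ : ∃ P : H →L[ℂ] H, ∀ x, P x = (1 / 2 : ℂ) • (x + Q x) :=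
      ⟨(1 / 2 : ℂ) • (1 + Q), fun x => by simp⟩
    have hPc : IsCompactOperator P := by
      have h1 : IsCompactOperator (P.codRestrict V fun x => by rw [hP]; exact hPmem x) := by
        have := FiniteDimensional.proper ℂ V
        exact isCompactOperator_of_locallyCompactSpace_dom _
      exact h1.clm_comp V.subtypeL
    have hJPJ : IsCompactOperator (fun x => J (P (J x))) := by
      obtain ⟨K, hK, hK'⟩ := hPc
      refine ⟨J '' K, hK.image hJcont, ?_⟩
      have h1 : J ⁻¹' (P ⁻¹' K) ∈ 𝓝 (0 : H) := hJcont.continuousAt.preimage_mem_nhds (by rwa [hJ0])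
      exact mem_of_superset h1 fun x hx => ⟨_, hx, rfl⟩
    have hid : IsCompactOperator (fun x : H => (P x + J (P (J x))) - (2 : ℂ) • A x) :=
      (hPc.add hJPJ).sub (hc.smul (2 : ℂ))
    have hid2 : (fun x : H => (P x + J (P (J x))) - (2 : ℂ) • A x) = id := by
      funext x
      have h1 : (2 : ℂ) • A x = (1 / 2 : ℂ) • (Q x + R x) := by rw [← hA, smul_smul]; norm_num
      rw [h1, hP, hP, hJc, hJa, hJJ, ← hR]
      simp only [map_div₀, map_one, Complex.conj_ofNat, id]
      have : x = (1 / 2 : ℂ) • x + (1 / 2 : ℂ) • x := by rw [← add_smul]; norm_num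
      conv_rhs => rw [this]
      simp only [smul_add]
      abel
    rw [hid2] at hid
    exact FiniteDimensional.of_isCompactOperator_id (𝕜 := ℂ) hid
  have hBV : ∀ x ∈ V, (A * A) x ∈ V := fun x hx => by
    rw [hVmem] at hx ⊢
    rw [mul_apply_eq_comp, hcomm, hx]
  have hBs : (A * A).toLinearMap.IsSymmetric := fun x y => by
    change inner ℂ (A (A x)) y = inner ℂ x (A (A y))
    rw [hAs, hAs]
  have hBc : IsCompactOperator (A * A) := hc.comp_clm A
  -- Only A² preserves the space V of vectors fixed by Q; it is diagonalized there, and eigenvectors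
  -- of A are recovered from x and A x.
  obtain ⟨b, μ, hb, hμ⟩ := IsCompactOperator.exists_hilbertBasis_eigenvectors hVinf
    (A := (A * A).restrict hBV) (hBc.restrict' (f := (A * A).toLinearMap) hBV)
    (hBs.restrict_invariant hBV)
  obtain ⟨x, hx⟩ : ∃ x : ℕ → H, ∀ i, x i = ((b i : V) : H) := ⟨_, fun _ => rfl⟩
  have hxort : Orthonormal ℂ x := by
    have := b.orthonormal.comp_linearIsometry V.subtypeₗᵢ
    have h2 : x = V.subtypeₗᵢ ∘ b := funext fun i => by simp [hx]
    rwa [h2]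
  have hxQ : ∀ i, Q (x i) = x i := fun i => (hVmem _).mp (by rw [hx]; exact (b i).2)
  have hxB : ∀ i, A (A (x i)) = (μ i : ℂ) • x i := fun i => by
    have := congrArg (Subtype.val : V → H) (hb i)
    rw [hx]
    exact this
  have hxd : ∀ y, Q y = y → (∀ i, inner ℂ (x i) y = 0) → y = 0 := fun y hy h => by
    have h1 : (⟨y, (hVmem y).mpr hy⟩ : V) = 0 := by
      have h2 := b.hasSum_repr ⟨y, (hVmem y).mpr hy⟩
      have h3 : ∀ i, b.repr ⟨y, (hVmem y).mpr hy⟩ i = 0 := fun i => by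
        rw [HilbertBasis.repr_apply_apply, Submodule.coe_inner, ← hx]; exact h i
      simp only [h3, zero_smul] at h2
      exact h2.unique hasSum_zero
    exact congrArg Subtype.val h1
  have hxx : ∀ i j, inner ℂ (x i) (x j) = if i = j then (1 : ℂ) else 0 :=
    orthonormal_iff_ite.mp hxort
  have hxBx : ∀ i j, inner ℂ (A (x i)) (A (x j)) = if i = j then (μ i : ℂ) else 0 := fun i j => by
    rw [hAs, hxB, inner_smul_right, hxx]
    split_ifs with h
    · rw [h, mul_one]
    · simp
  -- Compressing 4A = Q + R and 16A² = 2 + QR + RQ to V and eliminating R leaves ⟨x i, A (x j)⟩ = 2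
  -- ⟨x i, A² (x j)⟩.
  have hxAx : ∀ i j, inner ℂ (x i) (A (x j)) = if i = j then (2 * μ i : ℂ) else 0 := fun i j => by
    have h1 : inner ℂ (x i) ((16 : ℂ) • A (A (x j))) = 16 * (if i = j then (μ i : ℂ) else 0) := by
      rw [inner_smul_right, ← hAs, hxBx]
    rw [hAA, inner_add_right, inner_add_right, ← hQs, hxQ, hxQ, inner_smul_right, hxx] at h1
    have h2 : inner ℂ (x i) ((4 : ℂ) • A (x j)) = inner ℂ (x i) (Q (x j) + R (x j)) := by rw [hA]
    rw [inner_smul_right, inner_add_right, hxQ, hxx] at h2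
    split_ifs at h1 h2 ⊢ with h
    · linear_combination (1 / 8) * h1 + (1 / 4) * h2
    · linear_combination (1 / 8) * h1 + (1 / 4) * h2
  have hμA : ∀ i, μ i = ‖A (x i)‖ ^ 2 := fun i => by
    have := hxBx i i
    rw [if_pos rfl, inner_self_eq_norm_sq_to_K] at this
    apply Complex.ofReal_injective
    rw [← this]
    simp
  have hμ0 : ∀ i, 0 ≤ μ i := fun i => by rw [hμA]; positivity
  obtain ⟨l, hl⟩ : ∃ l : ℕ → ℝ, ∀ i, l i = √(μ i) := ⟨_, fun _ => rfl⟩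
  have hl0 : ∀ i, 0 ≤ l i := fun i => by rw [hl]; positivity
  have hll : ∀ i, μ i = l i ^ 2 := fun i => by rw [hl, Real.sq_sqrt (hμ0 i)]
  have hllC : ∀ i, (μ i : ℂ) = (l i : ℂ) ^ 2 := fun i => by rw [hll]; push_cast; rfl
  -- The inequality ‖A‖ ≤ 1/2 gives ≤. If l = 1/2, then (1/2 + A)x is an eigenvector for 1/2 unless
  -- it vanishes; if it vanishes, x is one for -1/2.
  have hlt : ∀ i, l i < 1 / 2 := fun i => by
    refine lt_of_le_of_ne ?_ fun h => ?_
    · have h1 := hAn (x i)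
      rw [hxort.1, mul_one] at h1
      rw [hl, hμA, Real.sqrt_sq (norm_nonneg _)]
      exact h1
    · have h1 : (1 / 2 : ℂ) • x i + A (x i) = 0 := hp _ (by
        rw [map_add, map_smul, hxB, hllC, h, smul_add, smul_smul, add_comm]
        norm_num)
      have h2 : x i = 0 := hm _ (by rw [neg_smul]; exact eq_neg_of_add_eq_zero_right h1)
      exact hxort.ne_zero i h2
  have hAx0 : ∀ i, l i = 0 → A (x i) = 0 := fun i h => by
    have := hμA i
    rw [hll, h] at this
    simpa using this.symm
  have hRx0 : ∀ i, l i = 0 → R (x i) = -x i := fun i h => by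
    have := hA (x i)
    rw [hAx0 i h, smul_zero, hxQ] at this
    exact (neg_eq_of_add_eq_zero_right this.symm).symm
  -- When l i = 0, the vector x i lies in the kernel of A and so does J (x i), which Q reverses.
  -- This gives x i a partner orthogonal to V in the kernel.
  have hQJx : ∀ i, l i = 0 → Q (J (x i)) = -J (x i) := fun i h => by rw [hQJ, hRx0 i h, hJneg]
  have hxJx : ∀ i j, l j = 0 → inner ℂ (x i) (J (x j)) = 0 := fun i j h => by
    have h1 := hQs (x i) (J (x j))
    rw [hxQ, hQJx j h, inner_neg_right] at h1
    exact self_eq_neg.mp h1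
  have hAJx : ∀ j, l j = 0 → A (J (x j)) = 0 := fun j h => by rw [hAJ, hAx0 j h, hJ0]
  -- As A²x = l²x, the vectors l x + A x and l x - A x are eigenvectors for l and -l.
  obtain ⟨w, hw⟩ : ∃ w : ℝ → ℕ → H, ∀ s i, w s i = (l i : ℂ) • x i + (s : ℂ) • A (x i) :=
    ⟨_, fun _ _ => rfl⟩
  have hww : ∀ s t i j, inner ℂ (w s i) (w t j) =
      if i = j then ((l i ^ 2 * (1 + s * t + 2 * (s + t) * l i) : ℝ) : ℂ) else 0 := fun s t i j => by
    rw [hw, hw]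
    simp only [inner_add_left, inner_add_right, inner_smul_left, inner_smul_right,
      Complex.conj_ofReal, hAs (x i) (x j), hxx, hxAx, hxBx]
    split_ifs with h
    · rw [← h, hllC]; push_cast; ring
    · simp
  have hAw : ∀ s i, s * s = 1 → A (w s i) = ((s * l i : ℝ) : ℂ) • w s i := fun s i h => by
    have h' : (s : ℂ) * s = 1 := by exact_mod_cast h
    rw [hw, map_add, map_smul, map_smul, hxB, smul_add, smul_smul, smul_smul, smul_smul, hllC,
      add_comm]
    congr 2
    · push_cast; ring
    · push_cast; linear_combination (-(l i : ℂ)) * h'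
  have hwJ : ∀ s i j, l j = 0 → inner ℂ (w s i) (J (x j)) = 0 := fun s i j h => by
    rw [hw, inner_add_left, inner_smul_left, inner_smul_left, hAs, hAJx j h, hxJx i j h]
    simp
  have hwx : ∀ s i j, l i ≠ 0 → l j = 0 → inner ℂ (w s i) (x j) = 0 := fun s i j hi h => by
    have hij : i ≠ j := fun hh => hi (hh ▸ h)
    rw [hw, inner_add_left, inner_smul_left, inner_smul_left, hAs, hAx0 j h, hxx, if_neg hij]
    simp
  -- The length of `w s i` for s = ±1, read off from `hww`; it is positive because l < 1/2.
  obtain ⟨N, hN⟩ : ∃ N : ℝ → ℕ → ℝ, ∀ s i, N s i = √(l i ^ 2 * (2 + 4 * s * l i)) :=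
    ⟨_, fun _ _ => rfl⟩
  have hNpos : ∀ s i, s = 1 ∨ s = -1 → l i ≠ 0 → 0 < l i ^ 2 * (2 + 4 * s * l i) := fun s i hs hi => by
    have h1 := hlt i
    have h2 := hl0 i
    have : 0 < 2 + 4 * s * l i := by rcases hs with rfl | rfl <;> linarith
    positivity
  have hNC : ∀ s i, s = 1 ∨ s = -1 → l i ≠ 0 →
      ((N s i : ℂ)⁻¹ * (N s i : ℂ)⁻¹) * ((l i ^ 2 * (1 + s * s + 2 * (s + s) * l i) : ℝ) : ℂ) = 1 := by
    intro s i hs hi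
    have h1 := hNpos s i hs hi
    have h2 : l i ^ 2 * (1 + s * s + 2 * (s + s) * l i) = N s i * N s i := by
      rw [hN, Real.mul_self_sqrt h1.le]
      rcases hs with rfl | rfl <;> ring
    have h3 : N s i ≠ 0 := by rw [hN]; exact (Real.sqrt_pos.mpr h1).ne'
    have h4 : (N s i : ℂ) ≠ 0 := by exact_mod_cast h3
    rw [h2]
    push_cast
    field_simp
  classical
  obtain ⟨φp, hφp⟩ : ∃ φ : ℕ → H, ∀ i, φ i = if l i = 0 then x i else (N 1 i : ℂ)⁻¹ • w 1 i :=
    ⟨_, fun _ => rfl⟩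
  obtain ⟨φm, hφm⟩ : ∃ φ : ℕ → H, ∀ i, φ i = if l i = 0 then J (x i) else (N (-1) i : ℂ)⁻¹ • w (-1) i :=
    ⟨_, fun _ => rfl⟩
  have hpp : ∀ i j, inner ℂ (φp i) (φp j) = if i = j then (1 : ℂ) else 0 := fun i j => by
    rw [hφp, hφp]
    split_ifs with hi hj hij hij hj hij hij
    · rw [hxx, if_pos hij]
    · rw [hxx, if_neg hij]
    · exact absurd (hij ▸ hi) hj
    · rw [inner_smul_right, ← inner_conj_symm, hwx 1 j i hj hi]; simp
    · exact absurd (hij ▸ hj) hi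
    · rw [inner_smul_left, hwx 1 i j hi hj]; simp
    · subst hij
      rw [inner_smul_left, inner_smul_right, hww, if_pos rfl, map_inv₀, Complex.conj_ofReal,
        ← mul_assoc]
      exact hNC 1 i (Or.inl rfl) hi
    · rw [inner_smul_left, inner_smul_right, hww, if_neg hij]; simp
  have hmm : ∀ i j, inner ℂ (φm i) (φm j) = if i = j then (1 : ℂ) else 0 := fun i j => by
    rw [hφm, hφm]
    split_ifs with hi hj hij hij hj hij hij
    · rw [hJi, hxx, if_pos hij.symm]
    · rw [hJi, hxx, if_neg (Ne.symm hij)]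
    · exact absurd (hij ▸ hi) hj
    · rw [inner_smul_right, ← inner_conj_symm, hwJ (-1) j i hi]; simp
    · exact absurd (hij ▸ hj) hi
    · rw [inner_smul_left, hwJ (-1) i j hj]; simp
    · subst hij
      rw [inner_smul_left, inner_smul_right, hww, if_pos rfl, map_inv₀, Complex.conj_ofReal,
        ← mul_assoc]
      exact hNC (-1) i (Or.inr rfl) hi
    · rw [inner_smul_left, inner_smul_right, hww, if_neg hij]; simp
  have hpm : ∀ i j, inner ℂ (φp i) (φm j) = 0 := fun i j => by
    rw [hφp, hφm]
    split_ifs with hi hj hj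
    · exact hxJx i j hj
    · rw [inner_smul_right, ← inner_conj_symm, hwx (-1) j i hj hi]; simp
    · rw [inner_smul_left, hwJ 1 i j hj]; simp
    · rw [inner_smul_left, inner_smul_right, hww]; norm_num
  refine ⟨l, φp, φm, hl0, hlt, ?_, ?_, ?_, ?_, ?_⟩
  · have := (Real.continuous_sqrt.tendsto 0).comp hμ
    rw [Real.sqrt_zero] at this
    exact this.congr fun i => (hl i).symm
  · intro i
    rw [hφp]
    split_ifs with hi
    · rw [hAx0 i hi, hi]; simp
    · rw [map_smul, hAw 1 i (by norm_num), smul_comm, one_mul]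
  · intro i
    rw [hφm]
    split_ifs with hi
    · rw [hAJx i hi, hi]; simp
    · rw [map_smul, hAw (-1) i (by norm_num), smul_comm]; simp
  · rw [orthonormal_iff_ite]
    rintro (i | i) (j | j)
    · simp [hpp]
    · simp [hpm]
    · simp only [Sum.elim_inl, Sum.elim_inr, reduceCtorEq, if_false]
      rw [← inner_conj_symm, hpm, map_zero]
    · simp [hmm]
  · rw [Submodule.topologicalClosure_eq_top_iff, Submodule.eq_bot_iff]
    intro y hy
    rw [Submodule.mem_orthogonal] at hy
    have hyp : ∀ i, inner ℂ (φp i) y = 0 := fun i => hy _ (Submodule.subset_span ⟨Sum.inl i, rfl⟩)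
    have hym : ∀ i, inner ℂ (φm i) y = 0 := fun i => hy _ (Submodule.subset_span ⟨Sum.inr i, rfl⟩)
    have hyw : ∀ i, l i ≠ 0 → inner ℂ (w 1 i) y = 0 ∧ inner ℂ (w (-1) i) y = 0 := fun i hi => by
      have h1 := hyp i
      have h2 := hym i
      have e1 : (N 1 i : ℂ) ≠ 0 := by
        rw [hN]; exact_mod_cast (Real.sqrt_pos.mpr (hNpos 1 i (Or.inl rfl) hi)).ne'
      have e2 : (N (-1) i : ℂ) ≠ 0 := by
        rw [hN]; exact_mod_cast (Real.sqrt_pos.mpr (hNpos (-1) i (Or.inr rfl) hi)).ne'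
      rw [hφp, if_neg hi, inner_smul_left, map_inv₀, Complex.conj_ofReal] at h1
      rw [hφm, if_neg hi, inner_smul_left, map_inv₀, Complex.conj_ofReal] at h2
      exact ⟨(mul_eq_zero.mp h1).resolve_left (inv_ne_zero e1),
        (mul_eq_zero.mp h2).resolve_left (inv_ne_zero e2)⟩
    have hyx : ∀ i, inner ℂ (x i) y = 0 ∧ inner ℂ (x i) (A y) = 0 := fun i => by
      by_cases hi : l i = 0
      · have h1 := hyp i
        rw [hφp, if_pos hi] at h1
        exact ⟨h1, by rw [← hAs, hAx0 i hi, inner_zero_left]⟩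
      · obtain ⟨h1, h2⟩ := hyw i hi
        rw [hw, inner_add_left, inner_smul_left, inner_smul_left] at h1 h2
        simp only [Complex.conj_ofReal] at h1 h2
        have hlc : (l i : ℂ) ≠ 0 := by exact_mod_cast hi
        push_cast at h1 h2
        have h3 : (l i : ℂ) * inner ℂ (x i) y = 0 := by linear_combination (1 / 2) * h1 + (1 / 2) * h2
        refine ⟨(mul_eq_zero.mp h3).resolve_left hlc, ?_⟩
        rw [← hAs]
        linear_combination (1 / 2) * h1 - (1 / 2) * h2
    -- A vector orthogonal to every x i has no component in V. This applies to both y and A y, which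
    -- then forces A²y = -(1/2) A y.
    have hproj : ∀ v, (∀ i, inner ℂ (x i) v = 0) → Q v = -v := fun v hv => by
      have : v + Q v = 0 := by
        refine hxd _ (by rw [map_add, hQQ, add_comm]) fun i => ?_
        rw [inner_add_right, ← hQs, hxQ, hv, add_zero]
      exact (neg_eq_of_add_eq_zero_right this).symm
    have hQy := hproj y fun i => (hyx i).1
    have hQAy := hproj (A y) fun i => (hyx i).2
    have hRy : R y = (4 : ℂ) • A y + y := by rw [hA, hQy]; abel
    have hRneg : ∀ v, R (-v) = -R v := fun v => by simp [hR, hJneg]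
    have hAAy : A (A y) = (-(1 / 2) : ℂ) • A y := by
      have h1 := hAA y
      rw [hQy, hRneg, hRy, map_add, map_smul, hQAy, hQy] at h1
      have h2 : (16 : ℂ) • A (A y) = (16 : ℂ) • ((-(1 / 2) : ℂ) • A y) := by
        rw [h1]; module
      exact smul_right_injective H (by norm_num : (16 : ℂ) ≠ 0) h2
    have hAy : A y = 0 := hm _ hAAy
    rw [hAy, smul_zero, zero_add] at hRy
    have hQJy : Q (J y) = J y := by rw [hQJ, hRy]
    -- With A y = 0 the vector J y lies in V. It is orthogonal to x i through A² if l i ≠ 0, and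
    -- through the partner J (x i) if l i = 0.
    have hJy : J y = 0 := hxd _ hQJy fun i => by
      by_cases hi : l i = 0
      · have := hym i
        rw [hφm, if_pos hi] at this
        rw [← hJi, hJJ, ← inner_conj_symm, this, map_zero]
      · have h1 : inner ℂ (A (A (x i))) (J y) = 0 := by rw [hAs, hAJ, hAy, hJ0]; simp
        rw [hxB, inner_smul_left, hllC] at h1
        have hlc : (l i : ℂ) ≠ 0 := by exact_mod_cast hi
        refine (mul_eq_zero.mp h1).resolve_left ?_
        rw [map_pow, Complex.conj_ofReal]
        exact pow_ne_zero _ hlc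
    rw [← hJJ y, hJy, hJ0]

end Hilbert

/-! ### Cauchy's integral formula for cycles, after Dixon. -/

section Cauchy

/-- Cauchy integrals are holomorphic off the support of the measure. -/
theorem hasDerivAt_integral_mul_inv_sub {α : Type*} [MeasurableSpace α] {ν : Measure α}
    {g p : α → ℂ} (hg : Integrable g ν) (hp : AEStronglyMeasurable p ν) {w₀ : ℂ} {δ : ℝ}
    (hδ : 0 < δ) (hd : ∀ᵐ a ∂ν, δ ≤ ‖p a - w₀‖) :
    HasDerivAt (fun w => ∫ a, g a * (p a - w)⁻¹ ∂ν) (∫ a, g a * (p a - w₀)⁻¹ ^ 2 ∂ν) w₀ := by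
  have hmeas : ∀ w, AEStronglyMeasurable (fun a => g a * (p a - w)⁻¹) ν := fun w =>
    hg.aestronglyMeasurable.mul
      ((hp.sub aestronglyMeasurable_const).aemeasurable.inv.aestronglyMeasurable)
  refine (hasDerivAt_integral_of_dominated_loc_of_deriv_le
    (F' := fun w a => g a * (p a - w)⁻¹ ^ 2) (bound := fun a => ‖g a‖ * (2 / δ) ^ 2)
    (Metric.ball_mem_nhds w₀ (half_pos hδ))
    (Eventually.of_forall hmeas) ?_ ?_ ?_ (hg.norm.mul_const _) ?_).2
  · refine hg.mul_bdd (c := 1 / δ)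
      ((hp.sub aestronglyMeasurable_const).aemeasurable.inv.aestronglyMeasurable) ?_
    filter_upwards [hd] with a ha
    rw [norm_inv, ← one_div]
    exact one_div_le_one_div_of_le hδ ha
  · exact hg.aestronglyMeasurable.mul
      (((hp.sub aestronglyMeasurable_const).aemeasurable.inv.aestronglyMeasurable).pow 2)
  · filter_upwards [hd] with a ha w hw
    have h1 : δ / 2 ≤ ‖p a - w‖ := by
      rw [mem_ball_iff_norm] at hw
      have := norm_sub_le_norm_sub_add_norm_sub (p a) w w₀
      linarith
    rw [norm_mul, norm_pow, norm_inv]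
    gcongr
    rw [← one_div, ← inv_div δ 2, ← one_div]
    exact one_div_le_one_div_of_le (half_pos hδ) h1
  · filter_upwards [hd] with a ha w hw
    have h1 : p a - w ≠ 0 := by
      intro h0
      rw [mem_ball_iff_norm] at hw
      have := norm_sub_le_norm_sub_add_norm_sub (p a) w w₀
      rw [h0, norm_zero] at this
      linarith
    have := (((hasDerivAt_id w).const_sub (p a)).inv h1).const_mul (g a)
    convert! this using 1
    simp only [id]
    field_simp

namespace IsClosedCurve

variable {γ : ℝ → ℂ}

theorem ae_norm_deriv_le (hγ : IsClosedCurve γ) : ∃ C : ℝ, ∀ᵐ t ∂volume.restrict (Ioc (0 : ℝ) 1), ‖deriv γ t‖ ≤ C := by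
  obtain ⟨P, -, -, C, hC⟩ := hγ.piecewise
  refine ⟨C, ?_⟩
  rw [ae_restrict_iff' measurableSet_Ioc]
  have h0 : volume ((P : Set ℝ) ∪ {1}) = 0 :=
    ((P.finite_toSet).union (finite_singleton 1)).measure_zero _
  filter_upwards [measure_eq_zero_iff_ae_notMem.mp h0] with t ht hm
  refine hC t ⟨⟨hm.1, lt_of_le_of_ne hm.2 fun h => ht (Or.inr h)⟩, fun h => ht (Or.inl h)⟩

theorem integrable_deriv (hγ : IsClosedCurve γ) : Integrable (deriv γ) (volume.restrict (Ioc (0 : ℝ) 1)) := by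
  obtain ⟨C, hC⟩ := hγ.ae_norm_deriv_le
  exact Integrable.of_bound (measurable_deriv γ).aestronglyMeasurable C hC

theorem _root_.ContinuousOn.aestronglyMeasurable_unitInterval {E : Type*} [TopologicalSpace E] [TopologicalSpace.PseudoMetrizableSpace E]
    [SecondCountableTopologyEither ℝ E] {g : ℝ → E} (hg : ContinuousOn g (Icc 0 1)) :
    AEStronglyMeasurable g (volume.restrict (Ioc (0 : ℝ) 1)) :=
  (hg.mono Ioc_subset_Icc_self).aestronglyMeasurable measurableSet_Ioc

theorem integrable_smul_deriv (hγ : IsClosedCurve γ) {E : Type*} [NormedAddCommGroup E] [NormedSpace ℂ E]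
    {g : ℝ → E} (hg : ContinuousOn g (Icc 0 1)) :
    Integrable (fun t => deriv γ t • g t) (volume.restrict (Ioc (0 : ℝ) 1)) := by
  obtain ⟨C, hC⟩ := isCompact_Icc.exists_bound_of_continuousOn hg
  refine hγ.integrable_deriv.smul_bdd C hg.aestronglyMeasurable_unitInterval ?_
  rw [ae_restrict_iff' measurableSet_Ioc]
  exact Eventually.of_forall fun t ht => hC t (Ioc_subset_Icc_self ht)

/-- F ∘ γ is continuous and differentiable off finitely many parameters, so the fundamental theorem
of calculus applies between equal endpoints. -/
theorem integral_deriv_mul_eq_zero (hγ : IsClosedCurve γ) {s : Set ℂ} (hs : ∀ t ∈ Icc (0 : ℝ) 1, γ t ∈ s) {F F' : ℂ → ℂ}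
    (hF : ∀ z ∈ s, HasDerivAt F (F' z) z) (hF' : ContinuousOn F' s) :
    ∫ t in (0 : ℝ)..1, deriv γ t * F' (γ t) = 0 := by
  obtain ⟨P, hP, -⟩ := hγ.piecewise
  have hc : ContinuousOn (fun t => F (γ t)) (Icc 0 1) :=
    ContinuousOn.comp (t := s) (fun z hz => (hF z hz).continuousAt.continuousWithinAt)
      hγ.continuousOn hs
  rw [integral_eq_of_hasDerivAt_off_countable_of_le (fun t => F (γ t)) _ zero_le_one
    P.countable_toSet hc, hγ.closed, sub_self]
  · intro t ht
    exact ((hF (γ t) (hs t (Ioo_subset_Icc_self ht.1))).scomp t (hP t ht).hasDerivAt)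
  · rw [intervalIntegrable_iff_integrableOn_Ioc_of_le zero_le_one]
    exact hγ.integrable_smul_deriv (hF'.comp hγ.continuousOn hs)

theorem isCompact_image (hγ : IsClosedCurve γ) : IsCompact (γ '' Icc 0 1) := isCompact_Icc.image_of_continuousOn hγ.continuousOn

theorem exists_dist_le (hγ : IsClosedCurve γ) {w : ℂ} (hw : w ∉ γ '' Icc 0 1) :
    ∃ δ > 0, ∀ᵐ t ∂volume.restrict (Ioc (0 : ℝ) 1), δ ≤ ‖γ t - w‖ := by
  obtain ⟨δ, hδ, hd⟩ := Metric.mem_nhds_iff.mp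
    (hγ.isCompact_image.isClosed.isOpen_compl.mem_nhds hw)
  refine ⟨δ, hδ, ?_⟩
  rw [ae_restrict_iff' measurableSet_Ioc]
  refine Eventually.of_forall fun t ht => ?_
  by_contra hcon
  push Not at hcon
  exact hd (mem_ball_iff_norm.mpr hcon) ⟨t, Ioc_subset_Icc_self ht, rfl⟩

theorem hasDerivAt_integral (hγ : IsClosedCurve γ) {g : ℝ → ℂ} (hg : ContinuousOn g (Icc 0 1)) {w : ℂ}
    (hw : w ∉ γ '' Icc 0 1) :
    HasDerivAt (fun w => ∫ t in (0 : ℝ)..1, deriv γ t * g t * (γ t - w)⁻¹)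
      (∫ t in (0 : ℝ)..1, deriv γ t * g t * (γ t - w)⁻¹ ^ 2) w := by
  obtain ⟨δ, hδ, hd⟩ := hγ.exists_dist_le hw
  simp only [intervalIntegral.integral_of_le zero_le_one]
  exact hasDerivAt_integral_mul_inv_sub (hγ.integrable_smul_deriv hg)
    (hγ.continuousOn.aestronglyMeasurable_unitInterval) hδ hd

/-- The derivative in w is the integral of (z - w)⁻² along the curve, which has the primitive -(z -
w)⁻¹. Hence the index is locally constant. -/
theorem hasDerivAt_index (hγ : IsClosedCurve γ) {w : ℂ} (hw : w ∉ γ '' Icc 0 1) :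
    HasDerivAt (fun w => ∫ t in (0 : ℝ)..1, deriv γ t * (γ t - w)⁻¹) 0 w := by
  have h1 := hγ.hasDerivAt_integral (g := fun _ => 1) continuousOn_const hw
  simp only [mul_one] at h1
  convert! h1 using 1
  symm
  refine hγ.integral_deriv_mul_eq_zero (s := {w}ᶜ) (F := fun z => -(z - w)⁻¹)
    (F' := fun z => (z - w)⁻¹ ^ 2) (fun t ht h => hw ⟨t, ht, h⟩) ?_ ?_
  · intro z hz
    have hz' : z - w ≠ 0 := sub_ne_zero.mpr hz
    have := (((hasDerivAt_id z).sub_const w).inv hz').neg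
    convert! this using 1
    simp only [id]
    field_simp
  · exact ((continuousOn_id.sub continuousOn_const).inv₀ fun z hz => sub_ne_zero.mpr hz).pow 2

theorem eventually_index_eq (hγ : IsClosedCurve γ) {w : ℂ} (hw : w ∉ γ '' Icc 0 1) : ∀ᶠ v in 𝓝 w,
    ∫ t in (0 : ℝ)..1, deriv γ t * (γ t - v)⁻¹ = ∫ t in (0 : ℝ)..1, deriv γ t * (γ t - w)⁻¹ := by
  obtain ⟨δ, hδ, hd⟩ := Metric.mem_nhds_iff.mp
    (hγ.isCompact_image.isClosed.isOpen_compl.mem_nhds hw)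
  filter_upwards [Metric.ball_mem_nhds w hδ] with v hv
  exact Metric.isOpen_ball.is_const_of_deriv_eq_zero (convex_ball w δ).isPreconnected
    (fun z hz => (hγ.hasDerivAt_index (hd hz)).differentiableAt.differentiableWithinAt)
    (fun z hz => (hγ.hasDerivAt_index (hd hz)).deriv) hv (Metric.mem_ball_self hδ)

/-- The curve lies in the disc |z| < |w|, where log(1 - z/w) is a primitive. -/
theorem index_eq_zero_of_large (hγ : IsClosedCurve γ) {R : ℝ} (hR : ∀ t ∈ Icc (0 : ℝ) 1, ‖γ t‖ ≤ R) {w : ℂ} (hw : R < ‖w‖) :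
    ∫ t in (0 : ℝ)..1, deriv γ t * (γ t - w)⁻¹ = 0 := by
  have hR0 : 0 ≤ R := (norm_nonneg _).trans (hR 0 ⟨le_rfl, zero_le_one⟩)
  have hw0 : w ≠ 0 := fun h => by rw [h, norm_zero] at hw; linarith
  refine hγ.integral_deriv_mul_eq_zero (s := Metric.ball 0 ‖w‖) (F := fun z => Complex.log (1 - z / w))
    (F' := fun z => (z - w)⁻¹) (fun t ht => by simpa using (hR t ht).trans_lt hw) ?_ ?_
  · intro z hz
    rw [mem_ball_zero_iff] at hz
    have h1 : ‖z / w‖ < 1 := by rw [norm_div]; exact (div_lt_one (by positivity)).mpr hz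
    have h2 : 1 - z / w ∈ Complex.slitPlane := by
      left
      have := (Complex.abs_re_le_norm (z / w)).trans_lt h1
      rw [abs_lt] at this
      simp only [Complex.sub_re, Complex.one_re]
      linarith
    have h3 := (((hasDerivAt_id z).div_const w).const_sub 1).clog h2
    convert! h3 using 1
    have h4 : z - w ≠ 0 := fun h => by
      rw [sub_eq_zero] at h; rw [h] at hz; exact lt_irrefl _ hz
    have h5 : w - z ≠ 0 := fun h => h4 (by rw [← neg_sub, h, neg_zero])
    have h6 : 1 - z / w = (w - z) / w := by field_simp
    rw [id, h6]
    field_simp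
    ring
  · refine (continuousOn_id.sub continuousOn_const).inv₀ fun z hz => ?_
    rw [mem_ball_zero_iff] at hz
    intro h
    replace h : z = w := sub_eq_zero.mp h
    rw [h] at hz
    exact lt_irrefl _ hz

theorem _root_.dslope_symm' (f : ℂ → ℂ) (a b : ℂ) : dslope f a b = dslope f b a := by
  by_cases h : b = a
  · rw [h]
  · rw [dslope_of_ne f h, dslope_of_ne f (Ne.symm h), slope_comm]

/-- The point w₀ may lie on the curve. The difference quotients are bounded uniformly in t near w₀,
by the mean value inequality if γ t is close and trivially otherwise; Cauchy's estimate then bounds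
their derivatives and allows differentiation under the integral. -/
theorem differentiableAt_integral_dslope (hγ : IsClosedCurve γ) {U : Set ℂ} (hU : IsOpen U) {f : ℂ → ℂ}
    (hf : DifferentiableOn ℂ f U) (hγU : ∀ t ∈ Icc (0 : ℝ) 1, γ t ∈ U) {w₀ : ℂ} (hw : w₀ ∈ U) :
    DifferentiableAt ℂ (fun w => ∫ t in (0 : ℝ)..1, deriv γ t * dslope f w (γ t)) w₀ := by
  obtain ⟨ε, hε, hεU⟩ := Metric.mem_nhds_iff.mp (hU.mem_nhds hw)
  -- Points w range over radius r, the circles of Cauchy's estimate stay within 2r, and γ t counts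
  -- as close within 3r, so a far γ t has distance at least r from those circles.
  obtain ⟨r, hr, hrε⟩ : ∃ r > 0, 4 * r = ε := ⟨ε / 4, by positivity, by ring⟩
  have hsub : Metric.closedBall w₀ (3 * r) ⊆ U := fun z hz => hεU (by
    rw [Metric.mem_closedBall] at hz; rw [Metric.mem_ball]; linarith)
  have hcd : ContinuousOn (deriv f) (Metric.closedBall w₀ (3 * r)) :=
    ((hf.deriv hU).continuousOn).mono hsub
  obtain ⟨L, hL⟩ := (isCompact_closedBall w₀ (3 * r)).exists_bound_of_continuousOn hcd
  obtain ⟨B, hB⟩ := (isCompact_closedBall w₀ (3 * r)).exists_bound_of_continuousOn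
    (hf.continuousOn.mono hsub)
  obtain ⟨B', hB'⟩ := isCompact_Icc.exists_bound_of_continuousOn
    (hf.continuousOn.comp hγ.continuousOn hγU)
  have hw₀mem : w₀ ∈ Metric.closedBall w₀ (3 * r) := Metric.mem_closedBall_self (by positivity)
  have hL0 : 0 ≤ L := (norm_nonneg _).trans (hL w₀ hw₀mem)
  have hB0 : 0 ≤ B := (norm_nonneg _).trans (hB w₀ hw₀mem)
  have hB0' : 0 ≤ B' := (norm_nonneg _).trans (hB' 0 ⟨le_rfl, zero_le_one⟩)
  obtain ⟨M, hM⟩ : ∃ M, M = L + (B' + B) / r := ⟨_, rfl⟩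
  have hMb : ∀ t ∈ Icc (0 : ℝ) 1, ∀ w ∈ Metric.closedBall w₀ (2 * r), ‖dslope f (γ t) w‖ ≤ M := by
    intro t ht w hw
    have hw3 : w ∈ Metric.closedBall w₀ (3 * r) := Metric.closedBall_subset_closedBall (by linarith) hw
    by_cases hne : w = γ t
    · rw [← hne, dslope_same]
      have : 0 ≤ (B' + B) / r := by positivity
      exact (hL w hw3).trans (by rw [hM]; linarith)
    · rw [dslope_of_ne f hne, slope_def_module, norm_smul, norm_inv]
      have hpos : 0 < ‖w - γ t‖ := norm_pos_iff.mpr (sub_ne_zero.mpr hne)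
      by_cases hfar : γ t ∈ Metric.closedBall w₀ (3 * r)
      · have := (convex_closedBall w₀ (3 * r)).norm_image_sub_le_of_norm_deriv_le
          (fun z hz => hf.differentiableAt (hU.mem_nhds (hsub hz))) hL hfar hw3
        rw [inv_mul_le_iff₀ hpos]
        have h2 : 0 ≤ (B' + B) / r := by positivity
        rw [hM]
        nlinarith
      · have h1 : r ≤ ‖w - γ t‖ := by
          rw [Metric.mem_closedBall, not_le, dist_comm] at hfar
          rw [Metric.mem_closedBall] at hw
          have := dist_triangle w₀ w (γ t)
          rw [dist_comm w₀ w, dist_eq_norm w (γ t)] at this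
          linarith
        have h2 : ‖f w - f (γ t)‖ ≤ B + B' := (norm_sub_le _ _).trans (add_le_add (hB w hw3) (hB' t ht))
        calc ‖w - γ t‖⁻¹ * ‖f w - f (γ t)‖ ≤ r⁻¹ * (B + B') := by gcongr
          _ = (B' + B) / r := by rw [inv_mul_eq_div, add_comm]
          _ ≤ M := by rw [hM]; linarith
  have hmeas : ∀ w ∈ U, ContinuousOn (fun t => dslope f w (γ t)) (Icc 0 1) := fun w hw =>
    ((continuousOn_dslope (hU.mem_nhds hw)).mpr
      ⟨hf.continuousOn, hf.differentiableAt (hU.mem_nhds hw)⟩).comp hγ.continuousOn hγU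
  have hdiff : ∀ t ∈ Icc (0 : ℝ) 1, DifferentiableOn ℂ (dslope f (γ t)) U := fun t ht =>
    (Complex.differentiableOn_dslope (hU.mem_nhds (hγU t ht))).mpr hf
  have hballU : ∀ w ∈ Metric.ball w₀ r, w ∈ U := fun w hw =>
    hsub (Metric.closedBall_subset_closedBall (by linarith) (Metric.ball_subset_closedBall hw))
  have hint : ∀ w ∈ U, Integrable (fun t => deriv γ t * dslope f w (γ t))
      (volume.restrict (Ioc (0 : ℝ) 1)) := fun w hw => hγ.integrable_smul_deriv (hmeas w hw)
  simp only [intervalIntegral.integral_of_le zero_le_one]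
  have hderiv : ∀ t ∈ Icc (0 : ℝ) 1, ∀ w ∈ U, HasDerivAt (fun w => dslope f w (γ t))
      (deriv (dslope f (γ t)) w) w := fun t ht w hw => by
    simp only [dslope_symm' f _ (γ t)]
    exact ((hdiff t ht).differentiableAt (hU.mem_nhds hw)).hasDerivAt
  refine (hasDerivAt_integral_of_dominated_loc_of_deriv_le
    (F' := fun w t => deriv γ t * deriv (fun w => dslope f w (γ t)) w)
    (bound := fun t => ‖deriv γ t‖ * (M / r)) (Metric.ball_mem_nhds w₀ hr)
    ?_ (hint w₀ hw) ?_ ?_ (hγ.integrable_deriv.norm.mul_const _) ?_).2.differentiableAt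
  · filter_upwards [hU.mem_nhds hw] with w hw
    exact (hint w hw).aestronglyMeasurable
  -- Measurability in t of the derivative: it is a pointwise limit of slopes along a sequence
  -- tending to w₀.
  · refine hγ.integrable_deriv.aestronglyMeasurable.mul ?_
    obtain ⟨u, hu⟩ : ∃ u : ℕ → ℂ, ∀ n, u n = w₀ + ((r / (n + 2) : ℝ) : ℂ) := ⟨_, fun _ => rfl⟩
    have hun : ∀ n, u n ≠ w₀ := fun n => by
      rw [hu]
      have : r / ((n : ℝ) + 2) ≠ 0 := by positivity
      rw [Ne, add_eq_left, Complex.ofReal_eq_zero]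
      exact this
    have huU : ∀ n, u n ∈ U := fun n => hballU _ (by
      rw [mem_ball_iff_norm, hu, add_sub_cancel_left, Complex.norm_real, Real.norm_of_nonneg (by positivity)]
      exact (div_lt_self hr (by have : (0 : ℝ) ≤ n := n.cast_nonneg; linarith)))
    have hulim : Tendsto u atTop (𝓝[≠] w₀) := by
      refine tendsto_nhdsWithin_iff.mpr ⟨?_, Eventually.of_forall hun⟩
      have h1 : Tendsto (fun n : ℕ => r / ((n : ℝ) + 2)) atTop (𝓝 0) :=
        tendsto_const_nhds.div_atTop (tendsto_atTop_add_const_right _ _ tendsto_natCast_atTop_atTop)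
      have h2 := tendsto_const_nhds (x := w₀) |>.add ((Complex.continuous_ofReal.tendsto 0).comp h1)
      rw [Complex.ofReal_zero, add_zero] at h2
      exact h2.congr fun n => (hu n).symm
    refine aestronglyMeasurable_of_tendsto_ae atTop
      (f := fun n t => slope (fun w => dslope f w (γ t)) w₀ (u n)) (fun n => ?_) ?_
    · simp only [slope_def_field]
      exact ((ContinuousOn.aestronglyMeasurable_unitInterval (hmeas _ (huU n))).sub
        (ContinuousOn.aestronglyMeasurable_unitInterval (hmeas _ hw))).mul_const (u n - w₀)⁻¹ |>.congr
        (Eventually.of_forall fun t => by simp [div_eq_mul_inv])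
    · rw [ae_restrict_iff' measurableSet_Ioc]
      refine Eventually.of_forall fun t ht => ?_
      have := hderiv t (Ioc_subset_Icc_self ht) w₀ hw
      rw [this.deriv]
      exact (hasDerivAt_iff_tendsto_slope.mp this).comp hulim
  · rw [ae_restrict_iff' measurableSet_Ioc]
    refine Eventually.of_forall fun t ht w hwb => ?_
    have ht' := Ioc_subset_Icc_self ht
    rw [(hderiv t ht' w (hballU w hwb)).deriv, norm_mul]
    gcongr
    have hsub2 : Metric.closedBall w r ⊆ Metric.closedBall w₀ (2 * r) := fun z hz => by
      rw [Metric.mem_closedBall] at hz ⊢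
      rw [Metric.mem_ball] at hwb
      linarith [dist_triangle z w w₀]
    refine Complex.norm_deriv_le_of_forall_mem_sphere_norm_le hr ?_ fun z hz =>
      hMb t ht' z (hsub2 (Metric.sphere_subset_closedBall hz))
    refine DifferentiableOn.diffContOnCl ((hdiff t ht').mono ?_)
    refine (Metric.closure_ball_subset_closedBall).trans (hsub2.trans ((Metric.closedBall_subset_closedBall (by linarith)).trans hsub))
  · rw [ae_restrict_iff' measurableSet_Ioc]
    refine Eventually.of_forall fun t ht w hwb => ?_
    have := hderiv t (Ioc_subset_Icc_self ht) w (hballU w hwb)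
    rw [this.deriv]
    exact this.const_mul _

end IsClosedCurve

theorem windingNumber_eq (γ : ℝ → ℂ) (w : ℂ) : windingNumber γ w =
    1 / (2 * Real.pi * Complex.I) * ∫ t in (0 : ℝ)..1, deriv γ t * (γ t - w)⁻¹ := by
  simp only [windingNumber, mul_comm]

/-- Cauchy's integral formula, homology version (Dixon's proof). -/
theorem EnclosesIn.cauchyFormula {γ : ℝ → ℂ} {K U : Set ℂ} (h : EnclosesIn γ K U) (hU : IsOpen U)
    {f : ℂ → ℂ} (hf : DifferentiableOn ℂ f U) {w : ℂ} (hwK : w ∈ K) (hwU : w ∈ U) :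
    1 / (2 * Real.pi * Complex.I) * ∫ t in (0 : ℝ)..1, deriv γ t * f (γ t) * (γ t - w)⁻¹ = f w := by
  classical
  have hγ := h.isClosedCurve
  have hγU : ∀ t ∈ Icc (0 : ℝ) 1, γ t ∈ U := fun t ht => (h.mem t ht).1
  have hpi : (2 * Real.pi * Complex.I : ℂ) ≠ 0 := Complex.two_pi_I_ne_zero
  have hfc : ContinuousOn (fun t => f (γ t)) (Icc 0 1) := hf.continuousOn.comp hγ.continuousOn hγU
  have hzero : ∀ v, windingNumber γ v = 0 → ∫ t in (0 : ℝ)..1, deriv γ t * (γ t - v)⁻¹ = 0 := by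
    intro v hv
    rw [windingNumber_eq] at hv
    exact (mul_eq_zero.mp hv).resolve_left (one_div_ne_zero hpi)
  have hsplit : ∀ v, v ∉ γ '' Icc 0 1 → ∫ t in (0 : ℝ)..1, deriv γ t * dslope f v (γ t) =
      (∫ t in (0 : ℝ)..1, deriv γ t * f (γ t) * (γ t - v)⁻¹) -
        f v * ∫ t in (0 : ℝ)..1, deriv γ t * (γ t - v)⁻¹ := by
    intro v hv
    have hinv : ContinuousOn (fun t => (γ t - v)⁻¹) (Icc 0 1) :=
      (hγ.continuousOn.sub continuousOn_const).inv₀ fun t ht h0 => hv ⟨t, ht, sub_eq_zero.mp h0⟩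
    rw [← intervalIntegral.integral_const_mul, ← intervalIntegral.integral_sub]
    · refine intervalIntegral.integral_congr fun t ht => ?_
      rw [uIcc_of_le zero_le_one] at ht
      have hne : γ t ≠ v := fun h0 => hv ⟨t, ht, h0⟩
      rw [dslope_of_ne f hne, slope_def_field]
      field_simp
    · rw [intervalIntegrable_iff_integrableOn_Ioc_of_le zero_le_one]
      refine (hγ.integrable_smul_deriv (hfc.mul hinv)).congr (Eventually.of_forall fun t => ?_)
      simp [mul_assoc]
    · rw [intervalIntegrable_iff_integrableOn_Ioc_of_le zero_le_one]
      exact (hγ.integrable_smul_deriv hinv).const_mul _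
  -- Dixon's function. The two expressions agree wherever the index is zero, so they glue to an
  -- entire function.
  let H : ℂ → ℂ := fun v => if v ∈ U then ∫ t in (0 : ℝ)..1, deriv γ t * dslope f v (γ t)
    else ∫ t in (0 : ℝ)..1, deriv γ t * f (γ t) * (γ t - v)⁻¹
  have hH0 : ∀ v, v ∉ γ '' Icc 0 1 → ∫ t in (0 : ℝ)..1, deriv γ t * (γ t - v)⁻¹ = 0 →
      H v = ∫ t in (0 : ℝ)..1, deriv γ t * f (γ t) * (γ t - v)⁻¹ := by
    intro v hv hv0
    simp only [H]
    split_ifs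
    · rw [hsplit v hv, hv0, mul_zero, sub_zero]
    · rfl
  have hdiff : Differentiable ℂ H := by
    intro v
    by_cases hv : v ∈ U
    · refine (hγ.differentiableAt_integral_dslope hU hf hγU hv).congr_of_eventuallyEq ?_
      filter_upwards [hU.mem_nhds hv] with u hu
      simp only [H, if_pos hu]
    · have hvγ : v ∉ γ '' Icc 0 1 := by
        rintro ⟨t, ht, rfl⟩
        exact hv (hγU t ht)
      refine (hγ.hasDerivAt_integral hfc hvγ).differentiableAt.congr_of_eventuallyEq ?_
      -- The index vanishes at v ∉ U and is locally constant, so the second expression is valid on a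
      -- whole neighbourhood of v, inside U too.
      filter_upwards [hγ.eventually_index_eq hvγ,
        hγ.isCompact_image.isClosed.isOpen_compl.mem_nhds hvγ] with u hu hu2
      exact hH0 u hu2 (hu.trans (hzero v (h.outside v hv)))
  have hlim : Tendsto H (cocompact ℂ) (𝓝 0) := by
    obtain ⟨R, hR⟩ := isCompact_Icc.exists_bound_of_continuousOn hγ.continuousOn
    obtain ⟨B, hB⟩ : ∃ B, B = ∫ t in Ioc (0 : ℝ) 1, ‖deriv γ t * f (γ t)‖ := ⟨_, rfl⟩
    have hB0 : 0 ≤ B := by rw [hB]; exact integral_nonneg fun t => norm_nonneg _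
    have h1 : Tendsto (fun v : ℂ => B * (‖v‖ - R)⁻¹) (cocompact ℂ) (𝓝 (B * 0)) :=
      (tendsto_inv_atTop_zero.comp
        (tendsto_atTop_add_const_right _ (-R) (tendsto_norm_cocompact_atTop (E := ℂ)))).const_mul B
    rw [mul_zero] at h1
    refine squeeze_zero_norm' ?_ h1
    filter_upwards [(tendsto_norm_cocompact_atTop (E := ℂ)).eventually_gt_atTop R] with v hv
    have hvγ : v ∉ γ '' Icc 0 1 := by
      rintro ⟨t, ht, rfl⟩
      exact absurd (hR t ht) (not_le.mpr hv)
    rw [hH0 v hvγ (hγ.index_eq_zero_of_large hR hv), intervalIntegral.integral_of_le zero_le_one, hB,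
      ← integral_mul_const]
    refine norm_integral_le_of_norm_le ?_ ?_
    · exact (hγ.integrable_smul_deriv hfc).norm.mul_const _
    · rw [ae_restrict_iff' measurableSet_Ioc]
      refine Eventually.of_forall fun t ht => ?_
      rw [norm_mul, norm_inv]
      have h2 : ‖v‖ - R ≤ ‖γ t - v‖ := by
        have h3 := norm_sub_norm_le v (γ t)
        rw [norm_sub_rev] at h3
        linarith [hR t (Ioc_subset_Icc_self ht)]
      have h3 : 0 < ‖v‖ - R := by linarith
      gcongr
  -- Liouville's theorem: H is entire and tends to zero at infinity.
  have hHw := hdiff.apply_eq_of_tendsto_cocompact w hlim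
  have hwγ : w ∉ γ '' Icc 0 1 := by
    rintro ⟨t, ht, rfl⟩
    exact (h.mem t ht).2 hwK
  simp only [H, if_pos hwU] at hHw
  rw [hsplit w hwγ] at hHw
  have h1 := h.inside w hwK
  rw [windingNumber_eq] at h1
  rw [sub_eq_zero.mp hHw, mul_left_comm, h1, mul_one]

end Cauchy

/-! ### Geometry of the boundary curve. -/

namespace PlanarDomain

variable {a : ℝ} (D : PlanarDomain a)

/-- The boundary curve as a point set. -/
def curve : Set ℂ := range D.z

/-- The positively oriented unit tangent. -/
noncomputable def tangent (x : ℂ) : ℂ := Complex.I * D.normal x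

theorem continuous_z : Continuous D.z := D.contDiff.continuous

theorem hasDerivAt_z (t : ℝ) : HasDerivAt D.z (deriv D.z t) t :=
  ((D.contDiff.differentiable one_ne_zero) t).hasDerivAt

theorem periodic_deriv : Function.Periodic (deriv D.z) 1 := fun t => by
  have h : (fun s => D.z (s + 1)) = D.z := funext D.periodic
  have := deriv_comp_add_const D.z 1 t
  rw [← this, h]

theorem exists_Ioc (t : ℝ) : ∃ s ∈ Ioc (0 : ℝ) 1, ∃ n : ℤ, t = s + n := by
  have h := existsUnique_add_zsmul_mem_Ioc (zero_lt_one' ℝ) t 0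
  obtain ⟨n, hn, -⟩ := h
  refine ⟨t + n • (1 : ℝ), by simpa using hn, -n, by simp⟩

theorem z_add_int (t : ℝ) (n : ℤ) : D.z (t + n) = D.z t := by
  simpa using D.periodic.int_mul n t

theorem deriv_add_int (t : ℝ) (n : ℤ) : deriv D.z (t + n) = deriv D.z t := by
  simpa using D.periodic_deriv.int_mul n t

theorem normal_z' (t : ℝ) : D.normal (D.z t) = D.normalAt t := by
  obtain ⟨s, hs, n, rfl⟩ := exists_Ioc t
  rw [z_add_int, D.normal_z hs, normalAt, normalAt, deriv_add_int]

theorem tangent_z (t : ℝ) : D.tangent (D.z t) = deriv D.z t / (‖deriv D.z t‖ : ℂ) := by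
  rw [tangent, normal_z', normalAt, ← mul_assoc]
  simp

theorem norm_tangent_le (x : ℂ) : ‖D.tangent x‖ ≤ 1 := by
  rw [tangent, norm_mul, Complex.norm_I, one_mul]; exact D.norm_normal_le x

theorem norm_tangent {x : ℂ} (hx : x ∈ D.curve) : ‖D.tangent x‖ = 1 := by
  obtain ⟨t, rfl⟩ := hx
  rw [tangent, norm_mul, Complex.norm_I, one_mul, normal_z', norm_normalAt]

theorem measurable_tangent : Measurable D.tangent := D.measurable_normal.const_mul _

theorem curve_eq_image : D.curve = D.z '' Icc 0 1 := by
  apply Subset.antisymm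
  · rintro _ ⟨t, rfl⟩
    obtain ⟨s, hs, n, rfl⟩ := exists_Ioc t
    exact ⟨s, Ioc_subset_Icc_self hs, (D.z_add_int s n).symm⟩
  · rintro _ ⟨t, -, rfl⟩
    exact ⟨t, rfl⟩

theorem isCompact_curve : IsCompact D.curve := by
  rw [curve_eq_image]; exact isCompact_Icc.image D.continuous_z

theorem ae_mem_curve : ∀ᵐ x ∂D.arcLength, x ∈ D.curve := by
  refine (ae_map_iff (p := fun x => x ∈ D.curve) D.continuous_z.measurable.aemeasurable
    D.isCompact_curve.isClosed.measurableSet).mpr ?_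
  exact Eventually.of_forall fun t => ⟨t, rfl⟩

theorem eq_add_int_of_z_eq {s t : ℝ} (h : D.z s = D.z t) : ∃ n : ℤ, t = s + n := by
  obtain ⟨s', hs, n, rfl⟩ := exists_Ioc s
  obtain ⟨t', ht, m, rfl⟩ := exists_Ioc t
  rw [z_add_int, z_add_int] at h
  have := D.injOn hs ht h
  exact ⟨m - n, by rw [this]; push_cast; ring⟩

theorem eq_of_z_eq {s t : ℝ} (h : D.z s = D.z t) (hst : |t - s| < 1) : s = t := by
  obtain ⟨n, rfl⟩ := D.eq_add_int_of_z_eq h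
  rw [add_sub_cancel_left] at hst
  have : |n| < 1 := by exact_mod_cast hst
  rw [Int.abs_lt_one_iff.mp this]; simp

/-- Periodicity brings every point of the curve within half a period of s, the range in which
`exists_chordArc` holds. -/
theorem exists_near (s t : ℝ) : ∃ t', |t' - s| ≤ 1 / 2 ∧ D.z t' = D.z t ∧
    deriv D.z t' = deriv D.z t := by
  refine ⟨t + (-round (t - s) : ℤ), ?_, D.z_add_int _ _, D.deriv_add_int _ _⟩
  have := abs_sub_round (t - s)
  push_cast
  rwa [show t + -(round (t - s) : ℝ) - s = t - s - round (t - s) by ring]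

theorem exists_deriv_lower : ∃ m > 0, ∀ t, m ≤ ‖deriv D.z t‖ := by
  obtain ⟨t₀, -, h⟩ := isCompact_Icc.exists_isMinOn (s := Icc (0 : ℝ) 1) ⟨0, by simp⟩
    D.continuous_deriv.norm.continuousOn
  refine ⟨‖deriv D.z t₀‖, norm_pos_iff.mpr (D.regular t₀), fun t => ?_⟩
  obtain ⟨s, hs, n, rfl⟩ := exists_Ioc t
  rw [deriv_add_int]
  exact h (Ioc_subset_Icc_self hs)

theorem exists_deriv_upper : ∃ L > 0, ∀ t, ‖deriv D.z t‖ ≤ L := by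
  obtain ⟨L, hL⟩ := isCompact_Icc.exists_bound_of_continuousOn (s := Icc (0 : ℝ) 1)
    D.continuous_deriv.continuousOn
  refine ⟨max L 1, by positivity, fun t => ?_⟩
  obtain ⟨s, hs, n, rfl⟩ := exists_Ioc t
  rw [deriv_add_int]
  exact (hL s (Ioc_subset_Icc_self hs)).trans (le_max_left _ _)

theorem exists_holder : ∃ C > 0, ∀ s t : ℝ, ‖deriv D.z s - deriv D.z t‖ ≤ C * |s - t| ^ a := by
  obtain ⟨C, hC⟩ := D.holder
  refine ⟨max C 1, by positivity, fun s t => (hC s t).trans ?_⟩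
  gcongr
  exact le_max_left _ _

/-- Mean value inequality for z u - u z'(s), whose derivative is small by the Hölder condition. -/
theorem exists_taylor (ha : 0 < a) : ∃ C > 0, ∀ s t : ℝ,
    ‖D.z t - D.z s - ((t - s : ℝ) : ℂ) * deriv D.z s‖ ≤ C * |t - s| ^ (1 + a) := by
  obtain ⟨C, hC, hH⟩ := D.exists_holder
  refine ⟨C, hC, fun s t => ?_⟩
  have hd : ∀ u : ℝ, HasDerivAt (fun u : ℝ => D.z u - (u : ℂ) * deriv D.z s)
      (deriv D.z u - deriv D.z s) u := fun u => by
    have h1 := ((hasDerivAt_id u).ofReal_comp).mul_const (deriv D.z s)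
    simp only [id, Complex.ofReal_one, one_mul] at h1
    exact (D.hasDerivAt_z u).sub h1
  have := (convex_uIcc s t).norm_image_sub_le_of_norm_hasDerivWithin_le (C := C * |t - s| ^ a)
    (fun u _ => (hd u).hasDerivWithinAt) (fun u hu => (hH u s).trans (mul_le_mul_of_nonneg_left
      (Real.rpow_le_rpow (abs_nonneg _) (abs_sub_left_of_mem_uIcc hu) ha.le) hC.le)) left_mem_uIcc right_mem_uIcc
  have e : D.z t - D.z s - ((t - s : ℝ) : ℂ) * deriv D.z s =
      (D.z t - (t : ℂ) * deriv D.z s) - (D.z s - (s : ℂ) * deriv D.z s) := by push_cast; ring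
  rw [e]
  refine this.trans (le_of_eq ?_)
  rw [Real.norm_eq_abs, Real.rpow_add' (abs_nonneg _) (by positivity), Real.rpow_one]
  ring

/-- For close parameters the linear term beats the Taylor remainder. For the others injectivity and
compactness give a positive minimal chord; parameters more than half a period apart must be excluded
since the curve closes up. -/
theorem exists_chordArc (ha : 0 < a) : ∃ c > 0, ∀ s t : ℝ, |t - s| ≤ 1 / 2 →
    c * |t - s| ≤ ‖D.z t - D.z s‖ := by
  obtain ⟨C, hC, hT⟩ := D.exists_taylor ha
  obtain ⟨m, hm, hmd⟩ := D.exists_deriv_lower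
  obtain ⟨δ, hδ, hδm⟩ : ∃ δ > 0, ∀ h : ℝ, |h| ≤ δ → C * |h| ^ a ≤ m / 2 := by
    have h1 : Tendsto (fun h : ℝ => C * |h| ^ a) (𝓝 0) (𝓝 (C * |0| ^ a)) :=
      ((continuous_abs.rpow_const fun _ => Or.inr ha.le).const_mul C |>.tendsto 0 :)
    rw [abs_zero, Real.zero_rpow ha.ne', mul_zero] at h1
    obtain ⟨δ, hδ, h2⟩ := Metric.eventually_nhds_iff.mp (h1.eventually_lt_const (half_pos hm))
    refine ⟨δ / 2, half_pos hδ, fun h hh => (h2 ?_).le⟩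
    rw [Real.dist_eq, sub_zero]; linarith
  have hK : IsCompact {p : ℝ × ℝ | p.1 ∈ Icc (0 : ℝ) 1 ∧ p.2 ∈ Icc (-(1 / 2) : ℝ) (1 / 2) ∧ δ ≤ |p.2|} := by
    have h1 : IsClosed {p : ℝ × ℝ | δ ≤ |p.2|} := isClosed_le continuous_const (by fun_prop)
    have h2 := ((isCompact_Icc (a := (0 : ℝ)) (b := 1)).prod (isCompact_Icc (a := (-(1 / 2) : ℝ)) (b := 1 / 2))).inter_right h1
    convert! h2 using 1
    ext p
    exact ⟨fun h => ⟨⟨h.1, h.2.1⟩, h.2.2⟩, fun h => ⟨h.1.1, h.1.2, h.2⟩⟩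
  obtain ⟨c, hc, hcb⟩ : ∃ c > 0, ∀ p ∈ {p : ℝ × ℝ | p.1 ∈ Icc (0 : ℝ) 1 ∧ p.2 ∈ Icc (-(1 / 2) : ℝ) (1 / 2) ∧ δ ≤ |p.2|},
      c ≤ ‖D.z (p.1 + p.2) - D.z p.1‖ := by
    have hcont : Continuous (fun p : ℝ × ℝ => ‖D.z (p.1 + p.2) - D.z p.1‖) := by
      have := D.continuous_z; fun_prop
    by_cases hne : {p : ℝ × ℝ | p.1 ∈ Icc (0 : ℝ) 1 ∧ p.2 ∈ Icc (-(1 / 2) : ℝ) (1 / 2) ∧ δ ≤ |p.2|}.Nonempty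
    · obtain ⟨p, hp, hmin⟩ := hK.exists_isMinOn hne hcont.continuousOn
      refine ⟨_, ?_, fun q hq => hmin hq⟩
      rw [gt_iff_lt, norm_pos_iff, sub_ne_zero]
      intro h
      have h2 := D.eq_of_z_eq h.symm (by
        rw [add_sub_cancel_left]
        exact lt_of_le_of_lt (abs_le.mpr hp.2.1) (by norm_num))
      have h3 : p.2 = 0 := by linarith
      have := hp.2.2
      rw [h3, abs_zero] at this
      linarith
    · exact ⟨1, one_pos, fun p hp => absurd ⟨p, hp⟩ hne⟩
  refine ⟨min (m / 2) c, by positivity, fun s t hst => ?_⟩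
  by_cases hsmall : |t - s| ≤ δ
  · have h1 := hT s t
    have h2 : m * |t - s| ≤ ‖((t - s : ℝ) : ℂ) * deriv D.z s‖ := by
      rw [norm_mul, Complex.norm_real, Real.norm_eq_abs, mul_comm]
      gcongr
      exact hmd s
    have h3 : C * |t - s| ^ (1 + a) ≤ m / 2 * |t - s| := by
      rw [Real.rpow_add' (abs_nonneg _) (by positivity), Real.rpow_one]
      nlinarith [hδm _ hsmall, abs_nonneg (t - s)]
    have h4 := norm_sub_norm_le (((t - s : ℝ) : ℂ) * deriv D.z s)
      (((t - s : ℝ) : ℂ) * deriv D.z s - (D.z t - D.z s))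
    rw [sub_sub_cancel, norm_sub_rev _ (D.z t - D.z s)] at h4
    nlinarith [min_le_left (m / 2) c, abs_nonneg (t - s)]
  · obtain ⟨s', hs', n, hn⟩ := exists_Ioc s
    have h1 := hcb (s', t - s) ⟨Ioc_subset_Icc_self hs', abs_le.mp hst, (not_le.mp hsmall).le⟩
    have e1 : D.z (s' + (t - s)) = D.z t := by
      rw [← D.z_add_int _ n]; congr 1; rw [hn]; ring
    have e2 : D.z s' = D.z s := by rw [hn, z_add_int]
    simp only [e1, e2] at h1
    have h2 : min (m / 2) c * |t - s| ≤ c * 1 :=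
      mul_le_mul (min_le_right _ _) (hst.trans (by norm_num)) (abs_nonneg _) hc.le
    linarith

theorem lintegral_arcLength {g : ℂ → ENNReal} (hg : Measurable g) :
    ∫⁻ x, g x ∂D.arcLength = ∫⁻ t in Ioc (0 : ℝ) 1, ENNReal.ofReal ‖deriv D.z t‖ * g (D.z t) := by
  rw [arcLength, lintegral_map hg D.continuous_z.measurable]
  exact lintegral_withDensity_eq_lintegral_mul _
    (D.continuous_deriv.norm.measurable.ennreal_ofReal) (hg.comp D.continuous_z.measurable)

theorem _root_.lintegral_abs_rpow_lt_top {b : ℝ} (hb : b < 1) :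
    ∫⁻ t in Ioc (-2 : ℝ) 2, ENNReal.ofReal (|t| ^ (-b)) < ⊤ := by
  have h1 : IntervalIntegrable (fun t : ℝ => |t| ^ (-b)) volume 0 2 :=
    (intervalIntegral.intervalIntegrable_rpow' (by linarith : -1 < -b)).congr fun t ht => by
      rw [uIoc_of_le (by norm_num)] at ht
      simp only [abs_of_pos ht.1]
  have h2 : IntervalIntegrable (fun t : ℝ => |t| ^ (-b)) volume (-2) 0 := by
    have := (IntervalIntegrable.iff_comp_neg (by finiteness)).mp h1
    simp only [abs_neg, neg_zero] at this
    exact this.symm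
  have h3 := h2.trans h1
  rw [intervalIntegrable_iff_integrableOn_Ioc_of_le (by norm_num)] at h3
  have h4 := h3.2
  rw [hasFiniteIntegral_iff_norm] at h4
  refine lt_of_le_of_lt (lintegral_mono fun t => ?_) h4
  exact ENNReal.ofReal_le_ofReal (le_abs_self _)

/-- Weakly singular kernels are uniformly integrable along the curve. -/
theorem exists_lintegral_le (ha : 0 < a) {b : ℝ} (hb0 : 0 ≤ b) (hb : b < 1) : ∃ M : ℝ, 0 ≤ M ∧ ∀ x ∈ D.curve,
    ∫⁻ y, ENNReal.ofReal (‖x - y‖ ^ (-b)) ∂D.arcLength ≤ ENNReal.ofReal M := by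
  obtain ⟨c, hc, hcA⟩ := D.exists_chordArc ha
  obtain ⟨L, hL, hLd⟩ := D.exists_deriv_upper
  set I : ENNReal := ∫⁻ t in Ioc (-2 : ℝ) 2, ENNReal.ofReal (|t| ^ (-b)) with hI
  have hIlt : I < ⊤ := lintegral_abs_rpow_lt_top hb
  have hshift : ∀ u : ℝ, |u - 1 / 2| ≤ 3 / 2 → ∫⁻ t in Ioc (0 : ℝ) 1, ENNReal.ofReal (|t - u| ^ (-b)) ≤ I := by
    intro u hu
    rw [abs_le] at hu
    have h1 : ∫⁻ t in Ioc (0 : ℝ) 1, ENNReal.ofReal (|t - u| ^ (-b)) =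
        ∫⁻ t in Ioc (0 - u) (1 - u), ENNReal.ofReal (|t| ^ (-b)) := by
      have hmp := (measurePreserving_sub_right (volume : Measure ℝ) u).setLIntegral_comp_preimage
        (s := Ioc (0 - u) (1 - u)) measurableSet_Ioc
        (f := fun t => ENNReal.ofReal (|t| ^ (-b))) (by fun_prop)
      rw [preimage_sub_const_Ioc] at hmp
      simpa using hmp
    rw [h1]
    exact lintegral_mono_set (Ioc_subset_Ioc (by linarith) (by linarith))
  have hfin : ENNReal.ofReal (L * c ^ (-b)) * (I + (I + I)) ≠ ⊤ :=
    ENNReal.mul_ne_top ENNReal.ofReal_ne_top (by simp [hIlt.ne])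
  refine ⟨(ENNReal.ofReal (L * c ^ (-b)) * (I + (I + I))).toReal, ENNReal.toReal_nonneg, ?_⟩
  rintro x hx
  rw [ENNReal.ofReal_toReal hfin]
  obtain ⟨s, hs, rfl⟩ : ∃ s ∈ Ioc (0 : ℝ) 1, D.z s = x := by
    obtain ⟨t, rfl⟩ := hx
    obtain ⟨s, hs, n, rfl⟩ := exists_Ioc t
    exact ⟨s, hs, (D.z_add_int s n).symm⟩
  rw [D.lintegral_arcLength (by fun_prop)]
  -- The comparison with |t - u| holds only within half a period, so the parameter s and its two
  -- neighbouring translates are needed to cover the whole period.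
  have hpt : ∀ t ∈ Ioc (0 : ℝ) 1, ENNReal.ofReal ‖deriv D.z t‖ * ENNReal.ofReal (‖D.z s - D.z t‖ ^ (-b)) ≤
      ENNReal.ofReal (L * c ^ (-b)) * (ENNReal.ofReal (|t - s| ^ (-b)) +
        (ENNReal.ofReal (|t - (s - 1)| ^ (-b)) + ENNReal.ofReal (|t - (s + 1)| ^ (-b)))) := by
    intro t ht
    have key : ∀ u : ℝ, D.z u = D.z s → |t - u| ≤ 1 / 2 → ENNReal.ofReal ‖deriv D.z t‖ *
        ENNReal.ofReal (‖D.z s - D.z t‖ ^ (-b)) ≤ ENNReal.ofReal (L * c ^ (-b)) * ENNReal.ofReal (|t - u| ^ (-b)) := by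
      intro u hu htu
      rw [← ENNReal.ofReal_mul (norm_nonneg _), ← ENNReal.ofReal_mul (by positivity)]
      refine ENNReal.ofReal_le_ofReal ?_
      have h1 := hcA u t htu
      rw [hu, norm_sub_rev] at h1
      rcases (abs_nonneg (t - u)).eq_or_lt with h0 | h0
      · have : t = u := by
          rw [eq_comm, abs_eq_zero, sub_eq_zero] at h0; exact h0
        rw [this, hu, sub_self, sub_self, norm_zero, abs_zero]
        -- At distance zero the power with exponent -b is 1 if b = 0 and is 0 by convention if b >
        -- 0.
        rcases hb0.eq_or_lt with hb00 | hb00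
        · rw [← hb00]
          simpa using hLd u
        · rw [Real.zero_rpow (by linarith)]; simp
      · rw [mul_assoc, ← Real.mul_rpow hc.le (abs_nonneg _)]
        exact mul_le_mul (hLd t) (Real.rpow_le_rpow_of_nonpos (by positivity) h1 (by linarith))
          (by positivity) hL.le
    rcases le_total (t - s) (-(1 / 2)) with h | h
    · refine (key (s - 1) (by simpa [sub_eq_add_neg] using D.z_add_int s (-1)) (abs_le.mpr ⟨?_, ?_⟩)).trans ?_
      · linarith [ht.1, hs.2]
      · linarith [ht.1, hs.2]
      · gcongr
        exact le_trans le_self_add le_add_self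
    · rcases le_total (t - s) (1 / 2) with h' | h'
      · refine (key s rfl (abs_le.mpr ⟨h, h'⟩)).trans ?_
        gcongr
        exact le_self_add
      · refine (key (s + 1) (D.periodic s) (abs_le.mpr ⟨?_, ?_⟩)).trans ?_
        · linarith [ht.2, hs.1]
        · linarith [ht.2, hs.1]
        · gcongr
          exact le_trans le_add_self le_add_self
  refine (setLIntegral_mono' measurableSet_Ioc hpt).trans ?_
  rw [lintegral_const_mul _ (by fun_prop), lintegral_add_left (by fun_prop), lintegral_add_left (by fun_prop)]
  have h1 := hs.1
  have h2 := hs.2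
  gcongr
  · exact hshift s (abs_le.mpr ⟨by linarith, by linarith⟩)
  · exact hshift _ (abs_le.mpr ⟨by linarith, by linarith⟩)
  · exact hshift _ (abs_le.mpr ⟨by linarith, by linarith⟩)

/-- A chord is tangential up to the Taylor remainder, and its tangential part makes the product
real. This is the cancellation that makes the Neumann-Poincaré kernel weakly singular. -/
theorem exists_normal_bound (ha : 0 < a) : ∃ C > 0, ∀ x ∈ D.curve, ∀ y ∈ D.curve,
    |(starRingEnd ℂ (y - x) * D.tangent x).im| ≤ C * ‖y - x‖ ^ (1 + a) := by
  obtain ⟨C, hC, hT⟩ := D.exists_taylor ha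
  obtain ⟨c, hc, hcA⟩ := D.exists_chordArc ha
  refine ⟨C * (c⁻¹) ^ (1 + a), by positivity, ?_⟩
  rintro _ ⟨s, rfl⟩ _ ⟨t₀, rfl⟩
  obtain ⟨t, hts, htz, -⟩ := D.exists_near s t₀
  rw [← htz]
  have h1 := hT s t
  have h2 := hcA s t hts
  have hm : ‖deriv D.z s‖ ≠ 0 := by simpa using D.regular s
  have e1 : (starRingEnd ℂ (D.z t - D.z s) * D.tangent (D.z s)).im =
      (starRingEnd ℂ (D.z t - D.z s - ((t - s : ℝ) : ℂ) * deriv D.z s) * D.tangent (D.z s)).im := by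
    have e2 : (starRingEnd ℂ (((t - s : ℝ) : ℂ) * deriv D.z s) * D.tangent (D.z s)).im = 0 := by
      rw [tangent_z, map_mul, Complex.conj_ofReal, mul_assoc, mul_div_assoc', mul_comm (starRingEnd ℂ _),
        Complex.mul_conj, ← Complex.ofReal_div, ← Complex.ofReal_mul, Complex.ofReal_im]
    rw [map_sub (starRingEnd ℂ) (D.z t - D.z s), sub_mul, Complex.sub_im, e2, sub_zero]
  rw [e1]
  refine (Complex.abs_im_le_norm _).trans ?_
  rw [norm_mul, D.norm_tangent ⟨s, rfl⟩, mul_one, RCLike.norm_conj, mul_assoc, ← Real.mul_rpow (by positivity) (norm_nonneg _)]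
  refine h1.trans ?_
  gcongr
  rw [inv_mul_eq_div, le_div_iff₀ hc]
  linarith

theorem integral_mul_tangent {g : ℂ → ℂ} (hg : Measurable g) :
    ∫ x, g x * D.tangent x ∂D.arcLength = ∫ t in (0 : ℝ)..1, g (D.z t) * deriv D.z t := by
  rw [D.integral_arcLength (fun x => g x * D.tangent x) (hg.mul D.measurable_tangent)]
  refine intervalIntegral.integral_congr fun t _ => ?_
  have hm : (‖deriv D.z t‖ : ℂ) ≠ 0 := by simpa using D.regular t
  simp only [tangent_z]
  field_simp

end PlanarDomain

/-! ### The two sides of the curve; connectedness of the exterior. -/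

namespace PlanarDomain

variable {a : ℝ} (D : PlanarDomain a)

/-- The exterior of the domain. -/
def exterior : Set ℂ := (closure D.carrier)ᶜ

theorem isOpen_exterior : IsOpen D.exterior := isClosed_closure.isOpen_compl

theorem frontier_eq_curve : frontier D.carrier = D.curve := D.frontier_eq

theorem notMem_curve_of_mem_carrier {w : ℂ} (h : w ∈ D.carrier) : w ∉ D.curve := by
  rw [← frontier_eq_curve, D.isOpen.frontier_eq]
  exact fun h' => h'.2 h

theorem notMem_curve_of_mem_exterior {w : ℂ} (h : w ∈ D.exterior) : w ∉ D.curve := by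
  rw [← frontier_eq_curve, D.isOpen.frontier_eq]
  exact fun h' => h h'.1

theorem mem_carrier_or_mem_exterior {w : ℂ} (h : w ∉ D.curve) : w ∈ D.carrier ∨ w ∈ D.exterior := by
  rw [← frontier_eq_curve, D.isOpen.frontier_eq] at h
  by_contra hcon
  push Not at hcon
  exact h ⟨not_not.mp hcon.2, hcon.1⟩

theorem disjoint_carrier_exterior : Disjoint D.carrier D.exterior :=
  disjoint_compl_right.mono_left subset_closure

theorem subset_or_subset {s : Set ℂ} (hs : IsPreconnected s) (h : s ⊆ D.curveᶜ) :
    s ⊆ D.carrier ∨ s ⊆ D.exterior := by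
  rcases s.eq_empty_or_nonempty with rfl | ⟨x, hx⟩
  · exact Or.inl (empty_subset _)
  have hsub : s ⊆ D.carrier ∪ D.exterior := fun w hw => D.mem_carrier_or_mem_exterior (h hw)
  rcases hsub hx with hx' | hx'
  · exact Or.inl (hs.subset_left_of_subset_union D.isOpen D.isOpen_exterior
      D.disjoint_carrier_exterior hsub ⟨x, hx, hx'⟩)
  · exact Or.inr (hs.subset_right_of_subset_union D.isOpen D.isOpen_exterior
      D.disjoint_carrier_exterior hsub ⟨x, hx, hx'⟩)

/-- Coordinates near a boundary point: arc parameter and displacement along a fixed normal. -/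
noncomputable def tube (t₀ : ℝ) (p : ℝ × ℝ) : ℂ := D.z p.1 + (p.2 : ℂ) * (Complex.I * deriv D.z t₀)

theorem continuous_tube (t₀ : ℝ) : Continuous (D.tube t₀) := by
  have := D.continuous_z
  unfold tube
  fun_prop

/-- The tube map has an onto strict derivative, so it covers a neighbourhood. A point displaced
along the fixed normal is not on the curve: nearby arcs stay almost tangential, and distant arcs are
excluded by the chord-arc bound. -/
theorem exists_tube (ha : 0 < a) (t₀ : ℝ) : ∃ δ > 0, ∃ r > 0,
    (∀ p ∈ Ioo (t₀ - δ) (t₀ + δ) ×ˢ Ioo (-r) r, p.2 ≠ 0 → D.tube t₀ p ∉ D.curve) ∧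
    D.tube t₀ '' (Ioo (t₀ - δ) (t₀ + δ) ×ˢ Ioo (-r) r) ∈ 𝓝 (D.z t₀) := by
  obtain ⟨c, hc, hcA⟩ := D.exists_chordArc ha
  have hm : 0 < ‖deriv D.z t₀‖ := norm_pos_iff.mpr (D.regular t₀)
  obtain ⟨δ₁, hδ₁, hd⟩ := Metric.continuousAt_iff.mp (D.continuous_deriv.continuousAt (x := t₀))
    (‖deriv D.z t₀‖ / 2) (half_pos hm)
  have hmv : ∀ s ∈ Metric.ball t₀ δ₁, ∀ t ∈ Metric.ball t₀ δ₁,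
      ‖D.z t - D.z s - ((t - s : ℝ) : ℂ) * deriv D.z t₀‖ ≤ ‖deriv D.z t₀‖ / 2 * |t - s| := by
    intro s hs t ht
    have hd' : ∀ u : ℝ, HasDerivAt (fun u : ℝ => D.z u - (u : ℂ) * deriv D.z t₀)
        (deriv D.z u - deriv D.z t₀) u := fun u => by
      have h1 := ((hasDerivAt_id u).ofReal_comp).mul_const (deriv D.z t₀)
      simp only [id, Complex.ofReal_one, one_mul] at h1
      exact (D.hasDerivAt_z u).sub h1
    have := (convex_ball t₀ δ₁).norm_image_sub_le_of_norm_hasDerivWithin_le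
      (fun u _ => (hd' u).hasDerivWithinAt) (fun u hu => by
        have := hd hu
        rw [dist_eq_norm] at this
        exact this.le) hs ht
    have e : D.z t - D.z s - ((t - s : ℝ) : ℂ) * deriv D.z t₀ =
        (D.z t - (t : ℂ) * deriv D.z t₀) - (D.z s - (s : ℂ) * deriv D.z t₀) := by push_cast; ring
    rw [e, ← Real.norm_eq_abs]
    exact this
  -- The displacement is then shorter than any chord whose parameter gap exceeds δ₁/2.
  obtain ⟨r, hr, hrm⟩ : ∃ r > 0, r * ‖deriv D.z t₀‖ = c * (δ₁ / 2) := ⟨c * (δ₁ / 2) / ‖deriv D.z t₀‖, by positivity, by field_simp⟩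
  refine ⟨δ₁ / 2, half_pos hδ₁, r, hr, ?_, ?_⟩
  · rintro ⟨s, ρ⟩ ⟨hs, hρ⟩ hρ0 ⟨t', ht'⟩
    simp only [mem_Ioo] at hs hρ hρ0
    obtain ⟨t, hts, htz, -⟩ := D.exists_near s t'
    rw [← htz] at ht'
    have heq : D.z t - D.z s = (ρ : ℂ) * (Complex.I * deriv D.z t₀) := by
      rw [ht', tube]; ring
    by_cases htb : t ∈ Metric.ball t₀ δ₁
    · have hsb : s ∈ Metric.ball t₀ δ₁ := by
        rw [Metric.mem_ball, Real.dist_eq, abs_lt]; constructor <;> linarith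
      have h1 := hmv s hsb t htb
      have e1 : D.z t - D.z s - ((t - s : ℝ) : ℂ) * deriv D.z t₀ =
          ((ρ : ℂ) * Complex.I - ((t - s : ℝ) : ℂ)) * deriv D.z t₀ := by rw [heq]; ring
      rw [e1, norm_mul] at h1
      -- In units of z'(t₀), the displacement ρ i is within |t - s|/2 of the real number t - s. Real
      -- parts give t = s, and then imaginary parts give ρ = 0.
      have h2 : ‖(ρ : ℂ) * Complex.I - ((t - s : ℝ) : ℂ)‖ ≤ |t - s| / 2 := by
        have : ‖(ρ : ℂ) * Complex.I - ((t - s : ℝ) : ℂ)‖ * ‖deriv D.z t₀‖ ≤ |t - s| / 2 * ‖deriv D.z t₀‖ := by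
          linarith
        exact le_of_mul_le_mul_right this hm
      have h3 := Complex.abs_re_le_norm ((ρ : ℂ) * Complex.I - ((t - s : ℝ) : ℂ))
      have h4 := Complex.abs_im_le_norm ((ρ : ℂ) * Complex.I - ((t - s : ℝ) : ℂ))
      simp only [Complex.sub_re, Complex.mul_re, Complex.ofReal_re, Complex.I_re, mul_zero,
        Complex.ofReal_im, sub_zero, zero_sub, abs_neg, Complex.sub_im, Complex.mul_im,
        Complex.I_im, mul_one, add_zero] at h3 h4
      have h5 : |t - s| = 0 := by linarith [abs_nonneg (t - s)]
      have h6 : |ρ| = 0 := by linarith [abs_nonneg ρ]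
      exact hρ0 (abs_eq_zero.mp h6)
    · have h1 := hcA s t hts
      rw [heq, norm_mul, norm_mul, Complex.norm_I, one_mul, Complex.norm_real, Real.norm_eq_abs] at h1
      have h2 : δ₁ / 2 < |t - s| := by
        rw [Metric.mem_ball, Real.dist_eq, not_lt] at htb
        have h3 : |s - t₀| < δ₁ / 2 := by rw [abs_lt]; constructor <;> linarith
        have := abs_sub_le t s t₀
        linarith
      have h3 : |ρ| < r := abs_lt.mpr hρ
      have h4 : |ρ| * ‖deriv D.z t₀‖ < r * ‖deriv D.z t₀‖ := by gcongr
      nlinarith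
  · have hstrict : HasStrictFDerivAt (D.tube t₀)
        ((ContinuousLinearMap.fst ℝ ℝ ℝ).smulRight (deriv D.z t₀) +
          (ContinuousLinearMap.snd ℝ ℝ ℝ).smulRight (Complex.I * deriv D.z t₀)) (t₀, 0) := by
      have h1 : HasStrictDerivAt D.z (deriv D.z t₀) t₀ :=
        (D.contDiff.contDiffAt).hasStrictDerivAt one_ne_zero
      have h2 := h1.hasStrictFDerivAt.comp ((t₀, 0) : ℝ × ℝ) (hasStrictFDerivAt_fst (𝕜 := ℝ))
      have h3 := (hasStrictFDerivAt_snd (𝕜 := ℝ) (p := ((t₀, 0) : ℝ × ℝ))).smul_const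
        (Complex.I * deriv D.z t₀)
      have h4 := h2.add h3
      convert! h4 using 1
    have hsurj : (((ContinuousLinearMap.fst ℝ ℝ ℝ).smulRight (deriv D.z t₀) +
          (ContinuousLinearMap.snd ℝ ℝ ℝ).smulRight (Complex.I * deriv D.z t₀) : ℝ × ℝ →L[ℝ] ℂ)).range = ⊤ := by
      rw [LinearMap.range_eq_top]
      intro w
      obtain ⟨u, hu⟩ : ∃ u, w = u * deriv D.z t₀ :=
        ⟨w / deriv D.z t₀, (div_mul_cancel₀ _ (D.regular t₀)).symm⟩
      refine ⟨(u.re, u.im), ?_⟩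
      change u.re • deriv D.z t₀ + u.im • (Complex.I * deriv D.z t₀) = w
      rw [Complex.real_smul, Complex.real_smul, hu]
      conv_rhs => rw [← Complex.re_add_im u]
      ring
    have hmap := hstrict.map_nhds_eq_of_surj hsurj
    have hz : D.tube t₀ (t₀, 0) = D.z t₀ := by simp [tube]
    rw [hz] at hmap
    rw [← hmap]
    refine image_mem_map (prod_mem_nhds (Ioo_mem_nhds ?_ ?_) (Ioo_mem_nhds ?_ ?_)) <;> linarith

/-- The part of a tubular neighbourhood to the right of the curve. -/
def rightStrip (t₀ δ r : ℝ) : Set ℂ := D.tube t₀ '' (Ioo (t₀ - δ) (t₀ + δ) ×ˢ Ioo (-r) 0)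

theorem isPreconnected_rightStrip (t₀ δ r : ℝ) : IsPreconnected (D.rightStrip t₀ δ r) :=
  (isPreconnected_Ioo.prod isPreconnected_Ioo).image _ (D.continuous_tube t₀).continuousOn

/-- The left half of the tube is connected and misses the curve, so it lies on one side; `leftOf` at
the single point t₀ decides which one. -/
theorem exists_strips (ha : 0 < a) (t₀ : ℝ) : ∃ δ > 0, ∃ r > 0,
    (∀ s ∈ Ioo (t₀ - δ) (t₀ + δ), ∀ ρ ∈ Ioo 0 r, D.tube t₀ (s, ρ) ∈ D.carrier) ∧
    D.rightStrip t₀ δ r ⊆ D.curveᶜ ∧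
    ∀ᶠ w in 𝓝 (D.z t₀), w ∈ D.curve ∨ w ∈ D.carrier ∨ w ∈ D.rightStrip t₀ δ r := by
  obtain ⟨δ, hδ, r, hr, hoff, hnhds⟩ := D.exists_tube ha t₀
  have hL : ∀ s ∈ Ioo (t₀ - δ) (t₀ + δ), ∀ ρ ∈ Ioo 0 r, D.tube t₀ (s, ρ) ∈ D.carrier := by
    have hpre : IsPreconnected (D.tube t₀ '' (Ioo (t₀ - δ) (t₀ + δ) ×ˢ Ioo 0 r)) :=
      (isPreconnected_Ioo.prod isPreconnected_Ioo).image _ (D.continuous_tube t₀).continuousOn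
    have hsub : D.tube t₀ '' (Ioo (t₀ - δ) (t₀ + δ) ×ˢ Ioo 0 r) ⊆ D.curveᶜ := by
      rintro _ ⟨p, ⟨hp1, hp2⟩, rfl⟩
      exact hoff p ⟨hp1, ⟨by linarith [hp2.1], hp2.2⟩⟩ hp2.1.ne'
    rcases D.subset_or_subset hpre hsub with h | h
    · exact fun s hs ρ hρ => h ⟨(s, ρ), ⟨hs, hρ⟩, rfl⟩
    · exfalso
      obtain ⟨ρ, h1, h2⟩ := ((D.leftOf t₀).and (Ioo_mem_nhdsGT hr)).exists
      have h3 : D.tube t₀ (t₀, ρ) ∈ D.exterior := h ⟨(t₀, ρ), ⟨⟨by simp only; linarith, by simp only; linarith⟩, h2⟩, rfl⟩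
      exact disjoint_left.mp D.disjoint_carrier_exterior h1 h3
  refine ⟨δ, hδ, r, hr, hL, ?_, ?_⟩
  · rintro _ ⟨p, ⟨hp1, hp2⟩, rfl⟩
    exact hoff p ⟨hp1, ⟨hp2.1, by linarith [hp2.2]⟩⟩ hp2.2.ne
  · filter_upwards [hnhds] with w hw
    obtain ⟨⟨s, ρ⟩, ⟨hs, hρ⟩, rfl⟩ := hw
    simp only at hs hρ
    rcases lt_trichotomy ρ 0 with h | h | h
    · exact Or.inr (Or.inr ⟨(s, ρ), ⟨hs, hρ.1, h⟩, rfl⟩)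
    · left
      rw [h]
      exact ⟨s, by simp [tube]⟩
    · exact Or.inr (Or.inl (hL s hs ρ ⟨h, hρ.2⟩))

theorem rightStrip_nonempty {t₀ δ r s : ℝ} (hr : 0 < r) (hs : s ∈ Ioo (t₀ - δ) (t₀ + δ)) {V : Set ℂ}
    (hV : V ∈ 𝓝 (D.z s)) : ∃ w ∈ V, w ∈ D.rightStrip t₀ δ r := by
  have h1 : Tendsto (fun ρ : ℝ => D.tube t₀ (s, ρ)) (𝓝[<] 0) (𝓝 (D.z s)) := by
    have h2 : Continuous (fun ρ : ℝ => D.tube t₀ (s, ρ)) :=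
      (D.continuous_tube t₀).comp (by fun_prop)
    have h3 := h2.tendsto 0
    have h4 : D.tube t₀ (s, 0) = D.z s := by simp [tube]
    rw [h4] at h3
    exact h3.mono_left nhdsWithin_le_nhds
  obtain ⟨ρ, h3, h4⟩ := ((h1.eventually hV).and (Ioo_mem_nhdsLT (neg_lt_zero.mpr hr))).exists
  exact ⟨_, h3, (s, ρ), ⟨hs, h4⟩, rfl⟩

/-- If the right sides of the curve lie in the exterior, then the exterior is connected. -/
theorem isPreconnected_exterior_of_strips (ha : 0 < a)
    (hR : ∀ t₀ δ r, D.rightStrip t₀ δ r ⊆ D.curveᶜ → 0 < δ → 0 < r → D.rightStrip t₀ δ r ⊆ D.exterior) :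
    IsPreconnected D.exterior := by
  choose δ hδ r hr hL hoff hnhds using D.exists_strips ha
  have hRe : ∀ t, D.rightStrip t (δ t) (r t) ⊆ D.exterior := fun t =>
    hR t _ _ (hoff t) (hδ t) (hr t)
  have hmeet : ∀ t, ∀ s ∈ Ioo (t - δ t) (t + δ t),
      (D.rightStrip t (δ t) (r t) ∩ D.rightStrip s (δ s) (r s)).Nonempty := by
    intro t s hs
    obtain ⟨w, hw, hw2⟩ := D.rightStrip_nonempty (hr t) hs (hnhds s)
    have hwe := hRe t hw2
    rcases hw with h | h | h
    · exact absurd h (D.notMem_curve_of_mem_exterior hwe)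
    · exact absurd hwe (disjoint_left.mp D.disjoint_carrier_exterior h)
    · exact ⟨w, hw2, h⟩
  have hne : ∀ t, (D.rightStrip t (δ t) (r t)).Nonempty := fun t => by
    obtain ⟨w, hw, -⟩ := hmeet t t ⟨by linarith [hδ t], by linarith [hδ t]⟩
    exact ⟨w, hw⟩
  have hcomp : ∀ p ∈ D.exterior, ∀ t, (connectedComponentIn D.exterior p ∩ D.rightStrip t (δ t) (r t)).Nonempty →
      D.rightStrip t (δ t) (r t) ⊆ connectedComponentIn D.exterior p := by
    rintro p hp t ⟨w, hw, hw2⟩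
    rw [connectedComponentIn_eq hw]
    exact (D.isPreconnected_rightStrip _ _ _).subset_connectedComponentIn hw2 (hRe t)
  -- A component of the exterior is not the whole plane, so it has a frontier point. That point lies
  -- on the curve, and the component must contain the right strip next to it.
  have hall : ∀ p ∈ D.exterior, ∀ t, D.rightStrip t (δ t) (r t) ⊆ connectedComponentIn D.exterior p := by
    intro p hp
    have hopen : IsOpen (connectedComponentIn D.exterior p) := D.isOpen_exterior.connectedComponentIn
    have hpmem := mem_connectedComponentIn hp
    obtain ⟨q, hq⟩ : (frontier (connectedComponentIn D.exterior p)).Nonempty := by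
      rw [nonempty_frontier_iff]
      refine ⟨⟨p, hpmem⟩, fun h => ?_⟩
      obtain ⟨w, hw⟩ := D.isConnected.nonempty
      have : w ∈ connectedComponentIn D.exterior p := h ▸ mem_univ w
      exact disjoint_left.mp D.disjoint_carrier_exterior hw (connectedComponentIn_subset _ _ this)
    rw [hopen.frontier_eq] at hq
    have hqe : q ∉ D.exterior := fun h => by
      have h1 := D.isOpen_exterior.connectedComponentIn.mem_nhds (mem_connectedComponentIn h)
      obtain ⟨w, hw, hw2⟩ := mem_closure_iff_nhds.mp hq.1 _ h1
      have h3 := connectedComponentIn_eq hw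
      have h4 := connectedComponentIn_eq hw2
      apply hq.2
      rw [h4, ← h3]
      exact mem_connectedComponentIn h
    have hqc : q ∉ D.carrier := fun h => by
      obtain ⟨w, hw, hw2⟩ := mem_closure_iff_nhds.mp hq.1 _ (D.isOpen.mem_nhds h)
      exact disjoint_left.mp D.disjoint_carrier_exterior hw (connectedComponentIn_subset _ _ hw2)
    have hqΓ : q ∈ D.curve := by
      by_contra h
      exact (D.mem_carrier_or_mem_exterior h).elim hqc hqe
    obtain ⟨t, rfl⟩ := hqΓ
    have ht : D.rightStrip t (δ t) (r t) ⊆ connectedComponentIn D.exterior p := by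
      obtain ⟨w, hw, hw2⟩ := mem_closure_iff_nhds.mp hq.1 _ (hnhds t)
      have hwe := connectedComponentIn_subset _ _ hw2
      rcases hw with h | h | h
      · exact absurd h (D.notMem_curve_of_mem_exterior hwe)
      · exact absurd hwe (disjoint_left.mp D.disjoint_carrier_exterior h)
      · exact hcomp p hp t ⟨w, hw2, h⟩
    -- Neighbouring right strips overlap. So a component containing one of them contains all, and
    -- any two components coincide.
    have hloc : IsLocallyConstant (fun s => D.rightStrip s (δ s) (r s) ⊆ connectedComponentIn D.exterior p) := by
      rw [IsLocallyConstant.iff_eventually_eq]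
      intro s
      filter_upwards [Ioo_mem_nhds (by linarith [hδ s] : s - δ s < s) (by linarith [hδ s] : s < s + δ s)] with u hu
      obtain ⟨w, hw, hw2⟩ := hmeet s u hu
      exact propext ⟨fun h => hcomp p hp s ⟨w, h hw2, hw⟩, fun h => hcomp p hp u ⟨w, h hw, hw2⟩⟩
    intro s
    have := hloc.apply_eq_of_preconnectedSpace s t
    exact this.mpr ht
  intro U V hU hV hUV hUne hVne
  obtain ⟨p, hpe, hpU⟩ := hUne
  obtain ⟨q, hqe, hqV⟩ := hVne
  obtain ⟨w, hw⟩ := hne 0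
  have h1 := hall p hpe 0 hw
  have h2 := hall q hqe 0 hw
  have h3 : connectedComponentIn D.exterior p = connectedComponentIn D.exterior q := by
    rw [connectedComponentIn_eq h1, connectedComponentIn_eq h2]
  obtain ⟨v, hv, hv2⟩ := (isPreconnected_connectedComponentIn (x := p) (F := D.exterior)) U V hU hV
    ((connectedComponentIn_subset _ _).trans hUV)
    ⟨p, mem_connectedComponentIn hpe, hpU⟩ ⟨q, h3 ▸ mem_connectedComponentIn hqe, hqV⟩
  exact ⟨v, connectedComponentIn_subset _ _ hv, hv2⟩

end PlanarDomain

/-! ### The winding number near the curve. -/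

namespace PlanarDomain

variable {a : ℝ} (D : PlanarDomain a)

theorem isClosedCurve_z : IsClosedCurve D.z where
  continuousOn := D.continuous_z.continuousOn
  closed := by have := D.periodic 0; rw [zero_add] at this; exact this.symm
  piecewise := by
    obtain ⟨L, -, hL⟩ := D.exists_deriv_upper
    exact ⟨∅, fun t _ => (D.hasDerivAt_z t).differentiableAt, D.continuous_deriv.continuousOn,
      L, fun t _ => hL t⟩

theorem notMem_image_z {w : ℂ} (hw : w ∉ D.curve) : w ∉ D.z '' Icc 0 1 := by
  rwa [← curve_eq_image]

/-- The Cauchy kernel on the curve seen from a point at (signed) distance `r` along the normal at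
`t₀`, minus the same kernel for the tangent line. -/
noncomputable def cauchyDefect (t₀ r h : ℝ) : ℂ :=
  deriv D.z (t₀ + h) * (D.z (t₀ + h) - D.tube t₀ (t₀, r))⁻¹ - ((h : ℂ) - r * Complex.I)⁻¹

/-- Subtracting the kernel of the tangent line leaves a singularity |h|^(a - 1) with a constant
independent of r. This dominates the limit r → 0. -/
theorem exists_cauchyDefect_le (ha : 0 < a) (t₀ : ℝ) : ∃ C : ℝ, ∃ r₁ > 0,
    ∀ r : ℝ, |r| ≤ r₁ → ∀ h : ℝ, |h| ≤ 1 / 2 → h ≠ 0 →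
      ‖D.cauchyDefect t₀ r h‖ ≤ C * |h| ^ (-(1 - a)) ∧ D.z (t₀ + h) - D.tube t₀ (t₀, r) ≠ 0 := by
  obtain ⟨CH, hCH, hH⟩ := D.exists_holder
  obtain ⟨CT, hCT, hT⟩ := D.exists_taylor ha
  obtain ⟨c, hc, hcA⟩ := D.exists_chordArc ha
  set m := deriv D.z t₀ with hm
  have hm0 : 0 < ‖m‖ := norm_pos_iff.mpr (D.regular t₀)
  obtain ⟨h₀, hh₀, hhm⟩ : ∃ δ > 0, ∀ h : ℝ, |h| ≤ δ → CT * |h| ^ a ≤ ‖m‖ / 2 := by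
    have h1 : Tendsto (fun h : ℝ => CT * |h| ^ a) (𝓝 0) (𝓝 (CT * |0| ^ a)) :=
      ((continuous_abs.rpow_const fun _ => Or.inr ha.le).const_mul CT |>.tendsto 0 :)
    rw [abs_zero, Real.zero_rpow ha.ne', mul_zero] at h1
    obtain ⟨δ, hδ, hd⟩ := Metric.eventually_nhds_iff.mp
      (h1.eventually (gt_mem_nhds (half_pos hm0)))
    refine ⟨δ / 2, half_pos hδ, fun h hh => (hd ?_).le⟩
    rw [Real.dist_eq, sub_zero]; linarith
  have hc1 : 0 < min (‖m‖ / 2) (c / 2) := by positivity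
  set c₁ := min (‖m‖ / 2) (c / 2) with hc₁
  -- For |h| > h₀ this bound on r keeps the normal displacement below half of the chord, so the
  -- denominator stays of order |h|.
  refine ⟨(CH + CT) / c₁, c * h₀ / (2 * ‖m‖), by positivity, fun r hr h hh hh0 => ?_⟩
  have hpos : 0 < |h| := abs_pos.mpr hh0
  set P := D.z (t₀ + h) - D.tube t₀ (t₀, r) with hP
  set q := (h : ℂ) - r * Complex.I with hq
  have hT1 : ‖P - m * q‖ ≤ CT * |h| ^ (1 + a) := by
    have := hT t₀ (t₀ + h)
    rw [add_sub_cancel_left] at this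
    convert! this using 2
    rw [hP, hq, tube]; ring
  have hqh : |h| ≤ ‖q‖ := by
    have := Complex.abs_re_le_norm q
    simpa [hq] using this
  have hq0 : 0 < ‖q‖ := hpos.trans_le hqh
  have hsplit : |h| ^ (1 + a) = |h| * |h| ^ a := by
    rw [Real.rpow_add hpos, Real.rpow_one]
  have hPl : c₁ * |h| ≤ ‖P‖ := by
    by_cases hc' : |h| ≤ h₀
    · have h1 : ‖m * q‖ - ‖P - m * q‖ ≤ ‖P‖ := by
        have := norm_sub_norm_le (m * q) (m * q - P)
        rw [sub_sub_cancel, norm_sub_rev (m * q) P] at this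
        exact this
      rw [norm_mul] at h1
      have h2 : ‖m‖ * |h| ≤ ‖m‖ * ‖q‖ := by gcongr
      have h3 : CT * |h| ^ (1 + a) ≤ ‖m‖ / 2 * |h| := by
        rw [hsplit]
        calc CT * (|h| * |h| ^ a) = (CT * |h| ^ a) * |h| := by ring
          _ ≤ _ := by gcongr; exact hhm h hc'
      have h4 : c₁ * |h| ≤ ‖m‖ / 2 * |h| := by gcongr; exact min_le_left _ _
      linarith
    · push Not at hc'
      have h1 := hcA t₀ (t₀ + h) (by rwa [add_sub_cancel_left])
      rw [add_sub_cancel_left] at h1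
      have h2 : D.z (t₀ + h) - D.z t₀ = P + (r : ℂ) * (Complex.I * m) := by
        rw [hP, tube]; ring
      have h3 : ‖(r : ℂ) * (Complex.I * m)‖ = |r| * ‖m‖ := by
        rw [norm_mul, norm_mul, Complex.norm_I, one_mul, Complex.norm_real, Real.norm_eq_abs]
      have h4 := norm_add_le P ((r : ℂ) * (Complex.I * m))
      rw [← h2, h3] at h4
      have h5 : |r| * ‖m‖ ≤ c * h₀ / 2 := by
        calc |r| * ‖m‖ ≤ c * h₀ / (2 * ‖m‖) * ‖m‖ := by gcongr
          _ = _ := by field_simp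
      have h6 : c₁ * |h| ≤ c / 2 * |h| := by gcongr; exact min_le_right _ _
      nlinarith
  have hP0 : 0 < ‖P‖ := (by positivity : 0 < c₁ * |h|).trans_le hPl
  have hPne : P ≠ 0 := norm_pos_iff.mp hP0
  refine ⟨?_, hPne⟩
  have hqne : q ≠ 0 := norm_pos_iff.mp hq0
  have e1 : D.cauchyDefect t₀ r h = (deriv D.z (t₀ + h) - m) * P⁻¹ - (P - m * q) * (P⁻¹ * q⁻¹) := by
    rw [cauchyDefect, ← hP, ← hq]
    field_simp
    ring
  have e2 : |h| ^ (-(1 - a)) = |h| ^ a / |h| := by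
    rw [show -(1 - a) = a - 1 by ring, Real.rpow_sub_one hpos.ne']
  have hHh : ‖deriv D.z (t₀ + h) - m‖ ≤ CH * |h| ^ a := by
    have := hH (t₀ + h) t₀
    rwa [add_sub_cancel_left] at this
  have hinv : ‖P‖⁻¹ ≤ (c₁ * |h|)⁻¹ := by gcongr
  have hinvq : ‖q‖⁻¹ ≤ |h|⁻¹ := by gcongr
  calc ‖D.cauchyDefect t₀ r h‖ ≤ ‖deriv D.z (t₀ + h) - m‖ * ‖P‖⁻¹ + ‖P - m * q‖ * (‖P‖⁻¹ * ‖q‖⁻¹) := by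
        rw [e1]
        refine (norm_sub_le _ _).trans_eq ?_
        simp only [norm_mul, norm_inv]
    _ ≤ CH * |h| ^ a * (c₁ * |h|)⁻¹ + CT * |h| ^ (1 + a) * ((c₁ * |h|)⁻¹ * |h|⁻¹) := by gcongr
    _ = (CH + CT) / c₁ * |h| ^ (-(1 - a)) := by
        rw [e2, hsplit]; field_simp

theorem measurable_cauchyDefect (t₀ r : ℝ) : Measurable (D.cauchyDefect t₀ r) := by
  have h1 := D.continuous_z.measurable
  have h2 := D.continuous_deriv.measurable
  unfold cauchyDefect
  fun_prop

theorem intervalIntegrable_abs_rpow {a : ℝ} (ha : 0 < a) :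
    IntervalIntegrable (fun t : ℝ => |t| ^ (-(1 - a))) volume (-(1 / 2)) (1 / 2) := by
  rw [intervalIntegrable_iff_integrableOn_Ioc_of_le (by norm_num)]
  have hm : AEStronglyMeasurable (fun t : ℝ => |t| ^ (-(1 - a))) (volume.restrict (Ioc (-2) 2)) :=
    (by fun_prop : Measurable fun t : ℝ => |t| ^ (-(1 - a))).aestronglyMeasurable
  have h : IntegrableOn (fun t : ℝ => |t| ^ (-(1 - a))) (Ioc (-2) 2) :=
    (lintegral_ofReal_ne_top_iff_integrable hm
      (Eventually.of_forall fun t => by positivity)).mp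
      (lintegral_abs_rpow_lt_top (by linarith : 1 - a < 1)).ne
  exact h.mono_set (Ioc_subset_Ioc (by norm_num) (by norm_num))

theorem tendsto_integral_cauchyDefect (ha : 0 < a) (t₀ : ℝ) :
    Tendsto (fun r => ∫ h in (-(1 / 2) : ℝ)..(1 / 2), D.cauchyDefect t₀ r h) (𝓝[≠] 0)
      (𝓝 (∫ h in (-(1 / 2) : ℝ)..(1 / 2), D.cauchyDefect t₀ 0 h)) := by
  obtain ⟨C, r₁, hr₁, hC⟩ := D.exists_cauchyDefect_le ha t₀
  refine intervalIntegral.tendsto_integral_filter_of_dominated_convergence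
    (fun h => C * |h| ^ (-(1 - a))) (Eventually.of_forall fun r =>
      (D.measurable_cauchyDefect t₀ r).aestronglyMeasurable) ?_
    ((intervalIntegrable_abs_rpow ha).const_mul C) ?_
  · have : ∀ᶠ r : ℝ in 𝓝[≠] 0, |r| ≤ r₁ := by
      have := Metric.closedBall_mem_nhds (0 : ℝ) hr₁
      filter_upwards [mem_nhdsWithin_of_mem_nhds this] with r hr
      simpa using hr
    filter_upwards [this] with r hr
    have h0 : ∀ᵐ h : ℝ, h ≠ 0 := by simp [ae_iff]
    filter_upwards [h0] with h hh hI
    rw [uIoc_of_le (by norm_num)] at hI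
    exact (hC r hr h (abs_le.mpr ⟨hI.1.le, hI.2⟩) hh).1
  · have h0 : ∀ᵐ h : ℝ, h ≠ 0 := by simp [ae_iff]
    filter_upwards [h0] with h hh hI
    rw [uIoc_of_le (by norm_num)] at hI
    have hne := (hC 0 (by simpa using hr₁.le) h (abs_le.mpr ⟨hI.1.le, hI.2⟩) hh).2
    have hc : ContinuousAt (fun r : ℝ => D.cauchyDefect t₀ r h) 0 := by
      have h1 : Continuous (fun r : ℝ => D.tube t₀ (t₀, r)) :=
        (D.continuous_tube t₀).comp (by fun_prop)
      unfold cauchyDefect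
      refine (continuousAt_const.mul ((continuousAt_const.sub h1.continuousAt).inv₀ hne)).sub ?_
      refine ContinuousAt.inv₀ (by fun_prop) ?_
      simpa using hh
    exact hc.tendsto.mono_left nhdsWithin_le_nhds

/-- The angle under which a tangent segment is seen from height r. It tends to π or -π as r tends to
0 from the left or the right side of the curve, which accounts for the whole jump of the index. -/
theorem integral_im_inv_sub {r : ℝ} (hr : r ≠ 0) :
    (∫ h in (-(1 / 2) : ℝ)..(1 / 2), ((h : ℂ) - r * Complex.I)⁻¹).im = 2 * Real.arctan (1 / (2 * r)) := by
  have hne : ∀ h : ℝ, (h : ℂ) - r * Complex.I ≠ 0 := fun h h0 => by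
    have := congrArg Complex.im h0
    simp at this
    exact hr this
  have hcont : Continuous (fun h : ℝ => ((h : ℂ) - r * Complex.I)⁻¹) :=
    Continuous.inv₀ (by fun_prop) hne
  have h1 := Complex.imCLM.intervalIntegral_comp_comm (hcont.intervalIntegrable (μ := volume) (-(1 / 2)) (1 / 2))
  simp only [Complex.imCLM_apply] at h1
  rw [← h1]
  have hd : ∀ h ∈ uIcc (-(1 / 2) : ℝ) (1 / 2), HasDerivAt (fun h : ℝ => Real.arctan (h / r))
      (((h : ℂ) - r * Complex.I)⁻¹).im h := fun h _ => by
    have := ((hasDerivAt_id h).div_const r).arctan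
    convert! this using 1
    simp [Complex.inv_im, Complex.normSq_apply]
    field_simp
    ring
  rw [intervalIntegral.integral_eq_sub_of_hasDerivAt hd
    ((Complex.continuous_im.comp hcont).intervalIntegrable _ _)]
  rw [show -(1 / 2) / r = -(1 / 2 / r) by ring, Real.arctan_neg, show 1 / 2 / r = 1 / (2 * r) by field_simp]
  ring

/-- Behaviour of the winding number near the curve, in terms of the angle under which the curve is
seen from its point `z t₀`. -/
theorem tendsto_im_index (ha : 0 < a) (t₀ : ℝ) :
    Tendsto (fun r : ℝ => (∫ t in (0 : ℝ)..1, deriv D.z t * (D.z t - D.tube t₀ (t₀, r))⁻¹).im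
        - 2 * Real.arctan (1 / (2 * r))) (𝓝[≠] 0)
      (𝓝 (∫ t in (0 : ℝ)..1, (deriv D.z t * (D.z t - D.z t₀)⁻¹).im)) := by
  have hper : ∀ r : ℝ, Function.Periodic (fun t => deriv D.z t * (D.z t - D.tube t₀ (t₀, r))⁻¹) 1 :=
    fun r t => by simp only [D.periodic t, D.periodic_deriv t]
  have hz0 : D.tube t₀ (t₀, 0) = D.z t₀ := by simp [tube]
  have hlim := (Complex.continuous_im.tendsto _).comp (D.tendsto_integral_cauchyDefect ha t₀)
  obtain ⟨C, r₁, hr₁, hC⟩ := D.exists_cauchyDefect_le ha t₀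
  have hint : IntervalIntegrable (D.cauchyDefect t₀ 0) volume (-(1 / 2)) (1 / 2) := by
    refine ((intervalIntegrable_abs_rpow ha).const_mul C).mono_fun
      (D.measurable_cauchyDefect t₀ 0).aestronglyMeasurable ?_
    have h0 : ∀ᵐ h : ℝ ∂(volume.restrict (uIoc (-(1 / 2)) (1 / 2))), h ≠ 0 :=
      ae_restrict_of_ae (by simp [ae_iff])
    filter_upwards [h0, ae_restrict_mem measurableSet_uIoc] with h hh hI
    rw [uIoc_of_le (by norm_num)] at hI
    exact ((hC 0 (by simpa using hr₁.le) h (abs_le.mpr ⟨hI.1.le, hI.2⟩) hh).1).trans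
      (le_abs_self _)
  have hshift : ∀ (g : ℝ → ℂ), Function.Periodic g 1 →
      ∫ t in (0 : ℝ)..1, g t = ∫ h in (-(1 / 2) : ℝ)..(1 / 2), g (t₀ + h) := fun g hg => by
    rw [intervalIntegral.integral_comp_add_left g t₀]
    have := hg.intervalIntegral_add_eq 0 (t₀ + -(1 / 2))
    rw [zero_add] at this
    rw [this]
    congr 1; ring
  have hkap : (∫ h in (-(1 / 2) : ℝ)..(1 / 2), D.cauchyDefect t₀ 0 h).im =
      ∫ t in (0 : ℝ)..1, (deriv D.z t * (D.z t - D.z t₀)⁻¹).im := by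
    have h1 := Complex.imCLM.intervalIntegral_comp_comm hint
    simp only [Complex.imCLM_apply] at h1
    rw [← h1]
    have h2 : Function.Periodic (fun t => (deriv D.z t * (D.z t - D.z t₀)⁻¹).im) 1 := fun t => by
      simp only [D.periodic t, D.periodic_deriv t]
    have h3 := h2.intervalIntegral_add_eq 0 (t₀ + -(1 / 2))
    rw [zero_add] at h3
    have h4 := intervalIntegral.integral_comp_add_left (a := -(1 / 2)) (b := 1 / 2)
      (fun t => (deriv D.z t * (D.z t - D.z t₀)⁻¹).im) t₀
    rw [h3, show t₀ + -(1 / 2) + 1 = t₀ + 1 / 2 by ring, ← h4]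
    refine intervalIntegral.integral_congr fun h _ => ?_
    simp only [cauchyDefect, hz0, Complex.sub_im, Complex.ofReal_zero, zero_mul, sub_zero]
    rw [← Complex.ofReal_inv, Complex.ofReal_im, sub_zero]
  rw [← hkap]
  refine hlim.congr' ?_
  have hev : ∀ᶠ r : ℝ in 𝓝[≠] 0, D.tube t₀ (t₀, r) ∉ D.curve := by
    obtain ⟨δ, hδ, r, hr, hoff, -⟩ := D.exists_tube ha t₀
    filter_upwards [mem_nhdsWithin_of_mem_nhds (Ioo_mem_nhds (neg_lt_zero.mpr hr) hr),
      self_mem_nhdsWithin] with ρ hρ hρ0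
    exact hoff (t₀, ρ) ⟨⟨by simp only; linarith, by simp only; linarith⟩, hρ⟩ hρ0
  filter_upwards [hev, self_mem_nhdsWithin] with r hr hr0
  have hr0' : r ≠ 0 := hr0
  have hne : ∀ t, D.z t - D.tube t₀ (t₀, r) ≠ 0 := fun t h => hr ⟨t, sub_eq_zero.mp h⟩
  have hne' : ∀ h : ℝ, (h : ℂ) - r * Complex.I ≠ 0 := fun h h0 => by
    have := congrArg Complex.im h0
    simp at this
    exact hr0' this
  have hc1 : Continuous (fun h : ℝ => deriv D.z (t₀ + h) * (D.z (t₀ + h) - D.tube t₀ (t₀, r))⁻¹) := by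
    have h1 := D.continuous_z
    have h2 := D.continuous_deriv
    exact (by fun_prop : Continuous fun h : ℝ => deriv D.z (t₀ + h)).mul
      (Continuous.inv₀ (by fun_prop) fun h => hne _)
  have hc2 : Continuous (fun h : ℝ => ((h : ℂ) - r * Complex.I)⁻¹) :=
    Continuous.inv₀ (by fun_prop) hne'
  simp only [Function.comp_apply, cauchyDefect]
  rw [intervalIntegral.integral_sub (hc1.intervalIntegrable _ _) (hc2.intervalIntegrable _ _),
    Complex.sub_im, integral_im_inv_sub hr0', hshift _ (hper r)]

end PlanarDomain

/-! ### The winding number inside, outside and on the curve. -/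

namespace PlanarDomain

variable {a : ℝ} (D : PlanarDomain a)

theorem index_eqOn {V : Set ℂ} (hV : IsOpen V) (hc : IsPreconnected V) (hVΓ : V ⊆ D.curveᶜ)
    {v w : ℂ} (hv : v ∈ V) (hw : w ∈ V) :
    ∫ t in (0 : ℝ)..1, deriv D.z t * (D.z t - v)⁻¹ = ∫ t in (0 : ℝ)..1, deriv D.z t * (D.z t - w)⁻¹ :=
  hV.is_const_of_deriv_eq_zero hc
    (fun _ hu => (D.isClosedCurve_z.hasDerivAt_index
      (D.notMem_image_z (hVΓ hu))).differentiableAt.differentiableWithinAt)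
    (fun _ hu => (D.isClosedCurve_z.hasDerivAt_index (D.notMem_image_z (hVΓ hu))).deriv) hv hw

theorem tendsto_arctan_right :
    Tendsto (fun r : ℝ => 2 * Real.arctan (1 / (2 * r))) (𝓝[>] 0) (𝓝 Real.pi) := by
  have h1 : Tendsto (fun r : ℝ => 1 / (2 * r)) (𝓝[>] 0) atTop := by
    have := (tendsto_inv_nhdsGT_zero (𝕜 := ℝ)).const_mul_atTop (show (0 : ℝ) < 1 / 2 by norm_num)
    refine this.congr fun r => ?_
    rw [one_div, one_div, mul_inv]
  have h2 := ((Real.tendsto_arctan_atTop.mono_right nhdsWithin_le_nhds).comp h1).const_mul 2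
  rwa [show 2 * (Real.pi / 2) = Real.pi by ring] at h2

theorem tendsto_arctan_left :
    Tendsto (fun r : ℝ => 2 * Real.arctan (1 / (2 * r))) (𝓝[<] 0) (𝓝 (-Real.pi)) := by
  have h : Tendsto (fun r : ℝ => -r) (𝓝[<] 0) (𝓝[>] 0) := by
    refine tendsto_nhdsWithin_iff.mpr ⟨?_, ?_⟩
    · have := (continuous_neg (G := ℝ)).tendsto 0
      rw [neg_zero] at this
      exact this.mono_left nhdsWithin_le_nhds
    · filter_upwards [self_mem_nhdsWithin] with r hr
      have h : r < 0 := hr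
      exact neg_pos.mpr h
  refine ((tendsto_arctan_right.comp h).neg).congr fun r => ?_
  simp only [Function.comp_apply]
  rw [show 1 / (2 * -r) = -(1 / (2 * r)) by rw [mul_neg, div_neg], Real.arctan_neg]
  ring

theorem tendsto_tube_carrier (t₀ : ℝ) : ∀ᶠ r : ℝ in 𝓝[>] 0, D.tube t₀ (t₀, r) ∈ D.carrier :=
  D.leftOf t₀

theorem carrier_subset : D.carrier ⊆ D.curveᶜ := fun _ => D.notMem_curve_of_mem_carrier

theorem exterior_subset : D.exterior ⊆ D.curveᶜ := fun _ => D.notMem_curve_of_mem_exterior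

/-- The index is constant on the domain, so it equals its limit along the inner normal, where the
tangent contributes π. -/
theorem im_index_carrier_eq (ha : 0 < a) (t₀ : ℝ) {w : ℂ} (hw : w ∈ D.carrier) :
    (∫ t in (0 : ℝ)..1, deriv D.z t * (D.z t - w)⁻¹).im =
      (∫ t in (0 : ℝ)..1, (deriv D.z t * (D.z t - D.z t₀)⁻¹).im) + Real.pi := by
  have h1 := ((D.tendsto_im_index ha t₀).mono_left (nhdsWithin_mono _ fun r (hr : r ∈ Ioi 0) => ne_of_gt hr)).add
    tendsto_arctan_right
  simp only [sub_add_cancel] at h1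
  refine tendsto_nhds_unique (tendsto_const_nhds.congr' ?_) h1
  filter_upwards [D.tendsto_tube_carrier t₀] with r hr
  rw [D.index_eqOn D.isOpen D.isConnected.isPreconnected D.carrier_subset hw hr]

theorem im_index_eq_of_left (ha : 0 < a) (t₀ : ℝ) {c : ℝ}
    (hc : ∀ᶠ r : ℝ in 𝓝[<] 0, (∫ t in (0 : ℝ)..1, deriv D.z t * (D.z t - D.tube t₀ (t₀, r))⁻¹).im = c) :
    c = (∫ t in (0 : ℝ)..1, (deriv D.z t * (D.z t - D.z t₀)⁻¹).im) - Real.pi := by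
  have h1 := ((D.tendsto_im_index ha t₀).mono_left (nhdsWithin_mono _ fun r (hr : r ∈ Iio 0) => ne_of_lt hr)).add
    tendsto_arctan_left
  simp only [sub_add_cancel] at h1
  exact tendsto_nhds_unique (tendsto_const_nhds.congr' (hc.mono fun r hr => hr.symm)) h1

theorem eventually_mem_rightStrip {t₀ δ r : ℝ} (hδ : 0 < δ) (hr : 0 < r) :
    ∀ᶠ ρ : ℝ in 𝓝[<] 0, D.tube t₀ (t₀, ρ) ∈ D.rightStrip t₀ δ r := by
  filter_upwards [Ioo_mem_nhdsLT (neg_lt_zero.mpr hr)] with ρ hρ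
  exact ⟨(t₀, ρ), ⟨⟨by simp only; linarith, by simp only; linarith⟩, hρ⟩, rfl⟩

/-- If the right side also lay in the domain, the index would be the same constant on both sides of
the curve, although it jumps by 2π across it. -/
theorem rightStrip_subset_exterior (ha : 0 < a) (t₀ δ r : ℝ) (h : D.rightStrip t₀ δ r ⊆ D.curveᶜ)
    (hδ : 0 < δ) (hr : 0 < r) : D.rightStrip t₀ δ r ⊆ D.exterior := by
  rcases D.subset_or_subset (D.isPreconnected_rightStrip t₀ δ r) h with h | h
  · exfalso
    obtain ⟨w, hw⟩ := D.isConnected.nonempty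
    have h1 := D.im_index_carrier_eq ha t₀ hw
    have h2 := D.im_index_eq_of_left ha t₀ (c := (∫ t in (0 : ℝ)..1, deriv D.z t * (D.z t - w)⁻¹).im) <| by
      filter_upwards [D.eventually_mem_rightStrip hδ hr] with ρ hρ
      rw [D.index_eqOn D.isOpen D.isConnected.isPreconnected D.carrier_subset hw (h hρ)]
    linarith [Real.pi_pos]
  · exact h

theorem isPreconnected_exterior (ha : 0 < a) : IsPreconnected D.exterior :=
  D.isPreconnected_exterior_of_strips ha (D.rightStrip_subset_exterior ha)

theorem exists_large_exterior (R : ℝ) : ∃ w ∈ D.exterior, R < ‖w‖ := by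
  obtain ⟨R', hR'⟩ := D.isBounded.closure.exists_norm_le
  refine ⟨((max R (max R' 0) + 1 : ℝ) : ℂ), fun h => ?_, ?_⟩
  · have := hR' _ h
    rw [Complex.norm_real, Real.norm_eq_abs] at this
    have h1 := le_abs_self (max R (max R' 0) + 1)
    have h2 := (le_max_left R' 0).trans (le_max_right R (max R' 0))
    linarith
  · rw [Complex.norm_real, Real.norm_eq_abs]
    have h1 := le_abs_self (max R (max R' 0) + 1)
    have h2 := le_max_left R (max R' 0)
    linarith

/-- The exterior is connected and reaches infinity, where the index vanishes. -/
theorem index_exterior (ha : 0 < a) {w : ℂ} (hw : w ∈ D.exterior) :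
    ∫ t in (0 : ℝ)..1, deriv D.z t * (D.z t - w)⁻¹ = 0 := by
  obtain ⟨R, hR⟩ := D.isCompact_curve.isBounded.exists_norm_le
  obtain ⟨v, hv, hvR⟩ := D.exists_large_exterior R
  rw [D.index_eqOn D.isOpen_exterior (D.isPreconnected_exterior ha) D.exterior_subset hw hv]
  exact D.isClosedCurve_z.index_eq_zero_of_large (fun t _ => hR _ ⟨t, rfl⟩) hvR

/-- The curve is seen from each of its points under the angle `π`. -/
theorem angle_eq_pi (ha : 0 < a) {x : ℂ} (hx : x ∈ D.curve) :
    ∫ t in (0 : ℝ)..1, (deriv D.z t * (D.z t - x)⁻¹).im = Real.pi := by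
  obtain ⟨t₀, rfl⟩ := hx
  obtain ⟨δ, hδ, r, hr, -, hoff, -⟩ := D.exists_strips ha t₀
  have h := D.rightStrip_subset_exterior ha t₀ δ r hoff hδ hr
  have := D.im_index_eq_of_left ha t₀ (c := 0) <| by
    filter_upwards [D.eventually_mem_rightStrip hδ hr] with ρ hρ
    rw [D.index_exterior ha (h hρ), Complex.zero_im]
  linarith

/-- The real part has the single-valued primitive log |z t - w|. -/
theorem re_index_eq_zero {w : ℂ} (hw : w ∉ D.curve) :
    (∫ t in (0 : ℝ)..1, deriv D.z t * (D.z t - w)⁻¹).re = 0 := by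
  have hne : ∀ t, D.z t - w ≠ 0 := fun t h => hw ⟨t, sub_eq_zero.mp h⟩
  have hc : Continuous (fun t => deriv D.z t * (D.z t - w)⁻¹) :=
    D.continuous_deriv.mul (Continuous.inv₀ (D.continuous_z.sub continuous_const) hne)
  have h1 := Complex.reCLM.intervalIntegral_comp_comm (hc.intervalIntegrable (μ := volume) 0 1)
  simp only [Complex.reCLM_apply] at h1
  rw [← h1]
  have hd : ∀ t ∈ uIcc (0 : ℝ) 1, HasDerivAt
      (fun t => 1 / 2 * Real.log ((D.z t - w).re * (D.z t - w).re + (D.z t - w).im * (D.z t - w).im))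
      (deriv D.z t * (D.z t - w)⁻¹).re t := fun t _ => by
    have h2 : HasDerivAt (fun t => (D.z t - w).re) (deriv D.z t).re t :=
      Complex.reCLM.hasFDerivAt.comp_hasDerivAt t ((D.hasDerivAt_z t).sub_const w)
    have h3 : HasDerivAt (fun t => (D.z t - w).im) (deriv D.z t).im t :=
      Complex.imCLM.hasFDerivAt.comp_hasDerivAt t ((D.hasDerivAt_z t).sub_const w)
    have h4 : (D.z t - w).re * (D.z t - w).re + (D.z t - w).im * (D.z t - w).im ≠ 0 := by
      rw [← Complex.normSq_apply]
      exact (Complex.normSq_pos.mpr (hne t)).ne'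
    have h5 := (((h2.mul h2).add (h3.mul h3)).log h4).const_mul (1 / 2)
    refine h5.congr_deriv ?_
    rw [Complex.mul_re, Complex.inv_re, Complex.inv_im, Complex.normSq_apply]
    simp only [Pi.add_apply, Pi.mul_apply]
    field_simp
    ring
  rw [intervalIntegral.integral_eq_sub_of_hasDerivAt hd
    ((Complex.continuous_re.comp hc).intervalIntegrable _ _)]
  have := D.periodic 0
  rw [zero_add] at this
  rw [this, sub_self]

theorem index_carrier (ha : 0 < a) {w : ℂ} (hw : w ∈ D.carrier) :
    ∫ t in (0 : ℝ)..1, deriv D.z t * (D.z t - w)⁻¹ = 2 * Real.pi * Complex.I := by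
  apply Complex.ext
  · rw [D.re_index_eq_zero (D.notMem_curve_of_mem_carrier hw)]
    simp
  · rw [D.im_index_carrier_eq ha 0 hw, D.angle_eq_pi ha ⟨0, rfl⟩]
    simp; ring

theorem integral_cauchy_carrier (ha : 0 < a) {w : ℂ} (hw : w ∈ D.carrier) :
    ∫ y, (y - w)⁻¹ * D.tangent y ∂D.arcLength = 2 * Real.pi * Complex.I := by
  rw [D.integral_mul_tangent (g := fun y => (y - w)⁻¹) (by fun_prop), ← D.index_carrier ha hw]
  simp only [mul_comm]

theorem integral_cauchy_exterior (ha : 0 < a) {w : ℂ} (hw : w ∈ D.exterior) :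
    ∫ y, (y - w)⁻¹ * D.tangent y ∂D.arcLength = 0 := by
  rw [D.integral_mul_tangent (g := fun y => (y - w)⁻¹) (by fun_prop), ← D.index_exterior ha hw]
  simp only [mul_comm]

theorem npKernel_eq (x y : ℂ) : D.npKernel x y = 1 / (2 * Real.pi) * ((x - y)⁻¹ * D.tangent x).im := by
  rw [npKernel, tangent]
  congr 1
  rw [Complex.inner, Complex.mul_im, Complex.inv_re, Complex.inv_im, Complex.normSq_eq_norm_sq]
  simp
  ring

/-- The kernel measures the angle element as seen from x, up to the factor 1/(2π), and the total
angle is π. In other words, the transpose of 𝒦* maps 1 to 1/2. -/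
theorem integral_npKernel (ha : 0 < a) {x : ℂ} (hx : x ∈ D.curve) :
    ∫ y, (D.npKernel y x : ℂ) ∂D.arcLength = 1 / 2 := by
  have hm : Measurable fun y => (D.npKernel y x : ℂ) := by
    simp only [npKernel_eq]
    exact Complex.measurable_ofReal.comp ((Complex.measurable_im.comp
      ((measurable_id.sub_const x).inv.mul D.measurable_tangent)).const_mul _)
  rw [D.integral_arcLength _ hm]
  have h : ∀ t, (‖deriv D.z t‖ : ℂ) * (D.npKernel (D.z t) x : ℂ) =
      ((1 / (2 * Real.pi) * (deriv D.z t * (D.z t - x)⁻¹).im : ℝ) : ℂ) := fun t => by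
    have hn : ‖deriv D.z t‖ ≠ 0 := by simpa using D.regular t
    rw [npKernel_eq, tangent_z, ← Complex.ofReal_mul, mul_comm (deriv D.z t),
      ← mul_div_assoc, Complex.div_ofReal_im]
    congr 1
    field_simp
  simp only [h]
  rw [intervalIntegral.integral_ofReal, intervalIntegral.integral_const_mul, D.angle_eq_pi ha hx]
  push_cast
  have := Real.pi_ne_zero
  field_simp

end PlanarDomain

/-! ### Schur's test and integral operators on L². -/

theorem MeasureTheory.eLpNorm_two_sq {α E : Type*} [MeasurableSpace α] [NormedAddCommGroup E]
    (f : α → E) (μ : Measure α) : eLpNorm f 2 μ ^ 2 = ∫⁻ x, ‖f x‖ₑ ^ 2 ∂μ := by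
  have := eLpNorm_nnreal_pow_eq_lintegral (μ := μ) (f := f) (p := 2) two_ne_zero
  simpa using this

/-- Cauchy-Schwarz after splitting k f as √k · √k f. -/
theorem MeasureTheory.sq_lintegral_mul_le {α : Type*} [MeasurableSpace α] {μ : Measure α}
    {k f : α → ENNReal} (hk : Measurable k) (hf : Measurable f) :
    (∫⁻ x, k x * f x ∂μ) ^ 2 ≤ (∫⁻ x, k x ∂μ) * ∫⁻ x, k x * f x ^ 2 ∂μ := by
  have h := ENNReal.lintegral_mul_norm_pow_le (μ := μ) hk.aemeasurable
    (hk.mul (hf.pow_const 2)).aemeasurable (p := 1 / 2) (q := 1 / 2) (by norm_num) (by norm_num)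
    (by norm_num)
  have hp : ∀ A : ENNReal, (A ^ (1 / 2 : ℝ)) ^ 2 = A := fun A => by
    rw [← ENNReal.rpow_natCast, ← ENNReal.rpow_mul]; norm_num
  have hq : ∀ A : ENNReal, (A ^ 2) ^ (1 / 2 : ℝ) = A := fun A => by
    rw [← ENNReal.rpow_natCast, ← ENNReal.rpow_mul]; norm_num
  have e : ∀ x, k x ^ (1 / 2 : ℝ) * (k * fun x => f x ^ 2) x ^ (1 / 2 : ℝ) = k x * f x := fun x => by
    rw [Pi.mul_apply, ENNReal.mul_rpow_of_nonneg _ _ (by norm_num), hq, ← mul_assoc, ← sq, hp]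
  simp only [e] at h
  calc (∫⁻ x, k x * f x ∂μ) ^ 2 ≤ _ := pow_le_pow_left₀ (by simp) h 2
    _ = _ := by rw [mul_pow, hp, hp]; rfl

namespace PlanarDomain

variable {a : ℝ} (D : PlanarDomain a)

/-- A measurable kernel on the curve that satisfies the hypotheses of Schur's test. -/
structure IsSchurKernel (k : ℂ → ℂ → ℝ) (M : ℝ) : Prop where
  measurable : Measurable (Function.uncurry k)
  nonneg : 0 ≤ M
  left : ∀ x ∈ D.curve, ∫⁻ y, ‖k x y‖ₑ ∂D.arcLength ≤ ENNReal.ofReal M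
  right : ∀ y ∈ D.curve, ∫⁻ x, ‖k x y‖ₑ ∂D.arcLength ≤ ENNReal.ofReal M

variable {D} {k : ℂ → ℂ → ℝ} {M : ℝ}

theorem IsSchurKernel.measurable_left (h : D.IsSchurKernel k M) (x : ℂ) : Measurable (k x) :=
  h.measurable.comp measurable_prodMk_left

theorem IsSchurKernel.measurable_right (h : D.IsSchurKernel k M) (y : ℂ) : Measurable fun x => k x y :=
  h.measurable.comp measurable_prodMk_right

/-- Weighted Cauchy-Schwarz uses the bound of the row integrals; then the order of integration is
exchanged and the bound of the column integrals is used. -/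
theorem IsSchurKernel.lintegral_le (h : D.IsSchurKernel k M) {f : ℂ → ENNReal} (hf : Measurable f) :
    ∫⁻ x, (∫⁻ y, ‖k x y‖ₑ * f y ∂D.arcLength) ^ 2 ∂D.arcLength ≤
      ENNReal.ofReal M ^ 2 * ∫⁻ y, f y ^ 2 ∂D.arcLength := by
  have hm : Measurable (Function.uncurry fun x y => ‖k x y‖ₑ * f y ^ 2) :=
    h.measurable.enorm.mul ((hf.comp measurable_snd).pow_const 2)
  calc ∫⁻ x, (∫⁻ y, ‖k x y‖ₑ * f y ∂D.arcLength) ^ 2 ∂D.arcLength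
      ≤ ∫⁻ x, ENNReal.ofReal M * ∫⁻ y, ‖k x y‖ₑ * f y ^ 2 ∂D.arcLength ∂D.arcLength := by
        refine lintegral_mono_ae ?_
        filter_upwards [D.ae_mem_curve] with x hx
        exact (sq_lintegral_mul_le (h.measurable_left x).enorm hf).trans (by gcongr; exact h.left x hx)
    _ = ENNReal.ofReal M * ∫⁻ y, ∫⁻ x, ‖k x y‖ₑ * f y ^ 2 ∂D.arcLength ∂D.arcLength := by
        rw [lintegral_const_mul' _ _ (by simp), lintegral_lintegral_swap hm.aemeasurable]
    _ ≤ ENNReal.ofReal M * ∫⁻ y, ENNReal.ofReal M * f y ^ 2 ∂D.arcLength := by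
        gcongr 1
        refine lintegral_mono_ae ?_
        filter_upwards [D.ae_mem_curve] with y hy
        rw [lintegral_mul_const _ (h.measurable_right y).enorm]
        gcongr
        exact h.right y hy
    _ = _ := by rw [lintegral_const_mul' _ _ (by simp), sq, mul_assoc]

theorem IsSchurKernel.eLpNorm_le (h : D.IsSchurKernel k M) (φ : D.L2) :
    eLpNorm (fun x => ∫ y, (k x y : ℂ) * φ y ∂D.arcLength) 2 D.arcLength ≤
      ENNReal.ofReal M * eLpNorm φ 2 D.arcLength := by
  refine (ENNReal.pow_right_strictMono (n := 2) two_ne_zero).le_iff_le.mp ?_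
  simp only [mul_pow, eLpNorm_two_sq]
  refine le_trans (lintegral_mono fun x => ?_)
    (h.lintegral_le (Lp.stronglyMeasurable φ).measurable.enorm)
  gcongr
  refine (enorm_integral_le_lintegral_enorm _).trans_eq (lintegral_congr fun y => ?_)
  rw [enorm_mul, ← ofReal_norm, Complex.norm_real, ofReal_norm]

theorem IsSchurKernel.ae_integrable (h : D.IsSchurKernel k M) (φ : D.L2) :
    ∀ᵐ x ∂D.arcLength, Integrable (fun y => (k x y : ℂ) * φ y) D.arcLength := by
  have h1 := h.lintegral_le (f := fun y => ‖φ y‖ₑ) (Lp.stronglyMeasurable φ).measurable.enorm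
  have h2 : ∫⁻ x, (∫⁻ y, ‖k x y‖ₑ * ‖φ y‖ₑ ∂D.arcLength) ^ 2 ∂D.arcLength ≠ ⊤ := by
    refine (h1.trans_lt (ENNReal.mul_lt_top (by simp) ?_)).ne
    rw [← eLpNorm_two_sq]
    exact ENNReal.pow_lt_top (Lp.eLpNorm_lt_top φ)
  have hm : Measurable fun x => (∫⁻ y, ‖k x y‖ₑ * ‖φ y‖ₑ ∂D.arcLength) ^ 2 := by
    refine Measurable.pow_const (Measurable.lintegral_prod_right' (f := fun p : ℂ × ℂ => ‖k p.1 p.2‖ₑ * ‖φ p.2‖ₑ) ?_) 2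
    exact h.measurable.enorm.mul ((Lp.stronglyMeasurable φ).measurable.enorm.comp measurable_snd)
  filter_upwards [ae_lt_top hm h2] with x hx
  refine ⟨((Complex.measurable_ofReal.comp (h.measurable_left x)).mul
    (Lp.stronglyMeasurable φ).measurable).aestronglyMeasurable, ?_⟩
  rw [hasFiniteIntegral_iff_enorm]
  have h3 : ∫⁻ y, ‖k x y‖ₑ * ‖φ y‖ₑ ∂D.arcLength < ⊤ := by
    by_contra hcon
    rw [not_lt_top_iff.mp hcon] at hx
    simp at hx
  refine lt_of_eq_of_lt (lintegral_congr fun y => ?_) h3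
  rw [enorm_mul, ← ofReal_norm, Complex.norm_real, ofReal_norm]

theorem IsSchurKernel.memLp (h : D.IsSchurKernel k M) (φ : D.L2) :
    MemLp (fun x => ∫ y, (k x y : ℂ) * φ y ∂D.arcLength) 2 D.arcLength := by
  refine ⟨(StronglyMeasurable.integral_prod_right (f := fun x y => (k x y : ℂ) * φ y) ?_).aestronglyMeasurable,
    (h.eLpNorm_le φ).trans_lt (ENNReal.mul_lt_top (by simp) (Lp.eLpNorm_lt_top φ))⟩
  exact ((Complex.measurable_ofReal.comp h.measurable).mul
    ((Lp.stronglyMeasurable φ).measurable.comp measurable_snd)).stronglyMeasurable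

theorem IsSchurKernel.norm_toLp_le (h : D.IsSchurKernel k M) (φ : D.L2) :
    ‖(h.memLp φ).toLp‖ ≤ M * ‖φ‖ := by
  rw [Lp.norm_toLp, Lp.norm_def, ← ENNReal.toReal_ofReal h.nonneg, ← ENNReal.toReal_mul]
  exact ENNReal.toReal_mono (ENNReal.mul_ne_top (by simp) (Lp.eLpNorm_ne_top φ)) (h.eLpNorm_le φ)

theorem IsSchurKernel.exists_isIntegralOperator (h : D.IsSchurKernel k M) :
    ∃ T, D.IsIntegralOperator k T := by
  refine ⟨LinearMap.mkContinuous
    { toFun := fun φ => (h.memLp φ).toLp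
      map_add' := fun φ ψ => ?_
      map_smul' := fun c φ => ?_ } M h.norm_toLp_le, fun φ => ?_⟩
  · apply Lp.ext
    filter_upwards [(h.memLp (φ + ψ)).coeFn_toLp, (h.memLp φ).coeFn_toLp, (h.memLp ψ).coeFn_toLp,
      Lp.coeFn_add (h.memLp φ).toLp (h.memLp ψ).toLp, h.ae_integrable φ, h.ae_integrable ψ]
      with x h1 h2 h3 h4 h5 h6
    rw [h1, h4, Pi.add_apply, h2, h3, ← integral_add h5 h6]
    refine integral_congr_ae ?_
    filter_upwards [Lp.coeFn_add φ ψ] with y hy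
    rw [hy, Pi.add_apply, mul_add]
  · apply Lp.ext
    filter_upwards [(h.memLp (c • φ)).coeFn_toLp, (h.memLp φ).coeFn_toLp,
      Lp.coeFn_smul c (h.memLp φ).toLp] with x h1 h2 h3
    rw [RingHom.id_apply, h1, h3, Pi.smul_apply, h2, ← integral_smul]
    refine integral_congr_ae ?_
    filter_upwards [Lp.coeFn_smul c φ] with y hy
    rw [hy, Pi.smul_apply, smul_eq_mul, smul_eq_mul]
    ring
  · filter_upwards [h.ae_integrable φ, (h.memLp φ).coeFn_toLp] with x h1 h2
    exact ⟨h1, h2⟩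

theorem IsIntegralOperator.norm_le {T : D.L2 →L[ℂ] D.L2} (hT : D.IsIntegralOperator k T)
    (h : D.IsSchurKernel k M) : ‖T‖ ≤ M := by
  refine ContinuousLinearMap.opNorm_le_bound _ h.nonneg fun φ => ?_
  refine le_trans (le_of_eq ?_) (h.norm_toLp_le φ)
  congr 1
  apply Lp.ext
  filter_upwards [hT φ, (h.memLp φ).coeFn_toLp] with x h1 h2
  rw [h1.2, h2]

theorem IsIntegralOperator.sub {k' : ℂ → ℂ → ℝ} {T T' : D.L2 →L[ℂ] D.L2}
    (hT : D.IsIntegralOperator k T) (hT' : D.IsIntegralOperator k' T') :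
    D.IsIntegralOperator (fun x y => k x y - k' x y) (T - T') := by
  intro φ
  filter_upwards [hT φ, hT' φ, Lp.coeFn_sub (T φ) (T' φ)] with x h1 h2 h3
  have e : (fun y => ((k x y - k' x y : ℝ) : ℂ) * φ y) =
      fun y => (k x y : ℂ) * φ y - (k' x y : ℂ) * φ y := by
    funext y; push_cast; ring
  rw [e]
  refine ⟨h1.1.sub h2.1, ?_⟩
  rw [integral_sub h1.1 h2.1, ← h1.2, ← h2.2]
  exact h3

variable (D) in
theorem isIntegralOperator_integralOperator (h : ∃ T, D.IsIntegralOperator k T) :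
    D.IsIntegralOperator k (D.integralOperator k) := by
  rw [integralOperator, dif_pos h]
  exact h.choose_spec

theorem IsSchurKernel.of_bound {η : ℝ} (hk : Measurable (Function.uncurry k)) (hη : 0 ≤ η)
    (h : ∀ x ∈ D.curve, ∀ y ∈ D.curve, |k x y| ≤ η) :
    D.IsSchurKernel k (η * D.arcLength.real univ) := by
  have key : ∀ f : ℂ → ℝ, (∀ y ∈ D.curve, |f y| ≤ η) →
      ∫⁻ y, ‖f y‖ₑ ∂D.arcLength ≤ ENNReal.ofReal (η * D.arcLength.real univ) := fun f hf => by
    calc ∫⁻ y, ‖f y‖ₑ ∂D.arcLength ≤ ∫⁻ y, ENNReal.ofReal η ∂D.arcLength := by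
          refine lintegral_mono_ae ?_
          filter_upwards [D.ae_mem_curve] with y hy
          rw [Real.enorm_eq_ofReal_abs]
          exact ENNReal.ofReal_le_ofReal (hf y hy)
      _ = _ := by
          rw [lintegral_const, ENNReal.ofReal_mul hη, Measure.real, ENNReal.ofReal_toReal (by simp)]
  exact ⟨hk, by positivity, fun x hx => key _ (h x hx), fun y hy => key _ fun x hx => h x hx y hy⟩

end PlanarDomain

/-! ### Compactness of weakly singular integral operators. -/

theorem ContinuousLinearMap.isCompactOperator_of_mem_finiteDimensional {E : Type*}
    [NormedAddCommGroup E] [NormedSpace ℂ E] (T : E →L[ℂ] E) (F : Submodule ℂ E)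
    [FiniteDimensional ℂ F] (h : ∀ x, T x ∈ F) : IsCompactOperator T := by
  have : ProperSpace F := FiniteDimensional.proper ℂ F
  exact (isCompactOperator_of_locallyCompactSpace_dom (T.codRestrict F h)).clm_comp F.subtypeL

namespace PlanarDomain

variable {a : ℝ} {D : PlanarDomain a} {k : ℂ → ℂ → ℝ} {M : ℝ}

/-- The range is spanned by the indicators of the finitely many fibres of `s`. -/
theorem IsIntegralOperator.isCompactOperator_of_simpleFunc {P : Type*} {s : SimpleFunc ℂ P}
    {κ : P → ℂ → ℝ} {T : D.L2 →L[ℂ] D.L2} (hT : D.IsIntegralOperator (fun x y => κ (s x) y) T) :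
    IsCompactOperator T := by
  classical
  set v : P → D.L2 := fun q => indicatorConstLp 2 (s.measurableSet_fiber q)
    (measure_ne_top D.arcLength _) (1 : ℂ) with hv
  set F : Submodule ℂ D.L2 := Submodule.span ℂ (s.range.image v : Finset D.L2) with hF
  have : FiniteDimensional ℂ F := FiniteDimensional.span_finset ℂ _
  refine T.isCompactOperator_of_mem_finiteDimensional F fun φ => ?_
  set c : P → ℂ := fun q => ∫ y, (κ q y : ℂ) * φ y ∂D.arcLength with hc
  have e : T φ = ∑ q ∈ s.range, c q • v q := by
    apply Lp.ext
    have h1 : ∀ᵐ x ∂D.arcLength, ∀ q ∈ s.range, (c q • v q : D.L2) x =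
        c q * (s ⁻¹' {q}).indicator (fun _ => (1 : ℂ)) x := by
      refine (ae_ball_iff (S := (s.range : Set P)) s.range.countable_toSet).mpr fun q _ => ?_
      filter_upwards [Lp.coeFn_smul (c q) (v q),
        indicatorConstLp_coeFn (p := 2) (hs := s.measurableSet_fiber q)
          (hμs := measure_ne_top D.arcLength _) (c := (1 : ℂ))] with x h1 h2
      rw [h1, Pi.smul_apply, h2, smul_eq_mul]
    filter_upwards [hT φ, Lp.coeFn_finsetSum s.range (fun q => c q • v q), h1] with x h2 h3 h4
    rw [h2.2, h3, Finset.sum_apply, Finset.sum_congr rfl h4]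
    rw [Finset.sum_eq_single (s x)]
    · simp [hc]
    · intro q _ hq
      rw [indicator_of_notMem (fun h => hq (by simpa using h.symm)), mul_zero]
    · intro h
      exact absurd (s.mem_range_self x) h
  rw [e]
  exact Submodule.sum_mem _ fun q hq => Submodule.smul_mem _ _
    (Submodule.subset_span (Finset.mem_coe.mpr (Finset.mem_image_of_mem v hq)))

theorem isCompactOperator_of_approx {T : D.L2 →L[ℂ] D.L2} (hT : D.IsIntegralOperator k T)
    (h : ∀ ε > 0, ∃ k' : ℂ → ℂ → ℝ, ∃ T' : D.L2 →L[ℂ] D.L2, D.IsIntegralOperator k' T' ∧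
      IsCompactOperator T' ∧ D.IsSchurKernel (fun x y => k x y - k' x y) ε) :
    IsCompactOperator T := by
  have hc := isClosed_setOfPred_isCompactOperator (𝕜₁ := ℂ) (𝕜₂ := ℂ) (σ₁₂ := RingHom.id ℂ)
    (M₁ := D.L2) (M₂ := D.L2)
  change T ∈ {f : D.L2 →L[ℂ] D.L2 | IsCompactOperator f}
  rw [← hc.closure_eq, Metric.mem_closure_iff]
  intro ε hε
  obtain ⟨k', T', hT', hcT', hS⟩ := h (ε / 2) (half_pos hε)
  refine ⟨T', hcT', ?_⟩
  rw [dist_eq_norm]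
  exact ((hT.sub hT').norm_le hS).trans_lt (half_lt_self hε)

/-- Rounding the parameter p x to one of finitely many points changes the kernel uniformly little.
Only the dependence on the parameter has to be continuous; `p` itself may be merely measurable, as
is the case for x ↦ (x, ν x) below. -/
theorem isCompactOperator_of_continuous {P : Type*} [PseudoMetricSpace P] [ProperSpace P]
    [SecondCountableTopology P] [Nonempty P] [MeasurableSpace P] [BorelSpace P]
    {κ : P → ℂ → ℝ} (hκ : Continuous (Function.uncurry κ)) {p : ℂ → P} (hp : Measurable p)
    {K : Set P} (hK : IsCompact K) (hpK : ∀ x ∈ D.curve, p x ∈ K) :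
    ∃ T, D.IsIntegralOperator (fun x y => κ (p x) y) T ∧ IsCompactOperator T := by
  have hpm : Measurable (Function.uncurry fun x y => κ (p x) y) :=
    hκ.measurable.comp ((hp.comp measurable_fst).prodMk measurable_snd)
  set K' := Metric.cthickening 1 K with hK'
  have hK'c : IsCompact K' := hK.cthickening
  have hKK' : K ⊆ K' := Metric.self_subset_cthickening K
  have hcc : IsCompact (K' ×ˢ D.curve) := hK'c.prod D.isCompact_curve
  obtain ⟨B, hB⟩ := hcc.exists_bound_of_continuousOn hκ.continuousOn
  have hbound : ∀ q : ℂ → P, (∀ x ∈ D.curve, q x ∈ K') → ∀ x ∈ D.curve, ∀ y ∈ D.curve,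
      |κ (q x) y| ≤ max B 0 := fun q hq x hx y hy =>
    (hB (q x, y) ⟨hq x hx, hy⟩).trans (le_max_left _ _)
  have hS := IsSchurKernel.of_bound (D := D) hpm (le_max_right B 0)
    (hbound p fun x hx => hKK' (hpK x hx))
  obtain ⟨T, hT⟩ := hS.exists_isIntegralOperator
  refine ⟨T, hT, isCompactOperator_of_approx hT fun ε hε => ?_⟩
  obtain ⟨η, hη, hηε⟩ : ∃ η > 0, η * D.arcLength.real univ ≤ ε :=
    ⟨ε / (D.arcLength.real univ + 1), by positivity, by
      rw [div_mul_eq_mul_div, div_le_iff₀ (by positivity)]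
      nlinarith [measureReal_nonneg (μ := D.arcLength) (s := univ)]⟩
  have huc := hcc.uniformContinuousOn_of_continuous hκ.continuousOn
  rw [Metric.uniformContinuousOn_iff] at huc
  obtain ⟨δ, hδ, hd⟩ := huc η hη
  set δ' := min δ 1 with hδ'
  have hδ'0 : 0 < δ' := by positivity
  set e := TopologicalSpace.denseSeq P with he
  obtain ⟨N, hN⟩ : ∃ N, ∀ q ∈ K, ∃ n ≤ N, dist (e n) q < δ' := by
    have hcov : K ⊆ ⋃ n, Metric.ball (e n) δ' := fun q _ => by
      obtain ⟨n, hn⟩ := (TopologicalSpace.denseRange_denseSeq P).exists_dist_lt q hδ'0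
      exact mem_iUnion.mpr ⟨n, hn⟩
    obtain ⟨t, ht⟩ := hK.elim_finite_subcover _ (fun n => Metric.isOpen_ball) hcov
    refine ⟨t.sup id, fun q hq => ?_⟩
    obtain ⟨n, hn, hqn⟩ := mem_iUnion₂.mp (ht hq)
    exact ⟨n, Finset.le_sup (f := id) hn, by rw [dist_comm]; exact hqn⟩
  set s : SimpleFunc ℂ P := (SimpleFunc.nearestPt e N).comp p hp with hs
  have hsd : ∀ x ∈ D.curve, dist (s x) (p x) < δ' := fun x hx => by
    obtain ⟨n, hn, hd⟩ := hN (p x) (hpK x hx)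
    have h1 := SimpleFunc.edist_nearestPt_le e (p x) hn
    rw [edist_dist, edist_dist, ENNReal.ofReal_le_ofReal_iff dist_nonneg] at h1
    exact h1.trans_lt hd
  have hsK : ∀ x ∈ D.curve, s x ∈ K' := fun x hx =>
    Metric.mem_cthickening_of_dist_le _ (p x) 1 K (hpK x hx)
      ((hsd x hx).le.trans (min_le_right _ _))
  have hsm : Measurable (Function.uncurry fun x y => κ (s x) y) :=
    hκ.measurable.comp ((s.measurable.comp measurable_fst).prodMk measurable_snd)
  obtain ⟨T', hT'⟩ := (IsSchurKernel.of_bound (D := D) hsm (le_max_right B 0)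
    (hbound s hsK)).exists_isIntegralOperator
  refine ⟨_, T', hT', hT'.isCompactOperator_of_simpleFunc, ?_⟩
  have h1 := IsSchurKernel.of_bound (D := D) (k := fun x y => κ (p x) y - κ (s x) y) (hpm.sub hsm)
    hη.le fun x hx y hy => by
      have := hd (p x, y) ⟨hKK' (hpK x hx), hy⟩ (s x, y) ⟨hsK x hx, hy⟩ (by
        rw [Prod.dist_eq, dist_self, max_eq_left dist_nonneg, dist_comm]
        exact (hsd x hx).trans_le (min_le_left _ _))
      rw [Real.dist_eq] at this
      exact this.le
  exact ⟨h1.measurable, hε.le, fun x hx => (h1.left x hx).trans (ENNReal.ofReal_le_ofReal hηε),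
    fun x hx => (h1.right x hx).trans (ENNReal.ofReal_le_ofReal hηε)⟩

variable (D) in
theorem arcLength_singleton (x : ℂ) : D.arcLength {x} = 0 := by
  have hs : (D.z ⁻¹' {x} ∩ Ioc 0 1).Subsingleton := fun s hs t ht =>
    D.injOn hs.2 ht.2 (hs.1.trans ht.1.symm)
  rw [arcLength, Measure.map_apply D.continuous_z.measurable (measurableSet_singleton x)]
  refine withDensity_absolutelyContinuous _ _ ?_
  rw [Measure.restrict_apply (D.continuous_z.measurable (measurableSet_singleton x))]
  exact hs.measure_zero _

theorem ae_ne (x : ℂ) : ∀ᵐ y ∂D.arcLength, y ≠ x := by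
  rw [ae_iff]
  simpa using D.arcLength_singleton x

theorem exists_isSchurKernel (ha : 0 < a) {b : ℝ} (hb0 : 0 ≤ b) (hb : b < 1) :
    ∃ M : ℝ, 0 ≤ M ∧ ∀ (k : ℂ → ℂ → ℝ) (C : ℝ), Measurable (Function.uncurry k) → 0 ≤ C →
      (∀ x ∈ D.curve, ∀ y ∈ D.curve, x ≠ y → |k x y| ≤ C * ‖x - y‖ ^ (-b)) → D.IsSchurKernel k (C * M) := by
  obtain ⟨M, hM, h⟩ := D.exists_lintegral_le ha hb0 hb
  refine ⟨M, hM, fun k C hk hC hb => ?_⟩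
  have key : ∀ x ∈ D.curve, ∀ f : ℂ → ℝ, (∀ y ∈ D.curve, x ≠ y → |f y| ≤ C * ‖x - y‖ ^ (-b)) →
      ∫⁻ y, ‖f y‖ₑ ∂D.arcLength ≤ ENNReal.ofReal (C * M) := fun x hx f hf => by
    calc ∫⁻ y, ‖f y‖ₑ ∂D.arcLength
        ≤ ∫⁻ y, ENNReal.ofReal C * ENNReal.ofReal (‖x - y‖ ^ (-b)) ∂D.arcLength := by
          refine lintegral_mono_ae ?_
          filter_upwards [D.ae_mem_curve, ae_ne x] with y hy hyx
          rw [Real.enorm_eq_ofReal_abs, ← ENNReal.ofReal_mul hC]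
          exact ENNReal.ofReal_le_ofReal (hf y hy hyx.symm)
      _ ≤ _ := by
          rw [lintegral_const_mul' _ _ (by simp), ENNReal.ofReal_mul hC]
          gcongr
          exact h x hx
  exact ⟨hk, by positivity, fun x hx => key x hx _ (hb x hx),
    fun y hy => key y hy _ fun x hx hxy => by rw [norm_sub_rev]; exact hb x hx y hy hxy.symm⟩

/-- Weakly singular integral operators whose truncations are continuous are compact. -/
theorem isCompactOperator_of_weaklySingular (ha : 0 < a) {b : ℝ} (hb0 : 0 ≤ b) (hb : b < 1) {C : ℝ}
    (hC : 0 ≤ C) (hk : Measurable (Function.uncurry k)) {T : D.L2 →L[ℂ] D.L2}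
    (hT : D.IsIntegralOperator k T)
    {P : Type*} [PseudoMetricSpace P] [ProperSpace P]
    [SecondCountableTopology P] [Nonempty P] [MeasurableSpace P] [BorelSpace P] {p : ℂ → P}
    (hp : Measurable p) {K : Set P} (hK : IsCompact K) (hpK : ∀ x ∈ D.curve, p x ∈ K)
    {κ : ℝ → P → ℂ → ℝ} (hκ : ∀ η > 0, Continuous (Function.uncurry (κ η)))
    (h1 : ∀ η > 0, ∀ x ∈ D.curve, ∀ y ∈ D.curve, η ≤ ‖x - y‖ → κ η (p x) y = k x y)
    (h2 : ∀ η > 0, η < 1 → ∀ x ∈ D.curve, ∀ y ∈ D.curve,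
      x ≠ y → |k x y - κ η (p x) y| ≤ C * ‖x - y‖ ^ (-b)) :
    IsCompactOperator T := by
  -- The truncation error lives on |x - y| < η; raising the exponent from b to b' gains the factor
  -- η^(b' - b) and keeps an integrable singularity.
  obtain ⟨b', hbb', hb'⟩ := exists_between hb
  obtain ⟨M, hM, hMs⟩ := exists_isSchurKernel (D := D) ha (hb0.trans hbb'.le) hb'
  refine isCompactOperator_of_approx hT fun ε hε => ?_
  obtain ⟨η, hη, hη1, hηε⟩ : ∃ η > 0, η < 1 ∧ C * η ^ (b' - b) * M ≤ ε := by
    have h3 : Tendsto (fun η : ℝ => C * η ^ (b' - b) * M) (𝓝 0) (𝓝 (C * 0 ^ (b' - b) * M)) :=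
      ((((continuous_id.rpow_const fun _ => Or.inr (sub_nonneg.mpr hbb'.le)).const_mul C).mul_const M).tendsto 0 :)
    rw [Real.zero_rpow (sub_pos.mpr hbb').ne', mul_zero, zero_mul] at h3
    obtain ⟨η, h4, h5⟩ := (((h3.mono_left nhdsWithin_le_nhds).eventually (gt_mem_nhds hε)).and
      (Ioo_mem_nhdsGT (zero_lt_one' ℝ))).exists
    exact ⟨η, h5.1, h5.2, h4.le⟩
  obtain ⟨T', hT', hcT'⟩ := isCompactOperator_of_continuous (D := D) (hκ η hη) hp hK hpK
  refine ⟨_, T', hT', hcT', ?_⟩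
  have hm : Measurable (Function.uncurry fun x y => k x y - κ η (p x) y) :=
    hk.sub ((hκ η hη).measurable.comp ((hp.comp measurable_fst).prodMk measurable_snd))
  have h3 := hMs _ (C * η ^ (b' - b)) hm (by positivity) fun x hx y hy hne => by
    by_cases hxy : η ≤ ‖x - y‖
    · simp only [h1 η hη x hx y hy hxy, sub_self, abs_zero]
      positivity
    · push Not at hxy
      refine (h2 η hη hη1 x hx y hy hne).trans ?_
      rw [mul_assoc]
      gcongr
      have h0 : 0 < ‖x - y‖ := norm_pos_iff.mpr (sub_ne_zero.mpr hne)
      calc ‖x - y‖ ^ (-b) = ‖x - y‖ ^ (b' - b) * ‖x - y‖ ^ (-b') := by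
            rw [← Real.rpow_add h0]; congr 1; ring
        _ ≤ _ := by gcongr
  exact ⟨h3.measurable, hε.le, fun x hx => (h3.left x hx).trans (ENNReal.ofReal_le_ofReal hηε),
    fun x hx => (h3.right x hx).trans (ENNReal.ofReal_le_ofReal hηε)⟩

end PlanarDomain

/-! ### Boundedness and compactness of 𝒮 and 𝒦*. -/

theorem Real.abs_log_le_rpow {r R : ℝ} (hr : 0 < r) (hrR : r ≤ R) (hR : 1 ≤ R) :
    |Real.log r| ≤ 2 * R * r ^ (-(1 / 2) : ℝ) := by
  have h1 := Real.log_le_rpow_div hr.le (one_half_pos (α := ℝ))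
  have h2 := Real.log_le_rpow_div (inv_pos.mpr hr).le (one_half_pos (α := ℝ))
  rw [Real.log_inv, Real.inv_rpow hr.le, ← Real.rpow_neg hr.le] at h2
  have h3 : r ^ (1 / 2 : ℝ) = r * r ^ (-(1 / 2) : ℝ) := by
    rw [← Real.rpow_one_add' hr.le (by norm_num)]; norm_num
  have h4 : 0 < r ^ (-(1 / 2) : ℝ) := by positivity
  rw [abs_le]
  constructor
  · have : r ^ (-(1 / 2) : ℝ) ≤ R * r ^ (-(1 / 2) : ℝ) := le_mul_of_one_le_left h4.le hR
    linarith
  · rw [h3] at h1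
    have : r * r ^ (-(1 / 2) : ℝ) ≤ R * r ^ (-(1 / 2) : ℝ) := by gcongr
    linarith

namespace PlanarDomain

variable {a : ℝ} (D : PlanarDomain a)

theorem exists_norm_sub_le : ∃ R : ℝ, 1 ≤ R ∧ ∀ x ∈ D.curve, ∀ y ∈ D.curve, ‖x - y‖ ≤ R := by
  obtain ⟨R, hR⟩ := D.isCompact_curve.isBounded.exists_norm_le
  refine ⟨max 1 (R + R), le_max_left _ _, fun x hx y hy => ?_⟩
  exact ((norm_sub_le _ _).trans (add_le_add (hR x hx) (hR y hy))).trans (le_max_right _ _)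

theorem measurable_singleLayerKernel : Measurable (Function.uncurry singleLayerKernel) := by
  unfold singleLayerKernel
  exact (Real.measurable_log.comp (measurable_fst.sub measurable_snd).norm).const_mul _

theorem exists_singleLayerKernel_le : ∃ C : ℝ, 0 ≤ C ∧ ∀ x ∈ D.curve, ∀ y ∈ D.curve, x ≠ y →
    |Real.log ‖x - y‖| ≤ C * ‖x - y‖ ^ (-(1 / 2) : ℝ) ∧
    |singleLayerKernel x y| ≤ C * ‖x - y‖ ^ (-(1 / 2) : ℝ) := by
  obtain ⟨R, hR1, hR⟩ := D.exists_norm_sub_le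
  have hpi : 1 / (2 * Real.pi) ≤ 1 := by
    rw [div_le_one (by positivity)]
    linarith [Real.pi_gt_three]
  refine ⟨2 * R, by positivity, fun x hx y hy hxy => ?_⟩
  have h := Real.abs_log_le_rpow (norm_pos_iff.mpr (sub_ne_zero.mpr hxy)) (hR x hx y hy) hR1
  refine ⟨h, ?_⟩
  rw [singleLayerKernel, abs_mul, abs_of_nonneg (by positivity : 0 ≤ 1 / (2 * Real.pi))]
  exact (mul_le_of_le_one_left (abs_nonneg _) hpi).trans h

theorem isIntegralOperator_singleLayer (ha : 0 < a) :
    D.IsIntegralOperator singleLayerKernel D.singleLayer := by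
  obtain ⟨C, hC, h⟩ := D.exists_singleLayerKernel_le
  obtain ⟨M, hM, hMs⟩ := exists_isSchurKernel (D := D) ha (b := 1 / 2) (by norm_num) (by norm_num)
  exact D.isIntegralOperator_integralOperator
    (hMs _ C measurable_singleLayerKernel hC fun x hx y hy hxy =>
      (h x hx y hy hxy).2).exists_isIntegralOperator

theorem isCompactOperator_singleLayer (ha : 0 < a) : IsCompactOperator D.singleLayer := by
  obtain ⟨C, hC, h⟩ := D.exists_singleLayerKernel_le
  have hpi : 1 / (2 * Real.pi) ≤ 1 := by
    rw [div_le_one (by positivity)]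
    linarith [Real.pi_gt_three]
  refine isCompactOperator_of_weaklySingular ha (b := 1 / 2) (by norm_num) (by norm_num) hC
    measurable_singleLayerKernel (D.isIntegralOperator_singleLayer ha) (p := fun x : ℂ => x)
    measurable_id D.isCompact_curve (fun x hx => hx)
    (κ := fun η x y => 1 / (2 * Real.pi) * Real.log (max ‖x - y‖ η)) ?_ ?_ ?_
  · intro η hη
    refine continuous_const.mul (Continuous.log (by fun_prop) fun p => ?_)
    exact (hη.trans_le (le_max_right _ _)).ne'
  · intro η hη x hx y hy hxy
    simp only [max_eq_left hxy, singleLayerKernel]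
  · intro η hη hη1 x hx y hy hxy
    refine le_trans ?_ (h x hx y hy hxy).1
    have h0 : 0 < ‖x - y‖ := norm_pos_iff.mpr (sub_ne_zero.mpr hxy)
    rw [singleLayerKernel, ← mul_sub, abs_mul, abs_of_nonneg (by positivity : 0 ≤ 1 / (2 * Real.pi))]
    refine (mul_le_of_le_one_left (abs_nonneg _) hpi).trans ?_
    rcases le_total η ‖x - y‖ with h1 | h1
    · rw [max_eq_left h1, sub_self, abs_zero]; positivity
    · rw [max_eq_right h1]
      -- As η < 1, both logarithms are negative, so truncating at η costs at most |log |x - y||.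
      have h2 := Real.log_le_log h0 h1
      have h3 := Real.log_neg hη hη1
      rw [abs_of_nonpos (by linarith), abs_of_nonpos (by linarith)]
      linarith

theorem measurable_npKernel : Measurable (Function.uncurry D.npKernel) := by
  have h : Measurable fun p : ℂ × ℂ => inner ℝ (p.1 - p.2) (D.normal p.1) :=
    (measurable_fst.sub measurable_snd).inner (D.measurable_normal.comp measurable_fst)
  exact (h.div ((measurable_fst.sub measurable_snd).norm.pow_const 2)).const_mul _

theorem exists_npKernel_le (ha : 0 < a) : ∃ C : ℝ, 0 ≤ C ∧ ∀ x ∈ D.curve, ∀ y ∈ D.curve, x ≠ y →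
    |inner ℝ (x - y) (D.normal x)| ≤ C * ‖x - y‖ ^ (1 + a) ∧
    |D.npKernel x y| ≤ C * ‖x - y‖ ^ (-(1 - a)) := by
  obtain ⟨C, hC, h⟩ := D.exists_normal_bound ha
  have hpi : 1 / (2 * Real.pi) ≤ 1 := by
    rw [div_le_one (by positivity)]
    linarith [Real.pi_gt_three]
  have hin : ∀ x y : ℂ, inner ℝ (x - y) (D.normal x) = -(starRingEnd ℂ (y - x) * D.tangent x).im := by
    intro x y
    rw [tangent, Complex.inner]
    simp
    ring
  refine ⟨C, hC.le, fun x hx y hy hxy => ?_⟩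
  have h1 := h x hx y hy
  have h2 : |inner ℝ (x - y) (D.normal x)| ≤ C * ‖x - y‖ ^ (1 + a) := by
    rw [hin, abs_neg, norm_sub_rev]
    exact h1
  have h0 : 0 < ‖x - y‖ := norm_pos_iff.mpr (sub_ne_zero.mpr hxy)
  refine ⟨h2, ?_⟩
  rw [npKernel, abs_mul, abs_of_nonneg (by positivity : 0 ≤ 1 / (2 * Real.pi)), abs_div,
    abs_of_nonneg (by positivity : 0 ≤ ‖x - y‖ ^ 2)]
  refine (mul_le_of_le_one_left (by positivity) hpi).trans ?_
  rw [div_le_iff₀ (by positivity)]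
  refine h2.trans_eq ?_
  rw [mul_assoc, ← Real.rpow_natCast, ← Real.rpow_add h0]
  congr 2
  push_cast
  ring

theorem isIntegralOperator_npOperator (ha : 0 < a) (ha1 : a ≤ 1) :
    D.IsIntegralOperator D.npKernel D.npOperator := by
  obtain ⟨C, hC, h⟩ := D.exists_npKernel_le ha
  obtain ⟨M, hM, hMs⟩ := exists_isSchurKernel (D := D) ha (b := 1 - a) (by linarith) (by linarith)
  exact D.isIntegralOperator_integralOperator
    (hMs _ C D.measurable_npKernel hC fun x hx y hy hxy =>
      (h x hx y hy hxy).2).exists_isIntegralOperator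

theorem isCompactOperator_npOperator (ha : 0 < a) (ha1 : a ≤ 1) : IsCompactOperator D.npOperator := by
  obtain ⟨C, hC, h⟩ := D.exists_npKernel_le ha
  have hpi : 0 < 2 * Real.pi := by positivity
  -- Taking the normal as an extra parameter in the unit disc makes the truncated kernel continuous.
  refine isCompactOperator_of_weaklySingular ha (b := 1 - a) (by linarith) (by linarith) hC
    D.measurable_npKernel (D.isIntegralOperator_npOperator ha ha1) (p := fun x : ℂ => (x, D.normal x))
    (measurable_id.prodMk D.measurable_normal) (D.isCompact_curve.prod (isCompact_closedBall (0 : ℂ) 1))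
    (fun x hx => ⟨hx, by simpa using D.norm_normal_le x⟩)
    (κ := fun η p y => 1 / (2 * Real.pi) * (inner ℝ (p.1 - y) p.2 / (max ‖p.1 - y‖ η) ^ 2)) ?_ ?_ ?_
  · intro η hη
    refine continuous_const.mul (Continuous.div (by fun_prop) (by fun_prop) fun p => ?_)
    exact pow_ne_zero 2 (hη.trans_le (le_max_right _ _)).ne'
  · intro η hη x hx y hy hxy
    simp only [max_eq_left hxy, npKernel]
  · intro η hη hη1 x hx y hy hxy
    refine le_trans ?_ (h x hx y hy hxy).2
    have h0 : 0 < ‖x - y‖ := norm_pos_iff.mpr (sub_ne_zero.mpr hxy)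
    rw [npKernel, ← mul_sub, abs_mul, abs_mul]
    gcongr 1
    rw [div_eq_mul_inv, div_eq_mul_inv, ← mul_sub, abs_mul, abs_mul]
    gcongr 1
    have h1 : (max ‖x - y‖ η ^ 2)⁻¹ ≤ (‖x - y‖ ^ 2)⁻¹ := by
      gcongr
      exact le_max_left _ _
    have h2 : 0 ≤ (max ‖x - y‖ η ^ 2)⁻¹ := by positivity
    rw [abs_of_nonneg (by linarith), abs_of_nonneg (by linarith)]
    linarith

end PlanarDomain

/-! ### The Cauchy-Pompeiu formula and uniqueness for the Cauchy transform. -/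

/-- Twice the Wirtinger derivative `∂/∂z̄`. -/
noncomputable def dbar (g : ℂ → ℝ) (p : ℂ) : ℂ :=
  (fderiv ℝ g p 1 : ℂ) + Complex.I * (fderiv ℝ g p Complex.I : ℂ)

/-- In polar coordinates w is the radial and i w the angular direction; for |w| = 1 the factor conj
w is the phase of the Cauchy kernel. -/
theorem fderiv_mul_dbar (g : ℂ → ℝ) (p w : ℂ) :
    (fderiv ℝ g p w : ℂ) + Complex.I * (fderiv ℝ g p (Complex.I * w) : ℂ) =
      starRingEnd ℂ w * dbar g p := by
  have h1 : w = w.re • (1 : ℂ) + w.im • Complex.I := by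
    rw [Complex.real_smul, Complex.real_smul, mul_one]
    exact (Complex.re_add_im w).symm
  have h2 : Complex.I * w = (-w.im) • (1 : ℂ) + w.re • Complex.I := by
    apply Complex.ext <;> simp
  have h3 : starRingEnd ℂ w = (w.re : ℂ) - w.im * Complex.I := by
    apply Complex.ext <;> simp
  have h4 : fderiv ℝ g p w = w.re * fderiv ℝ g p 1 + w.im * fderiv ℝ g p Complex.I := by
    conv_lhs => rw [h1]
    simp only [map_add, map_smul, smul_eq_mul]
  have h5 : fderiv ℝ g p (Complex.I * w) =
      -w.im * fderiv ℝ g p 1 + w.re * fderiv ℝ g p Complex.I := by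
    rw [h2]
    simp only [map_add, map_smul, smul_eq_mul]
  rw [h4, h5, h3, dbar]
  push_cast
  linear_combination (w.im * fderiv ℝ g p Complex.I : ℂ) * Complex.I_sq

section Pompeiu

variable {g : ℂ → ℝ}

theorem continuous_dbar (hg : ContDiff ℝ 1 g) : Continuous (dbar g) := by
  have := hg.continuous_fderiv one_ne_zero
  unfold dbar
  fun_prop

theorem hasCompactSupport_dbar (hgc : HasCompactSupport g) : HasCompactSupport (dbar g) := by
  refine (hgc.fderiv ℝ).mono fun p hp => ?_
  contrapose! hp
  simp only [Function.mem_support, not_not] at hp ⊢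
  simp [dbar, hp]

theorem integrableOn_polar {E : Type*} [NormedAddCommGroup E] {F : ℝ × ℝ → E} (hF : Continuous F) {R : ℝ}
    (hR : ∀ p : ℝ × ℝ, R < p.1 → F p = 0) :
    IntegrableOn F (Ioi (0 : ℝ) ×ˢ Ioo (-Real.pi) Real.pi) := by
  have h : IntegrableOn F (Icc 0 R ×ˢ Icc (-Real.pi) Real.pi) :=
    hF.continuousOn.integrableOn_compact (isCompact_Icc.prod isCompact_Icc)
  refine IntegrableOn.of_forall_sdiff_eq_zero h (measurableSet_Ioi.prod measurableSet_Ioo) fun p hp => ?_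
  apply hR
  by_contra hcon
  exact hp.2 ⟨⟨(mem_Ioi.mp hp.1.1).le, not_lt.mp hcon⟩, Ioo_subset_Icc_self hp.1.2⟩

/-- The Cauchy-Pompeiu formula for a compactly supported function. -/
theorem integral_dbar_mul_inv (hg : ContDiff ℝ 1 g) (hgc : HasCompactSupport g) (y : ℂ) :
    ∫ w : ℂ, dbar g (y + w) * w⁻¹ = -(2 * Real.pi) * (g y : ℂ) := by
  obtain ⟨R, hR0, hR⟩ : ∃ R > 0, ∀ w : ℂ, R < ‖w‖ → g =ᶠ[𝓝 (y + w)] 0 := by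
    obtain ⟨R', hR'⟩ := hgc.isBounded.exists_norm_le
    refine ⟨max (R' + ‖y‖) 1, by positivity, fun w hw => ?_⟩
    apply notMem_tsupport_iff_eventuallyEq.mp
    intro h
    have h1 := hR' _ h
    have h2 := norm_sub_le (y + w) y
    rw [add_sub_cancel_left] at h2
    have := le_max_left (R' + ‖y‖) 1
    linarith
  set e : ℝ → ℂ := fun θ => (Real.cos θ : ℂ) + Real.sin θ * Complex.I with he
  have hec : Continuous e := by fun_prop
  have hne : ∀ θ, ‖e θ‖ = 1 := fun θ => by
    have := Complex.norm_polarCoord_symm (1, θ)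
    rw [Complex.polarCoord_symm_apply] at this
    simpa only [Complex.ofReal_one, one_mul, abs_one] using this
  have hed : ∀ θ : ℝ, HasDerivAt e (Complex.I * e θ) θ := fun θ => by
    have h1 := (Real.hasDerivAt_cos θ).ofReal_comp
    have h2 := ((Real.hasDerivAt_sin θ).ofReal_comp).mul_const Complex.I
    refine (h1.add h2).congr_deriv ?_
    simp only [he]
    push_cast
    linear_combination (-Complex.sin θ) * Complex.I_sq
  -- Radial and angular derivatives of g. The Jacobian r cancels the singularity of the kernel, so
  -- the integrand becomes F₁ + i F₂.
  set F₁ : ℝ × ℝ → ℝ := fun p => fderiv ℝ g (y + p.1 * e p.2) (e p.2) with hF₁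
  set F₂ : ℝ × ℝ → ℝ := fun p => fderiv ℝ g (y + p.1 * e p.2) (Complex.I * e p.2) with hF₂
  have hfd := hg.continuous_fderiv one_ne_zero
  have hpc : Continuous fun p : ℝ × ℝ => y + p.1 * e p.2 := by fun_prop
  have hF₁c : Continuous F₁ := (hfd.comp hpc).clm_apply (by fun_prop)
  have hF₂c : Continuous F₂ := (hfd.comp hpc).clm_apply (by fun_prop)
  have hz : ∀ p : ℝ × ℝ, R < p.1 → fderiv ℝ g (y + p.1 * e p.2) = 0 := fun p hp => by
    have h1 : R < ‖(p.1 : ℂ) * e p.2‖ := by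
      rw [norm_mul, hne, mul_one, Complex.norm_real, Real.norm_eq_abs]
      exact hp.trans_le (le_abs_self _)
    rw [(hR _ h1).fderiv_eq]
    simp
  have hF₁i := integrableOn_polar hF₁c (R := R) fun p hp => by simp [hF₁, hz p hp]
  have hF₂i := integrableOn_polar hF₂c (R := R) fun p hp => by simp [hF₂, hz p hp]
  have hgd : ∀ p, HasFDerivAt g (fderiv ℝ g p) p := fun p => (hg.differentiable one_ne_zero p).hasFDerivAt
  -- On each ray the radial derivative integrates to -g y.
  have I₁ : ∫ p in Ioi (0 : ℝ) ×ˢ Ioo (-Real.pi) Real.pi, F₁ p = -(2 * Real.pi) * g y := by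
    rw [Measure.volume_eq_prod, ← setIntegral_prod_swap, setIntegral_prod]
    swap
    · rw [Measure.volume_eq_prod] at hF₁i
      exact hF₁i.swap
    have : ∀ θ : ℝ, ∫ r in Ioi (0 : ℝ), F₁ (Prod.swap (θ, r)) = -g y := fun θ => by
      have hd : ∀ r ∈ Ici (0 : ℝ), HasDerivAt (fun r : ℝ => g (y + r * e θ)) (F₁ (Prod.swap (θ, r))) r := fun r _ => by
        have h1 : HasDerivAt (fun r : ℝ => y + r * e θ) (e θ) r := by
          have := ((hasDerivAt_id r).ofReal_comp.mul_const (e θ)).const_add y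
          simpa using this
        exact (hgd _).comp_hasDerivAt r h1
      have hi : IntegrableOn (fun r : ℝ => F₁ (Prod.swap (θ, r))) (Ioi 0) := by
        have h2 : Continuous fun r : ℝ => F₁ (Prod.swap (θ, r)) := hF₁c.comp (by fun_prop)
        refine IntegrableOn.of_forall_sdiff_eq_zero (h2.continuousOn.integrableOn_compact
          (isCompact_Icc (a := (0 : ℝ)) (b := R))) measurableSet_Ioi fun r hr => ?_
        have : R < r := by
          by_contra hcon
          exact hr.2 ⟨(mem_Ioi.mp hr.1).le, not_lt.mp hcon⟩
        simp [hF₁, hz (r, θ) this]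
      have hl : Tendsto (fun r : ℝ => g (y + r * e θ)) atTop (𝓝 0) := by
        refine tendsto_const_nhds.congr' ?_
        filter_upwards [eventually_gt_atTop R] with r hr
        refine ((hR ((r : ℂ) * e θ) ?_).self_of_nhds).symm
        rw [norm_mul, hne, mul_one, Complex.norm_real, Real.norm_eq_abs]
        exact hr.trans_le (le_abs_self _)
      rw [integral_Ioi_of_hasDerivAt_of_tendsto' hd hi hl]
      simp
    simp only [this]
    rw [setIntegral_const, Measure.real, Real.volume_Ioo, ENNReal.toReal_ofReal (by linarith [Real.pi_pos]),
      smul_eq_mul]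
    ring
  -- On each circle the angular derivative integrates to zero.
  have I₂ : ∫ p in Ioi (0 : ℝ) ×ˢ Ioo (-Real.pi) Real.pi, F₂ p = 0 := by
    rw [Measure.volume_eq_prod, setIntegral_prod _ hF₂i]
    refine setIntegral_eq_zero_of_forall_eq_zero fun r hr => ?_
    have hr0 : (0 : ℝ) < r := hr
    rw [← integral_Ioc_eq_integral_Ioo, ← intervalIntegral.integral_of_le (by linarith [Real.pi_pos])]
    have hd : ∀ θ ∈ uIcc (-Real.pi) Real.pi,
        HasDerivAt (fun θ : ℝ => r⁻¹ * g (y + r * e θ)) (F₂ (r, θ)) θ := fun θ _ => by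
      have h1 : HasDerivAt (fun θ : ℝ => y + r * e θ) (r * (Complex.I * e θ)) θ :=
        ((hed θ).const_mul (r : ℂ)).const_add y
      have h2 := ((hgd _).comp_hasDerivAt θ h1).const_mul r⁻¹
      refine h2.congr_deriv ?_
      rw [show (r : ℂ) * (Complex.I * e θ) = r • (Complex.I * e θ) from Complex.real_smul.symm, map_smul,
        smul_eq_mul, inv_mul_cancel_left₀ hr0.ne']
    rw [intervalIntegral.integral_eq_sub_of_hasDerivAt hd
      ((hF₂c.comp (by fun_prop : Continuous fun θ : ℝ => (r, θ))).intervalIntegrable _ _)]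
    simp [he]
  rw [← Complex.integral_comp_polarCoord_symm]
  have key : ∀ p ∈ polarCoord.target, p.1 • (dbar g (y + Complex.polarCoord.symm p) *
      (Complex.polarCoord.symm p)⁻¹) = (F₁ p : ℂ) + Complex.I * (F₂ p : ℂ) := fun p hp => by
    have hp1 : 0 < p.1 := hp.1
    have hp1' : (p.1 : ℂ) ≠ 0 := by exact_mod_cast hp1.ne'
    have h1 : Complex.polarCoord.symm p = p.1 * e p.2 := Complex.polarCoord_symm_apply p
    have h2 : starRingEnd ℂ (e p.2) * e p.2 = 1 := by
      rw [mul_comm, Complex.mul_conj, Complex.normSq_eq_norm_sq, hne]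
      simp
    have h3 : (e p.2)⁻¹ = starRingEnd ℂ (e p.2) := (eq_inv_of_mul_eq_one_left h2).symm
    rw [h1, fderiv_mul_dbar, mul_inv, h3, Complex.real_smul]
    field_simp
  rw [setIntegral_congr_fun polarCoord.open_target.measurableSet key]
  change ∫ p in Ioi (0 : ℝ) ×ˢ Ioo (-Real.pi) Real.pi, ((F₁ p : ℂ) + Complex.I * (F₂ p : ℂ)) = _
  rw [integral_add hF₁i.ofReal (hF₂i.ofReal.const_mul _), integral_const_mul,
    integral_complex_ofReal, integral_complex_ofReal, I₁, I₂]
  push_cast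
  ring

end Pompeiu

theorem integrableOn_ball_inv (R : ℝ) : IntegrableOn (fun w : ℂ => w⁻¹) (Metric.ball 0 R) := by
  refine integrableOn_ball_of_norm_le_rpow (C := 1) (α := 1) (by simp) (by simp) ?_
    (by fun_prop : Measurable fun w : ℂ => w⁻¹).aestronglyMeasurable
  refine Eventually.of_forall fun w => ?_
  rw [norm_inv, one_mul, Real.rpow_neg_one]

/-- A measure on a bounded set is determined by its Cauchy transform. -/
theorem ae_eq_zero_of_cauchyTransform {μ : Measure ℂ} [IsFiniteMeasure μ] {h : ℂ → ℂ}
    (hh : Integrable h μ) {S : Set ℂ} (hS : Bornology.IsBounded S) (hSμ : ∀ᵐ y ∂μ, y ∈ S)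
    (h0 : ∀ᵐ w : ℂ, ∫ y, h y * (y - w)⁻¹ ∂μ = 0) : h =ᵐ[μ] 0 := by
  refine ae_eq_zero_of_integral_contDiff_smul_eq_zero hh.locallyIntegrable fun g hg hgc => ?_
  have hg1 : ContDiff ℝ 1 g := hg.of_le (by norm_cast)
  obtain ⟨R, hR⟩ : ∃ R, ∀ y ∈ S, ∀ w ∈ Function.support (dbar g), w - y ∈ Metric.ball (0 : ℂ) R := by
    obtain ⟨R₁, h1⟩ := hS.exists_norm_le
    obtain ⟨R₂, h2⟩ := (hasCompactSupport_dbar hgc).isBounded.exists_norm_le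
    refine ⟨R₂ + R₁ + 1, fun y hy w hw => ?_⟩
    rw [mem_ball_zero_iff]
    have := norm_sub_le w y
    have := h1 y hy
    have := h2 w (subset_tsupport _ hw)
    linarith
  obtain ⟨B, hB⟩ : ∃ B, ∀ w, ‖dbar g w‖ ≤ B :=
    (hasCompactSupport_dbar hgc).exists_bound_of_continuous (continuous_dbar hg1)
  -- The kernel is not integrable over the plane. Cutting it off to a ball changes nothing on the
  -- support of dbar g and makes Fubini's theorem applicable.
  set ψ : ℂ → ℂ := (Metric.ball (0 : ℂ) R).indicator fun w => w⁻¹ with hψ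
  have hψi : Integrable ψ := (integrable_indicator_iff Metric.isOpen_ball.measurableSet).mpr
    (integrableOn_ball_inv R)
  have hconv : Integrable (fun p : ℂ × ℂ => h p.2 * ψ (p.1 - p.2)) (volume.prod μ) :=
    hh.convolution_integrand (ContinuousLinearMap.mul ℂ ℂ) hψi
  have hint : Integrable (fun p : ℂ × ℂ => dbar g p.1 * (h p.2 * ψ (p.1 - p.2))) (volume.prod μ) :=
    hconv.bdd_mul (c := B) ((continuous_dbar hg1).comp continuous_fst).aestronglyMeasurable
      (Eventually.of_forall fun p => hB p.1)
  have hpsi : ∀ y ∈ S, ∀ w, dbar g w * (h y * ψ (w - y)) = h y * (dbar g w * (w - y)⁻¹) := fun y hy w => by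
    by_cases hw : dbar g w = 0
    · rw [hw]; ring
    · rw [hψ, indicator_of_mem (hR y hy w hw)]; ring
  have e1 : ∀ y, (g y : ℂ) = -(2 * Real.pi : ℂ)⁻¹ * ∫ w : ℂ, dbar g w * (w - y)⁻¹ := fun y => by
    have h1 := integral_dbar_mul_inv hg1 hgc y
    have h2 := integral_add_left_eq_self (μ := (volume : Measure ℂ)) (fun w => dbar g w * (w - y)⁻¹) y
    simp only [add_sub_cancel_left] at h2
    rw [← h2, h1]
    have : (Real.pi : ℂ) ≠ 0 := by exact_mod_cast Real.pi_ne_zero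
    field_simp
  have e2 : ∫ y, g y • h y ∂μ = -(2 * Real.pi : ℂ)⁻¹ * ∫ y, (∫ w : ℂ, dbar g w * (h y * ψ (w - y))) ∂μ := by
    rw [← integral_const_mul]
    refine integral_congr_ae ?_
    filter_upwards [hSμ] with y hy
    simp only [hpsi y hy]
    rw [integral_const_mul, Complex.real_smul, e1]
    ring
  rw [e2, integral_integral_swap (f := fun y w => dbar g w * (h y * ψ (w - y))) hint.swap]
  have e3 : ∀ᵐ w : ℂ, ∫ y, dbar g w * (h y * ψ (w - y)) ∂μ = 0 := by
    filter_upwards [h0] with w hw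
    have : ∫ y, dbar g w * (h y * ψ (w - y)) ∂μ = ∫ y, -dbar g w * (h y * (y - w)⁻¹) ∂μ := by
      refine integral_congr_ae ?_
      filter_upwards [hSμ] with y hy
      rw [hpsi y hy, ← neg_sub y w, inv_neg]
      ring
    rw [this, integral_const_mul, hw, mul_zero]
  rw [integral_congr_ae e3]
  simp

namespace PlanarDomain

variable {a : ℝ} (D : PlanarDomain a)

/-- A C¹ curve has dimension at most 1. So vanishing of the Cauchy transform off the curve is
vanishing almost everywhere in the plane. -/
theorem volume_curve : volume D.curve = 0 := by
  have h : (volume : Measure ℂ) ≪ Measure.hausdorffMeasure (Module.finrank ℝ ℂ : ℝ) :=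
    Measure.absolutelyContinuous_isAddHaarMeasure _ _
  refine measure_zero_of_dimH_lt (d := 2) (by simpa using h) ?_
  refine (ContDiff.dimH_range_le D.contDiff).trans_lt ?_
  simp

/-- A function on the curve whose Cauchy transform vanishes off the curve is zero. -/
theorem ae_eq_zero_of_cauchyTransform {h : ℂ → ℂ} (hh : Integrable h D.arcLength)
    (h0 : ∀ w ∉ D.curve, ∫ y, h y * (y - w)⁻¹ ∂D.arcLength = 0) : h =ᵐ[D.arcLength] 0 := by
  refine _root_.ae_eq_zero_of_cauchyTransform hh D.isCompact_curve.isBounded D.ae_mem_curve ?_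
  filter_upwards [measure_eq_zero_iff_ae_notMem.mp D.volume_curve] with w hw
  exact h0 w hw

end PlanarDomain

/-! ### Hölder functions on the curve and the Cauchy singular integral. -/

namespace PlanarDomain

variable {a : ℝ} (D : PlanarDomain a)

/-- Hölder functions on the curve. -/
structure IsHolder (F : ℂ → ℂ) : Prop where
  measurable : Measurable F
  bound : ∃ β C : ℝ, 0 < β ∧ β ≤ 1 ∧ 0 ≤ C ∧
    ∀ x ∈ D.curve, ∀ y ∈ D.curve, ‖F y - F x‖ ≤ C * ‖y - x‖ ^ β

variable {D} {F H : ℂ → ℂ}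

theorem IsHolder.exists_le (hF : D.IsHolder F) {β : ℝ} (hβ : 0 < β) : ∃ β' C : ℝ, 0 < β' ∧ β' ≤ β ∧
    β' ≤ 1 ∧ 0 ≤ C ∧ ∀ γ, 0 < γ → γ ≤ β' → ∀ x ∈ D.curve, ∀ y ∈ D.curve,
      ‖F y - F x‖ ≤ C * ‖y - x‖ ^ γ := by
  obtain ⟨β₀, C, h0, h1, hC, h⟩ := hF.bound
  obtain ⟨R, hR1, hR⟩ := D.exists_norm_sub_le
  refine ⟨min β₀ β, C * R, by positivity, min_le_right _ _, (min_le_left _ _).trans h1, by positivity,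
    fun γ hγ hγβ x hx y hy => (h x hx y hy).trans ?_⟩
  rw [mul_assoc]
  gcongr
  have hγ0 : 0 ≤ β₀ - γ := sub_nonneg.mpr (hγβ.trans (min_le_left _ _))
  calc ‖y - x‖ ^ β₀ = ‖y - x‖ ^ (β₀ - γ) * ‖y - x‖ ^ γ := by
        rw [← Real.rpow_add' (norm_nonneg _) (by linarith)]
        congr 1; ring
    _ ≤ R ^ (β₀ - γ) * ‖y - x‖ ^ γ := by gcongr; exact hR y hy x hx
    _ ≤ R * ‖y - x‖ ^ γ := by
        gcongr
        calc R ^ (β₀ - γ) ≤ R ^ (1 : ℝ) := Real.rpow_le_rpow_of_exponent_le hR1 (by linarith)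
          _ = R := Real.rpow_one R

theorem IsHolder.exists_common (hF : D.IsHolder F) (hH : D.IsHolder H) : ∃ β C : ℝ, 0 < β ∧ β ≤ 1 ∧
    0 ≤ C ∧ ∀ x ∈ D.curve, ∀ y ∈ D.curve,
      ‖F y - F x‖ ≤ C * ‖y - x‖ ^ β ∧ ‖H y - H x‖ ≤ C * ‖y - x‖ ^ β := by
  obtain ⟨β, C, h0, -, h1, hC, h⟩ := hF.exists_le one_pos
  obtain ⟨β', C', h0', h2, h1', hC', h'⟩ := hH.exists_le h0
  refine ⟨β', max C C', h0', h1', by positivity, fun x hx y hy => ⟨?_, ?_⟩⟩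
  · exact (h β' h0' h2 x hx y hy).trans (by gcongr; exact le_max_left _ _)
  · exact (h' β' h0' le_rfl x hx y hy).trans (by gcongr; exact le_max_right _ _)

theorem IsHolder.exists_norm_le (hF : D.IsHolder F) : ∃ B : ℝ, 0 ≤ B ∧ ∀ x ∈ D.curve, ‖F x‖ ≤ B := by
  obtain ⟨β, C, h0, h1, hC, h⟩ := hF.bound
  obtain ⟨R, hR1, hR⟩ := D.exists_norm_sub_le
  have h0' : D.z 0 ∈ D.curve := ⟨0, rfl⟩
  refine ⟨‖F (D.z 0)‖ + C * R ^ β, by positivity, fun x hx => ?_⟩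
  have h2 := h _ h0' x hx
  have h3 := norm_le_norm_add_norm_sub' (F x) (F (D.z 0))
  have h4 : C * ‖x - D.z 0‖ ^ β ≤ C * R ^ β := by gcongr; exact hR x hx _ h0'
  linarith

theorem IsHolder.add (hF : D.IsHolder F) (hH : D.IsHolder H) : D.IsHolder fun y => F y + H y := by
  obtain ⟨β, C, h0, h1, hC, h⟩ := hF.exists_common hH
  refine ⟨hF.measurable.add hH.measurable, β, 2 * C, h0, h1, by positivity, fun x hx y hy => ?_⟩
  rw [add_sub_add_comm]
  refine (norm_add_le _ _).trans ?_
  linarith [(h x hx y hy).1, (h x hx y hy).2]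

theorem IsHolder.mul (hF : D.IsHolder F) (hH : D.IsHolder H) : D.IsHolder fun y => F y * H y := by
  obtain ⟨β, C, h0, h1, hC, h⟩ := hF.exists_common hH
  obtain ⟨B, hB0, hB⟩ := hF.exists_norm_le
  obtain ⟨B', hB0', hB'⟩ := hH.exists_norm_le
  refine ⟨hF.measurable.mul hH.measurable, β, C * B' + B * C, h0, h1, by positivity, fun x hx y hy => ?_⟩
  rw [show F y * H y - F x * H x = (F y - F x) * H y + F x * (H y - H x) by ring]
  refine (norm_add_le _ _).trans ?_
  rw [norm_mul, norm_mul, add_mul]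
  have hp : 0 ≤ ‖y - x‖ ^ β := by positivity
  refine add_le_add ?_ ?_
  · calc ‖F y - F x‖ * ‖H y‖ ≤ (C * ‖y - x‖ ^ β) * B' := by
          gcongr
          · exact (h x hx y hy).1
          · exact hB' y hy
      _ = _ := by ring
  · calc ‖F x‖ * ‖H y - H x‖ ≤ B * (C * ‖y - x‖ ^ β) := by
          gcongr
          · exact hB x hx
          · exact (h x hx y hy).2
      _ = _ := by ring

theorem IsHolder.star (hF : D.IsHolder F) : D.IsHolder fun y => starRingEnd ℂ (F y) := by
  obtain ⟨β, C, h0, h1, hC, h⟩ := hF.bound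
  refine ⟨Complex.continuous_conj.measurable.comp hF.measurable, β, C, h0, h1, hC, fun x hx y hy => ?_⟩
  rw [← map_sub, RCLike.norm_conj]
  exact h x hx y hy

theorem isHolder_const (c : ℂ) : D.IsHolder fun _ => c :=
  ⟨measurable_const, 1, 0, one_pos, le_rfl, le_rfl, fun x _ y _ => by simp⟩

theorem isHolder_id : D.IsHolder fun y => y :=
  ⟨measurable_id, 1, 1, one_pos, le_rfl, zero_le_one, fun x _ y _ => by simp⟩

theorem IsHolder.const_mul (hF : D.IsHolder F) (c : ℂ) : D.IsHolder fun y => c * F y :=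
  (isHolder_const c).mul hF

theorem IsHolder.sub (hF : D.IsHolder F) (hH : D.IsHolder H) : D.IsHolder fun y => F y - H y := by
  simpa [sub_eq_add_neg] using hF.add (hH.const_mul (-1))

theorem exists_dist_pos {v : ℂ} (hv : v ∉ D.curve) : ∃ δ > 0, ∀ y ∈ D.curve, δ ≤ ‖y - v‖ := by
  obtain ⟨δ, hδ, h⟩ := Metric.mem_nhds_iff.mp (D.isCompact_curve.isClosed.isOpen_compl.mem_nhds hv)
  refine ⟨δ, hδ, fun y hy => ?_⟩
  by_contra hcon
  exact h (by rw [Metric.mem_ball, dist_eq_norm]; exact not_le.mp hcon) hy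

theorem isHolder_inv_sub {v : ℂ} (hv : v ∉ D.curve) : D.IsHolder fun y => (y - v)⁻¹ := by
  obtain ⟨δ, hδ, h⟩ := exists_dist_pos hv
  refine ⟨by fun_prop, 1, δ⁻¹ * δ⁻¹, one_pos, le_rfl, by positivity, fun x hx y hy => ?_⟩
  have hx0 : x - v ≠ 0 := norm_pos_iff.mp (hδ.trans_le (h x hx))
  have hy0 : y - v ≠ 0 := norm_pos_iff.mp (hδ.trans_le (h y hy))
  rw [show (y - v)⁻¹ - (x - v)⁻¹ = (x - v)⁻¹ * (y - v)⁻¹ * (x - y) by field_simp; ring, norm_mul,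
    norm_mul, norm_inv, norm_inv, Real.rpow_one, norm_sub_rev x y]
  gcongr
  · exact h x hx
  · exact h y hy

theorem IsHolder.integrable (hF : D.IsHolder F) : Integrable F D.arcLength := by
  obtain ⟨B, -, hB⟩ := hF.exists_norm_le
  exact Integrable.of_bound hF.measurable.aestronglyMeasurable B
    (D.ae_mem_curve.mono hB)

theorem _root_.MeasureTheory.Integrable.mul_tangent {f : ℂ → ℂ} (hf : Integrable f D.arcLength) :
    Integrable (fun y => f y * D.tangent y) D.arcLength :=
  hf.mul_bdd (c := 1) D.measurable_tangent.aestronglyMeasurable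
    (Eventually.of_forall fun y => D.norm_tangent_le y)

section WeaklySingular

variable {k : ℂ → ℂ → ℂ} {b C : ℝ}

theorem exists_lintegral_weaklySingular_le (ha : 0 < a) (hb0 : 0 ≤ b) (hb : b < 1) (hC : 0 ≤ C)
    (h : ∀ x ∈ D.curve, ∀ y ∈ D.curve, x ≠ y → ‖k x y‖ ≤ C * ‖x - y‖ ^ (-b)) :
    ∃ M : ℝ, 0 ≤ M ∧ ∀ x ∈ D.curve, ∫⁻ y, ‖k x y‖ₑ ∂D.arcLength ≤ ENNReal.ofReal M := by
  obtain ⟨M, hM, hMx⟩ := D.exists_lintegral_le ha hb0 hb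
  refine ⟨C * M, by positivity, fun x hx => ?_⟩
  calc ∫⁻ y, ‖k x y‖ₑ ∂D.arcLength
      ≤ ∫⁻ y, ENNReal.ofReal C * ENNReal.ofReal (‖x - y‖ ^ (-b)) ∂D.arcLength := by
        refine lintegral_mono_ae ?_
        filter_upwards [D.ae_mem_curve, ae_ne x] with y hy hyx
        rw [← ofReal_norm, ← ENNReal.ofReal_mul hC]
        exact ENNReal.ofReal_le_ofReal (h x hx y hy hyx.symm)
    _ ≤ _ := by
        rw [lintegral_const_mul' _ _ (by simp), ENNReal.ofReal_mul hC]
        gcongr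
        exact hMx x hx

theorem integrable_weaklySingular (ha : 0 < a) (hb0 : 0 ≤ b) (hb : b < 1) (hC : 0 ≤ C)
    (hk : Measurable (Function.uncurry k))
    (h : ∀ x ∈ D.curve, ∀ y ∈ D.curve, x ≠ y → ‖k x y‖ ≤ C * ‖x - y‖ ^ (-b)) {x : ℂ} (hx : x ∈ D.curve) :
    Integrable (k x) D.arcLength := by
  obtain ⟨M, -, hM⟩ := exists_lintegral_weaklySingular_le ha hb0 hb hC h
  exact ⟨(hk.comp measurable_prodMk_left).aestronglyMeasurable, (hM x hx).trans_lt (by simp)⟩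

theorem integrable_prod_weaklySingular (ha : 0 < a) (hb0 : 0 ≤ b) (hb : b < 1) (hC : 0 ≤ C)
    (hk : Measurable (Function.uncurry k))
    (h : ∀ x ∈ D.curve, ∀ y ∈ D.curve, x ≠ y → ‖k x y‖ ≤ C * ‖x - y‖ ^ (-b)) :
    Integrable (Function.uncurry k) (D.arcLength.prod D.arcLength) := by
  obtain ⟨M, -, hM⟩ := exists_lintegral_weaklySingular_le ha hb0 hb hC h
  refine ⟨hk.aestronglyMeasurable, ?_⟩
  rw [hasFiniteIntegral_iff_enorm, lintegral_prod _ hk.enorm.aemeasurable]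
  calc ∫⁻ x, ∫⁻ y, ‖k x y‖ₑ ∂D.arcLength ∂D.arcLength ≤ ∫⁻ x, ENNReal.ofReal M ∂D.arcLength := by
        refine lintegral_mono_ae ?_
        filter_upwards [D.ae_mem_curve] with x hx
        exact hM x hx
    _ < ⊤ := by
        rw [lintegral_const]
        exact ENNReal.mul_lt_top (by simp) (measure_lt_top _ _)

end WeaklySingular

theorem ae_prod_mem_curve : ∀ᵐ p : ℂ × ℂ ∂(D.arcLength.prod D.arcLength),
    p.1 ∈ D.curve ∧ p.2 ∈ D.curve ∧ p.2 ≠ p.1 := by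
  have hm : MeasurableSet {p : ℂ × ℂ | p.1 ∈ D.curve ∧ p.2 ∈ D.curve ∧ p.2 ≠ p.1} := by
    have hc := D.isCompact_curve.isClosed.measurableSet
    exact (measurable_fst hc).inter ((measurable_snd hc).inter
      (measurableSet_eq_fun measurable_snd measurable_fst).compl)
  refine (Measure.ae_prod_mem_iff_ae_ae_mem hm).mpr ?_
  filter_upwards [D.ae_mem_curve] with x hx
  filter_upwards [D.ae_mem_curve, ae_ne x] with y hy hyx
  exact ⟨hx, hy, hyx⟩

variable (D)

/-- The difference quotient kernel of `F` for the Cauchy integral. -/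
noncomputable def cauchyDiff (F : ℂ → ℂ) (x y : ℂ) : ℂ := (F y - F x) * (y - x)⁻¹ * D.tangent y

/-- The Cauchy singular integral `F ↦ (πi)⁻¹ p.v. ∫ F(y) (y - x)⁻¹ dy`. -/
noncomputable def cauchyTransform (F : ℂ → ℂ) (x : ℂ) : ℂ :=
  F x + (Real.pi * Complex.I : ℂ)⁻¹ * ∫ y, D.cauchyDiff F x y ∂D.arcLength

variable {D}

theorem measurable_cauchyDiff (hF : Measurable F) : Measurable (Function.uncurry (D.cauchyDiff F)) := by
  have := D.measurable_tangent
  exact (((hF.comp measurable_snd).sub (hF.comp measurable_fst)).mul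
    (measurable_snd.sub measurable_fst).inv).mul (this.comp measurable_snd)

theorem IsHolder.exists_cauchyDiff_le (hF : D.IsHolder F) : ∃ b C : ℝ, 0 ≤ b ∧ b < 1 ∧ 0 ≤ C ∧
    ∀ x ∈ D.curve, ∀ y ∈ D.curve, x ≠ y → ‖D.cauchyDiff F x y‖ ≤ C * ‖x - y‖ ^ (-b) ∧
      ‖F y - F x‖ * ‖x - y‖⁻¹ ≤ C * ‖x - y‖ ^ (-b) := by
  obtain ⟨β, C, h0, h1, hC, h⟩ := hF.bound
  refine ⟨1 - β, C, by linarith, by linarith, hC, fun x hx y hy hxy => ?_⟩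
  have hpos : 0 < ‖x - y‖ := norm_pos_iff.mpr (sub_ne_zero.mpr hxy)
  have key : ‖F y - F x‖ * ‖x - y‖⁻¹ ≤ C * ‖x - y‖ ^ (-(1 - β)) := by
    rw [show -(1 - β) = β - 1 by ring, Real.rpow_sub_one hpos.ne', div_eq_mul_inv, ← mul_assoc]
    gcongr
    rw [norm_sub_rev x y]
    exact h x hx y hy
  refine ⟨le_trans ?_ key, key⟩
  rw [cauchyDiff, norm_mul, norm_mul, norm_inv, norm_sub_rev y x]
  exact mul_le_of_le_one_right (by positivity) (D.norm_tangent_le y)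

theorem IsHolder.integrable_cauchyDiff (hF : D.IsHolder F) (ha : 0 < a) {x : ℂ} (hx : x ∈ D.curve) :
    Integrable (D.cauchyDiff F x) D.arcLength := by
  obtain ⟨b, C, hb0, hb, hC, h⟩ := hF.exists_cauchyDiff_le
  exact integrable_weaklySingular ha hb0 hb hC (measurable_cauchyDiff hF.measurable)
    (fun x hx y hy hxy => (h x hx y hy hxy).1) hx

theorem measurable_cauchyTransform (hF : Measurable F) : Measurable (D.cauchyTransform F) :=
  hF.add (((measurable_cauchyDiff hF).stronglyMeasurable.integral_prod_right
    (ν := D.arcLength)).measurable.const_mul _)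

theorem IsHolder.exists_cauchyTransform_le (hF : D.IsHolder F) (ha : 0 < a) :
    ∃ B : ℝ, ∀ x ∈ D.curve, ‖D.cauchyTransform F x‖ ≤ B := by
  obtain ⟨b, C, hb0, hb, hC, h⟩ := hF.exists_cauchyDiff_le
  obtain ⟨M, hM, hMx⟩ := exists_lintegral_weaklySingular_le ha hb0 hb hC
    (fun x hx y hy hxy => (h x hx y hy hxy).1)
  obtain ⟨B, hB0, hB⟩ := hF.exists_norm_le
  refine ⟨B + ‖(Real.pi * Complex.I : ℂ)⁻¹‖ * M, fun x hx => ?_⟩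
  refine (norm_add_le _ _).trans (add_le_add (hB x hx) ?_)
  rw [norm_mul]
  gcongr
  rw [← ENNReal.ofReal_le_ofReal_iff hM, ofReal_norm]
  exact (enorm_integral_le_lintegral_enorm _).trans (hMx x hx)

theorem IsHolder.integrable_cauchyTransform (hF : D.IsHolder F) (ha : 0 < a) :
    Integrable (D.cauchyTransform F) D.arcLength := by
  obtain ⟨B, hB⟩ := hF.exists_cauchyTransform_le ha
  exact Integrable.of_bound (measurable_cauchyTransform hF.measurable).aestronglyMeasurable B
    (D.ae_mem_curve.mono hB)

end PlanarDomain

/-! ### Antisymmetry of the Cauchy singular integral. -/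

/-- The regularized Cauchy kernel `conj w / (|w|² + ε²)`. -/
noncomputable def regInv (ε : ℝ) (w : ℂ) : ℂ := starRingEnd ℂ w * (((‖w‖ ^ 2 + ε ^ 2 : ℝ)) : ℂ)⁻¹

theorem regInv_neg (ε : ℝ) (w : ℂ) : regInv ε (-w) = -regInv ε w := by
  simp [regInv]

theorem regInv_zero (w : ℂ) : regInv 0 w = w⁻¹ := by
  rw [regInv, Complex.inv_def w, Complex.normSq_eq_norm_sq]
  simp

theorem norm_regInv_le (ε : ℝ) (w : ℂ) : ‖regInv ε w‖ ≤ ‖w‖⁻¹ := by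
  rcases eq_or_ne w 0 with rfl | hw
  · simp [regInv]
  have h : 0 < ‖w‖ := norm_pos_iff.mpr hw
  have h2 : 0 ≤ ‖w‖ ^ 2 + ε ^ 2 := by positivity
  rw [regInv, norm_mul, RCLike.norm_conj, norm_inv, Complex.norm_real, Real.norm_eq_abs,
    abs_of_nonneg h2, ← div_eq_mul_inv, div_le_iff₀ (by positivity)]
  have : ‖w‖⁻¹ * (‖w‖ ^ 2 + ε ^ 2) = ‖w‖ + ‖w‖⁻¹ * ε ^ 2 := by field_simp
  rw [this]
  have : 0 ≤ ‖w‖⁻¹ * ε ^ 2 := by positivity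
  linarith

theorem continuous_regInv {ε : ℝ} (hε : ε ≠ 0) : Continuous (regInv ε) := by
  refine Complex.continuous_conj.mul (Continuous.inv₀ (by fun_prop) fun w => ?_)
  have : 0 < ‖w‖ ^ 2 + ε ^ 2 := by positivity
  exact_mod_cast this.ne'

theorem tendsto_regInv {w : ℂ} (hw : w ≠ 0) : Tendsto (fun ε => regInv ε w) (𝓝[>] 0) (𝓝 w⁻¹) := by
  rw [← regInv_zero]
  refine ContinuousAt.tendsto ?_ |>.mono_left nhdsWithin_le_nhds
  refine continuousAt_const.mul (ContinuousAt.inv₀ (by fun_prop) ?_)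
  have : 0 < ‖w‖ ^ 2 + (0 : ℝ) ^ 2 := by
    have := norm_pos_iff.mpr hw
    positivity
  exact_mod_cast this.ne'

namespace PlanarDomain

variable {a : ℝ} {D : PlanarDomain a} {F H U : ℂ → ℂ}

theorem integrable_prod_of_bound {f : ℂ × ℂ → ℂ} (hf : Measurable f) {B : ℝ}
    (h : ∀ x ∈ D.curve, ∀ y ∈ D.curve, ‖f (x, y)‖ ≤ B) :
    Integrable f (D.arcLength.prod D.arcLength) :=
  Integrable.of_bound hf.aestronglyMeasurable B
    (ae_prod_mem_curve.mono fun p hp => h p.1 hp.1 p.2 hp.2.1)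

theorem exists_regInv_le {ε : ℝ} (hε : ε ≠ 0) : ∃ B : ℝ, 0 ≤ B ∧ ∀ x ∈ D.curve, ∀ y ∈ D.curve,
    ‖regInv ε (y - x)‖ ≤ B := by
  have hc : ContinuousOn (fun p : ℂ × ℂ => regInv ε (p.2 - p.1)) (D.curve ×ˢ D.curve) :=
    ((continuous_regInv hε).comp (by fun_prop)).continuousOn
  obtain ⟨B, hB⟩ := (D.isCompact_curve.prod D.isCompact_curve).exists_bound_of_continuousOn hc
  exact ⟨max B 0, le_max_right _ _, fun x hx y hy => (hB (x, y) ⟨hx, hy⟩).trans (le_max_left _ _)⟩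

theorem integrable_regInv {ε : ℝ} (hε : ε ≠ 0) {x : ℂ} (hx : x ∈ D.curve) :
    Integrable (fun y => regInv ε (y - x) * D.tangent y) D.arcLength := by
  obtain ⟨B, -, hB⟩ := D.exists_regInv_le hε
  have h : Integrable (fun y => regInv ε (y - x)) D.arcLength :=
    Integrable.of_bound ((continuous_regInv hε).comp (by fun_prop : Continuous fun y => y - x)
      ).aestronglyMeasurable B (D.ae_mem_curve.mono fun y hy => hB x hx y hy)
  exact h.mul_tangent

/-- The real part is the derivative of (1/2) log(|z t - x|² + ε²) along the closed curve. -/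
theorem re_integral_regInv {ε : ℝ} (hε : ε ≠ 0) (x : ℂ) :
    (∫ y, regInv ε (y - x) * D.tangent y ∂D.arcLength).re = 0 := by
  have hcr : Continuous fun y => regInv ε (y - x) := (continuous_regInv hε).comp (by fun_prop)
  rw [D.integral_mul_tangent (g := fun y => regInv ε (y - x)) hcr.measurable]
  have hc : Continuous (fun t => regInv ε (D.z t - x) * deriv D.z t) :=
    (hcr.comp D.continuous_z).mul D.continuous_deriv
  have h1 := Complex.reCLM.intervalIntegral_comp_comm (hc.intervalIntegrable (μ := volume) 0 1)
  simp only [Complex.reCLM_apply] at h1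
  rw [← h1]
  have hd : ∀ t ∈ uIcc (0 : ℝ) 1, HasDerivAt
      (fun t => 1 / 2 * Real.log ((D.z t - x).re * (D.z t - x).re + (D.z t - x).im * (D.z t - x).im + ε ^ 2))
      (regInv ε (D.z t - x) * deriv D.z t).re t := fun t _ => by
    have h2 : HasDerivAt (fun t => (D.z t - x).re) (deriv D.z t).re t :=
      Complex.reCLM.hasFDerivAt.comp_hasDerivAt t ((D.hasDerivAt_z t).sub_const x)
    have h3 : HasDerivAt (fun t => (D.z t - x).im) (deriv D.z t).im t :=
      Complex.imCLM.hasFDerivAt.comp_hasDerivAt t ((D.hasDerivAt_z t).sub_const x)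
    have h4 : (D.z t - x).re * (D.z t - x).re + (D.z t - x).im * (D.z t - x).im + ε ^ 2 ≠ 0 := by
      have : 0 < ε ^ 2 := by positivity
      nlinarith [mul_self_nonneg (D.z t - x).re, mul_self_nonneg (D.z t - x).im]
    have h5 := ((((h2.mul h2).add (h3.mul h3)).add_const (ε ^ 2)).log h4).const_mul (1 / 2)
    refine h5.congr_deriv ?_
    rw [regInv, ← Complex.normSq_eq_norm_sq, Complex.normSq_apply, ← Complex.ofReal_inv]
    simp only [Pi.add_apply, Pi.mul_apply, Complex.mul_re, Complex.mul_im, Complex.conj_re, Complex.conj_im,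
      Complex.ofReal_re, Complex.ofReal_im]
    field_simp
    ring
  rw [intervalIntegral.integral_eq_sub_of_hasDerivAt hd
    ((Complex.continuous_re.comp hc).intervalIntegrable _ _)]
  have := D.periodic 0
  rw [zero_add] at this
  rw [this, sub_self]

/-- Off zero the regularized kernel is the Cauchy kernel times a factor in (0, 1]. -/
theorem abs_im_regInv_le (ε : ℝ) (w τ : ℂ) : |(regInv ε w * τ).im| ≤ |(w⁻¹ * τ).im| := by
  rcases eq_or_ne w 0 with rfl | hw
  · simp [regInv]
  have h : 0 < ‖w‖ := norm_pos_iff.mpr hw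
  have e1 : (regInv ε w * τ).im = (starRingEnd ℂ w * τ).im * (‖w‖ ^ 2 + ε ^ 2)⁻¹ := by
    rw [regInv, ← Complex.ofReal_inv, mul_right_comm, Complex.im_mul_ofReal]
  have e2 : (w⁻¹ * τ).im = (starRingEnd ℂ w * τ).im * (‖w‖ ^ 2)⁻¹ := by
    have := regInv_zero w
    rw [← this, regInv, ← Complex.ofReal_inv, mul_right_comm, Complex.im_mul_ofReal]
    simp
  rw [e1, e2, abs_mul, abs_mul]
  gcongr
  nlinarith [sq_nonneg ε]

theorem exists_im_inv_le (ha : 0 < a) (ha1 : a ≤ 1) : ∃ M : ℝ, ∀ x ∈ D.curve,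
    Integrable (fun y => |((y - x)⁻¹ * D.tangent y).im|) D.arcLength ∧
      ∫ y, |((y - x)⁻¹ * D.tangent y).im| ∂D.arcLength ≤ M := by
  obtain ⟨C, hC, h⟩ := D.exists_npKernel_le ha
  have hm : Measurable (Function.uncurry fun x y : ℂ => ((|((y - x)⁻¹ * D.tangent y).im| : ℝ) : ℂ)) := by
    refine Complex.measurable_ofReal.comp ((Complex.measurable_im.comp ?_).abs)
    exact (measurable_snd.sub measurable_fst).inv.mul (D.measurable_tangent.comp measurable_snd)
  have hb : ∀ x ∈ D.curve, ∀ y ∈ D.curve, x ≠ y →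
      ‖((|((y - x)⁻¹ * D.tangent y).im| : ℝ) : ℂ)‖ ≤ 2 * Real.pi * C * ‖x - y‖ ^ (-(1 - a)) := by
    intro x hx y hy hxy
    have h1 := (h y hy x hx hxy.symm).2
    have hpi := Real.pi_pos
    rw [npKernel_eq, abs_mul, abs_of_nonneg (by positivity : 0 ≤ 1 / (2 * Real.pi)), one_div,
      inv_mul_le_iff₀ (by positivity), norm_sub_rev y x, ← mul_assoc] at h1
    rwa [Complex.norm_real, Real.norm_eq_abs, abs_abs]
  obtain ⟨M, hM, hMx⟩ := exists_lintegral_weaklySingular_le ha (by linarith : 0 ≤ 1 - a) (by linarith)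
    (by positivity) hb
  refine ⟨M, fun x hx => ?_⟩
  have hi := integrable_weaklySingular ha (by linarith : 0 ≤ 1 - a) (by linarith) (by positivity) hm hb hx
  have hi' : Integrable (fun y => |((y - x)⁻¹ * D.tangent y).im|) D.arcLength := by
    simpa using hi.re
  refine ⟨hi', ?_⟩
  rw [← ENNReal.ofReal_le_ofReal_iff hM,
    ofReal_integral_eq_lintegral_ofReal hi' (Eventually.of_forall fun y => abs_nonneg _)]
  refine le_trans (le_of_eq (lintegral_congr fun y => ?_)) (hMx x hx)
  rw [← ofReal_norm, Complex.norm_real, Real.norm_eq_abs, abs_abs]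

/-- The real part vanishes and the imaginary part is dominated by the weakly singular angle kernel.
The Cauchy kernel itself is not integrable, so a bound uniform in ε needs this splitting. -/
theorem exists_norm_integral_regInv_le (ha : 0 < a) (ha1 : a ≤ 1) : ∃ M : ℝ, ∀ ε : ℝ, ε ≠ 0 →
    ∀ x ∈ D.curve, ‖∫ y, regInv ε (y - x) * D.tangent y ∂D.arcLength‖ ≤ M := by
  obtain ⟨M, hM⟩ := D.exists_im_inv_le ha ha1
  refine ⟨M, fun ε hε x hx => ?_⟩
  have h1 := Complex.norm_le_abs_re_add_abs_im (∫ y, regInv ε (y - x) * D.tangent y ∂D.arcLength)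
  rw [D.re_integral_regInv hε, abs_zero, zero_add] at h1
  refine h1.trans (le_trans ?_ (hM x hx).2)
  have h2 := integral_im (D.integrable_regInv hε hx)
  simp only [RCLike.im_eq_complex_im] at h2
  rw [← h2]
  refine (abs_integral_le_integral_abs).trans ?_
  refine integral_mono (D.integrable_regInv hε hx).im.abs (hM x hx).1 fun y => ?_
  exact abs_im_regInv_le ε _ _

/-- The limit is i times the angle π under which the curve is seen from x. -/
theorem tendsto_integral_regInv (ha : 0 < a) (ha1 : a ≤ 1) {x : ℂ} (hx : x ∈ D.curve) :
    Tendsto (fun ε => ∫ y, regInv ε (y - x) * D.tangent y ∂D.arcLength) (𝓝[>] 0)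
      (𝓝 (Real.pi * Complex.I)) := by
  obtain ⟨M, hM⟩ := D.exists_im_inv_le ha ha1
  have hε0 : ∀ᶠ ε : ℝ in 𝓝[>] 0, ε ≠ 0 := by
    filter_upwards [self_mem_nhdsWithin] with ε hε
    exact ne_of_gt hε
  have h1 : Tendsto (fun ε => ∫ y, (regInv ε (y - x) * D.tangent y).im ∂D.arcLength) (𝓝[>] 0)
      (𝓝 (∫ y, ((y - x)⁻¹ * D.tangent y).im ∂D.arcLength)) := by
    refine tendsto_integral_filter_of_dominated_convergence _ ?_ ?_ (hM x hx).1 ?_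
    · filter_upwards [hε0] with ε hε
      exact (D.integrable_regInv hε hx).im.aestronglyMeasurable
    · exact Eventually.of_forall fun ε => Eventually.of_forall fun y => abs_im_regInv_le ε _ _
    · filter_upwards [ae_ne x] with y hy
      exact (Complex.continuous_im.tendsto _).comp
        ((tendsto_regInv (sub_ne_zero.mpr hy)).mul_const _)
  have h2 : ∫ y, ((y - x)⁻¹ * D.tangent y).im ∂D.arcLength = Real.pi := by
    have h3 := D.integral_npKernel ha hx
    simp only [npKernel_eq] at h3
    rw [integral_complex_ofReal, integral_const_mul] at h3
    have h4 : 1 / (2 * Real.pi) * ∫ y, ((y - x)⁻¹ * D.tangent y).im ∂D.arcLength = 1 / 2 := by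
      have := congrArg Complex.re h3
      simpa using this
    have := Real.pi_pos
    rw [one_div, inv_mul_eq_iff_eq_mul₀ (by positivity)] at h4
    linarith
  rw [h2] at h1
  have h5 : Tendsto (fun ε => ((∫ y, (regInv ε (y - x) * D.tangent y).im ∂D.arcLength : ℝ) : ℂ) * Complex.I)
      (𝓝[>] 0) (𝓝 (Real.pi * Complex.I)) :=
    ((Complex.continuous_ofReal.tendsto _).comp h1).mul_const _
  refine h5.congr' ?_
  filter_upwards [hε0] with ε hε
  have h6 := integral_im (D.integrable_regInv hε hx)
  simp only [RCLike.im_eq_complex_im] at h6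
  rw [h6]
  apply Complex.ext
  · simp [D.re_integral_regInv hε]
  · simp

/-- The iterated difference quotient integral. -/
theorem IsHolder.integral_cauchyDiff (hU : D.IsHolder U) (ha : 0 < a) (ha1 : a ≤ 1) :
    ∫ x, (∫ y, D.cauchyDiff U x y ∂D.arcLength) * D.tangent x ∂D.arcLength =
      -(2 * Real.pi * Complex.I) * ∫ x, U x * D.tangent x ∂D.arcLength := by
  set σ := D.arcLength with hσ
  set g : ℝ → ℂ × ℂ → ℂ := fun ε p =>
    (U p.2 - U p.1) * regInv ε (p.2 - p.1) * D.tangent p.2 * D.tangent p.1 with hg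
  have hτ := D.measurable_tangent
  have hUm := hU.measurable
  have hε0 : ∀ᶠ ε : ℝ in 𝓝[>] 0, ε ≠ 0 := by
    filter_upwards [self_mem_nhdsWithin] with ε hε
    exact ne_of_gt hε
  obtain ⟨b, C, hb0, hb, hC, hbd⟩ := hU.exists_cauchyDiff_le
  have hI0 : Integrable (Function.uncurry (D.cauchyDiff U)) (σ.prod σ) :=
    integrable_prod_weaklySingular ha hb0 hb hC (measurable_cauchyDiff hUm)
      fun x hx y hy hxy => (hbd x hx y hy hxy).1
  have hI1 : Integrable (fun p : ℂ × ℂ => D.cauchyDiff U p.1 p.2 * D.tangent p.1) (σ.prod σ) :=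
    hI0.mul_bdd (c := 1) (hτ.comp measurable_fst).aestronglyMeasurable
      (Eventually.of_forall fun p => D.norm_tangent_le p.1)
  have hgm : ∀ ε : ℝ, ε ≠ 0 → Measurable (g ε) := fun ε hε =>
    ((((hUm.comp measurable_snd).sub (hUm.comp measurable_fst)).mul
      ((continuous_regInv hε).measurable.comp (measurable_snd.sub measurable_fst))).mul
      (hτ.comp measurable_snd)).mul (hτ.comp measurable_fst)
  have hlim : Tendsto (fun ε => ∫ p, g ε p ∂(σ.prod σ)) (𝓝[>] 0)
      (𝓝 (∫ p, D.cauchyDiff U p.1 p.2 * D.tangent p.1 ∂(σ.prod σ))) := by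
    refine tendsto_integral_filter_of_dominated_convergence
      (fun p => ‖D.cauchyDiff U p.1 p.2 * D.tangent p.1‖) ?_ ?_ hI1.norm ?_
    · filter_upwards [hε0] with ε hε
      exact (hgm ε hε).aestronglyMeasurable
    · refine Eventually.of_forall fun ε => ?_
      refine Eventually.of_forall fun p => ?_
      simp only [hg, cauchyDiff, norm_mul, norm_inv]
      gcongr
      exact norm_regInv_le ε _
    · filter_upwards [ae_prod_mem_curve] with p hp
      exact (((tendsto_regInv (sub_ne_zero.mpr hp.2.2)).const_mul _).mul_const _).mul_const _
  rw [integral_prod _ hI1] at hlim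
  simp only [integral_mul_const] at hlim
  obtain ⟨B, hB0, hB⟩ := hU.exists_norm_le
  obtain ⟨M, hM⟩ := D.exists_norm_integral_regInv_le ha ha1
  have hlim2 : Tendsto (fun ε => -2 * ∫ x, U x * D.tangent x *
      ∫ y, regInv ε (y - x) * D.tangent y ∂σ ∂σ) (𝓝[>] 0)
      (𝓝 (-2 * ∫ x, U x * D.tangent x * (Real.pi * Complex.I) ∂σ)) := by
    refine Tendsto.const_mul _ ?_
    refine tendsto_integral_filter_of_dominated_convergence (fun _ => B * 1 * M) ?_ ?_
      (integrable_const _) ?_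
    · filter_upwards [hε0] with ε hε
      refine ((hUm.mul hτ).mul ?_).aestronglyMeasurable
      refine (StronglyMeasurable.integral_prod_right
        (f := fun x y => regInv ε (y - x) * D.tangent y) ?_).measurable
      exact (((continuous_regInv hε).measurable.comp (measurable_snd.sub measurable_fst)).mul
        (hτ.comp measurable_snd)).stronglyMeasurable
    · filter_upwards [hε0] with ε hε
      filter_upwards [D.ae_mem_curve] with x hx
      rw [norm_mul, norm_mul]
      gcongr
      · exact hB x hx
      · exact D.norm_tangent_le x
      · exact hM ε hε x hx
    · filter_upwards [D.ae_mem_curve] with x hx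
      exact (D.tendsto_integral_regInv ha ha1 hx).const_mul _
  -- The regularized kernel is bounded, so the difference U y - U x may be split; it is odd, so
  -- exchanging x and y makes both halves equal.
  have heq : ∀ ε : ℝ, ε ≠ 0 → ∫ p, g ε p ∂(σ.prod σ) =
      -2 * ∫ x, U x * D.tangent x * ∫ y, regInv ε (y - x) * D.tangent y ∂σ ∂σ := fun ε hε => by
    obtain ⟨B', hB0', hB'⟩ := D.exists_regInv_le hε
    have hfm : Measurable fun p : ℂ × ℂ => U p.1 * D.tangent p.1 * (regInv ε (p.2 - p.1) * D.tangent p.2) :=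
      ((hUm.mul hτ).comp measurable_fst).mul
        (((continuous_regInv hε).measurable.comp (measurable_snd.sub measurable_fst)).mul
        (hτ.comp measurable_snd))
    have hfi : Integrable (fun p : ℂ × ℂ => U p.1 * D.tangent p.1 * (regInv ε (p.2 - p.1) * D.tangent p.2))
        (σ.prod σ) := integrable_prod_of_bound hfm (B := B * 1 * (B' * 1)) fun x hx y hy => by
      simp only [norm_mul]
      gcongr
      · exact hB x hx
      · exact D.norm_tangent_le x
      · exact hB' x hx y hy
      · exact D.norm_tangent_le y
    have e : g ε = fun p => -(U p.swap.1 * D.tangent p.swap.1 * (regInv ε (p.swap.2 - p.swap.1) * D.tangent p.swap.2))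
        - U p.1 * D.tangent p.1 * (regInv ε (p.2 - p.1) * D.tangent p.2) := by
      funext p
      simp only [hg, Prod.fst_swap, Prod.snd_swap]
      rw [← neg_sub p.2 p.1, regInv_neg]
      ring
    have hfi' : Integrable (fun p : ℂ × ℂ => -(U p.swap.1 * D.tangent p.swap.1 *
        (regInv ε (p.swap.2 - p.swap.1) * D.tangent p.swap.2))) (σ.prod σ) := hfi.swap.neg
    rw [e, integral_sub hfi' hfi, integral_neg]
    have hsw := integral_prod_swap (μ := σ) (ν := σ)
      (fun p : ℂ × ℂ => U p.1 * D.tangent p.1 * (regInv ε (p.2 - p.1) * D.tangent p.2))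
    rw [hsw, integral_prod _ hfi]
    simp only [integral_const_mul]
    ring
  have := tendsto_nhds_unique (hlim2.congr' (hε0.mono fun ε hε => (heq ε hε).symm)) hlim
  rw [← this, integral_mul_const]
  ring

/-- The Cauchy singular integral is antisymmetric. -/
theorem IsHolder.integral_cauchyTransform_mul (hF : D.IsHolder F) (hH : D.IsHolder H) (ha : 0 < a)
    (ha1 : a ≤ 1) :
    ∫ x, D.cauchyTransform F x * H x * D.tangent x ∂D.arcLength =
      -∫ x, F x * D.cauchyTransform H x * D.tangent x ∂D.arcLength := by
  set σ := D.arcLength with hσ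
  have hτ := D.measurable_tangent
  have hU := hF.mul hH
  have hI := hU.integral_cauchyDiff ha ha1
  have iF := fun x (hx : x ∈ D.curve) => hF.integrable_cauchyDiff ha hx
  have iH := fun x (hx : x ∈ D.curve) => hH.integrable_cauchyDiff ha hx
  have iU := fun x (hx : x ∈ D.curve) => hU.integrable_cauchyDiff ha hx
  -- W changes sign when x and y are exchanged, so its integral is zero. Expanding the product
  -- expresses it by the difference quotients of FH, F and H, which reduces the claim to
  -- `IsHolder.integral_cauchyDiff` for FH.
  set W : ℂ × ℂ → ℂ := fun p => (F p.2 - F p.1) * (H p.2 - H p.1) * (p.2 - p.1)⁻¹ * D.tangent p.2 * D.tangent p.1 with hW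
  have hWi : Integrable W (σ.prod σ) := by
    obtain ⟨b, C, hb0, hb, hC, hbd⟩ := hF.exists_cauchyDiff_le
    obtain ⟨B, hB0, hB⟩ := hH.exists_norm_le
    refine integrable_prod_weaklySingular (k := fun x y => W (x, y)) (C := 2 * B * C) ha hb0 hb
      (by positivity) ?_ ?_
    · exact ((((((hF.measurable.comp measurable_snd).sub (hF.measurable.comp measurable_fst)).mul
        ((hH.measurable.comp measurable_snd).sub (hH.measurable.comp measurable_fst))).mul
        (measurable_snd.sub measurable_fst).inv).mul (hτ.comp measurable_snd)).mul
        (hτ.comp measurable_fst))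
    · intro x hx y hy hxy
      have h1 : W (x, y) = D.cauchyDiff F x y * ((H y - H x) * D.tangent x) := by
        simp only [hW, cauchyDiff]; ring
      rw [h1, norm_mul, norm_mul]
      calc ‖D.cauchyDiff F x y‖ * (‖H y - H x‖ * ‖D.tangent x‖) ≤
          (C * ‖x - y‖ ^ (-b)) * ((B + B) * 1) := by
            gcongr
            · exact (hbd x hx y hy hxy).1
            · exact (norm_sub_le _ _).trans (add_le_add (hB y hy) (hB x hx))
            · exact D.norm_tangent_le x
        _ = _ := by ring
  have hW0 : ∫ p, W p ∂(σ.prod σ) = 0 := by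
    have h1 := integral_prod_swap (μ := σ) (ν := σ) W
    have h2 : ∀ p : ℂ × ℂ, W p.swap = -W p := fun p => by
      simp only [hW, Prod.fst_swap, Prod.snd_swap]
      rw [← neg_sub p.2 p.1, inv_neg]
      ring
    simp only [h2, integral_neg] at h1
    linear_combination (-1 / 2 : ℂ) * h1
  rw [integral_prod _ hWi] at hW0
  have hpi : (Real.pi * Complex.I : ℂ) ≠ 0 :=
    mul_ne_zero (by exact_mod_cast Real.pi_ne_zero) Complex.I_ne_zero
  have key : ∀ x ∈ D.curve, D.cauchyTransform F x * H x * D.tangent x + F x * D.cauchyTransform H x * D.tangent x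
      = 2 * (F x * H x * D.tangent x) + (Real.pi * Complex.I : ℂ)⁻¹ *
        ((∫ y, D.cauchyDiff (fun y => F y * H y) x y ∂σ) * D.tangent x - ∫ y, W (x, y) ∂σ) := by
    intro x hx
    have e1 : ∀ y, W (x, y) = (D.cauchyDiff (fun y => F y * H y) x y - D.cauchyDiff F x y * H x -
        D.cauchyDiff H x y * F x) * D.tangent x := fun y => by
      simp only [hW, cauchyDiff]; ring
    simp only [e1]
    have iUF : Integrable (fun y => D.cauchyDiff (fun y => F y * H y) x y - D.cauchyDiff F x y * H x) σ :=
      (iU x hx).sub ((iF x hx).mul_const _)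
    rw [integral_mul_const, integral_sub iUF ((iH x hx).mul_const _),
      integral_sub (iU x hx) ((iF x hx).mul_const _), integral_mul_const, integral_mul_const]
    simp only [cauchyTransform]
    ring
  have hCF : Integrable (fun x => D.cauchyTransform F x * H x * D.tangent x) σ := by
    obtain ⟨B, hB0, hB⟩ := hH.exists_norm_le
    exact ((hF.integrable_cauchyTransform ha).mul_bdd (c := B) hH.measurable.aestronglyMeasurable
      (D.ae_mem_curve.mono hB)).mul_tangent
  have hCH : Integrable (fun x => F x * D.cauchyTransform H x * D.tangent x) σ := by
    obtain ⟨B, hB0, hB⟩ := hF.exists_norm_le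
    exact ((hH.integrable_cauchyTransform ha).bdd_mul (c := B) hF.measurable.aestronglyMeasurable
      (D.ae_mem_curve.mono hB)).mul_tangent
  have hUi : Integrable (fun x => F x * H x * D.tangent x) σ := hU.integrable.mul_tangent
  have hdi : Integrable (fun x => (∫ y, D.cauchyDiff (fun y => F y * H y) x y ∂σ) * D.tangent x) σ := by
    have h1 := ((hU.integrable_cauchyTransform ha).sub hU.integrable).mul_tangent.const_mul
      (Real.pi * Complex.I : ℂ)
    refine h1.congr (Eventually.of_forall fun x => ?_)
    simp only [Pi.sub_apply, cauchyTransform]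
    field_simp
    ring
  rw [eq_neg_iff_add_eq_zero, ← integral_add hCF hCH]
  rw [integral_congr_ae (D.ae_mem_curve.mono key)]
  have hdW : Integrable (fun x => (Real.pi * Complex.I : ℂ)⁻¹ *
      ((∫ y, D.cauchyDiff (fun y => F y * H y) x y ∂σ) * D.tangent x - ∫ y, W (x, y) ∂σ)) σ :=
    (hdi.sub hWi.integral_prod_left).const_mul _
  rw [integral_add (hUi.const_mul 2) hdW, integral_const_mul, integral_const_mul]
  rw [integral_sub hdi hWi.integral_prod_left, hI, hW0]
  field_simp
  ring

end PlanarDomain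

/-! ### Eigenfunctions of the Cauchy singular integral; its square. -/

namespace PlanarDomain

variable {a : ℝ} {D : PlanarDomain a} {F H U : ℂ → ℂ}

open Classical in
variable (D) in
/-- `-1` in the domain and `1` outside: the eigenvalue of the Cauchy singular integral on
`y ↦ (y - v)⁻¹`. -/
noncomputable def side (v : ℂ) : ℝ := if v ∈ D.carrier then -1 else 1

theorem side_carrier {v : ℂ} (hv : v ∈ D.carrier) : D.side v = -1 := if_pos hv

theorem side_exterior {v : ℂ} (hv : v ∈ D.exterior) : D.side v = 1 :=
  if_neg fun h => disjoint_left.mp D.disjoint_carrier_exterior h hv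

theorem side_mul_self (v : ℂ) : D.side v * D.side v = 1 := by
  unfold side; split_ifs <;> norm_num

theorem integral_tangent : ∫ y, D.tangent y ∂D.arcLength = 0 := by
  have := D.integral_mul_tangent (g := fun _ => 1) measurable_const
  simp only [one_mul] at this
  rw [this]
  have h := D.isClosedCurve_z.integral_deriv_mul_eq_zero (s := univ) (F := fun z => z) (F' := fun _ => 1)
    (fun _ _ => mem_univ _) (fun z _ => hasDerivAt_id z) continuousOn_const
  simpa using h

theorem pi_I_ne_zero : (Real.pi * Complex.I : ℂ) ≠ 0 :=
  mul_ne_zero (by exact_mod_cast Real.pi_ne_zero) Complex.I_ne_zero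

theorem integral_inv_sub_tangent (ha : 0 < a) {v : ℂ} (hv : v ∉ D.curve) :
    ∫ y, (y - v)⁻¹ * D.tangent y ∂D.arcLength = (1 - D.side v) * (Real.pi * Complex.I) := by
  rcases D.mem_carrier_or_mem_exterior hv with h | h
  · rw [D.integral_cauchy_carrier ha h, side_carrier h]; push_cast; ring
  · rw [D.integral_cauchy_exterior ha h, side_exterior h]; push_cast; ring

theorem integral_inv_sub_sq_tangent {v : ℂ} (hv : v ∉ D.curve) :
    ∫ y, (y - v)⁻¹ ^ 2 * D.tangent y ∂D.arcLength = 0 := by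
  rw [D.integral_mul_tangent (g := fun y => (y - v)⁻¹ ^ 2) (by fun_prop)]
  have h := D.isClosedCurve_z.integral_deriv_mul_eq_zero (s := {v}ᶜ) (F := fun z => -(z - v)⁻¹)
    (F' := fun z => (z - v)⁻¹ ^ 2) (fun t _ => fun h => hv ⟨t, h⟩) ?_ ?_
  · simpa only [mul_comm] using h
  · intro z hz
    have hz' : z - v ≠ 0 := sub_ne_zero.mpr hz
    refine (((hasDerivAt_id z).sub_const v).inv hz').neg.congr_deriv ?_
    simp [neg_div]
  · exact ContinuousOn.pow (ContinuousOn.inv₀ (by fun_prop) fun z hz => sub_ne_zero.mpr hz) 2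

theorem cauchyTransform_const (c x : ℂ) : D.cauchyTransform (fun _ => c) x = c := by
  simp [cauchyTransform, cauchyDiff]

theorem cauchyTransform_id (x : ℂ) : D.cauchyTransform (fun y => y) x = x := by
  have : ∫ y, D.cauchyDiff (fun y => y) x y ∂D.arcLength = ∫ y, D.tangent y ∂D.arcLength := by
    refine integral_congr_ae ?_
    filter_upwards [ae_ne x] with y hy
    rw [cauchyDiff, mul_inv_cancel₀ (sub_ne_zero.mpr hy), one_mul]
  rw [cauchyTransform, this, integral_tangent, mul_zero, add_zero]

/-- Partial fractions for the product of the kernels at x and at v. -/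
theorem IsHolder.cauchyTransform_mul_inv_sub (hF : D.IsHolder F) (ha : 0 < a) {v x : ℂ}
    (hv : v ∉ D.curve) (hx : x ∈ D.curve) :
    D.cauchyTransform (fun y => F y * (y - v)⁻¹) x = (x - v)⁻¹ * (D.cauchyTransform F x -
      (Real.pi * Complex.I : ℂ)⁻¹ * ∫ y, F y * (y - v)⁻¹ * D.tangent y ∂D.arcLength) := by
  have hFG : Integrable (fun y => F y * (y - v)⁻¹ * D.tangent y) D.arcLength :=
    (hF.mul (isHolder_inv_sub hv)).integrable.mul_tangent
  have hxv : x - v ≠ 0 := fun h => hv (sub_eq_zero.mp h ▸ hx)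
  have : ∫ y, D.cauchyDiff (fun y => F y * (y - v)⁻¹) x y ∂D.arcLength =
      ∫ y, ((x - v)⁻¹ * D.cauchyDiff F x y - (x - v)⁻¹ * (F y * (y - v)⁻¹ * D.tangent y)) ∂D.arcLength := by
    refine integral_congr_ae ?_
    filter_upwards [ae_ne x, D.ae_mem_curve] with y hy hyc
    have h1 : y - x ≠ 0 := sub_ne_zero.mpr hy
    have h2 : y - v ≠ 0 := fun h => hv (sub_eq_zero.mp h ▸ hyc)
    simp only [cauchyDiff]
    field_simp
    ring
  rw [cauchyTransform, this, integral_sub ((hF.integrable_cauchyDiff ha hx).const_mul _) (hFG.const_mul _),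
    integral_const_mul, integral_const_mul, cauchyTransform]
  ring

theorem cauchyTransform_inv_sub (ha : 0 < a) {v x : ℂ} (hv : v ∉ D.curve) (hx : x ∈ D.curve) :
    D.cauchyTransform (fun y => (y - v)⁻¹) x = D.side v * (x - v)⁻¹ := by
  have h := (isHolder_const (D := D) 1).cauchyTransform_mul_inv_sub ha hv hx
  simp only [one_mul] at h
  rw [h, cauchyTransform_const, integral_inv_sub_tangent ha hv]
  have := pi_I_ne_zero
  field_simp
  ring

theorem cauchyTransform_inv_sub_sq (ha : 0 < a) {v x : ℂ} (hv : v ∉ D.curve) (hx : x ∈ D.curve) :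
    D.cauchyTransform (fun y => (y - v)⁻¹ ^ 2) x = D.side v * (x - v)⁻¹ ^ 2 := by
  have h := (isHolder_inv_sub hv).cauchyTransform_mul_inv_sub ha hv hx
  simp only [← sq] at h
  rw [h, cauchyTransform_inv_sub ha hv hx, integral_inv_sub_sq_tangent hv]
  ring

theorem isHolder_inv_sub_sq {v : ℂ} (hv : v ∉ D.curve) : D.IsHolder fun y => (y - v)⁻¹ ^ 2 := by
  simpa only [sq] using (isHolder_inv_sub hv).mul (isHolder_inv_sub hv)

/-- Antisymmetry moves C onto its eigenfunction (x - v)⁻¹. -/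
theorem IsHolder.integral_cauchyTransform_mul_inv_sub (hF : D.IsHolder F) (ha : 0 < a) (ha1 : a ≤ 1)
    {v : ℂ} (hv : v ∉ D.curve) :
    ∫ x, D.cauchyTransform F x * (x - v)⁻¹ * D.tangent x ∂D.arcLength =
      -D.side v * ∫ x, F x * (x - v)⁻¹ * D.tangent x ∂D.arcLength := by
  rw [hF.integral_cauchyTransform_mul (isHolder_inv_sub hv) ha ha1, neg_mul, ← integral_const_mul]
  congr 1
  refine integral_congr_ae ?_
  filter_upwards [D.ae_mem_curve] with x hx
  rw [cauchyTransform_inv_sub ha hv hx]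
  ring

theorem IsHolder.integral_cauchyTransform_mul_inv_sub_sq (hF : D.IsHolder F) (ha : 0 < a) (ha1 : a ≤ 1)
    {v : ℂ} (hv : v ∉ D.curve) :
    ∫ x, D.cauchyTransform F x * (x - v)⁻¹ ^ 2 * D.tangent x ∂D.arcLength =
      -D.side v * ∫ x, F x * (x - v)⁻¹ ^ 2 * D.tangent x ∂D.arcLength := by
  rw [hF.integral_cauchyTransform_mul (isHolder_inv_sub_sq hv) ha ha1, neg_mul, ← integral_const_mul]
  congr 1
  refine integral_congr_ae ?_
  filter_upwards [D.ae_mem_curve] with x hx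
  rw [cauchyTransform_inv_sub_sq ha hv hx]
  ring

theorem ae_eq_zero_of_mul_tangent {h : ℂ → ℂ} (hh : Integrable h D.arcLength)
    (h0 : ∀ v ∉ D.curve, ∫ y, h y * (y - v)⁻¹ * D.tangent y ∂D.arcLength = 0) : h =ᵐ[D.arcLength] 0 := by
  have h1 := D.ae_eq_zero_of_cauchyTransform hh.mul_tangent fun v hv => by
    rw [← h0 v hv]
    exact integral_congr_ae (Eventually.of_forall fun y => by ring)
  filter_upwards [h1, D.ae_mem_curve] with y hy hyc
  have h2 : D.tangent y ≠ 0 := by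
    rw [← norm_ne_zero_iff, D.norm_tangent hyc]; exact one_ne_zero
  exact (mul_eq_zero.mp hy).resolve_right h2

theorem integrable_mul_inv_sub_tangent {h : ℂ → ℂ} (hh : Integrable h D.arcLength) {v : ℂ} (hv : v ∉ D.curve) :
    Integrable (fun y => h y * (y - v)⁻¹ * D.tangent y) D.arcLength := by
  obtain ⟨B, -, hB⟩ := (isHolder_inv_sub hv).exists_norm_le
  exact (hh.mul_bdd (c := B) (isHolder_inv_sub hv).measurable.aestronglyMeasurable
    (D.ae_mem_curve.mono hB)).mul_tangent

/-- The Cauchy singular integral is an involution. -/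
theorem IsHolder.cauchyTransform_cauchyTransform (hF : D.IsHolder F) (hCF : D.IsHolder (D.cauchyTransform F))
    (ha : 0 < a) (ha1 : a ≤ 1) :
    D.cauchyTransform (D.cauchyTransform F) =ᵐ[D.arcLength] F := by
  have hi := hCF.integrable_cauchyTransform ha
  -- Tested against (y - v)⁻¹, the transform C multiplies by -`side v` each time, and the square of
  -- that is 1; such tests determine the function.
  have h := D.ae_eq_zero_of_mul_tangent (hi.sub hF.integrable) fun v hv => by
    simp only [Pi.sub_apply, sub_mul]
    rw [integral_sub (integrable_mul_inv_sub_tangent hi hv)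
      (integrable_mul_inv_sub_tangent hF.integrable hv),
      hCF.integral_cauchyTransform_mul_inv_sub ha ha1 hv, hF.integral_cauchyTransform_mul_inv_sub ha ha1 hv]
    have : (D.side v : ℂ) * D.side v = 1 := by exact_mod_cast side_mul_self v
    linear_combination (∫ x, F x * (x - v)⁻¹ * D.tangent x ∂D.arcLength) * this
  filter_upwards [h] with y hy
  exact sub_eq_zero.mp hy

end PlanarDomain

/-! ### Single and double layer potentials. -/

theorem Real.log_one_add_le_rpow {t : ℝ} (ht : 0 ≤ t) : Real.log (1 + t) ≤ 4 * t ^ (1 / 4 : ℝ) := by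
  have h1 : (1 + t) ^ (1 / 4 : ℝ) ≤ 1 + t ^ (1 / 4 : ℝ) := by
    have := Real.rpow_add_le_add_rpow zero_le_one ht (p := 1 / 4) (by norm_num) (by norm_num)
    simpa using this
  have h2 : Real.log (1 + t) = 4 * Real.log ((1 + t) ^ (1 / 4 : ℝ)) := by
    rw [Real.log_rpow (by linarith)]; ring
  have h3 := Real.log_le_sub_one_of_pos (by positivity : 0 < (1 + t) ^ (1 / 4 : ℝ))
  linarith

/-- A Hölder modulus for the logarithm, paid for by weak singularities. The exponent 1/4 leaves
singularities whose square is still integrable along the curve. -/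
theorem Real.abs_log_sub_log_le {r s : ℝ} (hr : 0 < r) (hs : 0 < s) :
    |Real.log r - Real.log s| ≤ 4 * |r - s| ^ (1 / 4 : ℝ) * (r ^ (-(1 / 4) : ℝ) + s ^ (-(1 / 4) : ℝ)) := by
  have key : ∀ {r s : ℝ}, 0 < s → s ≤ r → |Real.log r - Real.log s| ≤
      4 * |r - s| ^ (1 / 4 : ℝ) * s ^ (-(1 / 4) : ℝ) := by
    intro r s hs hsr
    have hr : 0 < r := hs.trans_le hsr
    rw [abs_of_nonneg (sub_nonneg.mpr (Real.log_le_log hs hsr)), ← Real.log_div hr.ne' hs.ne',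
      abs_of_nonneg (sub_nonneg.mpr hsr)]
    have h1 := Real.log_one_add_le_rpow (t := (r - s) / s) (div_nonneg (sub_nonneg.mpr hsr) hs.le)
    rw [Real.div_rpow (sub_nonneg.mpr hsr) hs.le] at h1
    rw [Real.rpow_neg hs.le, mul_assoc, ← div_eq_mul_inv]
    convert! h1 using 2
    field_simp
    ring
  have p1 : 0 ≤ r ^ (-(1 / 4) : ℝ) := by positivity
  have p2 : 0 ≤ s ^ (-(1 / 4) : ℝ) := by positivity
  rcases le_total s r with h | h
  · refine (key hs h).trans ?_
    gcongr
    linarith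
  · rw [abs_sub_comm, abs_sub_comm r s]
    refine (key hr h).trans ?_
    gcongr
    linarith

theorem Real.abs_log_le_rpow_quarter {r R : ℝ} (hr : 0 < r) (hrR : r ≤ R) (hR : 1 ≤ R) :
    |Real.log r| ≤ 8 * R ^ 2 * r ^ (-(1 / 4) : ℝ) := by
  have h1 := Real.abs_log_le_rpow (r := r ^ (1 / 2 : ℝ)) (R := R) (by positivity) ?_ hR
  · rw [Real.log_rpow hr, abs_mul, ← Real.rpow_mul hr.le] at h1
    norm_num at h1 ⊢
    have h2 : R * r ^ (-(1 / 4) : ℝ) ≤ R ^ 2 * r ^ (-(1 / 4) : ℝ) := by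
      gcongr
      nlinarith
    have h3 : 0 ≤ R ^ 2 * r ^ (-(1 / 4) : ℝ) := by positivity
    nlinarith
  · calc r ^ (1 / 2 : ℝ) ≤ R ^ (1 / 2 : ℝ) := by gcongr
      _ ≤ R ^ (1 : ℝ) := Real.rpow_le_rpow_of_exponent_le hR (by norm_num)
      _ = R := Real.rpow_one R

theorem MeasureTheory.Integrable.starRingEnd {α : Type*} {m : MeasurableSpace α} {μ : Measure α} {f : α → ℂ}
    (hf : Integrable f μ) : Integrable (fun x => (_root_.starRingEnd ℂ) (f x)) μ :=
  hf.mono (Complex.continuous_conj.comp_aestronglyMeasurable hf.1) (Eventually.of_forall fun x => by simp)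

namespace PlanarDomain

variable {a : ℝ} {D : PlanarDomain a} {F F' u φ : ℂ → ℂ}

variable (D) in
/-- The single layer potential of a function on the curve. -/
noncomputable def singleLayerFun (φ : ℂ → ℂ) (x : ℂ) : ℂ :=
  ∫ y, (singleLayerKernel x y : ℂ) * φ y ∂D.arcLength

variable (D) in
/-- The double layer potential of a function on the curve. -/
noncomputable def doubleLayerFun (u : ℂ → ℂ) (x : ℂ) : ℂ :=
  ∫ y, (D.npKernel y x : ℂ) * u y ∂D.arcLength

/-- The product is at most the sum of the squares, and the square of the singular factor has the
integrable exponent -1/2. -/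
theorem exists_integral_rpow_mul_le (ha : 0 < a) (hm : Measurable φ) (hφ : MemLp φ 2 D.arcLength) :
    ∃ M : ℝ, 0 ≤ M ∧ ∀ x ∈ D.curve, Integrable (fun y => ‖x - y‖ ^ (-(1 / 4) : ℝ) * ‖φ y‖) D.arcLength ∧
      ∫ y, ‖x - y‖ ^ (-(1 / 4) : ℝ) * ‖φ y‖ ∂D.arcLength ≤ M := by
  obtain ⟨M, hM, h⟩ := D.exists_lintegral_le ha (b := 1 / 2) (by norm_num) (by norm_num)
  have h2 : Integrable (fun y => ‖φ y‖ ^ 2) D.arcLength := hφ.integrable_norm_pow two_ne_zero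
  refine ⟨M + ∫ y, ‖φ y‖ ^ 2 ∂D.arcLength, by positivity, fun x hx => ?_⟩
  have hmx : Measurable fun y : ℂ => ‖x - y‖ ^ (-(1 / 2) : ℝ) := by fun_prop
  have h1 : Integrable (fun y => ‖x - y‖ ^ (-(1 / 2) : ℝ)) D.arcLength :=
    (lintegral_ofReal_ne_top_iff_integrable hmx.aestronglyMeasurable
      (Eventually.of_forall fun t => by positivity)).mp ((h x hx).trans_lt (by simp)).ne
  have h1' : ∫ y, ‖x - y‖ ^ (-(1 / 2) : ℝ) ∂D.arcLength ≤ M := by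
    rw [← ENNReal.ofReal_le_ofReal_iff hM,
      ofReal_integral_eq_lintegral_ofReal h1 (Eventually.of_forall fun y => by positivity)]
    exact h x hx
  have hb : ∀ y, ‖x - y‖ ^ (-(1 / 4) : ℝ) * ‖φ y‖ ≤ ‖x - y‖ ^ (-(1 / 2) : ℝ) + ‖φ y‖ ^ 2 := fun y => by
    have e : ‖x - y‖ ^ (-(1 / 2) : ℝ) = (‖x - y‖ ^ (-(1 / 4) : ℝ)) ^ 2 := by
      rw [← Real.rpow_natCast, ← Real.rpow_mul (norm_nonneg _)]; norm_num
    rw [e]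
    nlinarith [sq_nonneg (‖x - y‖ ^ (-(1 / 4) : ℝ) - ‖φ y‖), sq_nonneg (‖x - y‖ ^ (-(1 / 4) : ℝ)), sq_nonneg ‖φ y‖]
  have hi : Integrable (fun y => ‖x - y‖ ^ (-(1 / 4) : ℝ) * ‖φ y‖) D.arcLength := by
    refine (h1.add h2).mono' ((by fun_prop : Measurable fun y : ℂ => ‖x - y‖ ^ (-(1 / 4) : ℝ)).mul
      hm.norm).aestronglyMeasurable (Eventually.of_forall fun y => ?_)
    rw [Real.norm_eq_abs, abs_of_nonneg (by positivity)]
    exact hb y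
  refine ⟨hi, (integral_mono hi (h1.add h2) hb).trans ?_⟩
  simp only [Pi.add_apply]
  rw [integral_add h1 h2]
  linarith

theorem integrable_singleLayerKernel_mul (ha : 0 < a) (hm : Measurable φ) (hφ : MemLp φ 2 D.arcLength)
    {x : ℂ} (hx : x ∈ D.curve) :
    Integrable (fun y => (singleLayerKernel x y : ℂ) * φ y) D.arcLength := by
  obtain ⟨M, -, hM⟩ := exists_integral_rpow_mul_le ha hm hφ
  obtain ⟨R, hR1, hR⟩ := D.exists_norm_sub_le
  refine ((hM x hx).1.const_mul (8 * R ^ 2)).mono' ?_ ?_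
  · exact ((Complex.measurable_ofReal.comp (measurable_singleLayerKernel.comp
      measurable_prodMk_left)).mul hm).aestronglyMeasurable
  · filter_upwards [ae_ne x, D.ae_mem_curve] with y hy hyc
    have h := Real.abs_log_le_rpow_quarter (norm_pos_iff.mpr (sub_ne_zero.mpr hy.symm)) (hR x hx y hyc) hR1
    have hpi : 1 / (2 * Real.pi) ≤ 1 := by
      rw [div_le_one (by positivity)]
      linarith [Real.pi_gt_three]
    rw [norm_mul, Complex.norm_real, Real.norm_eq_abs, singleLayerKernel, abs_mul,
      abs_of_nonneg (by positivity : 0 ≤ 1 / (2 * Real.pi)), ← mul_assoc]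
    exact mul_le_mul_of_nonneg_right ((mul_le_of_le_one_left (abs_nonneg _) hpi).trans h) (norm_nonneg _)

theorem measurable_singleLayerFun (hm : Measurable φ) : Measurable (D.singleLayerFun φ) :=
  (StronglyMeasurable.integral_prod_right (f := fun x y => (singleLayerKernel x y : ℂ) * φ y)
    ((Complex.measurable_ofReal.comp measurable_singleLayerKernel).mul
      (hm.comp measurable_snd)).stronglyMeasurable).measurable

/-- Potentials of merely square integrable densities are Hölder, so the Cauchy singular integral can
be applied to them. -/
theorem isHolder_singleLayerFun (ha : 0 < a) (hm : Measurable φ) (hφ : MemLp φ 2 D.arcLength) :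
    D.IsHolder (D.singleLayerFun φ) := by
  obtain ⟨M, hM0, hM⟩ := exists_integral_rpow_mul_le ha hm hφ
  refine ⟨measurable_singleLayerFun hm, 1 / 4, 4 * (M + M), by norm_num, by norm_num, by positivity,
    fun x hx x' hx' => ?_⟩
  have i1 := integrable_singleLayerKernel_mul ha hm hφ hx
  have i2 := integrable_singleLayerKernel_mul ha hm hφ hx'
  have hpi : 1 / (2 * Real.pi) ≤ 1 := by
    rw [div_le_one (by positivity)]
    linarith [Real.pi_gt_three]
  rw [singleLayerFun, singleLayerFun, ← integral_sub i2 i1]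
  have hsum : Integrable (fun y => ‖x' - y‖ ^ (-(1 / 4) : ℝ) * ‖φ y‖ + ‖x - y‖ ^ (-(1 / 4) : ℝ) * ‖φ y‖)
    D.arcLength := (hM x' hx').1.add (hM x hx).1
  calc ‖∫ y, ((singleLayerKernel x' y : ℂ) * φ y - (singleLayerKernel x y : ℂ) * φ y) ∂D.arcLength‖
      ≤ ∫ y, 4 * ‖x' - x‖ ^ (1 / 4 : ℝ) *
        (‖x' - y‖ ^ (-(1 / 4) : ℝ) * ‖φ y‖ + ‖x - y‖ ^ (-(1 / 4) : ℝ) * ‖φ y‖) ∂D.arcLength := by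
        refine norm_integral_le_of_norm_le (hsum.const_mul _) ?_
        filter_upwards [ae_ne x, ae_ne x'] with y hy hy'
        have p1 : 0 < ‖x' - y‖ := norm_pos_iff.mpr (sub_ne_zero.mpr hy'.symm)
        have p2 : 0 < ‖x - y‖ := norm_pos_iff.mpr (sub_ne_zero.mpr hy.symm)
        have h1 := Real.abs_log_sub_log_le p1 p2
        have h2 : |‖x' - y‖ - ‖x - y‖| ≤ ‖x' - x‖ := by
          have := abs_norm_sub_norm_le (x' - y) (x - y)
          rwa [sub_sub_sub_cancel_right] at this
        rw [← sub_mul, norm_mul, ← Complex.ofReal_sub, Complex.norm_real, Real.norm_eq_abs,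
          singleLayerKernel, singleLayerKernel, ← mul_sub, abs_mul,
          abs_of_nonneg (by positivity : 0 ≤ 1 / (2 * Real.pi)), ← add_mul, ← mul_assoc]
        refine mul_le_mul_of_nonneg_right ((mul_le_of_le_one_left (abs_nonneg _) hpi).trans (h1.trans ?_))
          (norm_nonneg _)
        gcongr
    _ = 4 * ‖x' - x‖ ^ (1 / 4 : ℝ) * (∫ y, ‖x' - y‖ ^ (-(1 / 4) : ℝ) * ‖φ y‖ ∂D.arcLength +
        ∫ y, ‖x - y‖ ^ (-(1 / 4) : ℝ) * ‖φ y‖ ∂D.arcLength) := by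
        rw [integral_const_mul, integral_add (hM x' hx').1 (hM x hx).1]
    _ ≤ 4 * ‖x' - x‖ ^ (1 / 4 : ℝ) * (M + M) := by
        gcongr
        · exact (hM x' hx').2
        · exact (hM x hx).2
    _ = _ := by ring

/-- The double layer potential in terms of the Cauchy singular integral. -/
theorem integrable_npKernel (ha : 0 < a) (ha1 : a ≤ 1) {x : ℂ} (hx : x ∈ D.curve) :
    Integrable (fun y => (D.npKernel y x : ℂ)) D.arcLength := by
  obtain ⟨C, hC, h⟩ := D.exists_npKernel_le ha
  have hm : Measurable fun p : ℂ × ℂ => D.npKernel p.2 p.1 := by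
    have := D.measurable_npKernel.comp measurable_swap
    exact this
  have hm' : Measurable (Function.uncurry fun x y => (D.npKernel y x : ℂ)) := hm.complex_ofReal
  refine integrable_weaklySingular (k := fun x y => (D.npKernel y x : ℂ)) (b := 1 - a) (C := C) ha
    (by linarith) (by linarith) hC hm' ?_ hx
  intro x hx y hy hxy
  rw [Complex.norm_real, Real.norm_eq_abs, norm_sub_rev]
  exact (h y hy x hx hxy.symm).2

/-- The kernel is the imaginary part of the Cauchy kernel, hence a difference of that kernel and its
conjugate. Writing u y = u x + (u y - u x), the first term contributes u x / 2 by
`integral_npKernel` and the second gives convergent difference quotients. -/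
theorem IsHolder.doubleLayerFun_eq (hu : D.IsHolder u) (ha : 0 < a) (ha1 : a ≤ 1) {x : ℂ} (hx : x ∈ D.curve) :
    D.doubleLayerFun u x = 1 / 4 * (D.cauchyTransform u x +
      starRingEnd ℂ (D.cauchyTransform (fun y => starRingEnd ℂ (u y)) x)) := by
  have hnp := integrable_npKernel ha ha1 hx
  have i1 := hu.integrable_cauchyDiff ha hx
  have i2 := hu.star.integrable_cauchyDiff ha hx
  have i2' : Integrable (fun y => starRingEnd ℂ (D.cauchyDiff (fun y => starRingEnd ℂ (u y)) x y)) D.arcLength :=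
    i2.starRingEnd
  have hpi : (Real.pi : ℂ) ≠ 0 := by exact_mod_cast Real.pi_ne_zero
  have e : ∀ y, (D.npKernel y x : ℂ) * u y = (D.npKernel y x : ℂ) * u x +
      (4 * Real.pi * Complex.I : ℂ)⁻¹ * (D.cauchyDiff u x y -
        starRingEnd ℂ (D.cauchyDiff (fun y => starRingEnd ℂ (u y)) x y)) := fun y => by
    have h1 : (((y - x)⁻¹ * D.tangent y).im : ℂ) = ((y - x)⁻¹ * D.tangent y -
        starRingEnd ℂ ((y - x)⁻¹ * D.tangent y)) / (2 * Complex.I) := by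
      rw [Complex.im_eq_sub_conj]
    have h2 : D.cauchyDiff u x y - starRingEnd ℂ (D.cauchyDiff (fun y => starRingEnd ℂ (u y)) x y) =
        (u y - u x) * ((y - x)⁻¹ * D.tangent y - starRingEnd ℂ ((y - x)⁻¹ * D.tangent y)) := by
      simp only [cauchyDiff, map_mul, map_sub, Complex.conj_conj]
      ring
    rw [h2, npKernel_eq]
    push_cast
    rw [h1]
    field_simp
    ring
  rw [doubleLayerFun]
  simp only [e]
  have i3 : Integrable (fun y => (4 * Real.pi * Complex.I : ℂ)⁻¹ * (D.cauchyDiff u x y -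
        starRingEnd ℂ (D.cauchyDiff (fun y => starRingEnd ℂ (u y)) x y))) D.arcLength :=
    (i1.sub i2').const_mul _
  rw [integral_add (hnp.mul_const _) i3, integral_mul_const, D.integral_npKernel ha hx, integral_const_mul,
    integral_sub i1 i2', integral_conj, cauchyTransform, cauchyTransform]
  simp only [map_add, map_mul, map_inv₀, Complex.conj_conj, Complex.conj_I, Complex.conj_ofReal]
  field_simp
  ring

theorem intervalIntegrable_of_integrable {g : ℂ → ℂ} (hgm : Measurable g) (hg : Integrable g D.arcLength) (t₀ : ℝ) :
    IntervalIntegrable (fun t => (‖deriv D.z t‖ : ℂ) * g (D.z t)) volume t₀ (t₀ + 1) := by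
  have h1 : IntervalIntegrable (fun t => (‖deriv D.z t‖ : ℂ) * g (D.z t)) volume 0 (0 + 1) := by
    rw [zero_add, intervalIntegrable_iff_integrableOn_Ioc_of_le zero_le_one]
    have hm : Measurable fun t => (‖deriv D.z t‖ : ℂ) * g (D.z t) :=
      (Complex.measurable_ofReal.comp D.continuous_deriv.norm.measurable).mul
        (hgm.comp D.continuous_z.measurable)
    refine ⟨hm.aestronglyMeasurable, ?_⟩
    have h2 := hg.2
    rw [hasFiniteIntegral_iff_enorm, D.lintegral_arcLength hgm.enorm] at h2
    rw [hasFiniteIntegral_iff_enorm]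
    refine lt_of_eq_of_lt (lintegral_congr fun t => ?_) h2
    rw [enorm_mul, ← ofReal_norm, Complex.norm_real, norm_norm]
  refine Function.Periodic.intervalIntegrable (T := 1) (fun t => ?_) one_ne_zero h1 _ _
  simp only [D.periodic t, D.periodic_deriv t]

theorem integral_arcLength_shift {g : ℂ → ℂ} (hgm : Measurable g) (t₀ : ℝ) :
    ∫ y, g y ∂D.arcLength = ∫ t in t₀..t₀ + 1, (‖deriv D.z t‖ : ℂ) * g (D.z t) := by
  rw [D.integral_arcLength g hgm]
  have h : Function.Periodic (fun t => (‖deriv D.z t‖ : ℂ) * g (D.z t)) 1 := fun t => by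
    simp only [D.periodic t, D.periodic_deriv t]
  have := h.intervalIntegral_add_eq 0 t₀
  rwa [zero_add] at this

/-- Integration by parts in the single layer potential of a tangential derivative. -/
theorem singleLayerFun_deriv (ha : 0 < a) (hFm : Measurable F) (hF'm : Measurable F')
    (hF : ∀ y ∈ D.curve, HasDerivAt F (F' y) y) {B L : ℝ} (hL0 : 0 ≤ L) (hB : ∀ y ∈ D.curve, ‖F' y‖ ≤ B)
    (hL : ∀ x ∈ D.curve, ∀ y ∈ D.curve, ‖F y - F x‖ ≤ L * ‖y - x‖) {x : ℂ} (hx : x ∈ D.curve) :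
    D.singleLayerFun (fun y => F' y * D.tangent y) x = -(Complex.I / 4) * (D.cauchyTransform F x -
      starRingEnd ℂ (D.cauchyTransform (fun y => starRingEnd ℂ (F y)) x)) := by
  have hFh : D.IsHolder F := ⟨hFm, 1, L, one_pos, le_rfl, hL0, by simpa using hL⟩
  have i1 := hFh.integrable_cauchyDiff ha hx
  have i2 := hFh.star.integrable_cauchyDiff ha hx
  have i2' : Integrable (fun y => starRingEnd ℂ (D.cauchyDiff (fun y => starRingEnd ℂ (F y)) x y)) D.arcLength :=
    i2.starRingEnd
  have hB0 : 0 ≤ B := (norm_nonneg _).trans (hB x hx)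
  have hφm : Measurable fun y => F' y * D.tangent y := hF'm.mul D.measurable_tangent
  have hφ : MemLp (fun y => F' y * D.tangent y) 2 D.arcLength := by
    refine MemLp.of_bound hφm.aestronglyMeasurable (B * 1) ?_
    filter_upwards [D.ae_mem_curve] with y hy
    rw [norm_mul]
    gcongr
    · exact hB y hy
    · exact D.norm_tangent_le y
  have i3 := integrable_singleLayerKernel_mul ha hφm hφ hx
  -- The derivative along arc length of log |y - x| (F y - F x).
  set g : ℂ → ℂ := fun y => 1 / 2 * (D.cauchyDiff F x y + starRingEnd ℂ (D.cauchyDiff (fun y => starRingEnd ℂ (F y)) x y)) +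
    2 * Real.pi * ((singleLayerKernel x y : ℂ) * (F' y * D.tangent y)) with hg
  have i12 : Integrable (fun y => 1 / 2 * (D.cauchyDiff F x y +
      starRingEnd ℂ (D.cauchyDiff (fun y => starRingEnd ℂ (F y)) x y))) D.arcLength := (i1.add i2').const_mul _
  have hgi : Integrable g D.arcLength := i12.add (i3.const_mul _)
  have hgm : Measurable g := by
    have m1 : Measurable fun y => D.cauchyDiff F x y := by
      have := Measurable.comp (f := fun y : ℂ => (x, y)) (measurable_cauchyDiff (D := D) hFm) (by fun_prop)
      exact this
    have m2 : Measurable fun y => D.cauchyDiff (fun y => starRingEnd ℂ (F y)) x y := by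
      have := Measurable.comp (f := fun y : ℂ => (x, y))
        (measurable_cauchyDiff (D := D) hFh.star.measurable) (by fun_prop)
      exact this
    have m3' : Measurable fun y => singleLayerKernel x y := by
      have := Measurable.comp (f := fun y : ℂ => (x, y)) measurable_singleLayerKernel (by fun_prop)
      exact this
    have m3 : Measurable fun y => (singleLayerKernel x y : ℂ) := m3'.complex_ofReal
    have m4 : Measurable fun y => starRingEnd ℂ (D.cauchyDiff (fun y => starRingEnd ℂ (F y)) x y) :=
      Complex.continuous_conj.measurable.comp m2
    have m5 : Measurable fun y => (singleLayerKernel x y : ℂ) * (F' y * D.tangent y) := m3.mul hφm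
    exact ((m1.add m4).const_mul (1 / 2)).add (m5.const_mul (2 * Real.pi : ℂ))
  have hg0 : ∫ y, g y ∂D.arcLength = 0 := by
    obtain ⟨t₀, rfl⟩ := hx
    rw [integral_arcLength_shift hgm t₀]
    -- The factor F - F(x) removes the logarithmic singularity, so f is continuous. Starting the
    -- period at t₀ puts the singular parameters at the endpoints, where f has equal values.
    set f : ℝ → ℂ := fun t => (Real.log ‖D.z t - D.z t₀‖ : ℂ) * (F (D.z t) - F (D.z t₀)) with hf
    have hfb : ∀ t, ‖f t‖ ≤ 2 * L * ‖D.z t - D.z t₀‖ ^ (1 / 2 : ℝ) * max 1 ‖D.z t - D.z t₀‖ := fun t => by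
      rcases eq_or_ne (D.z t) (D.z t₀) with h | h
      · simp only [hf, h, sub_self, mul_zero, norm_zero]
        positivity
      · have hr : 0 < ‖D.z t - D.z t₀‖ := norm_pos_iff.mpr (sub_ne_zero.mpr h)
        have h1 := Real.abs_log_le_rpow hr (le_max_right 1 _) (le_max_left _ _)
        have h2 := hL _ ⟨t₀, rfl⟩ _ ⟨t, rfl⟩
        have h3 : ‖D.z t - D.z t₀‖ ^ (1 / 2 : ℝ) = ‖D.z t - D.z t₀‖ * ‖D.z t - D.z t₀‖ ^ (-(1 / 2) : ℝ) := by
          rw [← Real.rpow_one_add' hr.le (by norm_num)]; norm_num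
        simp only [hf]
        rw [norm_mul, Complex.norm_real, Real.norm_eq_abs, h3]
        calc _ ≤ (2 * max 1 ‖D.z t - D.z t₀‖ * ‖D.z t - D.z t₀‖ ^ (-(1 / 2) : ℝ)) * (L * ‖D.z t - D.z t₀‖) := by
              gcongr
          _ = _ := by ring
    have hfc : Continuous f := by
      rw [continuous_iff_continuousAt]
      intro t
      rcases eq_or_ne (D.z t) (D.z t₀) with h | h
      · have hft : f t = 0 := by simp [hf, h]
        rw [ContinuousAt, hft]
        refine squeeze_zero_norm hfb ?_
        have hz := D.continuous_z
        have hc : Continuous fun t => 2 * L * ‖D.z t - D.z t₀‖ ^ (1 / 2 : ℝ) * max 1 ‖D.z t - D.z t₀‖ := by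
          have : Continuous fun t => ‖D.z t - D.z t₀‖ ^ (1 / 2 : ℝ) :=
            Continuous.rpow_const (by fun_prop) fun _ => Or.inr (by norm_num)
          fun_prop
        have := hc.tendsto t
        simpa [h] using this
      · have hr : ‖D.z t - D.z t₀‖ ≠ 0 := (norm_pos_iff.mpr (sub_ne_zero.mpr h)).ne'
        have hz := D.continuous_z
        refine ContinuousAt.mul ?_ ?_
        · exact Complex.continuous_ofReal.continuousAt.comp
            (ContinuousAt.log (by fun_prop) hr)
        · exact (((hF _ ⟨t, rfl⟩).continuousAt.comp D.continuous_z.continuousAt :)).sub continuousAt_const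
    have hder := integral_eq_of_hasDerivAt_off_countable_of_le f
      (fun t => (‖deriv D.z t‖ : ℂ) * g (D.z t)) (le_add_of_nonneg_right zero_le_one : t₀ ≤ t₀ + 1)
      countable_empty hfc.continuousOn ?_ (intervalIntegrable_of_integrable hgm hgi t₀)
    · rw [hder]
      simp [hf, D.periodic t₀]
    · intro t ht
      have ht' : t ∈ Ioo t₀ (t₀ + 1) := ht.1
      have h : D.z t ≠ D.z t₀ := fun h => by
        have := D.eq_of_z_eq h.symm (by rw [abs_lt]; constructor <;> linarith [ht'.1, ht'.2])
        linarith [ht'.1]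
      have hne : D.z t - D.z t₀ ≠ 0 := sub_ne_zero.mpr h
      have h1 : HasDerivAt (fun t => Real.log ‖D.z t - D.z t₀‖) (deriv D.z t * (D.z t - D.z t₀)⁻¹).re t := by
        have h2 : HasDerivAt (fun t => (D.z t - D.z t₀).re) (deriv D.z t).re t :=
          Complex.reCLM.hasFDerivAt.comp_hasDerivAt t ((D.hasDerivAt_z t).sub_const _)
        have h3 : HasDerivAt (fun t => (D.z t - D.z t₀).im) (deriv D.z t).im t :=
          Complex.imCLM.hasFDerivAt.comp_hasDerivAt t ((D.hasDerivAt_z t).sub_const _)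
        have h4 : (D.z t - D.z t₀).re * (D.z t - D.z t₀).re + (D.z t - D.z t₀).im * (D.z t - D.z t₀).im ≠ 0 := by
          rw [← Complex.normSq_apply]
          exact (Complex.normSq_pos.mpr hne).ne'
        have h5 := (((h2.mul h2).add (h3.mul h3)).log h4).const_mul (1 / 2)
        have h6 : (fun t => Real.log ‖D.z t - D.z t₀‖) = fun t => 1 / 2 * Real.log ((D.z t - D.z t₀).re *
            (D.z t - D.z t₀).re + (D.z t - D.z t₀).im * (D.z t - D.z t₀).im) := by
          funext s
          rw [← Complex.normSq_apply, Complex.normSq_eq_norm_sq, Real.log_pow]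
          push_cast; ring
        rw [h6]
        refine h5.congr_deriv ?_
        rw [Complex.mul_re, Complex.inv_re, Complex.inv_im, Complex.normSq_apply]
        simp only [Pi.add_apply, Pi.mul_apply]
        field_simp
        ring
      have h2 : HasDerivAt (fun t => F (D.z t) - F (D.z t₀)) (F' (D.z t) * deriv D.z t) t :=
        ((hF _ ⟨t, rfl⟩).comp_of_eq t (D.hasDerivAt_z t) rfl).sub_const _
      have h3 := h1.ofReal_comp.mul h2
      refine h3.congr_deriv ?_
      have hn : (‖deriv D.z t‖ : ℂ) ≠ 0 := by simpa using D.regular t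
      have h7 : ((deriv D.z t * (D.z t - D.z t₀)⁻¹).re : ℂ) = (‖deriv D.z t‖ : ℂ) * (1 / 2 *
          (D.tangent (D.z t) * (D.z t - D.z t₀)⁻¹ + starRingEnd ℂ (D.tangent (D.z t) * (D.z t - D.z t₀)⁻¹))) := by
        rw [Complex.re_eq_add_conj, tangent_z]
        simp only [map_mul, map_div₀, Complex.conj_ofReal, map_inv₀]
        field_simp
      have hpi : (Real.pi : ℂ) ≠ 0 := by exact_mod_cast Real.pi_ne_zero
      rw [h7]
      simp only [hg, cauchyDiff, singleLayerKernel, map_mul, map_sub, Complex.conj_conj]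
      rw [norm_sub_rev (D.z t₀), tangent_z]
      push_cast
      simp only [map_div₀, Complex.conj_ofReal, map_inv₀, map_sub]
      field_simp
  have hsum : ∫ y, g y ∂D.arcLength = 1 / 2 * (∫ y, D.cauchyDiff F x y ∂D.arcLength +
      starRingEnd ℂ (∫ y, D.cauchyDiff (fun y => starRingEnd ℂ (F y)) x y ∂D.arcLength)) +
      2 * Real.pi * D.singleLayerFun (fun y => F' y * D.tangent y) x := by
    simp only [hg]
    rw [integral_add i12 (i3.const_mul _), integral_const_mul, integral_const_mul, integral_add i1 i2',
      integral_conj, singleLayerFun]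
  rw [hg0] at hsum
  have hpi : (Real.pi : ℂ) ≠ 0 := by exact_mod_cast Real.pi_ne_zero
  simp only [cauchyTransform, map_add, map_mul, map_inv₀, Complex.conj_conj, Complex.conj_I, Complex.conj_ofReal]
  have hs : D.singleLayerFun (fun y => F' y * D.tangent y) x = -(4 * Real.pi : ℂ)⁻¹ *
      (∫ y, D.cauchyDiff F x y ∂D.arcLength +
      starRingEnd ℂ (∫ y, D.cauchyDiff (fun y => starRingEnd ℂ (F y)) x y ∂D.arcLength)) := by
    field_simp
    linear_combination (-2 : ℂ) * hsum
  rw [hs]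
  field_simp
  ring

end PlanarDomain

/-! ### Dipoles and Cauchy integrals off the curve. -/

namespace PlanarDomain

variable {a : ℝ} {D : PlanarDomain a} {F H u : ℂ → ℂ} {v w x : ℂ}

theorem IsHolder.congr (hF : D.IsHolder F) (hH : Measurable H) (h : EqOn F H D.curve) : D.IsHolder H := by
  obtain ⟨β, C, h0, h1, hC, hb⟩ := hF.bound
  refine ⟨hH, β, C, h0, h1, hC, fun x hx y hy => ?_⟩
  rw [← h hx, ← h hy]
  exact hb x hx y hy

theorem cauchyTransform_congr (h : EqOn F H D.curve) (hx : x ∈ D.curve) :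
    D.cauchyTransform F x = D.cauchyTransform H x := by
  rw [cauchyTransform, cauchyTransform, h hx]
  congr 2
  refine integral_congr_ae ?_
  filter_upwards [D.ae_mem_curve] with y hy
  rw [cauchyDiff, cauchyDiff, h hx, h hy]

theorem cauchyTransform_const_mul (c : ℂ) : D.cauchyTransform (fun y => c * F y) x = c * D.cauchyTransform F x := by
  have : ∀ y, D.cauchyDiff (fun y => c * F y) x y = c * D.cauchyDiff F x y := fun y => by
    simp only [cauchyDiff]; ring
  simp only [cauchyTransform, this]
  rw [integral_const_mul]
  ring

theorem IsHolder.cauchyTransform_add (hF : D.IsHolder F) (hH : D.IsHolder H) (ha : 0 < a) (hx : x ∈ D.curve) :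
    D.cauchyTransform (fun y => F y + H y) x = D.cauchyTransform F x + D.cauchyTransform H x := by
  have : ∀ y, D.cauchyDiff (fun y => F y + H y) x y = D.cauchyDiff F x y + D.cauchyDiff H x y := fun y => by
    simp only [cauchyDiff]; ring
  simp only [cauchyTransform, this]
  rw [integral_add (hF.integrable_cauchyDiff ha hx) (hH.integrable_cauchyDiff ha hx)]
  ring

theorem IsHolder.cauchyTransform_sub (hF : D.IsHolder F) (hH : D.IsHolder H) (ha : 0 < a) (hx : x ∈ D.curve) :
    D.cauchyTransform (fun y => F y - H y) x = D.cauchyTransform F x - D.cauchyTransform H x := by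
  have h := hF.cauchyTransform_add (hH.const_mul (-1)) ha hx
  rw [cauchyTransform_const_mul] at h
  simp only [neg_mul, one_mul, ← sub_eq_add_neg] at h
  exact h

variable (D) in
/-- The tangential derivative of `y ↦ -(y - v)⁻¹`. -/
noncomputable def dipole (v y : ℂ) : ℂ := (y - v)⁻¹ ^ 2 * D.tangent y

theorem measurable_dipole : Measurable (D.dipole v) :=
  (by fun_prop : Measurable fun y : ℂ => (y - v)⁻¹ ^ 2).mul D.measurable_tangent

theorem exists_norm_dipole_le (hv : v ∉ D.curve) : ∃ B : ℝ, 0 ≤ B ∧ ∀ y ∈ D.curve, ‖D.dipole v y‖ ≤ B := by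
  obtain ⟨B, hB0, hB⟩ := (isHolder_inv_sub_sq hv).exists_norm_le
  refine ⟨B, hB0, fun y hy => ?_⟩
  rw [dipole, norm_mul]
  exact (mul_le_of_le_one_right (norm_nonneg _) (D.norm_tangent_le y)).trans (hB y hy)

theorem memLp_dipole (hv : v ∉ D.curve) : MemLp (D.dipole v) 2 D.arcLength := by
  obtain ⟨B, -, hB⟩ := exists_norm_dipole_le hv
  exact MemLp.of_bound measurable_dipole.aestronglyMeasurable B (D.ae_mem_curve.mono hB)

/-- Integration by parts with the primitive -(y - v)⁻¹, followed by the eigenvalue of C on (y -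
v)⁻¹. -/
theorem singleLayerFun_dipole (ha : 0 < a) (hv : v ∉ D.curve) (hx : x ∈ D.curve) :
    D.singleLayerFun (D.dipole v) x = Complex.I / 4 * (D.side v * (x - v)⁻¹ -
      starRingEnd ℂ (D.cauchyTransform (fun y => starRingEnd ℂ ((y - v)⁻¹)) x)) := by
  obtain ⟨B, hB0, hB⟩ := (isHolder_inv_sub_sq hv).exists_norm_le
  obtain ⟨δ, hδ, hd⟩ := exists_dist_pos hv
  have h := singleLayerFun_deriv (D := D) (F := fun y => (-1) * (y - v)⁻¹) (F' := fun y => (y - v)⁻¹ ^ 2) ha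
    (by fun_prop) (by fun_prop) (B := B) (L := δ⁻¹ * δ⁻¹) (fun y hy => ?_) (by positivity) hB
    (fun x hx y hy => ?_) hx
  · rw [cauchyTransform_const_mul, cauchyTransform_inv_sub ha hv hx] at h
    simp only [map_mul, map_neg, map_one] at h
    rw [cauchyTransform_const_mul] at h
    simp only [map_mul, map_neg, map_one] at h
    unfold dipole
    rw [h]
    ring
  · have hne : y - v ≠ 0 := fun h => hv (sub_eq_zero.mp h ▸ hy)
    have := ((hasDerivAt_id y).sub_const v).inv hne
    refine (this.const_mul (-1)).congr_deriv ?_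
    simp only [id]
    field_simp
  · have hx0 : x - v ≠ 0 := norm_pos_iff.mp (hδ.trans_le (hd x hx))
    have hy0 : y - v ≠ 0 := norm_pos_iff.mp (hδ.trans_le (hd y hy))
    have e : -1 * (y - v)⁻¹ - -1 * (x - v)⁻¹ = (y - v)⁻¹ * (x - v)⁻¹ * (y - x) := by
      field_simp; ring
    rw [e, norm_mul, norm_mul, norm_inv, norm_inv]
    gcongr
    · exact hd y hy
    · exact hd x hx

theorem isHolder_singleLayerFun_dipole (ha : 0 < a) (hv : v ∉ D.curve) :
    D.IsHolder (D.singleLayerFun (D.dipole v)) :=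
  isHolder_singleLayerFun ha measurable_dipole (memLp_dipole hv)

theorem conj_singleLayerFun_dipole (ha : 0 < a) (hv : v ∉ D.curve) (hx : x ∈ D.curve) :
    starRingEnd ℂ (D.singleLayerFun (D.dipole v) x) = -(Complex.I / 4) * (D.side v * starRingEnd ℂ ((x - v)⁻¹) -
      D.cauchyTransform (fun y => starRingEnd ℂ ((y - v)⁻¹)) x) := by
  rw [singleLayerFun_dipole ha hv hx]
  simp only [map_mul, map_sub, Complex.conj_conj, map_div₀, Complex.conj_I, Complex.conj_ofReal, map_ofNat]
  ring

/-- The conjugate of the potential of a dipole is an eigenfunction of the Cauchy singular integral. -/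
theorem cauchyTransform_conj_singleLayerFun_dipole (ha : 0 < a) (ha1 : a ≤ 1) (hv : v ∉ D.curve) :
    D.cauchyTransform (fun y => starRingEnd ℂ (D.singleLayerFun (D.dipole v) y)) =ᵐ[D.arcLength]
      fun x => -D.side v * starRingEnd ℂ (D.singleLayerFun (D.dipole v) x) := by
  have hG : D.IsHolder fun y => starRingEnd ℂ ((y - v)⁻¹) := (isHolder_inv_sub hv).star
  have hu := (isHolder_singleLayerFun_dipole ha hv).star
  -- For G = conj (y - v)⁻¹, the transform C G is a combination of G and of a conjugated single
  -- layer potential, hence Hölder. So C may be applied again, and C²G = G.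
  have hCG : D.IsHolder (D.cauchyTransform fun y => starRingEnd ℂ ((y - v)⁻¹)) := by
    refine ((hG.const_mul (D.side v)).sub (hu.const_mul (4 * Complex.I))).congr
      (measurable_cauchyTransform hG.measurable) fun x hx => ?_
    simp only []
    rw [conj_singleLayerFun_dipole ha hv hx]
    linear_combination (D.side v * starRingEnd ℂ ((x - v)⁻¹) -
      D.cauchyTransform (fun y => starRingEnd ℂ ((y - v)⁻¹)) x) * Complex.I_sq
  filter_upwards [hG.cauchyTransform_cauchyTransform hCG ha ha1, D.ae_mem_curve] with x hx hxc
  rw [cauchyTransform_congr (H := fun x => -(Complex.I / 4) * (D.side v * starRingEnd ℂ ((x - v)⁻¹) -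
      D.cauchyTransform (fun y => starRingEnd ℂ ((y - v)⁻¹)) x))
    (fun y hy => conj_singleLayerFun_dipole ha hv hy) hxc, cauchyTransform_const_mul,
    (hG.const_mul (D.side v)).cauchyTransform_sub hCG ha hxc, cauchyTransform_const_mul, hx,
    conj_singleLayerFun_dipole ha hv hxc]
  have hs : (D.side v : ℂ) * D.side v = 1 := by exact_mod_cast D.side_mul_self v
  linear_combination (-(Complex.I / 4) * starRingEnd ℂ ((x - v)⁻¹)) * hs

/-- Dipoles on opposite sides of the curve are orthogonal for the energy. -/
theorem integral_conj_singleLayerFun_dipole_mul_dipole (ha : 0 < a) (ha1 : a ≤ 1) (hv : v ∉ D.curve)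
    (hw : w ∉ D.curve) (h : D.side v ≠ D.side w) :
    ∫ y, starRingEnd ℂ (D.singleLayerFun (D.dipole v) y) * D.dipole w y ∂D.arcLength = 0 := by
  have hu := (isHolder_singleLayerFun_dipole (v := v) ha hv).star
  -- Evaluating C on the first factor gives -`side v`, moving it to the second gives -`side w`; as
  -- these differ, the integral vanishes.
  have h1 := hu.integral_cauchyTransform_mul_inv_sub_sq ha ha1 hw
  have h2 : ∫ x, D.cauchyTransform (fun y => starRingEnd ℂ (D.singleLayerFun (D.dipole v) y)) x *
      (x - w)⁻¹ ^ 2 * D.tangent x ∂D.arcLength = -D.side v *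
      ∫ x, starRingEnd ℂ (D.singleLayerFun (D.dipole v) x) * (x - w)⁻¹ ^ 2 * D.tangent x ∂D.arcLength := by
    rw [← integral_const_mul]
    refine integral_congr_ae ?_
    filter_upwards [cauchyTransform_conj_singleLayerFun_dipole ha ha1 hv] with x hx
    rw [hx]; ring
  simp only [dipole, ← mul_assoc]
  rw [h2] at h1
  have h3 : ((D.side w : ℂ) - D.side v) ≠ 0 := by
    rw [sub_ne_zero]; exact_mod_cast h.symm
  refine (mul_eq_zero.mp ?_).resolve_left h3
  linear_combination h1

/-- In 𝒦 = (C + conj C conj)/4 the conjugated term acts on the potential by its eigenvalue -`side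
v`, while C is moved by antisymmetry to the dipole and gives -`side w`. -/
theorem integral_doubleLayerFun_mul_dipole (ha : 0 < a) (ha1 : a ≤ 1) (hv : v ∉ D.curve) (hw : w ∉ D.curve) :
    ∫ y, D.doubleLayerFun (D.singleLayerFun (D.dipole v)) y * D.dipole w y ∂D.arcLength =
      -(1 / 4) * (D.side v + D.side w) * ∫ y, D.singleLayerFun (D.dipole v) y * D.dipole w y ∂D.arcLength := by
  have hu := isHolder_singleLayerFun_dipole (v := v) ha hv
  have h1 := hu.integral_cauchyTransform_mul_inv_sub_sq ha ha1 hw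
  simp only [dipole, ← mul_assoc]
  set u := D.singleLayerFun (D.dipole v) with hudef
  obtain ⟨B, hB0, hB⟩ := (isHolder_inv_sub_sq hw).exists_norm_le
  have hG : AEStronglyMeasurable (fun y : ℂ => (y - w)⁻¹ ^ 2) D.arcLength :=
    (isHolder_inv_sub_sq hw).measurable.aestronglyMeasurable
  have i1 : Integrable (fun x => D.cauchyTransform u x * (x - w)⁻¹ ^ 2 * D.tangent x) D.arcLength :=
    ((hu.integrable_cauchyTransform ha).mul_bdd (c := B) hG (D.ae_mem_curve.mono hB)).mul_tangent
  have i2 : Integrable (fun x => u x * (x - w)⁻¹ ^ 2 * D.tangent x) D.arcLength :=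
    (hu.integrable.mul_bdd (c := B) hG (D.ae_mem_curve.mono hB)).mul_tangent
  have h2 : ∫ y, D.doubleLayerFun u y * (y - w)⁻¹ ^ 2 * D.tangent y ∂D.arcLength =
      ∫ y, (1 / 4 * (D.cauchyTransform u y * (y - w)⁻¹ ^ 2 * D.tangent y) -
        D.side v / 4 * (u y * (y - w)⁻¹ ^ 2 * D.tangent y)) ∂D.arcLength := by
    refine integral_congr_ae ?_
    filter_upwards [cauchyTransform_conj_singleLayerFun_dipole ha ha1 hv, D.ae_mem_curve] with x hx hxc
    rw [hu.doubleLayerFun_eq ha ha1 hxc, hudef, hx]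
    simp only [map_mul, map_neg, Complex.conj_conj, Complex.conj_ofReal]
    ring
  rw [h2, integral_sub (i1.const_mul _) (i2.const_mul _), integral_const_mul, integral_const_mul, h1]
  ring

variable (D) in
/-- The Cauchy integral of a function on the curve. -/
noncomputable def cauchyIntegral (h : ℂ → ℂ) (v : ℂ) : ℂ := ∫ y, h y * (y - v)⁻¹ * D.tangent y ∂D.arcLength

/-- So orthogonality to all dipoles with poles on one side means that the Cauchy integral is
constant on that side. -/
theorem hasDerivAt_cauchyIntegral {h : ℂ → ℂ} (hh : Integrable h D.arcLength) (hv : v ∉ D.curve) :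
    HasDerivAt (D.cauchyIntegral h) (∫ y, h y * D.dipole v y ∂D.arcLength) v := by
  obtain ⟨δ, hδ, hd⟩ := exists_dist_pos hv
  have := hasDerivAt_integral_mul_inv_sub hh.mul_tangent aestronglyMeasurable_id hδ (D.ae_mem_curve.mono hd)
  simp only [id] at this
  convert! this using 1
  · funext w
    exact integral_congr_ae (Eventually.of_forall fun y => by ring)
  · exact integral_congr_ae (Eventually.of_forall fun y => by simp only [dipole]; ring)

theorem exists_cauchyIntegral_le {h : ℂ → ℂ} (hh : Integrable h D.arcLength) {ε : ℝ} (hε : 0 < ε) :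
    ∃ R : ℝ, ∀ v, R < ‖v‖ → ‖D.cauchyIntegral h v‖ ≤ ε := by
  obtain ⟨R, hR⟩ := D.isCompact_curve.isBounded.exists_norm_le
  set N := ∫ y, ‖h y‖ ∂D.arcLength
  have hN : 0 ≤ N := integral_nonneg fun _ => norm_nonneg _
  refine ⟨R + (N + 1) / ε, fun v hv => ?_⟩
  have hp : 0 < (N + 1) / ε := by positivity
  calc ‖D.cauchyIntegral h v‖ ≤ ∫ y, ((N + 1) / ε)⁻¹ * ‖h y‖ ∂D.arcLength := by
        refine norm_integral_le_of_norm_le (hh.norm.const_mul _) ?_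
        filter_upwards [D.ae_mem_curve] with y hy
        have h1 : (N + 1) / ε ≤ ‖y - v‖ := by
          have := norm_sub_norm_le v y
          rw [norm_sub_rev] at this
          linarith [hR y hy]
        rw [norm_mul, norm_mul, norm_inv, mul_assoc, mul_comm]
        refine mul_le_mul_of_nonneg_right ?_ (norm_nonneg _)
        exact (mul_le_of_le_one_right (by positivity) (D.norm_tangent_le y)).trans (inv_anti₀ hp h1)
    _ = ((N + 1) / ε)⁻¹ * N := integral_const_mul _ _
    _ ≤ ε := by
        rw [inv_div, div_mul_eq_mul_div, div_le_iff₀ (by positivity)]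
        nlinarith

/-- The exterior reaches infinity, where Cauchy integrals tend to zero. -/
theorem cauchyIntegral_eq_zero_of_exterior_const {h : ℂ → ℂ} (hh : Integrable h D.arcLength) {c : ℂ}
    (hc : ∀ v ∈ D.exterior, D.cauchyIntegral h v = c) : ∀ v ∈ D.exterior, D.cauchyIntegral h v = 0 := by
  intro v hv
  rw [hc v hv, ← norm_le_zero_iff]
  refine le_of_forall_pos_le_add fun ε hε => ?_
  obtain ⟨R, hR⟩ := exists_cauchyIntegral_le (D := D) hh hε
  obtain ⟨w, hw, hwR⟩ := D.exists_large_exterior R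
  rw [← hc w hw, zero_add]
  exact hR w hwR

/-- Holomorphic functions are constant on either side if their derivative vanishes there. -/
theorem exists_cauchyIntegral_carrier {h : ℂ → ℂ} (hh : Integrable h D.arcLength)
    (h0 : ∀ v ∈ D.carrier, ∫ y, h y * D.dipole v y ∂D.arcLength = 0) :
    ∃ c, ∀ v ∈ D.carrier, D.cauchyIntegral h v = c := by
  obtain ⟨v₀, hv₀⟩ := D.isConnected.nonempty
  have hd : ∀ v ∈ D.carrier, HasDerivAt (D.cauchyIntegral h) 0 v := fun v hv => by
    rw [← h0 v hv]
    exact hasDerivAt_cauchyIntegral hh (D.carrier_subset hv)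
  exact ⟨_, fun v hv => D.isOpen.is_const_of_deriv_eq_zero D.isConnected.isPreconnected
    (fun v hv => (hd v hv).differentiableAt.differentiableWithinAt) (fun v hv => (hd v hv).deriv) hv hv₀⟩

theorem cauchyIntegral_exterior_eq_zero (ha : 0 < a) {h : ℂ → ℂ} (hh : Integrable h D.arcLength)
    (h0 : ∀ v ∈ D.exterior, ∫ y, h y * D.dipole v y ∂D.arcLength = 0) :
    ∀ v ∈ D.exterior, D.cauchyIntegral h v = 0 := by
  obtain ⟨v₀, hv₀, -⟩ := D.exists_large_exterior 0
  have hd : ∀ v ∈ D.exterior, HasDerivAt (D.cauchyIntegral h) 0 v := fun v hv => by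
    rw [← h0 v hv]
    exact hasDerivAt_cauchyIntegral hh (D.exterior_subset hv)
  exact cauchyIntegral_eq_zero_of_exterior_const hh fun v hv =>
    D.isOpen_exterior.is_const_of_deriv_eq_zero (D.isPreconnected_exterior ha)
    (fun v hv => (hd v hv).differentiableAt.differentiableWithinAt) (fun v hv => (hd v hv).deriv) hv hv₀

theorem cauchyIntegral_const (ha : 0 < a) (hv : v ∉ D.curve) (c : ℂ) :
    D.cauchyIntegral (fun _ => c) v = c * ((1 - D.side v) * (Real.pi * Complex.I)) := by
  rw [cauchyIntegral, ← integral_inv_sub_tangent ha hv, ← integral_const_mul]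
  simp only [mul_assoc]

theorem cauchyIntegral_add {h k : ℂ → ℂ} (hh : Integrable h D.arcLength) (hk : Integrable k D.arcLength)
    (hv : v ∉ D.curve) :
    D.cauchyIntegral (fun y => h y + k y) v = D.cauchyIntegral h v + D.cauchyIntegral k v := by
  rw [cauchyIntegral, cauchyIntegral, cauchyIntegral,
    ← integral_add (integrable_mul_inv_sub_tangent hh hv) (integrable_mul_inv_sub_tangent hk hv)]
  simp only [add_mul]

theorem cauchyIntegral_const_mul {h : ℂ → ℂ} (c : ℂ) :
    D.cauchyIntegral (fun y => c * h y) v = c * D.cauchyIntegral h v := by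
  rw [cauchyIntegral, cauchyIntegral, ← integral_const_mul]
  simp only [mul_assoc]

/-- After subtraction of the constant in the statement, the Cauchy integral vanishes on both sides
and uniqueness applies. -/
theorem ae_eq_const_of_cauchyIntegral (ha : 0 < a) {h : ℂ → ℂ} (hh : Integrable h D.arcLength) {c c' : ℂ}
    (hc : ∀ v ∈ D.carrier, D.cauchyIntegral h v = c) (hc' : ∀ v ∈ D.exterior, D.cauchyIntegral h v = c') :
    h =ᵐ[D.arcLength] fun _ => c / (2 * Real.pi * Complex.I) := by
  have h0 := cauchyIntegral_eq_zero_of_exterior_const hh hc'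
  have hpi := pi_I_ne_zero
  have hi : Integrable (fun y => h y + -(c / (2 * Real.pi * Complex.I))) D.arcLength :=
    hh.add (integrable_const _)
  have := D.ae_eq_zero_of_mul_tangent hi fun v hv => by
    change D.cauchyIntegral (fun y => h y + -(c / (2 * Real.pi * Complex.I))) v = 0
    rw [cauchyIntegral_add hh (integrable_const _) hv, cauchyIntegral_const ha hv]
    rcases D.mem_carrier_or_mem_exterior hv with h | h
    · rw [hc v h, side_carrier h]
      push_cast
      have hpi' : (Real.pi : ℂ) ≠ 0 := by exact_mod_cast Real.pi_ne_zero
      field_simp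
      ring
    · rw [h0 v h, side_exterior h]
      push_cast
      ring
  filter_upwards [this] with y hy
  simpa [add_neg_eq_zero] using hy

end PlanarDomain

/-! ### The algebra of traces: real traces are constant. -/

theorem le_of_forall_pow_le_mul_pow {x M C : ℝ} (hM : 0 ≤ M) (h : ∀ n : ℕ, x ^ n ≤ C * M ^ n) : x ≤ M := by
  by_contra! hlt
  rcases hM.eq_or_lt with rfl | hM
  · have := h 1
    simp only [pow_one, mul_zero] at this
    linarith
  · obtain ⟨n, hn⟩ := pow_unbounded_of_one_lt C ((one_lt_div hM).mpr hlt)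
    rw [div_pow, lt_div_iff₀ (by positivity)] at hn
    exact absurd (h n) (not_le.mpr hn)

/-- A character of an algebra of functions that is bounded for the uniform norm over `K` takes real values
at the functions that are real on `K`. -/
theorem AlgHom.im_eq_zero_of_real {A : Subalgebra ℂ (ℂ → ℂ)} (χ : A →ₐ[ℂ] ℂ) {K : Set ℂ} {C : ℝ}
    (hC : ∀ (F : A) (M : ℝ), (∀ y ∈ K, ‖(F : ℂ → ℂ) y‖ ≤ M) → ‖χ F‖ ≤ C * M) (F : A)
    (hF : ∀ y ∈ K, ((F : ℂ → ℂ) y).im = 0) {M : ℝ} (hM : ∀ y ∈ K, ‖(F : ℂ → ℂ) y‖ ≤ M) :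
    (χ F).im = 0 := by
  -- Applying the bound to powers of F removes the constant C.
  have hle : ∀ (F : A) (M : ℝ), 0 ≤ M → (∀ y ∈ K, ‖(F : ℂ → ℂ) y‖ ≤ M) → ‖χ F‖ ≤ M := fun F M hM0 hM => by
    refine le_of_forall_pow_le_mul_pow (C := C) hM0 fun n => ?_
    rw [← norm_pow, ← map_pow]
    refine hC _ _ fun y hy => ?_
    simp only [SubmonoidClass.coe_pow, Pi.pow_apply, norm_pow]
    exact pow_le_pow_left₀ (norm_nonneg _) (hM y hy) n
  by_contra hne
  set α := (χ F).re
  set β := (χ F).im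
  have hβ : 0 < β ^ 2 := by positivity
  -- With χ F = α + iβ, the element 1 - i s (F - α) has modulus at most √(1 + s²(M + |α|)²) on K,
  -- while χ maps it to 1 + sβ. For s = tβ with small t the term of first order wins unless β = 0.
  have key : ∀ t : ℝ, 0 < t → 2 ≤ t * (M + |α|) ^ 2 := fun t ht => by
    set s := t * β
    have h1 := hle (1 - algebraMap ℂ A (Complex.I * s) * (F - algebraMap ℂ A α))
      (√(1 + s ^ 2 * (M + |α|) ^ 2)) (by positivity) fun y hy => by
        have e : ((1 - algebraMap ℂ A (Complex.I * s) * (F - algebraMap ℂ A α) : A) : ℂ → ℂ) y =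
            (1 : ℝ) + ((-(s * (((F : ℂ → ℂ) y).re - α)) : ℝ) : ℂ) * Complex.I := by
          have h2 : (F : ℂ → ℂ) y = (((F : ℂ → ℂ) y).re : ℂ) := by
            apply Complex.ext <;> simp [hF y hy]
          have h3 : ((1 - algebraMap ℂ A (Complex.I * s) * (F - algebraMap ℂ A α) : A) : ℂ → ℂ) y =
            1 - Complex.I * s * ((F : ℂ → ℂ) y - α) := rfl
          rw [h3]
          nth_rewrite 1 [h2]
          push_cast
          ring
        rw [e, Complex.norm_add_mul_I]
        refine Real.sqrt_le_sqrt ?_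
        have h4 : |((F : ℂ → ℂ) y).re - α| ≤ M + |α| :=
          (abs_sub _ _).trans (add_le_add_left ((Complex.abs_re_le_norm _).trans (hM y hy)) _)
        have h5 : (((F : ℂ → ℂ) y).re - α) ^ 2 ≤ (M + |α|) ^ 2 := by
          rw [← sq_abs]; gcongr
        nlinarith [sq_nonneg s]
    have e : χ (1 - algebraMap ℂ A (Complex.I * s) * (F - algebraMap ℂ A α)) = ((1 + s * β : ℝ) : ℂ) := by
      rw [map_sub, map_mul, map_sub, map_one, AlgHom.commutes, AlgHom.commutes]
      have : χ F = α + β * Complex.I := (Complex.re_add_im _).symm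
      rw [this]
      simp only [Algebra.algebraMap_self, RingHom.id_apply]
      push_cast
      linear_combination -(s * β : ℂ) * Complex.I_sq
    rw [e, Complex.norm_real, Real.norm_eq_abs] at h1
    have h6 : (1 + s * β) ^ 2 ≤ 1 + s ^ 2 * (M + |α|) ^ 2 := by
      rw [← sq_abs, ← Real.sq_sqrt (by positivity : 0 ≤ 1 + s ^ 2 * (M + |α|) ^ 2)]
      gcongr
    have h7 : t * β ^ 2 * (2 + t * β ^ 2) ≤ t * β ^ 2 * (t * (M + |α|) ^ 2) := by
      simp only [s] at h6
      nlinarith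
    have h8 := le_of_mul_le_mul_left h7 (by positivity)
    have : 0 < t * β ^ 2 := by positivity
    linarith
  have h := key (1 / ((M + |α|) ^ 2 + 1)) (by positivity)
  rw [div_mul_eq_mul_div, le_div_iff₀ (by positivity)] at h
  nlinarith [sq_nonneg (M + |α|)]

theorem HasDerivAt.eq_zero_of_im_eq_zero {g : ℂ → ℂ} {g' z : ℂ} (hg : HasDerivAt g g' z)
    (h : ∀ᶠ w in 𝓝 z, (g w).im = 0) : g' = 0 := by
  have h1 := Complex.imCLM.hasFDerivAt.comp z (hg.hasFDerivAt.restrictScalars ℝ)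
  have h2 : HasFDerivAt (fun w => (g w).im) (0 : ℂ →L[ℝ] ℝ) z :=
    (hasFDerivAt_const (0 : ℝ) z).congr_of_eventuallyEq h
  have h3 := h1.unique h2
  have h4 := DFunLike.congr_fun h3 1
  have h5 := DFunLike.congr_fun h3 Complex.I
  simp at h4 h5
  exact Complex.ext h5 h4

namespace PlanarDomain

variable {a : ℝ} {D : PlanarDomain a} {F H u : ℂ → ℂ} {v w x : ℂ} {ε : ℝ}

variable (D) in
/-- Traces of functions that are holomorphic on the side `-ε` of the curve. -/
structure IsTrace (ε : ℝ) (F : ℂ → ℂ) : Prop where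
  isHolder : D.IsHolder F
  cauchyIntegral_eq : ∀ v ∉ D.curve, D.side v = ε → D.cauchyIntegral F v = 0

theorem side_eq_neg (hε : ε * ε = 1) (h : D.side v ≠ ε) : D.side v = -ε :=
  (mul_self_eq_mul_self_iff.mp ((D.side_mul_self v).trans hε.symm)).resolve_left h

/-- Tested against (y - v)⁻¹: on the side ε the Cauchy integrals of F and of C F vanish, and on the
other side C multiplies by -`side v` = ε. -/
theorem IsTrace.cauchyTransform_eq (hF : D.IsTrace ε F) (hε : ε * ε = 1) (ha : 0 < a) (ha1 : a ≤ 1) :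
    D.cauchyTransform F =ᵐ[D.arcLength] fun x => ε * F x := by
  have hC := hF.isHolder.integrable_cauchyTransform ha
  have hi := hF.isHolder.integrable.const_mul (-ε : ℂ)
  have := D.ae_eq_zero_of_mul_tangent (hC.add hi) fun v hv => by
    change D.cauchyIntegral (fun y => D.cauchyTransform F y + -ε * F y) v = 0
    rw [cauchyIntegral_add hC hi hv, cauchyIntegral_const_mul]
    have h := hF.isHolder.integral_cauchyTransform_mul_inv_sub ha ha1 hv
    rw [cauchyIntegral, h]
    change _ * D.cauchyIntegral F v + _ = 0
    by_cases hs : D.side v = ε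
    · rw [hF.cauchyIntegral_eq v hv hs]; ring
    · rw [side_eq_neg hε hs]; push_cast; ring
  filter_upwards [this] with x hx
  simp only [Pi.add_apply, Pi.zero_apply] at hx
  linear_combination hx

/-- Antisymmetry for the pair F, H(y - v)⁻¹, with C F = εF and C H = εH. This is multiplicativity of
the holomorphic extension, obtained without boundary values of the Cauchy integral. -/
theorem IsTrace.cauchyIntegral_mul (hF : D.IsTrace ε F) (hH : D.IsTrace ε H) (hε : ε * ε = 1) (ha : 0 < a)
    (ha1 : a ≤ 1) (hv : v ∉ D.curve) : D.cauchyIntegral (fun y => F y * H y) v =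
      ε * (2 * Real.pi * Complex.I)⁻¹ * (D.cauchyIntegral F v * D.cauchyIntegral H v) := by
  have h := hF.isHolder.integral_cauchyTransform_mul (hH.isHolder.mul (isHolder_inv_sub hv)) ha ha1
  have i1 := integrable_mul_inv_sub_tangent (hF.isHolder.mul hH.isHolder).integrable hv
  have i2 := integrable_mul_inv_sub_tangent hF.isHolder.integrable hv
  have e1 : ∫ x, D.cauchyTransform F x * (H x * (x - v)⁻¹) * D.tangent x ∂D.arcLength =
      ε * D.cauchyIntegral (fun y => F y * H y) v := by
    rw [cauchyIntegral, ← integral_const_mul]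
    refine integral_congr_ae ?_
    filter_upwards [hF.cauchyTransform_eq hε ha ha1] with x hx
    rw [hx]; ring
  have e2 : ∫ x, F x * D.cauchyTransform (fun y => H y * (y - v)⁻¹) x * D.tangent x ∂D.arcLength =
      ε * D.cauchyIntegral (fun y => F y * H y) v -
        (Real.pi * Complex.I)⁻¹ * D.cauchyIntegral H v * D.cauchyIntegral F v := by
    rw [cauchyIntegral, cauchyIntegral, cauchyIntegral, ← integral_const_mul, ← integral_const_mul,
      ← integral_sub (i1.const_mul _) (i2.const_mul _)]
    refine integral_congr_ae ?_
    filter_upwards [hH.cauchyTransform_eq hε ha ha1, D.ae_mem_curve] with x hx hxc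
    rw [hH.isHolder.cauchyTransform_mul_inv_sub ha hv hxc, hx]
    ring
  rw [e1, e2] at h
  have he : (ε : ℂ) * ε = 1 := by exact_mod_cast hε
  have hpi := pi_I_ne_zero
  rw [mul_assoc (2 : ℂ), mul_inv]
  linear_combination (ε / 2 : ℂ) * h - D.cauchyIntegral (fun y => F y * H y) v * he

theorem IsTrace.mul (hF : D.IsTrace ε F) (hH : D.IsTrace ε H) (hε : ε * ε = 1) (ha : 0 < a)
    (ha1 : a ≤ 1) : D.IsTrace ε fun y => F y * H y :=
  ⟨hF.isHolder.mul hH.isHolder, fun v hv hs => by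
    rw [hF.cauchyIntegral_mul hH hε ha ha1 hv, hF.cauchyIntegral_eq v hv hs]; ring⟩

theorem IsTrace.add (hF : D.IsTrace ε F) (hH : D.IsTrace ε H) : D.IsTrace ε fun y => F y + H y :=
  ⟨hF.isHolder.add hH.isHolder, fun v hv hs => by
    rw [cauchyIntegral_add hF.isHolder.integrable hH.isHolder.integrable hv, hF.cauchyIntegral_eq v hv hs,
      hH.cauchyIntegral_eq v hv hs, add_zero]⟩

theorem IsTrace.const_mul (hF : D.IsTrace ε F) (c : ℂ) : D.IsTrace ε fun y => c * F y :=
  ⟨hF.isHolder.const_mul c, fun v hv hs => by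
    rw [cauchyIntegral_const_mul, hF.cauchyIntegral_eq v hv hs, mul_zero]⟩

theorem isTrace_zero : D.IsTrace ε fun _ => 0 :=
  ⟨isHolder_const 0, fun v _ _ => by simp [cauchyIntegral]⟩

variable (D) in
/-- The algebra of the traces and the constants. -/
def traceAlgebra (hε : ε * ε = 1) (ha : 0 < a) (ha1 : a ≤ 1) : Subalgebra ℂ (ℂ → ℂ) where
  carrier := {F | ∃ (f : ℂ → ℂ) (c : ℂ), D.IsTrace ε f ∧ F = fun y => f y + c}
  mul_mem' := by
    rintro _ _ ⟨f, c, hf, rfl⟩ ⟨h, d, hh, rfl⟩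
    refine ⟨_, c * d, ((hf.mul hh hε ha ha1).add (hf.const_mul d)).add (hh.const_mul c), ?_⟩
    funext y
    simp only [Pi.mul_apply]
    ring
  add_mem' := by
    rintro _ _ ⟨f, c, hf, rfl⟩ ⟨h, d, hh, rfl⟩
    refine ⟨_, c + d, hf.add hh, ?_⟩
    funext y
    simp only [Pi.add_apply]
    ring
  algebraMap_mem' c := ⟨_, c, isTrace_zero, by funext y; simp⟩

theorem traceAlgebra_isHolder {hε : ε * ε = 1} {ha : 0 < a} {ha1 : a ≤ 1} (F : D.traceAlgebra hε ha ha1) :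
    D.IsHolder F := by
  obtain ⟨f, c, hf, h⟩ := F.2
  rw [h]
  exact hf.isHolder.add (isHolder_const c)

variable (D) in
/-- The jump of the Cauchy integral. -/
noncomputable def jump (v w : ℂ) (F : ℂ → ℂ) : ℂ :=
  (2 * Real.pi * Complex.I)⁻¹ * (D.cauchyIntegral F v - D.cauchyIntegral F w)

theorem jump_const (ha : 0 < a) (hv : v ∈ D.carrier) (hw : w ∈ D.exterior) (c : ℂ) :
    D.jump v w (fun _ => c) = c := by
  rw [jump, cauchyIntegral_const ha (D.carrier_subset hv), cauchyIntegral_const ha (D.exterior_subset hw),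
    side_carrier hv, side_exterior hw]
  have hpi : (Real.pi : ℂ) ≠ 0 := by exact_mod_cast Real.pi_ne_zero
  push_cast
  field_simp
  ring

theorem jump_add (hv : v ∈ D.carrier) (hw : w ∈ D.exterior) (hF : D.IsHolder F) (hH : D.IsHolder H) :
    D.jump v w (fun y => F y + H y) = D.jump v w F + D.jump v w H := by
  rw [jump, cauchyIntegral_add hF.integrable hH.integrable (D.carrier_subset hv),
    cauchyIntegral_add hF.integrable hH.integrable (D.exterior_subset hw), jump, jump]
  ring

theorem jump_const_mul (c : ℂ) : D.jump v w (fun y => c * F y) = c * D.jump v w F := by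
  rw [jump, cauchyIntegral_const_mul, cauchyIntegral_const_mul, jump]
  ring

theorem IsTrace.jump_mul (hF : D.IsTrace ε F) (hH : D.IsTrace ε H) (hε : ε * ε = 1) (ha : 0 < a)
    (ha1 : a ≤ 1) (hv : v ∈ D.carrier) (hw : w ∈ D.exterior) :
    D.jump v w (fun y => F y * H y) = D.jump v w F * D.jump v w H := by
  have hv' := D.carrier_subset hv
  have hw' := D.exterior_subset hw
  rw [jump, hF.cauchyIntegral_mul hH hε ha ha1 hv', hF.cauchyIntegral_mul hH hε ha ha1 hw', jump, jump]
  rcases mul_self_eq_one_iff.mp hε with rfl | rfl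
  · rw [hF.cauchyIntegral_eq w hw' (side_exterior hw), hH.cauchyIntegral_eq w hw' (side_exterior hw)]
    push_cast; ring
  · rw [hF.cauchyIntegral_eq v hv' (side_carrier hv), hH.cauchyIntegral_eq v hv' (side_carrier hv)]
    push_cast; ring

variable (D) in
/-- Evaluation at a point as a character of the algebra of traces. -/
noncomputable def traceEval (hε : ε * ε = 1) (ha : 0 < a) (ha1 : a ≤ 1) (hv : v ∈ D.carrier)
    (hw : w ∈ D.exterior) : D.traceAlgebra hε ha ha1 →ₐ[ℂ] ℂ where
  toFun F := D.jump v w F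
  map_one' := jump_const ha hv hw 1
  map_mul' := by
    rintro ⟨_, f, c, hf, rfl⟩ ⟨_, h, d, hh, rfl⟩
    have e : (((⟨fun y => f y + c, f, c, hf, rfl⟩ : D.traceAlgebra hε ha ha1) *
        ⟨fun y => h y + d, h, d, hh, rfl⟩ : D.traceAlgebra hε ha ha1) : ℂ → ℂ) =
        fun y => f y * h y + d * f y + c * h y + c * d := by
      funext y
      change (f y + c) * (h y + d) = _
      ring
    rw [e]
    have h1 := (hf.mul hh hε ha ha1).isHolder
    have h2 := hf.isHolder.const_mul d
    have h3 := hh.isHolder.const_mul c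
    rw [jump_add hv hw ((h1.add h2).add h3) (isHolder_const _), jump_add hv hw (h1.add h2) h3,
      jump_add hv hw h1 h2, jump_const ha hv hw, jump_const_mul, jump_const_mul,
      hf.jump_mul hh hε ha ha1 hv hw, jump_add hv hw hf.isHolder (isHolder_const _),
      jump_add hv hw hh.isHolder (isHolder_const _), jump_const ha hv hw, jump_const ha hv hw]
    ring
  map_zero' := jump_const ha hv hw 0
  map_add' F H := jump_add hv hw (traceAlgebra_isHolder F) (traceAlgebra_isHolder H)
  commutes' c := jump_const ha hv hw c

/-- The jump is a character of the algebra, bounded by the supremum over the curve since v and w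
keep a positive distance from it. -/
theorem im_jump_eq_zero (hε : ε * ε = 1) (ha : 0 < a) (ha1 : a ≤ 1) (hv : v ∈ D.carrier)
    (hw : w ∈ D.exterior) (hF : F ∈ D.traceAlgebra hε ha ha1) (hr : ∀ y ∈ D.curve, (F y).im = 0) :
    (D.jump v w F).im = 0 := by
  obtain ⟨M, -, hM⟩ := (traceAlgebra_isHolder ⟨F, hF⟩).exists_norm_le
  obtain ⟨B, hB0, hB⟩ := (isHolder_inv_sub (D.carrier_subset hv)).exists_norm_le
  obtain ⟨B', hB0', hB'⟩ := (isHolder_inv_sub (D.exterior_subset hw)).exists_norm_le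
  have hci : ∀ (F : ℂ → ℂ) (M B : ℝ) (v : ℂ), (∀ y ∈ D.curve, ‖F y‖ ≤ M) → (∀ y ∈ D.curve, ‖(y - v)⁻¹‖ ≤ B) →
      ‖D.cauchyIntegral F v‖ ≤ M * B * D.arcLength.real univ := fun F M B v hM hB => by
    refine norm_integral_le_of_norm_le_const (μ := D.arcLength) (C := M * B) ?_
    filter_upwards [D.ae_mem_curve] with y hy
    rw [norm_mul, norm_mul]
    have hM0 : 0 ≤ M := (norm_nonneg (F y)).trans (hM y hy)
    have hB0 : 0 ≤ B := (norm_nonneg (y - v)⁻¹).trans (hB y hy)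
    exact (mul_le_of_le_one_right (by positivity) (D.norm_tangent_le y)).trans
      (mul_le_mul (hM y hy) (hB y hy) (norm_nonneg _) hM0)
  refine AlgHom.im_eq_zero_of_real (D.traceEval hε ha ha1 hv hw) (K := D.curve)
    (C := ‖(2 * Real.pi * Complex.I : ℂ)⁻¹‖ * ((B + B') * D.arcLength.real univ)) (fun F M hM => ?_) ⟨F, hF⟩ hr hM
  change ‖D.jump v w F‖ ≤ _
  rw [jump, norm_mul, mul_assoc ‖_‖]
  refine mul_le_mul_of_nonneg_left ((norm_sub_le _ _).trans ((add_le_add (hci F M B v hM hB)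
    (hci F M B' w hM hB')).trans_eq ?_)) (norm_nonneg (2 * Real.pi * Complex.I : ℂ)⁻¹)
  ring

/-- A real Hölder function on the curve that is, up to a constant, the trace of a holomorphic function on
one side of the curve is constant. -/
theorem exists_ae_eq_const_of_real (hε : ε * ε = 1) (ha : 0 < a) (ha1 : a ≤ 1)
    (hF : F ∈ D.traceAlgebra hε ha ha1) (hr : ∀ y ∈ D.curve, (F y).im = 0) :
    ∃ c, F =ᵐ[D.arcLength] fun _ => c := by
  have hFi := (traceAlgebra_isHolder ⟨F, hF⟩).integrable
  obtain ⟨v₀, hv₀⟩ := D.isConnected.nonempty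
  obtain ⟨w₀, hw₀, -⟩ := D.exists_large_exterior 0
  obtain ⟨f, c, hf, rfl⟩ := hF
  have him := fun v hv w hw => im_jump_eq_zero hε ha ha1 (v := v) (w := w) hv hw ⟨f, c, hf, rfl⟩ hr
  have hc : ∀ v ∉ D.curve, D.side v = ε → D.cauchyIntegral (fun y => f y + c) v =
      c * ((1 - ε) * (Real.pi * Complex.I)) := fun v hv hs => by
    rw [cauchyIntegral_add hf.isHolder.integrable (integrable_const _) hv, hf.cauchyIntegral_eq v hv hs,
      cauchyIntegral_const ha hv, hs, zero_add]
  have hpi : (2 * Real.pi * Complex.I : ℂ)⁻¹ ≠ 0 := by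
    rw [mul_assoc]
    exact inv_ne_zero (mul_ne_zero two_ne_zero pi_I_ne_zero)
  -- On the side ε the Cauchy integral is a known constant. On the other side, moving the pole there
  -- shows that a holomorphic function has vanishing imaginary part, so its derivative is zero.
  rcases mul_self_eq_one_iff.mp hε with rfl | rfl
  · obtain ⟨c', hc'⟩ := exists_cauchyIntegral_carrier (D := D) hFi fun v hv => by
      have h1 := ((hasDerivAt_cauchyIntegral hFi (D.carrier_subset hv)).sub_const
        (D.cauchyIntegral (fun y => f y + c) w₀)).const_mul (2 * Real.pi * Complex.I : ℂ)⁻¹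
      have h2 := h1.eq_zero_of_im_eq_zero (Filter.mem_of_superset (D.isOpen.mem_nhds hv) fun w hw => him w hw w₀ hw₀)
      exact (mul_eq_zero.mp h2).resolve_left hpi
    exact ⟨_, ae_eq_const_of_cauchyIntegral ha hFi hc' fun v hv =>
      hc v (D.exterior_subset hv) (side_exterior hv)⟩
  · have h0 := cauchyIntegral_exterior_eq_zero (D := D) ha hFi fun w hw => by
      have h1 := ((hasDerivAt_cauchyIntegral hFi (D.exterior_subset hw)).const_sub
        (D.cauchyIntegral (fun y => f y + c) v₀)).const_mul (2 * Real.pi * Complex.I : ℂ)⁻¹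
      have h2 := h1.eq_zero_of_im_eq_zero (Filter.mem_of_superset (D.isOpen_exterior.mem_nhds hw) fun w hw => him v₀ hv₀ w hw)
      exact neg_eq_zero.mp ((mul_eq_zero.mp h2).resolve_left hpi)
    exact ⟨_, ae_eq_const_of_cauchyIntegral ha hFi
      (fun v hv => hc v (D.carrier_subset hv) (side_carrier hv)) h0⟩

/-- The Cauchy integral is constant on the side ε. Outside, that constant is zero by decay; inside,
it is removed by subtracting a constant from u. -/
theorem IsHolder.mem_traceAlgebra (hu : D.IsHolder u) (hε : ε * ε = 1) (ha : 0 < a) (ha1 : a ≤ 1)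
    (h : ∀ v ∉ D.curve, D.side v = ε → ∫ y, u y * D.dipole v y ∂D.arcLength = 0) :
    u ∈ D.traceAlgebra hε ha ha1 := by
  rcases mul_self_eq_one_iff.mp hε with rfl | rfl
  · refine ⟨u, 0, ⟨hu, fun v hv hs => ?_⟩, by simp⟩
    refine cauchyIntegral_exterior_eq_zero ha hu.integrable
      (fun v hv => h v (D.exterior_subset hv) (side_exterior hv)) v ?_
    refine (D.mem_carrier_or_mem_exterior hv).resolve_left fun hv => ?_
    rw [side_carrier hv] at hs
    norm_num at hs
  · obtain ⟨c, hc⟩ := exists_cauchyIntegral_carrier (D := D) hu.integrable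
      fun v hv => h v (D.carrier_subset hv) (side_carrier hv)
    set c' := c * (2 * Real.pi * Complex.I : ℂ)⁻¹ with hc'
    refine ⟨fun y => u y + -c', c', ⟨hu.add (isHolder_const _), fun v hv hs => ?_⟩, by simp⟩
    have hv' : v ∈ D.carrier := by
      refine (D.mem_carrier_or_mem_exterior hv).resolve_right fun hv => ?_
      rw [side_exterior hv] at hs
      norm_num at hs
    rw [cauchyIntegral_add hu.integrable (integrable_const _) hv, cauchyIntegral_const ha hv, hs, hc v hv', hc']
    have hpi : (Real.pi : ℂ) ≠ 0 := by exact_mod_cast Real.pi_ne_zero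
    push_cast
    field_simp
    ring

/-- A Hölder function on the curve that is, together with its conjugate, orthogonal to the dipoles on one
side of the curve is constant. -/
theorem IsHolder.exists_ae_eq_const (hu : D.IsHolder u) (hε : ε * ε = 1) (ha : 0 < a) (ha1 : a ≤ 1)
    (h : ∀ v ∉ D.curve, D.side v = ε → ∫ y, u y * D.dipole v y ∂D.arcLength = 0)
    (h' : ∀ v ∉ D.curve, D.side v = ε → ∫ y, starRingEnd ℂ (u y) * D.dipole v y ∂D.arcLength = 0) :
    ∃ c, u =ᵐ[D.arcLength] fun _ => c := by
  have m1 := hu.mem_traceAlgebra hε ha ha1 h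
  have m2 := hu.star.mem_traceAlgebra hε ha ha1 h'
  obtain ⟨c, hc⟩ := exists_ae_eq_const_of_real (D := D) hε ha ha1 (add_mem m1 m2) fun y _ => by
    simp
  obtain ⟨d, hd⟩ := exists_ae_eq_const_of_real (D := D) hε ha ha1
    (Subalgebra.smul_mem _ (sub_mem m1 m2) Complex.I) fun y _ => by simp
  refine ⟨(c - Complex.I * d) / 2, ?_⟩
  filter_upwards [hc, hd] with y hy hy'
  simp only [Pi.add_apply, Pi.smul_apply, Pi.sub_apply, smul_eq_mul] at hy hy'
  rw [← hy, ← hy']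
  linear_combination ((u y - starRingEnd ℂ (u y)) / 2) * Complex.I_sq

end PlanarDomain

/-! ### Positivity of the energy through Gaussian kernels. -/

theorem Real.abs_inv_mul_exp_sub_exp_le {b c s : ℝ} (hbc : b ≤ c) (hs : 0 < s) :
    |s⁻¹ * (Real.exp (-(b * s)) - Real.exp (-(c * s)))| ≤ (c - b) * Real.exp (-(b * s)) := by
  have h1 : Real.exp (-(c * s)) ≤ Real.exp (-(b * s)) := by
    apply Real.exp_le_exp.mpr
    nlinarith
  have h2 : Real.exp (-(c * s)) = Real.exp (-(b * s)) * Real.exp (-((c - b) * s)) := by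
    rw [← Real.exp_add]; congr 1; ring
  have h3 := Real.one_sub_le_exp_neg ((c - b) * s)
  have h4 := Real.exp_pos (-(b * s))
  rw [abs_of_nonneg (mul_nonneg (by positivity) (sub_nonneg.mpr h1)), inv_mul_le_iff₀ hs, h2]
  nlinarith

theorem Real.integrableOn_inv_mul_exp_sub_exp {b c : ℝ} (hb : 0 < b) (hc : 0 < c) :
    IntegrableOn (fun s : ℝ => s⁻¹ * (Real.exp (-(b * s)) - Real.exp (-(c * s)))) (Ioi 0) := by
  have key : ∀ {b c : ℝ}, 0 < b → b ≤ c →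
      IntegrableOn (fun s : ℝ => s⁻¹ * (Real.exp (-(b * s)) - Real.exp (-(c * s)))) (Ioi 0) := by
    intro b c hb hbc
    have h := (integrableOn_exp_mul_Ioi (a := -b) (by linarith) 0).const_mul (c - b)
    refine h.mono' (by fun_prop : Measurable _).aestronglyMeasurable ?_
    filter_upwards [ae_restrict_mem measurableSet_Ioi] with s hs
    rw [Real.norm_eq_abs, neg_mul]
    exact Real.abs_inv_mul_exp_sub_exp_le hbc hs
  rcases le_total b c with h | h
  · exact key hb h
  · refine (key hc h).neg.congr_fun (fun s _ => ?_) measurableSet_Ioi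
    simp only [Pi.neg_apply]
    ring

/-- Frullani's integral; with b = |x - y|² and c = 1 it writes -2 log |x - y| as a superposition of
Gaussians, up to terms constant in x and y. -/
theorem Real.integral_inv_mul_exp_sub_exp {b c : ℝ} (hb : 0 < b) (hc : 0 < c) :
    ∫ s in Ioi (0 : ℝ), s⁻¹ * (Real.exp (-(b * s)) - Real.exp (-(c * s))) = Real.log (c / b) := by
  have h := Frullani.integral_Ioi_eq (f := fun s : ℝ => Real.exp (-s)) (a := b) (b := c) (L := 1) (R := 0)
    ((by fun_prop : Continuous fun s : ℝ => Real.exp (-s)).locallyIntegrable.locallyIntegrableOn _) hb hc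
    ?_ ?_ (Real.integrableOn_inv_mul_exp_sub_exp hb hc)
  · simpa using h
  · have : Tendsto (fun s : ℝ => Real.exp (-s)) (𝓝 0) (𝓝 (Real.exp (-0))) :=
      (by fun_prop : Continuous fun s : ℝ => Real.exp (-s)).tendsto 0
    simpa using this.mono_left nhdsWithin_le_nhds
  · exact Real.tendsto_exp_neg_atTop_nhds_zero

theorem Real.integral_abs_inv_mul_exp_sub_exp {b c : ℝ} (hb : 0 < b) (hc : 0 < c) :
    ∫ s in Ioi (0 : ℝ), |s⁻¹ * (Real.exp (-(b * s)) - Real.exp (-(c * s)))| = |Real.log (c / b)| := by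
  have key : ∀ {b c : ℝ}, 0 < b → 0 < c → b ≤ c →
      ∫ s in Ioi (0 : ℝ), |s⁻¹ * (Real.exp (-(b * s)) - Real.exp (-(c * s)))| = |Real.log (c / b)| := by
    intro b c hb hc hbc
    rw [← Real.integral_inv_mul_exp_sub_exp hb hc, abs_of_nonneg]
    · refine setIntegral_congr_fun measurableSet_Ioi fun s (hs : 0 < s) => abs_of_nonneg ?_
      refine mul_nonneg (by positivity) (sub_nonneg.mpr (Real.exp_le_exp.mpr (by nlinarith)))
    · refine setIntegral_nonneg measurableSet_Ioi fun s (hs : 0 < s) => ?_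
      refine mul_nonneg (by positivity) (sub_nonneg.mpr (Real.exp_le_exp.mpr (by nlinarith)))
  rcases le_total b c with h | h
  · exact key hb hc h
  · have := key hc hb h
    rw [← inv_div b c, Real.log_inv, abs_neg, ← this]
    congr 1
    funext s
    rw [← neg_sub, mul_neg, abs_neg]

theorem Complex.hasSum_exp_mul_exp (u v : ℂ) :
    HasSum (fun k : ℕ × ℕ => u ^ k.1 / k.1.factorial * (v ^ k.2 / k.2.factorial))
      (Complex.exp u * Complex.exp v) := by
  have h : ∀ u : ℂ, HasSum (fun n : ℕ => u ^ n / n.factorial) (Complex.exp u) := fun u => by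
    rw [Complex.exp_eq_exp_ℂ]
    exact NormedSpace.expSeries_div_hasSum_exp u
  have hn : ∀ u : ℂ, Summable fun n : ℕ => ‖u ^ n / n.factorial‖ :=
    fun u => NormedSpace.norm_expSeries_div_summable u
  have hs := summable_mul_of_summable_norm (f := fun n : ℕ => u ^ n / (n.factorial : ℂ))
    (g := fun n : ℕ => v ^ n / (n.factorial : ℂ)) (hn u) (hn v)
  have := HasSum.mul (h u) (h v) hs
  exact this

/-- The Gaussian kernel is positive definite: expansion of its quadratic form into squares. -/
theorem hasSum_gaussian_form {μ : Measure ℂ} [SFinite μ] {φ : ℂ → ℂ} (hφ : Integrable φ μ) {w : ℂ} {R s : ℝ}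
    (hs : 0 ≤ s) (hR : ∀ᵐ y ∂μ, ‖y - w‖ ≤ R) :
    HasSum (fun k : ℕ × ℕ => ((s ^ k.1 / k.1.factorial * (s ^ k.2 / k.2.factorial) *
      ‖∫ y, starRingEnd ℂ (y - w) ^ k.1 * (y - w) ^ k.2 * (Real.exp (-(s * ‖y - w‖ ^ 2)) : ℂ) * φ y ∂μ‖ ^ 2 : ℝ) : ℂ))
      (∫ p, starRingEnd ℂ (φ p.1) * φ p.2 * (Real.exp (-(s * ‖p.1 - p.2‖ ^ 2)) : ℂ) ∂(μ.prod μ)) := by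
  set m : ℕ × ℕ → ℂ → ℂ := fun k y =>
    starRingEnd ℂ (y - w) ^ k.1 * (y - w) ^ k.2 * (Real.exp (-(s * ‖y - w‖ ^ 2)) : ℂ) * φ y with hm
  set c : ℕ × ℕ → ℝ := fun k => s ^ k.1 / k.1.factorial * (s ^ k.2 / k.2.factorial) with hc
  have hc0 : ∀ k, 0 ≤ c k := fun k => by positivity
  have hpc : ∀ k : ℕ × ℕ, Continuous fun y : ℂ =>
      starRingEnd ℂ (y - w) ^ k.1 * (y - w) ^ k.2 * (Real.exp (-(s * ‖y - w‖ ^ 2)) : ℂ) := fun k => by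
    have := Complex.continuous_conj
    fun_prop
  have hmb : ∀ k : ℕ × ℕ, ∀ᵐ y ∂μ, ‖starRingEnd ℂ (y - w) ^ k.1 * (y - w) ^ k.2 *
      (Real.exp (-(s * ‖y - w‖ ^ 2)) : ℂ)‖ ≤ R ^ k.1 * R ^ k.2 := fun k => by
    filter_upwards [hR] with y hy
    rw [norm_mul, norm_mul, norm_pow, norm_pow, RCLike.norm_conj, Complex.norm_real, Real.norm_eq_abs, Real.abs_exp]
    have h1 : Real.exp (-(s * ‖y - w‖ ^ 2)) ≤ 1 := by
      rw [← Real.exp_zero]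
      exact Real.exp_le_exp.mpr (by nlinarith [sq_nonneg ‖y - w‖])
    have hR0 := (norm_nonneg _).trans hy
    refine (mul_le_of_le_one_right (by positivity) h1).trans ?_
    gcongr
  have hmi : ∀ k, Integrable (m k) μ := fun k =>
    hφ.bdd_mul (c := R ^ k.1 * R ^ k.2) (hpc k).aestronglyMeasurable (hmb k)
  have hmn : ∀ k, ∫ y, ‖m k y‖ ∂μ ≤ R ^ k.1 * R ^ k.2 * ∫ y, ‖φ y‖ ∂μ := fun k => by
    rw [← integral_const_mul]
    refine integral_mono_ae (hmi k).norm (hφ.norm.const_mul _) ?_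
    filter_upwards [hmb k] with y hy
    rw [hm, norm_mul]
    exact mul_le_mul_of_nonneg_right hy (norm_nonneg _)
  set F : ℕ × ℕ → ℂ × ℂ → ℂ := fun k p => (c k : ℂ) * (starRingEnd ℂ (m k p.1) * m k p.2) with hF
  have hFi : ∀ k, Integrable (F k) (μ.prod μ) := fun k =>
    (((hmi k).starRingEnd).mul_prod (hmi k)).const_mul _
  have hFn : ∀ k, ∫ p, ‖F k p‖ ∂(μ.prod μ) = c k * ((∫ y, ‖m k y‖ ∂μ) * ∫ y, ‖m k y‖ ∂μ) := fun k => by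
    rw [← integral_prod_mul, ← integral_const_mul]
    refine integral_congr_ae (Eventually.of_forall fun p => ?_)
    simp only [hF]
    rw [norm_mul, norm_mul, RCLike.norm_conj, Complex.norm_real, Real.norm_eq_abs, abs_of_nonneg (hc0 k)]
  have hsum : Summable fun k => ∫ p, ‖F k p‖ ∂(μ.prod μ) := by
    have h1 : Summable fun n : ℕ => (s * R ^ 2) ^ n / n.factorial := Real.summable_pow_div_factorial _
    have h2 := (summable_mul_of_summable_norm (f := fun n : ℕ => (s * R ^ 2) ^ n / n.factorial)
      (g := fun n : ℕ => (s * R ^ 2) ^ n / n.factorial) h1.norm h1.norm).mul_right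
      ((∫ y, ‖φ y‖ ∂μ) * ∫ y, ‖φ y‖ ∂μ)
    refine Summable.of_nonneg_of_le (fun k => integral_nonneg fun _ => norm_nonneg _) (fun k => ?_) h2
    rw [hFn k]
    have h3 : 0 ≤ ∫ y, ‖m k y‖ ∂μ := integral_nonneg fun _ => norm_nonneg _
    calc c k * ((∫ y, ‖m k y‖ ∂μ) * ∫ y, ‖m k y‖ ∂μ)
        ≤ c k * ((R ^ k.1 * R ^ k.2 * ∫ y, ‖φ y‖ ∂μ) * (R ^ k.1 * R ^ k.2 * ∫ y, ‖φ y‖ ∂μ)) := by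
          have := hc0 k
          gcongr
          · exact h3.trans (hmn k)
          · exact hmn k
          · exact hmn k
      _ = _ := by
          simp only [hc]
          rw [mul_pow, mul_pow]
          ring
  have hmain := hasSum_integral_of_summable_integral_norm hFi hsum
  have e1 : ∀ k, ∫ p, F k p ∂(μ.prod μ) = ((c k * ‖∫ y, m k y ∂μ‖ ^ 2 : ℝ) : ℂ) := fun k => by
    simp only [hF]
    rw [integral_const_mul, integral_prod_mul (fun y => starRingEnd ℂ (m k y)), integral_conj,
      mul_comm (starRingEnd ℂ _), Complex.mul_conj, Complex.normSq_eq_norm_sq]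
    push_cast
    ring
  -- From |X - Y|² = |X|² + |Y|² - X conj Y - conj X Y, the cross terms expand into a double
  -- exponential series of products of a function of p.2 and the conjugate of the same function of
  -- p.1.
  have e2 : ∀ p : ℂ × ℂ, ∑' k, F k p =
      starRingEnd ℂ (φ p.1) * φ p.2 * (Real.exp (-(s * ‖p.1 - p.2‖ ^ 2)) : ℂ) := fun p => by
    set X := p.1 - w with hX
    set Y := p.2 - w with hY
    have h3 := (Complex.hasSum_exp_mul_exp (s * (X * starRingEnd ℂ Y)) (s * (starRingEnd ℂ X * Y))).mul_left
      (starRingEnd ℂ (φ p.1) * φ p.2 * ((Real.exp (-(s * ‖X‖ ^ 2)) : ℂ) * (Real.exp (-(s * ‖Y‖ ^ 2)) : ℂ)))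
    have h4 : (fun k : ℕ × ℕ => starRingEnd ℂ (φ p.1) * φ p.2 *
        ((Real.exp (-(s * ‖X‖ ^ 2)) : ℂ) * (Real.exp (-(s * ‖Y‖ ^ 2)) : ℂ)) *
        ((s * (X * starRingEnd ℂ Y)) ^ k.1 / k.1.factorial * ((s * (starRingEnd ℂ X * Y)) ^ k.2 / k.2.factorial))) =
        fun k => F k p := by
      funext k
      simp only [hF, hm, hc, ← hX, ← hY, map_mul, map_pow, Complex.conj_conj, Complex.conj_ofReal, mul_pow]
      push_cast
      ring
    rw [h4] at h3
    rw [h3.tsum_eq, mul_assoc (starRingEnd ℂ (φ p.1) * φ p.2)]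
    congr 1
    have hXY : p.1 - p.2 = X - Y := by simp [hX, hY]
    rw [Complex.ofReal_exp, Complex.ofReal_exp, Complex.ofReal_exp, ← Complex.exp_add, ← Complex.exp_add,
      ← Complex.exp_add, hXY]
    congr 1
    push_cast
    have h5 : ∀ z : ℂ, (‖z‖ : ℂ) ^ 2 = z * starRingEnd ℂ z := fun z => by
      rw [Complex.mul_conj, Complex.normSq_eq_norm_sq]; push_cast; rfl
    rw [h5, h5, h5, map_sub (starRingEnd ℂ) X Y]
    ring
  simp only [e1, e2] at hmain
  exact hmain

namespace PlanarDomain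

variable {a : ℝ} {D : PlanarDomain a} {φ ψ : ℂ → ℂ} {k : ℂ → ℂ → ℝ} {M : ℝ}

/-- |φ x ψ y| is at most |φ x|² + |ψ y|², and each square meets the kernel integrated in the other
variable, which Schur's hypothesis bounds. -/
theorem IsSchurKernel.integrable_prod (h : D.IsSchurKernel k M) (hφm : Measurable φ) (hψm : Measurable ψ)
    (hφ : MemLp φ 2 D.arcLength) (hψ : MemLp ψ 2 D.arcLength) :
    Integrable (fun p : ℂ × ℂ => (k p.1 p.2 : ℂ) * (φ p.1 * ψ p.2)) (D.arcLength.prod D.arcLength) := by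
  have hkm : Measurable fun p : ℂ × ℂ => k p.1 p.2 := h.measurable
  refine ⟨(hkm.complex_ofReal.mul ((hφm.comp measurable_fst).mul
    (hψm.comp measurable_snd))).aestronglyMeasurable, ?_⟩
  rw [hasFiniteIntegral_iff_enorm]
  have hfin : ∀ {f : ℂ → ℂ}, MemLp f 2 D.arcLength → ∫⁻ x, ‖f x‖ₑ ^ 2 ∂D.arcLength < ⊤ := fun hf => by
    rw [← eLpNorm_two_sq]
    exact ENNReal.pow_lt_top hf.2
  have m1 : Measurable fun p : ℂ × ℂ => ‖k p.1 p.2‖ₑ * ‖φ p.1‖ₑ ^ 2 :=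
    hkm.enorm.mul ((hφm.comp measurable_fst).enorm.pow_const 2)
  have m2 : Measurable fun p : ℂ × ℂ => ‖k p.1 p.2‖ₑ * ‖ψ p.2‖ₑ ^ 2 :=
    hkm.enorm.mul ((hψm.comp measurable_snd).enorm.pow_const 2)
  calc ∫⁻ p, ‖(k p.1 p.2 : ℂ) * (φ p.1 * ψ p.2)‖ₑ ∂(D.arcLength.prod D.arcLength)
      ≤ ∫⁻ p, (‖k p.1 p.2‖ₑ * ‖φ p.1‖ₑ ^ 2 + ‖k p.1 p.2‖ₑ * ‖ψ p.2‖ₑ ^ 2) ∂(D.arcLength.prod D.arcLength) := by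
        refine lintegral_mono fun p => ?_
        simp only [enorm_mul]
        rw [← mul_add]
        have e : ‖(k p.1 p.2 : ℂ)‖ₑ = ‖k p.1 p.2‖ₑ := by
          rw [← ofReal_norm, Complex.norm_real, ofReal_norm]
        rw [e]
        gcongr
        rw [sq, sq]
        rcases le_total ‖φ p.1‖ₑ ‖ψ p.2‖ₑ with h | h
        · exact (mul_le_mul_left h _).trans le_add_self
        · exact (mul_le_mul_right h _).trans le_self_add
    _ = (∫⁻ p, ‖k p.1 p.2‖ₑ * ‖φ p.1‖ₑ ^ 2 ∂(D.arcLength.prod D.arcLength)) +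
        ∫⁻ p, ‖k p.1 p.2‖ₑ * ‖ψ p.2‖ₑ ^ 2 ∂(D.arcLength.prod D.arcLength) := lintegral_add_left m1 _
    _ < ⊤ := by
        refine ENNReal.add_lt_top.mpr ⟨?_, ?_⟩
        · rw [lintegral_prod _ m1.aemeasurable]
          calc _ ≤ ∫⁻ x, ENNReal.ofReal M * ‖φ x‖ₑ ^ 2 ∂D.arcLength := by
                refine lintegral_mono_ae ?_
                filter_upwards [D.ae_mem_curve] with x hx
                rw [lintegral_mul_const _ (h.measurable_left x).enorm]
                gcongr
                exact h.left x hx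
            _ < ⊤ := by
                rw [lintegral_const_mul _ (hφm.enorm.pow_const 2)]
                exact ENNReal.mul_lt_top (by simp) (hfin hφ)
        · rw [lintegral_prod_symm _ m2.aemeasurable]
          calc _ ≤ ∫⁻ x, ENNReal.ofReal M * ‖ψ x‖ₑ ^ 2 ∂D.arcLength := by
                refine lintegral_mono_ae ?_
                filter_upwards [D.ae_mem_curve] with x hx
                rw [lintegral_mul_const _ (h.measurable_right x).enorm]
                gcongr
                exact h.right x hx
            _ < ⊤ := by
                rw [lintegral_const_mul _ (hψm.enorm.pow_const 2)]
                exact ENNReal.mul_lt_top (by simp) (hfin hψ)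

theorem IsSchurKernel.integral_mul_apply (h : D.IsSchurKernel k M) {T : D.L2 →L[ℂ] D.L2}
    (hT : D.IsIntegralOperator k T) (hφm : Measurable φ) (hφ : MemLp φ 2 D.arcLength) (ψ : D.L2) :
    ∫ x, φ x * T ψ x ∂D.arcLength =
      ∫ p, (k p.1 p.2 : ℂ) * (φ p.1 * ψ p.2) ∂(D.arcLength.prod D.arcLength) := by
  rw [integral_prod _ (h.integrable_prod hφm (Lp.stronglyMeasurable ψ).measurable hφ (Lp.memLp ψ))]
  refine integral_congr_ae ?_
  filter_upwards [hT ψ] with x hx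
  rw [hx.2, ← integral_const_mul]
  exact integral_congr_ae (Eventually.of_forall fun y => by ring)

theorem IsSchurKernel.integral_mul_apply' (h : D.IsSchurKernel k M) {T : D.L2 →L[ℂ] D.L2}
    (hT : D.IsIntegralOperator k T) (hφm : Measurable φ) (hφ : MemLp φ 2 D.arcLength) (ψ : D.L2) :
    ∫ x, φ x * T ψ x ∂D.arcLength = ∫ y, (∫ x, (k x y : ℂ) * φ x ∂D.arcLength) * ψ y ∂D.arcLength := by
  rw [h.integral_mul_apply hT hφm hφ, integral_prod_symm _
    (h.integrable_prod hφm (Lp.stronglyMeasurable ψ).measurable hφ (Lp.memLp ψ))]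
  refine integral_congr_ae (Eventually.of_forall fun y => ?_)
  simp only []
  rw [← integral_mul_const]
  exact integral_congr_ae (Eventually.of_forall fun x => by ring)

end PlanarDomain

namespace PlanarDomain

variable {a : ℝ} {D : PlanarDomain a} {φ ψ : ℂ → ℂ}

theorem exists_isSchurKernel_singleLayer (ha : 0 < a) : ∃ M, D.IsSchurKernel singleLayerKernel M := by
  obtain ⟨C, hC, h⟩ := D.exists_singleLayerKernel_le
  obtain ⟨M, hM, hMs⟩ := exists_isSchurKernel (D := D) ha (b := 1 / 2) (by norm_num) (by norm_num)
  exact ⟨_, hMs _ C measurable_singleLayerKernel hC fun x hx y hy hxy => (h x hx y hy hxy).2⟩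

theorem exists_isSchurKernel_np (ha : 0 < a) (ha1 : a ≤ 1) : ∃ M, D.IsSchurKernel D.npKernel M := by
  obtain ⟨C, hC, h⟩ := D.exists_npKernel_le ha
  obtain ⟨M, hM, hMs⟩ := exists_isSchurKernel (D := D) ha (b := 1 - a) (by linarith) (by linarith)
  exact ⟨_, hMs _ C D.measurable_npKernel hC fun x hx y hy hxy => (h x hx y hy hxy).2⟩

theorem singleLayerKernel_comm (x y : ℂ) : singleLayerKernel x y = singleLayerKernel y x := by
  rw [singleLayerKernel, singleLayerKernel, norm_sub_rev]

theorem measurable_coeFn (φ : D.L2) : Measurable φ := (Lp.stronglyMeasurable φ).measurable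

theorem memLp_conj {φ : ℂ → ℂ} (hφ : MemLp φ 2 D.arcLength) :
    MemLp (fun x => starRingEnd ℂ (φ x)) 2 D.arcLength :=
  ⟨Complex.continuous_conj.comp_aestronglyMeasurable hφ.1, by
    refine lt_of_eq_of_lt (eLpNorm_congr_norm_ae (Eventually.of_forall fun x => ?_)) hφ.2
    exact RCLike.norm_conj _⟩

theorem inner_eq_integral (φ ψ : D.L2) :
    inner ℂ φ ψ = ∫ x, starRingEnd ℂ (φ x) * ψ x ∂D.arcLength := by
  rw [L2.inner_def]
  refine integral_congr_ae (Eventually.of_forall fun x => ?_)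
  simp only [RCLike.inner_apply]
  ring

theorem inner_singleLayer (ha : 0 < a) (φ ψ : D.L2) : inner ℂ φ (D.singleLayer ψ) =
    ∫ p, (singleLayerKernel p.1 p.2 : ℂ) * (starRingEnd ℂ (φ p.1) * ψ p.2) ∂(D.arcLength.prod D.arcLength) := by
  obtain ⟨M, hM⟩ := exists_isSchurKernel_singleLayer (D := D) ha
  rw [inner_eq_integral]
  exact hM.integral_mul_apply (D.isIntegralOperator_singleLayer ha)
    (Complex.continuous_conj.measurable.comp (measurable_coeFn φ)) (memLp_conj (Lp.memLp φ)) ψ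

theorem inner_singleLayer_comm (ha : 0 < a) (φ ψ : D.L2) :
    inner ℂ (D.singleLayer φ) ψ = inner ℂ φ (D.singleLayer ψ) := by
  rw [← inner_conj_symm, inner_singleLayer ha, inner_singleLayer ha, ← integral_conj,
    ← integral_prod_swap]
  refine integral_congr_ae (Eventually.of_forall fun p => ?_)
  simp only [Prod.fst_swap, Prod.snd_swap, map_mul, Complex.conj_conj, Complex.conj_ofReal]
  rw [singleLayerKernel_comm]
  ring

/-- The difference has constant sign in s, so its absolute integral is 2 |log |x - y||, that is, 4π
times the modulus of the single layer kernel. Fubini's theorem thus applies. -/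
theorem integrable_gaussian_difference (ha : 0 < a) (hm : Measurable φ) (hφ : MemLp φ 2 D.arcLength) :
    Integrable (fun q : (ℂ × ℂ) × ℝ => ((q.2⁻¹ * (Real.exp (-(‖q.1.1 - q.1.2‖ ^ 2 * q.2)) - Real.exp (-(1 * q.2))) : ℝ) : ℂ) *
      (starRingEnd ℂ (φ q.1.1) * φ q.1.2)) ((D.arcLength.prod D.arcLength).prod (volume.restrict (Ioi 0))) := by
  obtain ⟨M, hM⟩ := exists_isSchurKernel_singleLayer (D := D) ha
  have hcm : Measurable fun x => starRingEnd ℂ (φ x) := Complex.continuous_conj.measurable.comp hm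
  have hk := hM.integrable_prod hcm hm (memLp_conj hφ) hφ
  have hmeas : Measurable fun q : (ℂ × ℂ) × ℝ =>
      ((q.2⁻¹ * (Real.exp (-(‖q.1.1 - q.1.2‖ ^ 2 * q.2)) - Real.exp (-(1 * q.2))) : ℝ) : ℂ) *
      (starRingEnd ℂ (φ q.1.1) * φ q.1.2) := by fun_prop
  rw [integrable_prod_iff hmeas.aestronglyMeasurable]
  constructor
  · filter_upwards [D.ae_prod_mem_curve] with p hp
    have h0 : 0 < ‖p.1 - p.2‖ ^ 2 := by
      have := norm_pos_iff.mpr (sub_ne_zero.mpr hp.2.2.symm)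
      positivity
    exact (Real.integrableOn_inv_mul_exp_sub_exp h0 one_pos).ofReal.mul_const _
  · refine (hk.norm.const_mul (4 * Real.pi)).congr ?_
    filter_upwards [D.ae_prod_mem_curve] with p hp
    have h0 := norm_pos_iff.mpr (sub_ne_zero.mpr hp.2.2.symm)
    simp only [norm_mul, Complex.norm_real, Real.norm_eq_abs]
    rw [integral_mul_const]
    simp only [← abs_mul]
    rw [Real.integral_abs_inv_mul_exp_sub_exp (by positivity) one_pos, singleLayerKernel, one_div (_ ^ 2),
      Real.log_inv, Real.log_pow, abs_neg, abs_mul, abs_mul, abs_of_nonneg (by positivity : 0 ≤ 1 / (2 * Real.pi))]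
    have := Real.pi_pos
    push_cast
    rw [abs_of_nonneg (by norm_num : (0:ℝ) ≤ 2)]
    field_simp
    ring

/-- In Frullani's integral the term exp(-s) does not depend on x, y and drops out because φ has mean
zero. -/
theorem neg_inner_singleLayer_eq (ha : 0 < a) (φ : D.L20) :
    Integrable (fun s : ℝ => ((s⁻¹ : ℝ) : ℂ) *
      ∫ p, starRingEnd ℂ ((φ : D.L2) p.1) * (φ : D.L2) p.2 * (Real.exp (-(s * ‖p.1 - p.2‖ ^ 2)) : ℂ)
        ∂(D.arcLength.prod D.arcLength)) (volume.restrict (Ioi 0)) ∧ -inner ℂ (φ : D.L2) (D.singleLayer φ) = (4 * Real.pi : ℂ)⁻¹ * ∫ s in Ioi (0 : ℝ), ((s⁻¹ : ℝ) : ℂ) *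
      ∫ p, starRingEnd ℂ ((φ : D.L2) p.1) * (φ : D.L2) p.2 * (Real.exp (-(s * ‖p.1 - p.2‖ ^ 2)) : ℂ)
        ∂(D.arcLength.prod D.arcLength) := by
  set f : ℂ → ℂ := ⇑(φ : D.L2) with hf
  have hfi : Integrable f D.arcLength := D.integrable_L2 φ
  have hf0 : ∫ x, f x ∂D.arcLength = 0 := φ.2
  have hg := integrable_gaussian_difference ha (measurable_coeFn (φ : D.L2)) (Lp.memLp (φ : D.L2))
  have hΦ : Integrable (fun p : ℂ × ℂ => starRingEnd ℂ (f p.1) * f p.2) (D.arcLength.prod D.arcLength) :=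
    hfi.starRingEnd.mul_prod hfi
  have hΦ0 : ∫ p : ℂ × ℂ, starRingEnd ℂ (f p.1) * f p.2 ∂(D.arcLength.prod D.arcLength) = 0 := by
    rw [integral_prod_mul (fun x => starRingEnd ℂ (f x)), hf0, mul_zero]
  have h1 : -inner ℂ (φ : D.L2) (D.singleLayer φ) = (4 * Real.pi : ℂ)⁻¹ *
      ∫ p, (∫ s in Ioi (0 : ℝ), ((s⁻¹ * (Real.exp (-(‖p.1 - p.2‖ ^ 2 * s)) - Real.exp (-(1 * s))) : ℝ) : ℂ) *
        (starRingEnd ℂ (f p.1) * f p.2)) ∂(D.arcLength.prod D.arcLength) := by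
    rw [inner_singleLayer ha, ← integral_neg, ← integral_const_mul]
    refine integral_congr_ae ?_
    filter_upwards [D.ae_prod_mem_curve] with p hp
    have h0 := norm_pos_iff.mpr (sub_ne_zero.mpr hp.2.2.symm)
    rw [integral_mul_const, integral_complex_ofReal, Real.integral_inv_mul_exp_sub_exp (by positivity) one_pos,
      one_div, Real.log_inv, Real.log_pow, singleLayerKernel]
    have : (Real.pi : ℂ) ≠ 0 := by exact_mod_cast Real.pi_ne_zero
    push_cast
    field_simp
    ring
  have hpt : ∀ s ∈ Ioi (0 : ℝ), ∫ p, ((s⁻¹ * (Real.exp (-(‖p.1 - p.2‖ ^ 2 * s)) - Real.exp (-(1 * s))) : ℝ) : ℂ) *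
      (starRingEnd ℂ (f p.1) * f p.2) ∂(D.arcLength.prod D.arcLength) = ((s⁻¹ : ℝ) : ℂ) *
      ∫ p, starRingEnd ℂ (f p.1) * f p.2 * (Real.exp (-(s * ‖p.1 - p.2‖ ^ 2)) : ℂ)
        ∂(D.arcLength.prod D.arcLength) := fun s (hs : 0 < s) => ?_
  · rw [h1, integral_integral_swap hg, setIntegral_congr_fun measurableSet_Ioi hpt]
    refine ⟨hg.integral_prod_right.congr ?_, rfl⟩
    filter_upwards [ae_restrict_mem measurableSet_Ioi] with s hs using hpt s hs
  have hb : Integrable (fun p : ℂ × ℂ => starRingEnd ℂ (f p.1) * f p.2 *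
      (Real.exp (-(s * ‖p.1 - p.2‖ ^ 2)) : ℂ)) (D.arcLength.prod D.arcLength) := by
    refine hΦ.mul_bdd (c := 1) (by fun_prop : Continuous fun p : ℂ × ℂ =>
      (Real.exp (-(s * ‖p.1 - p.2‖ ^ 2)) : ℂ)).aestronglyMeasurable (Eventually.of_forall fun p => ?_)
    rw [Complex.norm_real, Real.norm_eq_abs, Real.abs_exp, ← Real.exp_zero]
    exact Real.exp_le_exp.mpr (by nlinarith [sq_nonneg ‖p.1 - p.2‖])
  have e : ∀ p : ℂ × ℂ, ((s⁻¹ * (Real.exp (-(‖p.1 - p.2‖ ^ 2 * s)) - Real.exp (-(1 * s))) : ℝ) : ℂ) *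
      (starRingEnd ℂ (f p.1) * f p.2) = ((s⁻¹ : ℝ) : ℂ) * (starRingEnd ℂ (f p.1) * f p.2 *
      (Real.exp (-(s * ‖p.1 - p.2‖ ^ 2)) : ℂ) - (Real.exp (-(1 * s)) : ℂ) * (starRingEnd ℂ (f p.1) * f p.2)) := by
    intro p
    rw [mul_comm (‖p.1 - p.2‖ ^ 2)]
    push_cast
    ring
  simp only [e]
  rw [integral_const_mul, integral_sub hb (hΦ.const_mul _), integral_const_mul, hΦ0, mul_zero, sub_zero]

theorem exists_norm_sub_le_const (w : ℂ) : ∃ R : ℝ, ∀ᵐ y ∂D.arcLength, ‖y - w‖ ≤ R := by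
  obtain ⟨R, hR⟩ := D.isCompact_curve.isBounded.exists_norm_le
  exact ⟨R + ‖w‖, D.ae_mem_curve.mono fun y hy => (norm_sub_le _ _).trans (add_le_add (hR y hy) le_rfl)⟩

/-- The Cauchy transform as a superposition of Gaussian moments. -/
theorem integral_gaussian_moment (hφ : Integrable φ D.arcLength) (hm : Measurable φ) {w : ℂ} (hw : w ∉ D.curve) :
    ∫ s in Ioi (0 : ℝ), (∫ y, starRingEnd ℂ (y - w) * (Real.exp (-(s * ‖y - w‖ ^ 2)) : ℂ) * φ y ∂D.arcLength) =
      ∫ y, φ y * (y - w)⁻¹ ∂D.arcLength := by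
  obtain ⟨δ, hδ, hd⟩ := exists_dist_pos hw
  obtain ⟨R, hR⟩ := D.exists_norm_sub_le_const w
  have hi : Integrable (fun q : ℝ × ℂ => starRingEnd ℂ (q.2 - w) * (Real.exp (-(q.1 * ‖q.2 - w‖ ^ 2)) : ℂ) * φ q.2)
      ((volume.restrict (Ioi 0)).prod D.arcLength) := by
    have h1 : Integrable (fun s : ℝ => Real.exp (-(δ ^ 2) * s)) (volume.restrict (Ioi 0)) :=
      integrableOn_exp_mul_Ioi (neg_lt_zero.mpr (by positivity)) 0
    have h2 := (h1.mul_prod hφ.norm).const_mul R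
    refine h2.mono' ?_ ?_
    · have := Complex.continuous_conj
      refine Measurable.aestronglyMeasurable ?_
      fun_prop
    · have hs : ∀ᵐ q : ℝ × ℂ ∂((volume.restrict (Ioi (0:ℝ))).prod D.arcLength), q.1 ∈ Ioi (0 : ℝ) :=
        Measure.quasiMeasurePreserving_fst.ae (ae_restrict_mem measurableSet_Ioi)
      have hy : ∀ᵐ q : ℝ × ℂ ∂((volume.restrict (Ioi (0:ℝ))).prod D.arcLength), q.2 ∈ D.curve ∧ ‖q.2 - w‖ ≤ R :=
        Measure.quasiMeasurePreserving_snd.ae (D.ae_mem_curve.and hR)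
      filter_upwards [hs, hy] with q hq hq'
      rw [norm_mul, norm_mul, RCLike.norm_conj, Complex.norm_real, Real.norm_eq_abs, Real.abs_exp, mul_assoc]
      have hq0 : 0 < q.1 := hq
      have hdq := hd _ hq'.1
      have h3 : Real.exp (-(q.1 * ‖q.2 - w‖ ^ 2)) ≤ Real.exp (-(δ ^ 2) * q.1) := by
        refine Real.exp_le_exp.mpr ?_
        have : δ ^ 2 ≤ ‖q.2 - w‖ ^ 2 := by gcongr
        nlinarith
      have hR0 := (norm_nonneg _).trans hq'.2
      exact mul_le_mul hq'.2 (mul_le_mul_of_nonneg_right h3 (norm_nonneg _)) (by positivity) hR0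
  rw [integral_integral_swap hi]
  refine integral_congr_ae ?_
  filter_upwards [D.ae_mem_curve] with y hy
  have hne : y - w ≠ 0 := fun h => hw (sub_eq_zero.mp h ▸ hy)
  have hpos : 0 < ‖y - w‖ ^ 2 := by
    have := norm_pos_iff.mpr hne
    positivity
  have h1 : ∫ s in Ioi (0 : ℝ), Real.exp (-(s * ‖y - w‖ ^ 2)) = (‖y - w‖ ^ 2)⁻¹ := by
    have h := integral_exp_mul_Ioi (neg_lt_zero.mpr hpos) 0
    have h2 : ∀ s : ℝ, -(s * ‖y - w‖ ^ 2) = -‖y - w‖ ^ 2 * s := fun s => by ring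
    simp only [h2]
    rw [h, mul_zero, Real.exp_zero, neg_div_neg_eq, one_div]
  rw [integral_mul_const, integral_const_mul, integral_complex_ofReal, h1]
  have h5 : (‖y - w‖ : ℂ) ^ 2 = (y - w) * starRingEnd ℂ (y - w) := by
    rw [Complex.mul_conj, Complex.normSq_eq_norm_sq]; push_cast; rfl
  have hne' : starRingEnd ℂ (y - w) ≠ 0 := (map_ne_zero _).mpr hne
  push_cast
  rw [h5, mul_inv, ← mul_assoc, mul_comm (starRingEnd ℂ (y - w)), mul_assoc (y - w)⁻¹, mul_inv_cancel₀ hne']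
  ring

/-- The Gaussian forms are sums of squares of moments about any centre w. If the energy is zero, all
these moments vanish for almost every s; integrated over s, one of them is the Cauchy transform at
w, so φ vanishes. -/
theorem energyPosDef (ha : 0 < a) : D.EnergyPosDef := by
  refine ⟨fun φ ψ => inner_singleLayer_comm ha _ _, fun φ hφ => ?_⟩
  set f : ℂ → ℂ := ⇑(φ : D.L2) with hf
  have hfi : Integrable f D.arcLength := D.integrable_L2 φ
  have hfm : Measurable f := measurable_coeFn _
  set G : ℝ → ℂ := fun s => ∫ p, starRingEnd ℂ (f p.1) * f p.2 * (Real.exp (-(s * ‖p.1 - p.2‖ ^ 2)) : ℂ)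
        ∂(D.arcLength.prod D.arcLength) with hG
  have hsum := fun (w : ℂ) (s : ℝ) (hs : 0 ≤ s) =>
    Complex.reCLM.hasSum (hasSum_gaussian_form hfi (w := w) hs (D.exists_norm_sub_le_const w).choose_spec)
  simp only [Complex.reCLM_apply, Complex.ofReal_re] at hsum
  have hG0 : ∀ s, 0 ≤ s → 0 ≤ (G s).re := fun s hs => (hsum 0 s hs).nonneg fun k => by positivity
  obtain ⟨hint, heq⟩ := neg_inner_singleLayer_eq ha φ
  have hre : (-inner ℂ (φ : D.L2) (D.singleLayer φ)).re = (4 * Real.pi)⁻¹ * ∫ s in Ioi (0 : ℝ), s⁻¹ * (G s).re := by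
    have h1 := Complex.reCLM.integral_comp_comm hint
    simp only [Complex.reCLM_apply, Complex.re_ofReal_mul] at h1
    rw [heq, h1]
    have e : (4 * Real.pi : ℂ)⁻¹ = ((4 * Real.pi)⁻¹ : ℝ) := by push_cast; rfl
    rw [e, Complex.re_ofReal_mul]
  have hrint : Integrable (fun s : ℝ => s⁻¹ * (G s).re) (volume.restrict (Ioi 0)) := by
    have := hint.re
    simpa only [RCLike.re_to_complex, Complex.re_ofReal_mul] using this
  have hnn : 0 ≤ᵐ[volume.restrict (Ioi 0)] fun s : ℝ => s⁻¹ * (G s).re := by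
    filter_upwards [ae_restrict_mem measurableSet_Ioi] with s (hs : 0 < s)
    exact mul_nonneg (by positivity) (hG0 s hs.le)
  rw [hre]
  refine mul_pos (by positivity) ((integral_nonneg_of_ae hnn).lt_of_ne' fun h0 => hφ ?_)
  have hzero := (integral_eq_zero_iff_of_nonneg_ae hnn hrint).mp h0
  have hf0 := D.ae_eq_zero_of_cauchyTransform hfi fun w hw => by
    rw [← integral_gaussian_moment hfi hfm hw]
    refine integral_eq_zero_of_ae ?_
    filter_upwards [hzero, ae_restrict_mem measurableSet_Ioi] with s hs (hs0 : 0 < s)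
    have h1 : (G s).re = 0 := (mul_eq_zero.mp hs).resolve_left (inv_ne_zero hs0.ne')
    have h2 := hsum w s hs0.le
    change HasSum _ (G s).re at h2
    rw [h1, hasSum_zero_iff_of_nonneg fun k => by positivity] at h2
    -- The moment with weight conj (y - w), whose integral over s is the Cauchy kernel by
    -- `integral_gaussian_moment`.
    have h3 := congrFun h2 (1, 0)
    simp only [pow_one, pow_zero, mul_one, Nat.factorial_one, Nat.cast_one, div_one, Nat.factorial_zero,
      Pi.zero_apply] at h3
    exact norm_eq_zero.mp (pow_eq_zero_iff two_ne_zero |>.mp ((mul_eq_zero.mp h3).resolve_left hs0.ne'))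
  exact Subtype.ext (Lp.ext (hf0.trans (Lp.coeFn_zero ℂ 2 D.arcLength).symm))

end PlanarDomain

/-! ### The energy space: conjugation, dipoles and reflection. -/

namespace PlanarDomain

variable {a : ℝ} {D : PlanarDomain a} {φ ψ : D.L20}

theorem isClosed_L20 : IsClosed (D.L20 : Set D.L2) := by
  have h : Continuous fun φ : D.L2 => inner ℂ ((memLp_const 1 : MemLp (fun _ : ℂ => (1 : ℂ)) 2 D.arcLength).toLp) φ := by
    fun_prop
  convert! (isClosed_singleton (x := (0 : ℂ))).preimage h using 1
  ext φ
  change ∫ x, φ x ∂D.arcLength = 0 ↔ inner ℂ _ φ = 0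
  rw [inner_eq_integral]
  refine Eq.congr (integral_congr_ae ?_) rfl
  filter_upwards [(memLp_const 1 : MemLp (fun _ : ℂ => (1 : ℂ)) 2 D.arcLength).coeFn_toLp] with x hx
  rw [hx, map_one, one_mul]

instance : CompleteSpace D.L20 := isClosed_L20.completeSpace_coe

instance : SecondCountableTopology D.L2 := by
  have : Fact ((2 : ENNReal) ≠ ⊤) := ⟨by simp⟩
  infer_instance

theorem L20_ext (h : (φ : D.L2) =ᵐ[D.arcLength] (ψ : D.L2)) : φ = ψ := Subtype.ext (Lp.ext h)

variable (D) in
/-- The element of `L²₀` given by a function. -/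
noncomputable def mkL20 (f : ℂ → ℂ) (hf : MemLp f 2 D.arcLength) (h0 : ∫ x, f x ∂D.arcLength = 0) : D.L20 :=
  ⟨hf.toLp, by
    change ∫ x, _ ∂D.arcLength = 0
    rw [integral_congr_ae hf.coeFn_toLp, h0]⟩

theorem coeFn_mkL20 {f : ℂ → ℂ} (hf : MemLp f 2 D.arcLength) (h0 : ∫ x, f x ∂D.arcLength = 0) :
    ((D.mkL20 f hf h0 : D.L20) : D.L2) =ᵐ[D.arcLength] f := hf.coeFn_toLp

variable (D) in
/-- The dipole at a point off the curve as an element of `L²₀`. -/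
noncomputable def dipoleL20 (v : (D.curveᶜ : Set ℂ)) : D.L20 :=
  D.mkL20 (D.dipole v) (memLp_dipole v.2) (integral_inv_sub_sq_tangent v.2)

/-- Complex conjugation on `L²₀`. -/
noncomputable def conjL20 (φ : D.L20) : D.L20 :=
  D.mkL20 (fun x => starRingEnd ℂ ((φ : D.L2) x)) (memLp_conj (Lp.memLp _)) <| by
    rw [integral_conj, (φ.2 : ∫ x, (φ : D.L2) x ∂D.arcLength = 0), map_zero]

theorem coeFn_conjL20 (φ : D.L20) :
    (conjL20 φ : D.L2) =ᵐ[D.arcLength] fun x => starRingEnd ℂ ((φ : D.L2) x) := coeFn_mkL20 _ _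

theorem conjL20_add (φ ψ : D.L20) : conjL20 (φ + ψ) = conjL20 φ + conjL20 ψ := by
  refine L20_ext ?_
  filter_upwards [coeFn_conjL20 (φ + ψ), coeFn_conjL20 φ, coeFn_conjL20 ψ, Lp.coeFn_add (φ : D.L2) ψ,
    Lp.coeFn_add (conjL20 φ : D.L2) (conjL20 ψ)] with x h1 h2 h3 h4 h5
  rw [h1, Submodule.coe_add, h4, Submodule.coe_add, h5, Pi.add_apply, Pi.add_apply, h2, h3, map_add]

theorem conjL20_smul (c : ℂ) (φ : D.L20) : conjL20 (c • φ) = starRingEnd ℂ c • conjL20 φ := by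
  refine L20_ext ?_
  filter_upwards [coeFn_conjL20 (c • φ), coeFn_conjL20 φ, Lp.coeFn_smul c (φ : D.L2),
    Lp.coeFn_smul (starRingEnd ℂ c) (conjL20 φ : D.L2)] with x h1 h2 h3 h4
  rw [h1, Submodule.coe_smul, h3, Submodule.coe_smul, h4, Pi.smul_apply, Pi.smul_apply, h2, smul_eq_mul,
    smul_eq_mul, map_mul]

theorem conjL20_conjL20 (φ : D.L20) : conjL20 (conjL20 φ) = φ := by
  refine L20_ext ?_
  filter_upwards [coeFn_conjL20 (conjL20 φ), coeFn_conjL20 φ] with x h1 h2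
  rw [h1, h2, Complex.conj_conj]

theorem inner_toEnergy (ha : 0 < a) (φ ψ : D.L20) :
    inner ℂ (D.toEnergy φ) (D.toEnergy ψ) = -inner ℂ (φ : D.L2) (D.singleLayer ψ) := by
  have h : inner ℂ (D.toEnergy φ) (D.toEnergy ψ) = D.energyInner φ ψ :=
    UniformSpace.Completion.inner_coe (𝕜 := ℂ) (E := D.PreEnergy) φ ψ
  rw [h, energyInner, if_pos (energyPosDef ha)]

/-- The energy inner product through a potential. -/
theorem inner_toEnergy_eq (ha : 0 < a) (φ ψ : D.L20) {f : ℂ → ℂ} (hfm : Measurable f)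
    (hf : (φ : D.L2) =ᵐ[D.arcLength] fun x => starRingEnd ℂ (f x)) :
    inner ℂ (D.toEnergy φ) (D.toEnergy ψ) = -∫ x, D.singleLayerFun f x * (ψ : D.L2) x ∂D.arcLength := by
  obtain ⟨M, hM⟩ := exists_isSchurKernel_singleLayer (D := D) ha
  have hfL : MemLp f 2 D.arcLength := by
    have := memLp_conj ((memLp_congr_ae hf).mp (Lp.memLp (φ : D.L2)))
    simpa only [Complex.conj_conj] using this
  rw [inner_toEnergy ha, inner_eq_integral]
  congr 1
  have h := hM.integral_mul_apply' (D.isIntegralOperator_singleLayer ha) hfm hfL ψ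
  simp only [singleLayerKernel_comm _, singleLayerFun] at h ⊢
  rw [← h]
  refine integral_congr_ae ?_
  filter_upwards [hf] with x hx
  rw [hx, Complex.conj_conj]

theorem continuous_toEnergy (ha : 0 < a) : Continuous D.toEnergy := by
  refine (D.toEnergy.mkContinuous (√‖D.singleLayer‖) fun φ => ?_).continuous
  have h1 : ‖D.toEnergy φ‖ ^ 2 ≤ ‖D.singleLayer‖ * ‖φ‖ ^ 2 := by
    rw [← inner_self_eq_norm_sq (𝕜 := ℂ), inner_toEnergy ha]
    refine (RCLike.re_le_norm _).trans ?_
    rw [norm_neg]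
    refine (norm_inner_le_norm _ _).trans ?_
    have := D.singleLayer.le_opNorm φ
    rw [Submodule.norm_coe] at *
    nlinarith [norm_nonneg φ]
  rw [← Real.sqrt_sq (norm_nonneg φ), ← Real.sqrt_mul (norm_nonneg _)]
  exact Real.le_sqrt_of_sq_le h1

theorem injective_toEnergy (ha : 0 < a) : Function.Injective D.toEnergy := by
  rw [injective_iff_map_eq_zero]
  intro φ h
  by_contra hne
  have h1 := (energyPosDef ha).2 φ hne
  rw [← inner_toEnergy ha, h, inner_zero_left] at h1
  exact lt_irrefl _ h1

theorem denseRange_toEnergy : DenseRange D.toEnergy :=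
  UniformSpace.Completion.denseRange_coe (α := D.PreEnergy)

theorem singleLayerFun_conj (f : ℂ → ℂ) (x : ℂ) :
    D.singleLayerFun (fun y => starRingEnd ℂ (f y)) x = starRingEnd ℂ (D.singleLayerFun f x) := by
  rw [singleLayerFun, singleLayerFun, ← integral_conj]
  simp only [map_mul, Complex.conj_ofReal]

theorem inner_toEnergy_conjL20 (ha : 0 < a) (φ ψ : D.L20) :
    inner ℂ (D.toEnergy (conjL20 φ)) (D.toEnergy (conjL20 ψ)) = inner ℂ (D.toEnergy ψ) (D.toEnergy φ) := by
  have h1 : (φ : D.L2) =ᵐ[D.arcLength] fun x => starRingEnd ℂ (starRingEnd ℂ ((φ : D.L2) x)) := by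
    simp only [Complex.conj_conj]; exact EventuallyEq.rfl
  rw [← inner_conj_symm (D.toEnergy ψ), inner_toEnergy_eq ha _ _ (measurable_coeFn _) (coeFn_conjL20 φ),
    inner_toEnergy_eq ha φ ψ (Complex.continuous_conj.measurable.comp (measurable_coeFn (φ : D.L2))) h1, map_neg,
    ← integral_conj]
  congr 1
  refine integral_congr_ae ?_
  filter_upwards [coeFn_conjL20 ψ] with x hx
  have := singleLayerFun_conj (D := D) (φ : D.L2) x
  simp only [Function.comp_def]
  rw [this, hx, map_mul, Complex.conj_conj]

/-- Complex conjugation on the energy space. -/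
theorem exists_energyConj (ha : 0 < a) : ∃ J : D.Energy → D.Energy, (∀ φ, J (D.toEnergy φ) = D.toEnergy (conjL20 φ)) ∧
    (∀ x y, J (x + y) = J x + J y) ∧ (∀ (c : ℂ) x, J (c • x) = starRingEnd ℂ c • J x) ∧
    (∀ x, J (J x) = x) ∧ ∀ x y, inner ℂ (J x) (J y) = inner ℂ y x := by
  have hsub : ∀ φ ψ : D.L20, conjL20 (φ - ψ) = conjL20 φ - conjL20 ψ := fun φ ψ => by
    have h := conjL20_smul (-1) ψ
    simp only [map_neg, map_one, neg_smul, one_smul] at h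
    rw [sub_eq_add_neg, conjL20_add, h, sub_eq_add_neg]
  have hn : ∀ φ : D.L20, ‖D.toEnergy (conjL20 φ)‖ = ‖D.toEnergy φ‖ := fun φ => by
    have h := inner_toEnergy_conjL20 ha φ φ
    rw [inner_self_eq_norm_sq_to_K, inner_self_eq_norm_sq_to_K] at h
    have h2 : ‖D.toEnergy (conjL20 φ)‖ ^ 2 = ‖D.toEnergy φ‖ ^ 2 := by exact_mod_cast h
    exact (pow_left_inj₀ (norm_nonneg _) (norm_nonneg _) two_ne_zero).mp h2
  have hc : ∀ φ : D.L20, ‖D.toEnergy φ‖ = ‖(show D.PreEnergy from φ)‖ := fun φ =>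
    UniformSpace.Completion.norm_coe (E := D.PreEnergy) φ
  let j : D.PreEnergy → D.PreEnergy := fun φ => (conjL20 (φ : D.L20) : D.L20)
  have hj : Isometry j := Isometry.of_dist_eq fun x y => by
    rw [dist_eq_norm, dist_eq_norm]
    have h1 := hn (show D.L20 from x - y)
    rw [hc, hc] at h1
    have h2 : j x - j y = (conjL20 (show D.L20 from x - y) : D.L20) := (hsub x y).symm
    rw [h2]
    exact h1
  obtain ⟨J, hJ, hJc⟩ : ∃ J : D.Energy → D.Energy, (∀ φ, J (D.toEnergy φ) = D.toEnergy (conjL20 φ)) ∧ Continuous J :=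
    ⟨UniformSpace.Completion.map j, fun φ => UniformSpace.Completion.map_coe hj.uniformContinuous (φ : D.PreEnergy),
      UniformSpace.Completion.continuous_map⟩
  clear_value j
  have hd := D.denseRange_toEnergy
  refine ⟨J, hJ, fun x y => ?_, fun c x => ?_, fun x => ?_, fun x y => ?_⟩
  · refine hd.induction_on₂ (isClosed_eq (by fun_prop) (by fun_prop)) (fun φ ψ => ?_) x y
    rw [← map_add, hJ, hJ, hJ, conjL20_add, map_add]
  · refine hd.induction_on x (isClosed_eq (hJc.comp (continuous_const_smul c)) ((continuous_const_smul (starRingEnd ℂ c)).comp hJc)) fun φ => ?_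
    rw [← map_smul, hJ, hJ, conjL20_smul, map_smul]
  · refine hd.induction_on x (isClosed_eq (by fun_prop) (by fun_prop)) fun φ => ?_
    rw [hJ, hJ, conjL20_conjL20]
  · refine hd.induction_on₂ (isClosed_eq (by fun_prop) (by fun_prop)) (fun φ ψ => ?_) x y
    rw [hJ, hJ, inner_toEnergy_conjL20 ha]

theorem coeFn_dipoleL20 (v : (D.curveᶜ : Set ℂ)) : (D.dipoleL20 v : D.L2) =ᵐ[D.arcLength] D.dipole v :=
  coeFn_mkL20 _ _

/-- If φ is orthogonal to all dipoles, the Cauchy integral of conj φ is constant on each side; so φ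
is constant, and its mean is zero. -/
theorem topologicalClosure_span_dipoleL20 (ha : 0 < a) :
    (Submodule.span ℂ (range D.dipoleL20)).topologicalClosure = ⊤ := by
  rw [Submodule.topologicalClosure_eq_top_iff, Submodule.eq_bot_iff]
  intro φ hφ
  have h0 : ∀ v ∉ D.curve, ∫ y, starRingEnd ℂ ((φ : D.L2) y) * D.dipole v y ∂D.arcLength = 0 := fun v hv => by
    have h := (Submodule.mem_orthogonal' _ _).mp hφ _ (Submodule.subset_span ⟨⟨v, hv⟩, rfl⟩)
    rw [Submodule.coe_inner, inner_eq_integral] at h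
    rw [← h]
    refine integral_congr_ae ?_
    filter_upwards [coeFn_dipoleL20 ⟨v, hv⟩] with y hy
    rw [hy]
  have hi := (D.integrable_L2 φ).starRingEnd
  obtain ⟨c, hc⟩ := exists_cauchyIntegral_carrier hi fun v hv => h0 v (D.carrier_subset hv)
  have h1 := cauchyIntegral_exterior_eq_zero ha hi fun v hv => h0 v (D.exterior_subset hv)
  have h2 := ae_eq_const_of_cauchyIntegral ha hi hc h1
  rw [← inner_self_eq_zero (𝕜 := ℂ), Submodule.coe_inner, inner_eq_integral]
  have h3 : ∫ x, starRingEnd ℂ ((φ : D.L2) x) * (φ : D.L2) x ∂D.arcLength =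
      ∫ x, c / (2 * Real.pi * Complex.I) * (φ : D.L2) x ∂D.arcLength := by
    refine integral_congr_ae ?_
    filter_upwards [h2] with x hx
    rw [hx]
  rw [h3, integral_const_mul, (φ.2 : ∫ x, (φ : D.L2) x ∂D.arcLength = 0), mul_zero]

theorem inner_dipole (ha : 0 < a) (v : (D.curveᶜ : Set ℂ)) (ψ : D.L20) :
    inner ℂ (D.toEnergy (D.dipoleL20 v)) (D.toEnergy ψ) =
      -∫ x, starRingEnd ℂ (D.singleLayerFun (D.dipole v) x) * (ψ : D.L2) x ∂D.arcLength := by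
  rw [inner_toEnergy_eq ha _ ψ (f := fun y => starRingEnd ℂ (D.dipole v y))
    (Complex.continuous_conj.measurable.comp measurable_dipole)]
  · simp only [singleLayerFun_conj]
  · simp only [Complex.conj_conj]
    exact coeFn_dipoleL20 v

theorem inner_conj_dipole (ha : 0 < a) (v : (D.curveᶜ : Set ℂ)) (ψ : D.L20) :
    inner ℂ (D.toEnergy (conjL20 (D.dipoleL20 v))) (D.toEnergy ψ) =
      -∫ x, D.singleLayerFun (D.dipole v) x * (ψ : D.L2) x ∂D.arcLength := by
  refine inner_toEnergy_eq ha _ ψ measurable_dipole ?_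
  filter_upwards [coeFn_conjL20 (D.dipoleL20 v), coeFn_dipoleL20 v] with x h1 h2
  rw [h1, h2]

/-- The reflection that separates the dipoles in the domain from the dipoles outside. -/
theorem exists_energyReflection (ha : 0 < a) (ha1 : a ≤ 1) : ∃ Q : D.Energy →L[ℂ] D.Energy,
    (∀ x y, inner ℂ (Q x) y = inner ℂ x (Q y)) ∧ (∀ x, Q (Q x) = x) ∧
    ∀ v, Q (D.toEnergy (D.dipoleL20 v)) = (-D.side v : ℂ) • D.toEnergy (D.dipoleL20 v) := by
  -- Q is the reflection in the closed span of the dipoles with poles in the domain.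
  set K : Submodule ℂ D.Energy := (Submodule.span ℂ
    ((fun v => D.toEnergy (D.dipoleL20 v)) '' {v | D.side v = -1})).topologicalClosure with hK
  have : CompleteSpace K := (Submodule.isClosed_topologicalClosure _).completeSpace_coe
  have hQQ := K.reflection_reflection
  refine ⟨K.reflection.toContinuousLinearEquiv, fun x y => ?_, hQQ, fun v => ?_⟩
  · have h := K.reflection.inner_map_map x (K.reflection y)
    rw [hQQ] at h
    exact h
  · by_cases hv : D.side v = -1
    · have : D.toEnergy (D.dipoleL20 v) ∈ K :=
        Submodule.le_topologicalClosure _ (Submodule.subset_span ⟨v, hv, rfl⟩)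
      rw [hv]
      simpa using K.reflection_mem_subspace_eq_self this
    · have hv1 : D.side v = 1 := by rw [side_eq_neg (by norm_num) hv, neg_neg]
      -- Dipoles with poles outside are orthogonal to the inner ones for the energy, so Q reverses
      -- them.
      have : D.toEnergy (D.dipoleL20 v) ∈ Kᗮ := by
        rw [hK, Submodule.orthogonal_closure, Submodule.mem_orthogonal]
        intro u hu
        refine Submodule.span_induction (p := fun u _ => inner ℂ u (D.toEnergy (D.dipoleL20 v)) = 0)
          ?_ (inner_zero_left _) (fun x y _ _ h1 h2 => by rw [inner_add_left, h1, h2, add_zero])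
          (fun c x _ h => by rw [inner_smul_left, h, mul_zero]) hu
        rintro _ ⟨w, hw, rfl⟩
        rw [inner_dipole ha, neg_eq_zero, ← integral_conj_singleLayerFun_dipole_mul_dipole ha ha1 w.2 v.2
          (by rw [hw, hv1]; norm_num)]
        refine integral_congr_ae ?_
        filter_upwards [coeFn_dipoleL20 v] with x hx
        rw [hx]
      rw [hv1]
      simpa using Submodule.reflection_mem_subspace_orthogonalComplement_eq_neg this

end PlanarDomain

/-! ### The mean of a reflection and its conjugate. -/

section Abstract

variable {H : Type*} [NormedAddCommGroup H] [InnerProductSpace ℂ H]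

/-- J Q J is complex linear because the two conjugations cancel, and symmetric because J reverses
inner products. -/
theorem exists_average_conj {Q : H →L[ℂ] H} (hQs : ∀ x y, inner ℂ (Q x) y = inner ℂ x (Q y)) {J : H → H}
    (hJa : ∀ x y, J (x + y) = J x + J y) (hJc : ∀ (c : ℂ) x, J (c • x) = starRingEnd ℂ c • J x)
    (hJJ : ∀ x, J (J x) = x) (hJi : ∀ x y, inner ℂ (J x) (J y) = inner ℂ y x) :
    ∃ A : H →L[ℂ] H, (∀ x, (4 : ℂ) • A x = Q x + J (Q (J x))) ∧ ∀ x y, inner ℂ (A x) y = inner ℂ x (A y) := by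
  have hJn : ∀ x, ‖J x‖ = ‖x‖ := fun x => by
    rw [← sq_eq_sq₀ (norm_nonneg _) (norm_nonneg _)]
    have h1 := hJi x x
    rw [inner_self_eq_norm_sq_to_K, inner_self_eq_norm_sq_to_K] at h1
    exact_mod_cast h1
  let R : H →L[ℂ] H := LinearMap.mkContinuous
    { toFun := fun x => J (Q (J x))
      map_add' := fun x y => by rw [hJa, map_add, hJa]
      map_smul' := fun c x => by rw [hJc, map_smul, hJc, Complex.conj_conj]; rfl } ‖Q‖ fun x => by
      change ‖J (Q (J x))‖ ≤ _
      rw [hJn, ← hJn x]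
      exact Q.le_opNorm _
  have hR : ∀ x, R x = J (Q (J x)) := fun _ => rfl
  have hRs : ∀ x y, inner ℂ (R x) y = inner ℂ x (R y) := fun x y => by
    rw [hR, hR]
    nth_rewrite 1 [← hJJ y]
    nth_rewrite 2 [← hJJ x]
    rw [hJi, hJi, hQs]
  refine ⟨(4⁻¹ : ℂ) • (Q + R), fun x => ?_, fun x y => ?_⟩
  · simp [hR, smul_smul]
  · simp only [smul_apply, add_apply, inner_smul_left, inner_smul_right, inner_add_left, inner_add_right, hQs, hRs]
    simp only [map_inv₀, map_ofNat]

/-- Two vectors of equal length whose sum has twice that length coincide, by the parallelogram law.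
-/
theorem eq_smul_of_average {Q : H →L[ℂ] H} (hQs : ∀ x y, inner ℂ (Q x) y = inner ℂ x (Q y))
    (hQQ : ∀ x, Q (Q x) = x) {J : H → H} (hJi : ∀ x y, inner ℂ (J x) (J y) = inner ℂ y x) {κ : ℝ} (hκ : κ * κ = 1) {x : H}
    (hx : Q x + J (Q (J x)) = (2 * κ : ℂ) • x) : Q x = (κ : ℂ) • x ∧ J (Q (J x)) = (κ : ℂ) • x := by
  have hJn : ∀ x, ‖J x‖ = ‖x‖ := fun x => by
    rw [← sq_eq_sq₀ (norm_nonneg _) (norm_nonneg _)]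
    have h1 := hJi x x
    rw [inner_self_eq_norm_sq_to_K, inner_self_eq_norm_sq_to_K] at h1
    exact_mod_cast h1
  have hQn : ∀ x, ‖Q x‖ = ‖x‖ := fun x => by
    rw [← sq_eq_sq₀ (norm_nonneg _) (norm_nonneg _)]
    have h1 := hQs x (Q x)
    rw [hQQ, inner_self_eq_norm_sq_to_K, inner_self_eq_norm_sq_to_K] at h1
    exact_mod_cast h1
  have h := parallelogram_law_with_norm ℂ (Q x) (J (Q (J x)))
  have hκn : ‖(2 * κ : ℂ)‖ * ‖(2 * κ : ℂ)‖ = 4 := by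
    rw [← norm_mul, show (2 * κ : ℂ) * (2 * κ) = 4 * (κ * κ : ℝ) by push_cast; ring, hκ]
    norm_num
  rw [hx, norm_smul, hJn, hQn, hQn, hJn] at h
  have h0 : ‖Q x - J (Q (J x))‖ = 0 := by
    have : ‖Q x - J (Q (J x))‖ * ‖Q x - J (Q (J x))‖ = 0 := by nlinarith
    exact mul_self_eq_zero.mp this
  have h1 := sub_eq_zero.mp (norm_eq_zero.mp h0)
  have h2 : Q x = (κ : ℂ) • x := by
    rw [← h1, ← two_smul ℂ, mul_smul] at hx
    exact smul_right_injective H (two_ne_zero (α := ℂ)) hx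
  exact ⟨h2, h1 ▸ h2⟩

end Abstract

/-! ### The Neumann-Poincaré operator as such a mean; exclusion of ±1/2. -/

namespace PlanarDomain

variable {a : ℝ} {D : PlanarDomain a}

/-- Dual form of the fact that the double layer potential of 1 is 1/2. -/
theorem integral_npOperator (ha : 0 < a) (ha1 : a ≤ 1) (φ : D.L2) :
    ∫ x, D.npOperator φ x ∂D.arcLength = 1 / 2 * ∫ x, φ x ∂D.arcLength := by
  obtain ⟨M, hM⟩ := exists_isSchurKernel_np (D := D) ha ha1
  have h := hM.integral_mul_apply' (D.isIntegralOperator_npOperator ha ha1) (φ := fun _ => 1) measurable_const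
    (memLp_const 1) φ
  simp only [one_mul, mul_one] at h
  rw [h, ← integral_const_mul]
  refine integral_congr_ae ?_
  filter_upwards [D.ae_mem_curve] with y hy
  rw [D.integral_npKernel ha hy]

theorem exists_npL20 (ha : 0 < a) (ha1 : a ≤ 1) : ∃ T : D.L20 →L[ℂ] D.L20,
    (∀ φ, (T φ : D.L2) = D.npOperator φ) ∧ IsCompactOperator T := by
  have h : ∀ φ : D.L20, (D.npOperator ∘L D.L20.subtypeL) φ ∈ D.L20 := fun φ => by
    change ∫ x, D.npOperator φ x ∂D.arcLength = 0
    rw [integral_npOperator ha ha1, (φ.2 : ∫ x, (φ : D.L2) x ∂D.arcLength = 0), mul_zero]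
  refine ⟨(D.npOperator ∘L D.L20.subtypeL).codRestrict D.L20 h, fun φ => rfl, ?_⟩
  exact ((D.isCompactOperator_npOperator ha ha1).comp_clm D.L20.subtypeL).codRestrict h isClosed_L20

theorem integral_mul_npOperator (ha : 0 < a) (ha1 : a ≤ 1) {u : ℂ → ℂ} (hum : Measurable u)
    (hu : MemLp u 2 D.arcLength) (ψ : D.L2) : ∫ x, u x * D.npOperator ψ x ∂D.arcLength =
      ∫ x, D.doubleLayerFun u x * ψ x ∂D.arcLength := by
  obtain ⟨M, hM⟩ := exists_isSchurKernel_np (D := D) ha ha1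
  exact hM.integral_mul_apply' (D.isIntegralOperator_npOperator ha ha1) hum hu ψ

theorem IsHolder.memLp {u : ℂ → ℂ} (hu : D.IsHolder u) : MemLp u 2 D.arcLength := by
  obtain ⟨B, -, hB⟩ := hu.exists_norm_le
  exact MemLp.of_bound hu.measurable.aestronglyMeasurable B (D.ae_mem_curve.mono hB)

theorem arcLength_ne_zero (ha : 0 < a) : D.arcLength ≠ 0 := fun h => by
  have := D.integral_npKernel ha (x := D.z 0) ⟨0, rfl⟩
  rw [h, integral_zero_measure] at this
  norm_num at this

/-- L²₀ is the kernel of a functional on L², which contains the polynomials faithfully: arc length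
has no atoms, so it does not charge the finitely many roots. -/
theorem not_finiteDimensional_L20 (ha : 0 < a) : ¬ FiniteDimensional ℂ D.L20 := by
  intro hfin
  have hp : ∀ p : Polynomial ℂ, MemLp (fun y => p.eval y) 2 D.arcLength := fun p => by
    obtain ⟨B, hB⟩ := D.isCompact_curve.exists_bound_of_continuousOn p.continuous.continuousOn
    exact MemLp.of_bound p.continuous.aestronglyMeasurable B (D.ae_mem_curve.mono hB)
  let ℓ : D.L2 →ₗ[ℂ] ℂ :=
    { toFun := fun φ => ∫ x, φ x ∂D.arcLength
      map_add' := fun φ ψ => by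
        rw [← integral_add (D.integrable_L2 φ) (D.integrable_L2 ψ)]
        exact integral_congr_ae (Lp.coeFn_add φ ψ)
      map_smul' := fun c φ => by
        rw [RingHom.id_apply, smul_eq_mul, ← integral_const_mul]
        exact integral_congr_ae (Lp.coeFn_smul c φ) }
  have hker : ℓ.ker = D.L20 := rfl
  have : Module.Finite ℂ (D.L2 ⧸ D.L20) := hker ▸ Module.Finite.equiv ℓ.quotKerEquivRange.symm
  have : Module.Finite ℂ D.L2 := Module.Finite.of_submodule_quotient D.L20
  let P : Polynomial ℂ →ₗ[ℂ] D.L2 :=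
    { toFun := fun p => (hp p).toLp
      map_add' := fun p q => by
        refine Lp.ext ?_
        filter_upwards [(hp (p + q)).coeFn_toLp, (hp p).coeFn_toLp, (hp q).coeFn_toLp,
          Lp.coeFn_add (hp p).toLp (hp q).toLp] with x h1 h2 h3 h4
        rw [h1, h4, Pi.add_apply, h2, h3, Polynomial.eval_add]
      map_smul' := fun c p => by
        refine Lp.ext ?_
        filter_upwards [(hp (c • p)).coeFn_toLp, (hp p).coeFn_toLp, Lp.coeFn_smul c (hp p).toLp] with x h1 h2 h3
        rw [h1, RingHom.id_apply, h3, Pi.smul_apply, h2, Polynomial.eval_smul] }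
  refine Polynomial.not_finite (R := ℂ) (Module.Finite.of_injective P ?_)
  rw [injective_iff_map_eq_zero]
  intro p h0
  by_contra hne
  have h1 : ∀ᵐ x ∂D.arcLength, p.eval x = 0 := by
    have h2 : ((hp p).toLp : D.L2) = 0 := h0
    filter_upwards [(hp p).coeFn_toLp, Lp.coeFn_zero ℂ 2 D.arcLength] with x h3 h4
    rw [← h3, h2, h4, Pi.zero_apply]
  have h2 : ∀ᵐ x ∂D.arcLength, ∀ y ∈ p.roots.toFinset, x ≠ y :=
    (Finset.eventually_all _).mpr fun y _ => ae_ne y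
  have h3 : ∀ᵐ x ∂D.arcLength, False := by
    filter_upwards [h1, h2] with x hx hx'
    exact hx' x (by simpa [hne] using hx) rfl
  exact arcLength_ne_zero (D := D) ha (ae_eq_bot.mp (Filter.eventually_false_iff_eq_bot.mp h3))

theorem eq_zero_of_inner_dipole (ha : 0 < a) {x : D.Energy}
    (h : ∀ v, inner ℂ x (D.toEnergy (D.dipoleL20 v)) = 0) : x = 0 := by
  have hspan := Submodule.dense_iff_topologicalClosure_eq_top.mpr (topologicalClosure_span_dipoleL20 (D := D) ha)
  have := ContinuousLinearMap.ext_on hspan (f := innerSL ℂ x ∘L ⟨D.toEnergy, continuous_toEnergy ha⟩) (g := 0) <| by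
    rintro _ ⟨v, rfl⟩
    exact h v
  exact D.denseRange_toEnergy.eq_zero_of_inner_left ℂ fun φ => DFunLike.congr_fun this φ

/-- The operator on the energy space that is built from the reflection extends the Neumann-Poincaré operator. -/
theorem average_toEnergy (ha : 0 < a) (ha1 : a ≤ 1) {T : D.L20 →L[ℂ] D.L20}
    (hT : ∀ φ, (T φ : D.L2) = D.npOperator φ) {Q A : D.Energy →L[ℂ] D.Energy} {J : D.Energy → D.Energy}
    (hQs : ∀ x y, inner ℂ (Q x) y = inner ℂ x (Q y))
    (hQ : ∀ v, Q (D.toEnergy (D.dipoleL20 v)) = (-D.side v : ℂ) • D.toEnergy (D.dipoleL20 v))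
    (hJ : ∀ φ, J (D.toEnergy φ) = D.toEnergy (conjL20 φ)) (hJJ : ∀ x, J (J x) = x)
    (hJi : ∀ x y, inner ℂ (J x) (J y) = inner ℂ y x)
    (hA : ∀ x, (4 : ℂ) • A x = Q x + J (Q (J x))) (φ : D.L20) : A (D.toEnergy φ) = D.toEnergy (T φ) := by
  have hspan := Submodule.dense_iff_topologicalClosure_eq_top.mpr (topologicalClosure_span_dipoleL20 (D := D) ha)
  let ι : D.L20 →L[ℂ] D.Energy := ⟨D.toEnergy, continuous_toEnergy ha⟩
  suffices h : A ∘L ι = ι ∘L T from DFunLike.congr_fun h φ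
  refine ContinuousLinearMap.ext_on hspan ?_
  rintro _ ⟨w, rfl⟩
  change A (D.toEnergy (D.dipoleL20 w)) = D.toEnergy (T (D.dipoleL20 w))
  rw [← sub_eq_zero]
  set x := A (D.toEnergy (D.dipoleL20 w)) - D.toEnergy (T (D.dipoleL20 w)) with hx
  suffices h : J x = 0 by
    have h0 := hJi x x
    rw [h, inner_zero_left] at h0
    exact inner_self_eq_zero.mp h0.symm
  -- By density it suffices to compare both operators on a dipole at w, tested against the conjugate
  -- of a dipole at v. Both give -(`side v` + `side w`)/4 times the same inner product: A through Q
  -- on the two dipoles, 𝒦* through its transpose.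
  refine eq_zero_of_inner_dipole ha fun v => ?_
  have e1 : inner ℂ (J x) (D.toEnergy (D.dipoleL20 v)) = inner ℂ (J (D.toEnergy (D.dipoleL20 v))) x := by
    rw [← hJi, hJJ]
  set X := inner ℂ (J (D.toEnergy (D.dipoleL20 v))) (D.toEnergy (D.dipoleL20 w)) with hX
  have e2 : inner ℂ (J (D.toEnergy (D.dipoleL20 w))) (D.toEnergy (D.dipoleL20 v)) = X := by
    rw [← hJi, hJJ]
  have e3 : 4 * inner ℂ (J (D.toEnergy (D.dipoleL20 v))) (A (D.toEnergy (D.dipoleL20 w))) =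
      -(D.side v + D.side w) * X := by
    rw [← inner_smul_right, hA, inner_add_right, hJi, hQs, hQ, hQ, inner_smul_right, inner_smul_right, e2]
    ring
  have e4 : 4 * inner ℂ (J (D.toEnergy (D.dipoleL20 v))) (D.toEnergy (T (D.dipoleL20 w))) =
      -(D.side v + D.side w) * X := by
    have hu := isHolder_singleLayerFun_dipole (v := (v : ℂ)) ha v.2
    rw [hX, hJ, inner_conj_dipole ha, inner_conj_dipole ha, hT, integral_mul_npOperator ha ha1 hu.measurable hu.memLp]
    have h1 : ∀ f : ℂ → ℂ, ∫ x, f x * ((D.dipoleL20 w : D.L20) : D.L2) x ∂D.arcLength =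
        ∫ x, f x * D.dipole w x ∂D.arcLength := fun f => by
      refine integral_congr_ae ?_
      filter_upwards [coeFn_dipoleL20 w] with x hx
      rw [hx]
    rw [h1, h1, integral_doubleLayerFun_mul_dipole ha ha1 v.2 w.2]
    ring
  have e5 : (4 : ℂ) * inner ℂ (J (D.toEnergy (D.dipoleL20 v))) x = 0 := by
    rw [hx, inner_sub_right, mul_sub, e3, e4, sub_self]
  rw [e1]
  exact (mul_eq_zero.mp e5).resolve_left (by norm_num)

/-- The numbers `±1/2` are not eigenvalues on `L²₀`. -/
theorem eq_zero_of_average_eq (ha : 0 < a) (ha1 : a ≤ 1) {Q A : D.Energy →L[ℂ] D.Energy} {J : D.Energy → D.Energy}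
    (hQs : ∀ x y, inner ℂ (Q x) y = inner ℂ x (Q y)) (hQQ : ∀ x, Q (Q x) = x)
    (hQ : ∀ v, Q (D.toEnergy (D.dipoleL20 v)) = (-D.side v : ℂ) • D.toEnergy (D.dipoleL20 v))
    (hJ : ∀ φ, J (D.toEnergy φ) = D.toEnergy (conjL20 φ)) (hJc : ∀ (c : ℂ) x, J (c • x) = starRingEnd ℂ c • J x)
    (hJJ : ∀ x, J (J x) = x) (hJi : ∀ x y, inner ℂ (J x) (J y) = inner ℂ y x)
    (hA : ∀ x, (4 : ℂ) • A x = Q x + J (Q (J x))) {κ : ℝ} (hκ : κ * κ = 1) {φ : D.L20}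
    (hφ : A (D.toEnergy φ) = (κ / 2 : ℂ) • D.toEnergy φ) : φ = 0 := by
  have hx : Q (D.toEnergy φ) + J (Q (J (D.toEnergy φ))) = (2 * κ : ℂ) • D.toEnergy φ := by
    rw [← hA, hφ, smul_smul]; congr 1; ring
  obtain ⟨h1, h2⟩ := eq_smul_of_average hQs hQQ hJi hκ hx
  have h3 : Q (D.toEnergy (conjL20 φ)) = (κ : ℂ) • D.toEnergy (conjL20 φ) := by
    rw [← hJ, ← hJJ (Q _), h2, hJc, Complex.conj_ofReal]
  -- Q is symmetric, and on dipoles of side κ its eigenvalue is -κ, so these are orthogonal to every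
  -- x with Q x = κ x. This applies to φ and to its conjugate.
  have horth : ∀ {x : D.Energy}, Q x = (κ : ℂ) • x → ∀ v : (D.curveᶜ : Set ℂ), D.side v = κ →
      inner ℂ (D.toEnergy (D.dipoleL20 v)) x = 0 := fun {x} hx v hv => by
    have h := hQs (D.toEnergy (D.dipoleL20 v)) x
    rw [hQ, hx, inner_smul_left, inner_smul_right, hv, map_neg, Complex.conj_ofReal] at h
    have hκ0 : (κ : ℂ) ≠ 0 := by
      rintro h0
      rw [Complex.ofReal_eq_zero.mp h0] at hκ
      norm_num at hκ
    have h' : (κ : ℂ) * inner ℂ (D.toEnergy (D.dipoleL20 v)) x = 0 := by linear_combination -h / 2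
    exact (mul_eq_zero.mp h').resolve_left hκ0
  set f : ℂ → ℂ := ⇑(φ : D.L2) with hf
  have hfm : Measurable f := measurable_coeFn _
  have hu : D.IsHolder (D.singleLayerFun f) := isHolder_singleLayerFun ha hfm (Lp.memLp (φ : D.L2))
  obtain ⟨M, hM⟩ := exists_isSchurKernel_singleLayer (D := D) ha
  have hswap : ∀ v : (D.curveᶜ : Set ℂ), ∀ ψ : D.L20, inner ℂ (D.toEnergy (D.dipoleL20 v)) (D.toEnergy ψ) = 0 →
      ∫ y, starRingEnd ℂ (D.singleLayerFun (ψ : D.L2) y) * D.dipole v y ∂D.arcLength = 0 := fun v ψ h => by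
    rw [← inner_conj_symm, map_eq_zero, inner_toEnergy_eq ha ψ _ (f := fun y => starRingEnd ℂ ((ψ : D.L2) y))
      (Complex.continuous_conj.measurable.comp (measurable_coeFn (ψ : D.L2)))
      (by simp only [Complex.conj_conj]; exact EventuallyEq.rfl), neg_eq_zero] at h
    rw [← h]
    refine integral_congr_ae ?_
    filter_upwards [coeFn_dipoleL20 v] with y hy
    rw [hy, singleLayerFun_conj]
  have hconj : ∀ y, D.singleLayerFun (conjL20 φ : D.L2) y = starRingEnd ℂ (D.singleLayerFun f y) := fun y => by
    rw [← singleLayerFun_conj]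
    refine integral_congr_ae ?_
    filter_upwards [coeFn_conjL20 φ] with x hx
    rw [hx]
  -- The potential and its conjugate are orthogonal to all dipoles on one side, so the potential is
  -- constant and the energy of the mean-zero φ is zero.
  obtain ⟨c, hc⟩ := hu.exists_ae_eq_const hκ ha ha1
    (fun v hv hs => by
      have := hswap ⟨v, hv⟩ (conjL20 φ) (horth h3 ⟨v, hv⟩ hs)
      simpa only [hconj, Complex.conj_conj] using this)
    (fun v hv hs => hswap ⟨v, hv⟩ φ (horth h1 ⟨v, hv⟩ hs))
  refine injective_toEnergy (D := D) ha ?_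
  rw [map_zero, ← inner_self_eq_zero (𝕜 := ℂ), inner_toEnergy ha, inner_eq_integral, neg_eq_zero]
  have h4 : ∫ x, starRingEnd ℂ ((φ : D.L2) x) * D.singleLayer φ x ∂D.arcLength =
      ∫ x, c * starRingEnd ℂ ((φ : D.L2) x) ∂D.arcLength := by
    refine integral_congr_ae ?_
    filter_upwards [hc, D.isIntegralOperator_singleLayer ha φ] with x h5 h6
    rw [h6.2]
    change _ * D.singleLayerFun f x = _
    rw [h5, mul_comm]
  rw [h4, integral_const_mul, integral_conj, (φ.2 : ∫ x, (φ : D.L2) x ∂D.arcLength = 0), map_zero, mul_zero]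

end PlanarDomain

/-! ### The eigensystem and the coordinate functionals on ℋ. -/

namespace PlanarDomain

variable {a : ℝ} {D : PlanarDomain a}

theorem not_finiteDimensional_energy (ha : 0 < a) : ¬ FiniteDimensional ℂ D.Energy := fun _ =>
  not_finiteDimensional_L20 (D := D) ha (Module.Finite.of_injective D.toEnergy (injective_toEnergy ha))

theorem separableSpace_energy (ha : 0 < a) : TopologicalSpace.SeparableSpace D.Energy :=
  D.denseRange_toEnergy.separableSpace (continuous_toEnergy ha)

/-- The energy inner product is that of L² with the compact operator -𝒮, compressed to L²₀,
inserted; this is the setting of `IsCompactOperator.of_symmetrizable`. -/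
theorem isCompactOperator_of_extends (ha : 0 < a) {T : D.L20 →L[ℂ] D.L20} (hT : IsCompactOperator T)
    {A : D.Energy →L[ℂ] D.Energy} (hA : ∀ x y, inner ℂ (A x) y = inner ℂ x (A y))
    (hAT : ∀ φ, A (D.toEnergy φ) = D.toEnergy (T φ)) : IsCompactOperator A := by
  let S : D.L20 →L[ℂ] D.L20 := -(D.L20.orthogonalProjectionOnto ∘L (D.singleLayer ∘L D.L20.subtypeL))
  have hS : IsCompactOperator S :=
    (((D.isCompactOperator_singleLayer ha).comp_clm D.L20.subtypeL).clm_comp D.L20.orthogonalProjectionOnto).neg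
  refine IsCompactOperator.of_symmetrizable (not_finiteDimensional_L20 ha)
    (ι := ⟨D.toEnergy, continuous_toEnergy ha⟩) (injective_toEnergy ha) D.denseRange_toEnergy hT hS
    (fun φ ψ => ?_) hA hAT
  change inner ℂ (D.toEnergy φ) (D.toEnergy ψ) =
    inner ℂ φ (-(D.L20.orthogonalProjectionOnto (D.singleLayer (ψ : D.L2))))
  rw [inner_toEnergy ha, inner_neg_right, Submodule.inner_orthogonalProjectionOnto_eq_of_mem_left]

/-- An eigenvector of a symmetric operator for a real μ is orthogonal to the range of μ - A, which
contains the dense image of L²₀ as soon as μ - T is onto. -/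
theorem eq_zero_of_surjective {T : D.L20 →L[ℂ] D.L20} {A : D.Energy →L[ℂ] D.Energy}
    (hA : ∀ x y, inner ℂ (A x) y = inner ℂ x (A y)) (hAT : ∀ φ, A (D.toEnergy φ) = D.toEnergy (T φ)) {μ : ℝ}
    (hs : ∀ φ : D.L20, ∃ χ, (μ : ℂ) • χ - T χ = φ) {x : D.Energy} (hx : A x = (μ : ℂ) • x) : x = 0 := by
  refine D.denseRange_toEnergy.eq_zero_of_inner_left ℂ fun φ => ?_
  obtain ⟨χ, rfl⟩ := hs φ
  rw [map_sub, map_smul, ← hAT, inner_sub_right, ← hA, hx, inner_smul_left, inner_smul_right, Complex.conj_ofReal,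
    sub_self]

theorem exists_sub_eq_of_mem_resolventSet {E : Type*} [NormedAddCommGroup E] [NormedSpace ℂ E] {T : E →L[ℂ] E} {μ : ℂ}
    (h : μ ∈ resolventSet ℂ T) : ∃ B : E →L[ℂ] E, (∀ x, μ • B x - T (B x) = x) ∧ ∀ x, B (μ • x - T x) = x := by
  obtain ⟨u, hu⟩ := spectrum.mem_resolventSet_iff.mp h
  have h1 : ∀ x, (u : E →L[ℂ] E) x = μ • x - T x := fun x => by
    rw [hu, Algebra.algebraMap_eq_smul_one]; rfl
  refine ⟨(↑u⁻¹ : E →L[ℂ] E), fun x => ?_, fun x => ?_⟩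
  · rw [← h1]
    exact DFunLike.congr_fun u.mul_inv x
  · rw [← h1]
    exact DFunLike.congr_fun u.inv_mul x

/-- The symmetric extension of the Neumann-Poincaré operator to the energy space. -/
theorem exists_npExtension (ha : 0 < a) (ha1 : a ≤ 1) : ∃ (T : D.L20 →L[ℂ] D.L20) (A : D.Energy →L[ℂ] D.Energy),
    (∀ φ, (T φ : D.L2) = D.npOperator φ) ∧ (∀ φ, A (D.toEnergy φ) = D.toEnergy (T φ)) ∧
    (∀ x y, inner ℂ (A x) y = inner ℂ x (A y)) ∧ (1 / 2 : ℂ) ∈ resolventSet ℂ T ∧ (1 / 2 : ℂ) ∈ resolventSet ℂ A ∧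
    ∃ (ev : ℕ → ℝ) (plus minus : ℕ → D.Energy), (∀ i, 0 ≤ ev i) ∧ (∀ i, ev i < 1 / 2) ∧
      Tendsto ev atTop (𝓝 0) ∧ (∀ i, A (plus i) = (ev i : ℂ) • plus i) ∧
      (∀ i, A (minus i) = (-(ev i) : ℂ) • minus i) ∧ Orthonormal ℂ (Sum.elim plus minus) ∧
      (Submodule.span ℂ (range (Sum.elim plus minus))).topologicalClosure = ⊤ := by
  have := separableSpace_energy (D := D) ha
  obtain ⟨T, hT, hTc⟩ := exists_npL20 (D := D) ha ha1
  obtain ⟨Q, hQs, hQQ, hQ⟩ := exists_energyReflection (D := D) ha ha1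
  obtain ⟨J, hJ, hJa, hJc, hJJ, hJi⟩ := exists_energyConj (D := D) ha
  obtain ⟨A, hA, hAs⟩ := exists_average_conj hQs hJa hJc hJJ hJi
  have hAT := average_toEnergy ha ha1 hT hQs hQ hJ hJJ hJi hA
  have hAc := isCompactOperator_of_extends ha hTc hAs hAT
  -- Fredholm alternative for the compact T; since ±1/2 are not eigenvalues on L²₀, they are in its
  -- resolvent set. By `eq_zero_of_surjective` they are not eigenvalues on ℋ either.
  have hres : ∀ κ : ℝ, κ * κ = 1 → ((κ / 2 : ℝ) : ℂ) ∈ resolventSet ℂ T := fun κ hκ => by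
    refine (hTc.hasEigenvalue_or_mem_resolventSet ?_).resolve_left fun h => ?_
    · norm_cast
      rintro h
      nlinarith
    · obtain ⟨φ, hφ⟩ := h.exists_hasEigenvector
      refine hφ.2 (eq_zero_of_average_eq ha ha1 hQs hQQ hQ hJ hJc hJJ hJi hA hκ ?_)
      have h1 : T φ = ((κ / 2 : ℝ) : ℂ) • φ := hφ.apply_eq_smul
      rw [hAT, h1, map_smul]
      push_cast
      rfl
  have hzero : ∀ κ : ℝ, κ * κ = 1 → ∀ x, A x = ((κ / 2 : ℝ) : ℂ) • x → x = 0 := fun κ hκ x hx => by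
    obtain ⟨B, hB, -⟩ := exists_sub_eq_of_mem_resolventSet (hres κ hκ)
    exact eq_zero_of_surjective hAs hAT (fun φ => ⟨B φ, hB φ⟩) hx
  have e1 : ((1 / 2 : ℝ) : ℂ) = 1 / 2 := by push_cast; rfl
  refine ⟨T, A, hT, hAT, hAs, e1 ▸ hres 1 (by norm_num), ?_, ?_⟩
  · refine (hAc.hasEigenvalue_or_mem_resolventSet (by norm_num)).resolve_left fun h => ?_
    obtain ⟨x, hx⟩ := h.exists_hasEigenvector
    exact hx.2 (hzero 1 (by norm_num) x (by rw [e1]; exact hx.apply_eq_smul))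
  · refine exists_symmetric_eigensystem (not_finiteDimensional_energy ha) hQs hQQ hJa hJc hJJ hJi hA hAc
      (fun x hx => hzero 1 (by norm_num) x (by rw [e1, hx])) (fun x hx => hzero (-1) (by norm_num) x ?_)
    rw [hx]
    congr 1
    push_cast
    ring

/-- C fixes the identity function, whose tangential derivative is τ = iν. Integration by parts
therefore evaluates the remaining conjugated term as a potential of ν. -/
theorem doubleLayerFun_id (ha : 0 < a) (ha1 : a ≤ 1) {x : ℂ} (hx : x ∈ D.curve) :
    D.doubleLayerFun (fun y => y) x = 1 / 2 * x + D.singleLayerFun D.normal x := by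
  have h1 := isHolder_id.doubleLayerFun_eq ha ha1 hx
  have h2 := D.singleLayerFun_deriv ha (F := fun y => y) (F' := fun _ => 1) measurable_id measurable_const
    (fun y _ => hasDerivAt_id y) (B := 1) (L := 1) zero_le_one (by simp) (by simp) hx
  have h3 : D.singleLayerFun (fun y => 1 * D.tangent y) x = Complex.I * D.singleLayerFun D.normal x := by
    rw [singleLayerFun, singleLayerFun, ← integral_const_mul]
    congr 1; ext y
    rw [tangent]; ring
  rw [h3] at h2
  rw [cauchyTransform_id] at h1 h2
  rw [h1]
  linear_combination Complex.I * h2 - (D.singleLayerFun D.normal x + 1 / 4 * (x -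
    starRingEnd ℂ (D.cauchyTransform (fun y => starRingEnd ℂ y) x))) * Complex.I_mul_I

theorem integral_ofReal_mul_coord {k : ℂ → ℝ} {u : ℂ → ℂ} (h : Integrable (fun y => (k y : ℂ) * u y) D.arcLength)
    (j : Fin 2) : ∫ y, (k y : ℂ) * (coord j (u y) : ℂ) ∂D.arcLength =
      (coord j (∫ y, (k y : ℂ) * u y ∂D.arcLength) : ℂ) := by
  fin_cases j
  · have := integral_re h
    simp only [coord, Complex.re_ofReal_mul, RCLike.re_to_complex] at this ⊢
    simp [← this, ← integral_complex_ofReal]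
  · have := integral_im h
    simp only [coord, Complex.im_ofReal_mul, RCLike.im_to_complex] at this ⊢
    simp [← this, ← integral_complex_ofReal]

theorem memLp_normal : MemLp D.normal 2 D.arcLength :=
  MemLp.of_bound D.measurable_normal.aestronglyMeasurable 1 (Eventually.of_forall D.norm_normal_le)

theorem measurable_coord (j : Fin 2) : Measurable fun y => (coord j y : ℂ) := by
  unfold coord
  fin_cases j
  · exact Complex.measurable_ofReal.comp Complex.measurable_re
  · exact Complex.measurable_ofReal.comp Complex.measurable_im

theorem memLp_coord (j : Fin 2) : MemLp (fun y => (coord j y : ℂ)) 2 D.arcLength := by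
  obtain ⟨B, -, hB⟩ := (isHolder_id (D := D)).exists_norm_le
  refine MemLp.of_bound (measurable_coord j).aestronglyMeasurable B (D.ae_mem_curve.mono fun x hx => ?_)
  refine le_trans ?_ (hB x hx)
  unfold coord
  fin_cases j
  · simpa using Complex.abs_re_le_norm x
  · simpa using Complex.abs_im_le_norm x

theorem coord_add_half (j : Fin 2) (x w : ℂ) : (coord j (1 / 2 * x + w) : ℂ) = 1 / 2 * (coord j x : ℂ) + (coord j w : ℂ) := by
  have h : (1 / 2 : ℂ) = ((1 / 2 : ℝ) : ℂ) := by push_cast; rfl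
  rw [h]
  unfold coord
  fin_cases j
  · simp only [Fin.zero_eta, Matrix.cons_val_zero, Complex.add_re, Complex.re_ofReal_mul]; push_cast; rfl
  · simp only [Fin.mk_one, Matrix.cons_val_one, Matrix.cons_val_fin_one, Complex.add_im, Complex.im_ofReal_mul]
    push_cast; rfl

theorem doubleLayerFun_coord (ha : 0 < a) (ha1 : a ≤ 1) (j : Fin 2) {x : ℂ} (hx : x ∈ D.curve) :
    D.doubleLayerFun (fun y => (coord j y : ℂ)) x = 1 / 2 * (coord j x : ℂ) + D.singleLayerFun (D.normalComp j) x := by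
  have h1 : Integrable (fun y => (singleLayerKernel x y : ℂ) * D.normal y) D.arcLength :=
    integrable_singleLayerKernel_mul ha D.measurable_normal memLp_normal hx
  have h2 : Integrable (fun y => (D.npKernel y x : ℂ) * y) D.arcLength := by
    obtain ⟨B, -, hB⟩ := (isHolder_id (D := D)).exists_norm_le
    exact (integrable_npKernel ha ha1 hx).mul_bdd (c := B) measurable_id.aestronglyMeasurable
      (D.ae_mem_curve.mono hB)
  have h3 := integral_ofReal_mul_coord h2 j
  have h4 := integral_ofReal_mul_coord h1 j
  change D.doubleLayerFun _ x = (coord j (D.doubleLayerFun (fun y => y) x) : ℂ) at h3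
  change D.singleLayerFun (D.normalComp j) x = (coord j (D.singleLayerFun D.normal x) : ℂ) at h4
  rw [h3, h4, doubleLayerFun_id ha ha1 hx, coord_add_half]

/-- The operator `1/2 - 𝒦` carries the coordinates to single layer potentials of the normal. -/
theorem integral_coord_eq (ha : 0 < a) (ha1 : a ≤ 1) {T : D.L20 →L[ℂ] D.L20}
    (hT : ∀ φ, (T φ : D.L2) = D.npOperator φ) (j : Fin 2) (χ : D.L20) :
    ∫ y, (coord j y : ℂ) * (((1 / 2 : ℂ) • χ - T χ : D.L20) : D.L2) y ∂D.arcLength =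
      inner ℂ (D.toEnergy (D.nu j)) (D.toEnergy χ) := by
  have hν : ((D.nu j : D.L20) : D.L2) =ᵐ[D.arcLength] fun x => starRingEnd ℂ (D.normalComp j x) := by
    filter_upwards [(D.memLp_normalComp j).coeFn_toLp] with x hx
    exact hx.trans (Complex.conj_ofReal _).symm
  have hu : D.IsHolder (D.singleLayerFun (D.normalComp j)) :=
    isHolder_singleLayerFun ha (D.measurable_normalComp j) (D.memLp_normalComp j)
  have hc := memLp_coord (D := D) j
  have hI : ∀ {u : ℂ → ℂ}, MemLp u 2 D.arcLength → ∀ φ : D.L2, Integrable (fun y => u y * φ y) D.arcLength :=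
    fun hu φ => hu.integrable_mul (Lp.memLp φ)
  rw [inner_toEnergy_eq ha _ _ (D.measurable_normalComp j) hν]
  have e1 : ∫ y, (coord j y : ℂ) * (((1 / 2 : ℂ) • χ - T χ : D.L20) : D.L2) y ∂D.arcLength =
      ∫ y, (1 / 2 * ((coord j y : ℂ) * (χ : D.L2) y) - (coord j y : ℂ) * D.npOperator χ y) ∂D.arcLength := by
    refine integral_congr_ae ?_
    rw [Submodule.coe_sub, Submodule.coe_smul, hT]
    filter_upwards [Lp.coeFn_sub ((1 / 2 : ℂ) • (χ : D.L2)) (D.npOperator χ),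
      Lp.coeFn_smul (1 / 2 : ℂ) (χ : D.L2)] with y h1 h2
    rw [h1, Pi.sub_apply, h2, Pi.smul_apply, smul_eq_mul]
    ring
  have e2 : ∫ y, D.doubleLayerFun (fun y => (coord j y : ℂ)) y * (χ : D.L2) y ∂D.arcLength =
      ∫ y, (1 / 2 * ((coord j y : ℂ) * (χ : D.L2) y) + D.singleLayerFun (D.normalComp j) y * (χ : D.L2) y) ∂D.arcLength := by
    refine integral_congr_ae ?_
    filter_upwards [D.ae_mem_curve] with y hy
    rw [doubleLayerFun_coord ha ha1 j hy]
    ring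
  rw [e1, integral_sub ((hI hc _).const_mul _) (hI hc _), integral_mul_npOperator ha ha1 (measurable_coord j) hc, e2,
    integral_add ((hI hc _).const_mul _) (hI hu.memLp _)]
  ring

/-- By `integral_coord_eq` the functional is the energy product with ν_j after (1/2 - 𝒦*)⁻¹. The
inverses on L²₀ and on ℋ agree, and the latter is bounded for the energy norm. -/
theorem exists_isPairing (ha : 0 < a) (ha1 : a ≤ 1) (j : Fin 2) : ∃ Y, D.IsPairing j Y := by
  obtain ⟨T, A, hT, hAT, -, hT2, hA2, -⟩ := exists_npExtension (D := D) ha ha1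
  obtain ⟨B, -, hB⟩ := exists_sub_eq_of_mem_resolventSet hA2
  obtain ⟨R, hR, -⟩ := exists_sub_eq_of_mem_resolventSet hT2
  refine ⟨innerSL ℂ (D.toEnergy (D.nu j)) ∘L B, fun φ => ?_⟩
  have h1 : B (D.toEnergy φ) = D.toEnergy (R φ) := by
    nth_rewrite 1 [← hR φ]
    rw [map_sub, map_smul, ← hAT, hB]
  change inner ℂ (D.toEnergy (D.nu j)) (B (D.toEnergy φ)) = _
  rw [h1, ← integral_coord_eq ha ha1 hT j, hR]

theorem wellDefined (ha : 0 < a) (ha1 : a ≤ 1) : D.WellDefined where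
  singleLayer := D.isIntegralOperator_singleLayer ha
  npOperator := D.isIntegralOperator_npOperator ha ha1
  energy := energyPosDef ha
  npEnergy := by
    obtain ⟨T, A, hT, hAT, -⟩ := exists_npExtension (D := D) ha ha1
    have h : ∃ T, D.IsNPExtension T := ⟨A, fun φ => ⟨T φ, hT φ, hAT φ⟩⟩
    rw [npEnergy, dif_pos h]
    exact h.choose_spec
  pairing j := by
    rw [PlanarDomain.pairing, dif_pos (exists_isPairing ha ha1 j)]
    exact (exists_isPairing ha ha1 j).choose_spec

theorem npEnergy_eq (ha : 0 < a) (ha1 : a ≤ 1) {T : D.L20 →L[ℂ] D.L20}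
    (hT : ∀ φ, (T φ : D.L2) = D.npOperator φ) {A : D.Energy →L[ℂ] D.Energy}
    (hAT : ∀ φ, A (D.toEnergy φ) = D.toEnergy (T φ)) : D.npEnergy = A := by
  refine DFunLike.coe_injective (D.denseRange_toEnergy.equalizer D.npEnergy.continuous A.continuous ?_)
  funext φ
  obtain ⟨ψ, h1, h2⟩ := (wellDefined ha ha1).npEnergy φ
  change D.npEnergy (D.toEnergy φ) = A (D.toEnergy φ)
  rw [h2, hAT, Subtype.ext (h1.trans (hT φ).symm)]

end PlanarDomain

/-! ### Resolvents, eigenvector expansions and the contour integral. -/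

theorem HasSum.add_inl_inr {H : Type*} [NormedAddCommGroup H] [CompleteSpace H] {F : ℕ ⊕ ℕ → H} {g : H} (h : HasSum F g) :
    HasSum (fun n => F (Sum.inl n) + F (Sum.inr n)) g := by
  have h1 := (h.summable.comp_injective Sum.inl_injective).hasSum
  have h2 := (h.summable.comp_injective Sum.inr_injective).hasSum
  rw [h.unique (h1.sum h2)]
  exact h1.add h2

theorem continuousOn_resolvent_apply {E : Type*} [NormedAddCommGroup E] [NormedSpace ℂ E] [CompleteSpace E] (T : E →L[ℂ] E)
    (x : E) : ContinuousOn (fun w => resolvent T w x) (resolventSet ℂ T) := fun w hw => by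
  have h1 : ContinuousAt (resolvent T) w := (spectrum.hasDerivAt_resolvent_const_left hw).continuousAt
  exact (h1.clm_apply continuousAt_const).continuousWithinAt

section Abstract

variable {H : Type*} [NormedAddCommGroup H] [InnerProductSpace ℂ H] [CompleteSpace H] {κ : Type*}

/-- Bounded multipliers preserve square summability of the coefficients. -/
theorem Orthonormal.exists_diagonal {v : κ → H} (hv : Orthonormal ℂ v)
    (hc : (Submodule.span ℂ (range v)).topologicalClosure = ⊤) {c : κ → ℂ} {C : ℝ} (hC : ∀ i, ‖c i‖ ≤ C) (h : H) :
    ∃ g, ∀ i, inner ℂ (v i) g = c i * inner ℂ (v i) h := by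
  let b := HilbertBasis.mk hv hc.ge
  have hb : ∀ i, b i = v i := fun i => by rw [HilbertBasis.coe_mk]
  have hm : Memℓp (fun i => c i * inner ℂ (v i) h) 2 := by
    refine ((lp.memℓp (b.repr h)).norm.const_mul C).mono fun i => ?_
    change _ ≤ C * ‖b.repr h i‖
    rw [norm_mul, b.repr_apply_apply, hb]
    exact mul_le_mul_of_nonneg_right (hC i) (norm_nonneg _)
  refine ⟨b.repr.symm ⟨_, hm⟩, fun i => ?_⟩
  rw [← hb, ← b.repr_apply_apply, LinearIsometryEquiv.apply_symm_apply, hb]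

theorem Orthonormal.hasSum_inner_smul {v : κ → H} (hv : Orthonormal ℂ v)
    (hc : (Submodule.span ℂ (range v)).topologicalClosure = ⊤) (g : H) : HasSum (fun i => inner ℂ (v i) g • v i) g := by
  have := (HilbertBasis.mk hv hc.ge).hasSum_repr g
  simpa only [HilbertBasis.repr_apply_apply, HilbertBasis.coe_mk] using this

end Abstract

namespace PlanarDomain

variable {a : ℝ} {D : PlanarDomain a}

theorem integral_smul_sub (ha : 0 < a) (ha1 : a ≤ 1) (μ : ℂ) (φ : D.L2) :
    ∫ x, (μ • φ - D.npOperator φ) x ∂D.arcLength = (μ - 1 / 2) * ∫ x, φ x ∂D.arcLength := by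
  have e1 : ∫ x, (μ • φ - D.npOperator φ) x ∂D.arcLength = ∫ x, (μ * φ x - D.npOperator φ x) ∂D.arcLength := by
    refine integral_congr_ae ?_
    filter_upwards [Lp.coeFn_sub (μ • φ) (D.npOperator φ), Lp.coeFn_smul μ φ] with y h1 h2
    rw [h1, Pi.sub_apply, h2, Pi.smul_apply, smul_eq_mul]
  rw [e1, integral_sub ((D.integrable_L2 φ).const_mul _) (D.integrable_L2 _), integral_const_mul,
    integral_npOperator ha ha1, sub_mul]

/-- The range of 1/2 - 𝒦* consists of functions of mean zero and misses the constant 1. -/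
theorem half_mem_spectrum (ha : 0 < a) (ha1 : a ≤ 1) : (1 / 2 : ℂ) ∈ spectrum ℂ D.npOperator := fun h => by
  obtain ⟨B, hB, -⟩ := exists_sub_eq_of_mem_resolventSet h
  have h1 := integral_smul_sub ha ha1 (1 / 2) (B (memLp_const (1 : ℂ)).toLp)
  rw [hB, sub_self, zero_mul, integral_congr_ae (memLp_const (1 : ℂ)).coeFn_toLp] at h1
  have : D.arcLength.real univ = 0 := by simpa using h1
  exact arcLength_ne_zero ha (Measure.measure_univ_eq_zero.mp ((measureReal_eq_zero_iff).mp this))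

/-- Outside of the spectrum, the resolvent preserves the functions of zero mean. -/
theorem mem_resolventSet_npL20 (ha : 0 < a) (ha1 : a ≤ 1) {T : D.L20 →L[ℂ] D.L20}
    (hT : ∀ φ, (T φ : D.L2) = D.npOperator φ) {μ : ℂ} (hμ : μ ∉ spectrum ℂ D.npOperator) :
    μ ∈ resolventSet ℂ T ∧ ∀ φ : D.L20, (resolvent T μ φ : D.L2) = resolvent D.npOperator μ φ := by
  have hμ' : μ ∈ resolventSet ℂ D.npOperator := not_not.mp hμ
  obtain ⟨B, hB, hB'⟩ := exists_sub_eq_of_mem_resolventSet hμ'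
  -- μ - 𝒦* multiplies means by μ - 1/2, so its inverse preserves mean zero.
  have hne : μ - 1 / 2 ≠ 0 := fun h => hμ (sub_eq_zero.mp h ▸ half_mem_spectrum ha ha1)
  have hmem : ∀ φ : D.L20, (B ∘L D.L20.subtypeL) φ ∈ D.L20 := fun φ => by
    have h1 := integral_smul_sub ha ha1 μ (B φ)
    rw [hB, (φ.2 : ∫ x, (φ : D.L2) x ∂D.arcLength = 0)] at h1
    exact (mul_eq_zero.mp h1.symm).resolve_left hne
  let R : D.L20 →L[ℂ] D.L20 := (B ∘L D.L20.subtypeL).codRestrict D.L20 hmem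
  have hR : ∀ φ : D.L20, (R φ : D.L2) = B φ := fun _ => rfl
  have e1 : (algebraMap ℂ (D.L20 →L[ℂ] D.L20) μ - T) * R = 1 := by
    ext1 φ
    rw [Algebra.algebraMap_eq_smul_one]
    refine Subtype.ext ?_
    change μ • (R φ : D.L2) - (T (R φ) : D.L2) = φ
    rw [hT, hR, hB]
  have e2 : R * (algebraMap ℂ (D.L20 →L[ℂ] D.L20) μ - T) = 1 := by
    ext1 φ
    rw [Algebra.algebraMap_eq_smul_one]
    refine Subtype.ext ?_
    change B (μ • (φ : D.L2) - (T φ : D.L2)) = φ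
    rw [hT, hB']
  have hu : IsUnit (algebraMap ℂ (D.L20 →L[ℂ] D.L20) μ - T) := ⟨⟨_, R, e1, e2⟩, rfl⟩
  refine ⟨spectrum.mem_resolventSet_iff.mpr hu, fun φ => ?_⟩
  have h1 : resolvent T μ = R := Ring.inverse_unit ⟨_, R, e1, e2⟩
  have h2 : (algebraMap ℂ (D.L2 →L[ℂ] D.L2) μ - D.npOperator) * B = 1 := by
    ext1 φ
    rw [Algebra.algebraMap_eq_smul_one]
    exact hB φ
  have h3 : B * (algebraMap ℂ (D.L2 →L[ℂ] D.L2) μ - D.npOperator) = 1 := by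
    ext1 φ
    rw [Algebra.algebraMap_eq_smul_one]
    exact hB' φ
  have h4 : resolvent D.npOperator μ = B := Ring.inverse_unit ⟨_, B, h2, h3⟩
  rw [h1, h4, hR]

/-- By symmetry, pairing with an eigenvector turns w - T into multiplication by w - μ. -/
theorem inner_resolvent {T : D.L20 →L[ℂ] D.L20} {A : D.Energy →L[ℂ] D.Energy}
    (hA : ∀ x y, inner ℂ (A x) y = inner ℂ x (A y)) (hAT : ∀ φ, A (D.toEnergy φ) = D.toEnergy (T φ)) {μ : ℝ} {x : D.Energy}
    (hx : A x = (μ : ℂ) • x) {w : ℂ} (hw : w ∈ resolventSet ℂ T) (hne : w ≠ μ) (φ : D.L20) :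
    inner ℂ x (D.toEnergy (resolvent T w φ)) = inner ℂ x (D.toEnergy φ) * (w - μ)⁻¹ := by
  have h1 : w • resolvent T w φ - T (resolvent T w φ) = φ := by
    have := DFunLike.congr_fun (Ring.mul_inverse_cancel _ hw) φ
    rwa [Algebra.algebraMap_eq_smul_one] at this
  have h2 : inner ℂ x (D.toEnergy φ) = (w - μ) * inner ℂ x (D.toEnergy (resolvent T w φ)) := by
    nth_rewrite 1 [← h1]
    rw [map_sub, map_smul, ← hAT, inner_sub_right, ← hA, hx, inner_smul_left, inner_smul_right, Complex.conj_ofReal, sub_mul]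
  rw [h2]
  field_simp [sub_ne_zero.mpr hne]

/-- Were μ outside the spectrum on L², then μ - T would be onto on L²₀ and no eigenvector for μ
could exist in ℋ. Thus the contour encloses every eigenvalue on ℋ. -/
theorem mem_spectrum_of_eigenvector (ha : 0 < a) (ha1 : a ≤ 1) {T : D.L20 →L[ℂ] D.L20}
    (hT : ∀ φ, (T φ : D.L2) = D.npOperator φ) {A : D.Energy →L[ℂ] D.Energy}
    (hA : ∀ x y, inner ℂ (A x) y = inner ℂ x (A y)) (hAT : ∀ φ, A (D.toEnergy φ) = D.toEnergy (T φ)) {μ : ℝ} {x : D.Energy}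
    (hx : A x = (μ : ℂ) • x) (h0 : x ≠ 0) : (μ : ℂ) ∈ spectrum ℂ D.npOperator := by
  by_contra hμ
  obtain ⟨B, hB, -⟩ := exists_sub_eq_of_mem_resolventSet (mem_resolventSet_npL20 ha ha1 hT hμ).1
  exact h0 (eq_zero_of_surjective hA hAT (fun φ => ⟨B φ, hB φ⟩) hx)

theorem Eigensystem.hasSum_calcTerm (e : D.Eigensystem) {f : ℂ → ℂ} {h g : D.Energy}
    (hp : ∀ i, inner ℂ (e.plus i) g = f (e.ev i) * inner ℂ (e.plus i) h)
    (hm : ∀ i, inner ℂ (e.minus i) g = f (-(e.ev i)) * inner ℂ (e.minus i) h) : HasSum (e.calcTerm f h) g := by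
  have h1 := (e.orthonormal.hasSum_inner_smul e.complete g).add_inl_inr
  simp only [Sum.elim_inl, Sum.elim_inr, hp, hm] at h1
  exact h1

theorem Eigensystem.exists_hasSum_calcTerm (e : D.Eigensystem) {f : ℂ → ℂ} {C : ℝ} (hp : ∀ i, ‖f (e.ev i)‖ ≤ C)
    (hm : ∀ i, ‖f (-(e.ev i))‖ ≤ C) (h : D.Energy) : ∃ g, HasSum (e.calcTerm f h) g := by
  obtain ⟨g, hg⟩ := e.orthonormal.exists_diagonal e.complete
    (c := Sum.elim (fun i => f (e.ev i)) (fun i => f (-(e.ev i)))) (C := C) (by rintro (i | i); exacts [hp i, hm i]) h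
  exact ⟨g, e.hasSum_calcTerm (fun i => hg (Sum.inl i)) (fun i => hg (Sum.inr i))⟩

theorem nonempty_eigensystem (ha : 0 < a) (ha1 : a ≤ 1) : Nonempty D.Eigensystem := by
  obtain ⟨T, A, hT, hAT, -, -, -, ev, plus, minus, h1, h2, h3, h4, h5, h6, h7⟩ := exists_npExtension (D := D) ha ha1
  have hA := npEnergy_eq ha ha1 hT hAT
  exact ⟨⟨ev, plus, minus, h1, h2, h3, fun i => hA ▸ h4 i, fun i => hA ▸ h5 i, h6, h7⟩⟩

/-- The contour integral of the resolvent, taken in the norm of L²₀, is an element g. Its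
coefficients in the eigenbasis are those of f(𝒦*)φ by Cauchy's formula, so the series sums to it in
ℋ. -/
theorem exists_hasSum_calcTerm_cauchyIntegral (ha : 0 < a) (ha1 : a ≤ 1) (e : D.Eigensystem) {U : Set ℂ} {f : ℂ → ℂ} {γ : ℝ → ℂ}
    (hU : IsOpen U) (hKU : spectrum ℂ D.npOperator ⊆ U) (hf : DifferentiableOn ℂ f U)
    (hγ : EnclosesIn γ (spectrum ℂ D.npOperator) U) (φ : D.L20) :
    ∃ g : D.L20, HasSum (e.calcTerm f (D.toEnergy φ)) (D.toEnergy g) ∧ ∀ j,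
      IntervalIntegrable (fun t => f (γ t) * (∫ y, (coord j y : ℂ) * resolvent D.npOperator (γ t) (φ : D.L2) y ∂D.arcLength) *
        deriv γ t) volume 0 1 ∧
      1 / (2 * Real.pi * Complex.I) * ∫ t in (0 : ℝ)..1, f (γ t) *
        (∫ y, (coord j y : ℂ) * resolvent D.npOperator (γ t) (φ : D.L2) y ∂D.arcLength) * deriv γ t =
          ∫ y, (coord j y : ℂ) * (g : D.L2) y ∂D.arcLength := by
  obtain ⟨T, A, hT, hAT, hAs, -⟩ := exists_npExtension (D := D) ha ha1
  have hA := npEnergy_eq ha ha1 hT hAT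
  have hres := fun {t : ℝ} (ht : t ∈ Icc (0 : ℝ) 1) => mem_resolventSet_npL20 ha ha1 hT (hγ.mem t ht).2
  have hfc : ContinuousOn (fun t => f (γ t)) (Icc 0 1) :=
    hf.continuousOn.comp hγ.isClosedCurve.continuousOn fun t ht => (hγ.mem t ht).1
  have hRc : ContinuousOn (fun t => resolvent T (γ t) φ) (Icc 0 1) :=
    (continuousOn_resolvent_apply T φ).comp hγ.isClosedCurve.continuousOn fun t ht => (hres ht).1
  have hc : ContinuousOn (fun t => f (γ t) • resolvent T (γ t) φ) (Icc 0 1) := hfc.smul hRc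
  have hi := hγ.isClosedCurve.integrable_smul_deriv hc
  have hii : IntervalIntegrable (fun t => deriv γ t • f (γ t) • resolvent T (γ t) φ) volume 0 1 :=
    (intervalIntegrable_iff_integrableOn_Ioc_of_le zero_le_one).mpr hi
  -- Integrating in L²₀ rather than in ℋ is what makes f(𝒦*)φ a function of mean zero on the curve.
  set g : D.L20 := (1 / (2 * Real.pi * Complex.I) : ℂ) • ∫ t in (0 : ℝ)..1, deriv γ t • f (γ t) • resolvent T (γ t) φ with hg
  have hfun : ∀ L : D.L20 →L[ℂ] ℂ, L g = 1 / (2 * Real.pi * Complex.I) *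
      ∫ t in (0 : ℝ)..1, deriv γ t * f (γ t) * L (resolvent T (γ t) φ) := fun L => by
    rw [hg, map_smul, ← L.intervalIntegral_comp_comm hii, smul_eq_mul]
    simp only [map_smul, smul_eq_mul, mul_assoc]
  -- Under the integral the eigenvector turns the resolvent into (γ t - μ)⁻¹, and Cauchy's formula
  -- at the spectral point μ yields f μ.
  have hcoef : ∀ {μ : ℝ} {x : D.Energy}, D.npEnergy x = (μ : ℂ) • x → x ≠ 0 →
      inner ℂ x (D.toEnergy g) = f μ * inner ℂ x (D.toEnergy φ) := fun {μ x} hx h0 => by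
    have hμ := mem_spectrum_of_eigenvector ha ha1 hT hAs hAT (hA ▸ hx) h0
    have h1 := hfun (innerSL ℂ x ∘L ⟨D.toEnergy, continuous_toEnergy ha⟩)
    change inner ℂ x (D.toEnergy g) = 1 / (2 * Real.pi * Complex.I) * ∫ t in (0 : ℝ)..1, deriv γ t * f (γ t) *
      inner ℂ x (D.toEnergy (resolvent T (γ t) φ)) at h1
    rw [h1, ← hγ.cauchyFormula hU hf hμ (hKU hμ), mul_assoc _ _ (inner ℂ x (D.toEnergy φ)), ← intervalIntegral.integral_mul_const]
    congr 1
    refine intervalIntegral.integral_congr fun t ht => ?_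
    rw [uIcc_of_le zero_le_one] at ht
    change _ = deriv γ t * f (γ t) * (γ t - μ)⁻¹ * inner ℂ x (D.toEnergy φ)
    have hne : γ t ≠ μ := fun h => (hγ.mem t ht).2 (h ▸ hμ)
    change deriv γ t * f (γ t) * inner ℂ x (D.toEnergy (resolvent T (γ t) φ)) = _
    rw [inner_resolvent hAs hAT (hA ▸ hx) (hres ht).1 hne]
    ring
  refine ⟨g, e.hasSum_calcTerm (fun i => hcoef (e.np_plus i) (e.orthonormal.ne_zero (Sum.inl i))) (fun i => ?_), fun j => ?_⟩
  · have := hcoef (μ := -e.ev i) (by push_cast; exact e.np_minus i) (e.orthonormal.ne_zero (Sum.inr i))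
    push_cast at this
    exact this
  · let L : D.L20 →L[ℂ] ℂ := D.pairing j ∘L ⟨D.toEnergy, continuous_toEnergy ha⟩
    have hL : ∀ ψ : D.L20, L ψ = ∫ y, (coord j y : ℂ) * (ψ : D.L2) y ∂D.arcLength := (wellDefined ha ha1).pairing j
    have hLt : ∀ t ∈ Icc (0 : ℝ) 1, f (γ t) * (∫ y, (coord j y : ℂ) * resolvent D.npOperator (γ t) (φ : D.L2) y ∂D.arcLength) *
        deriv γ t = deriv γ t * f (γ t) * L (resolvent T (γ t) φ) := fun t ht => by
      rw [hL, (hres ht).2]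
      ring
    constructor
    · rw [intervalIntegrable_iff_integrableOn_Ioc_of_le zero_le_one]
      refine (integrableOn_congr_fun (fun t ht => ?_) measurableSet_Ioc).mpr (L.integrable_comp hi)
      change _ = L _
      rw [hLt t (Ioc_subset_Icc_self ht), map_smul, map_smul, smul_eq_mul, smul_eq_mul, mul_assoc]
    · rw [← hL, hfun]
      congr 1
      refine intervalIntegral.integral_congr fun t ht => hLt t ?_
      rwa [uIcc_of_le zero_le_one] at ht

end PlanarDomain

theorem lemma3p1 (a : ℝ) (ha0 : 0 < a) (ha1 : a ≤ 1) (D : PlanarDomain a) :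
    D.WellDefined ∧ Nonempty D.Eigensystem ∧
      ∀ (e : D.Eigensystem) (U : Set ℂ) (f : ℂ → ℂ) (γ : ℝ → ℂ),
        IsOpen U → spectrum ℂ D.npOperator ⊆ U → DifferentiableOn ℂ f U →
        EnclosesIn γ (spectrum ℂ D.npOperator) U →
        (∀ h : D.Energy, HasSum (e.calcTerm f h) (e.funCalc f h)) ∧
        ∃ g : Fin 2 → D.L20, (∀ k, D.toEnergy (g k) = e.funCalc f (D.toEnergy (D.nu k))) ∧
          ∀ j k,
            IntervalIntegrable
              (fun t => f (γ t) * D.polarizationTensor (γ t) j k * deriv γ t) volume 0 1 ∧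
            1 / (2 * Real.pi * Complex.I) *
                ∫ t in (0 : ℝ)..1, f (γ t) * D.polarizationTensor (γ t) j k * deriv γ t
              = ∫ y, (coord j y : ℂ) * (g k : D.L2) y ∂D.arcLength ∧
            HasSum (fun i => e.cPlus i j k * f (e.ev i) + e.cMinus i j k * f (-(e.ev i)))
              (∫ y, (coord j y : ℂ) * (g k : D.L2) y ∂D.arcLength) := by
  refine ⟨D.wellDefined ha0 ha1, D.nonempty_eigensystem ha0 ha1, fun e U f γ hU hKU hf hγ => ?_⟩
  obtain ⟨T, A, hT, hAT, hAs, -⟩ := PlanarDomain.exists_npExtension (D := D) ha0 ha1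
  have hA := PlanarDomain.npEnergy_eq ha0 ha1 hT hAT
  -- The spectrum is compact and contains all ±λ_i, so f is bounded on them; this gives convergence
  -- of the series for every h in ℋ.
  obtain ⟨C, hC⟩ := (spectrum.isCompact D.npOperator).exists_bound_of_continuousOn (hf.continuousOn.mono hKU)
  have hp : ∀ i, ‖f (e.ev i)‖ ≤ C := fun i => hC _ <| PlanarDomain.mem_spectrum_of_eigenvector ha0 ha1 hT hAs hAT
    (hA ▸ e.np_plus i) (e.orthonormal.ne_zero (Sum.inl i))
  have hm : ∀ i, ‖f (-(e.ev i))‖ ≤ C := fun i => hC _ <| by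
    have := PlanarDomain.mem_spectrum_of_eigenvector ha0 ha1 hT hAs hAT (μ := -e.ev i)
      (by push_cast; exact hA ▸ e.np_minus i) (e.orthonormal.ne_zero (Sum.inr i))
    push_cast at this
    exact this
  refine ⟨fun h => (e.exists_hasSum_calcTerm hp hm h).choose_spec.summable.hasSum, ?_⟩
  choose g hg using fun k => PlanarDomain.exists_hasSum_calcTerm_cauchyIntegral ha0 ha1 e hU hKU hf hγ (D.nu k)
  refine ⟨g, fun k => (hg k).1.tsum_eq.symm, fun j k => ⟨((hg k).2 j).1, ((hg k).2 j).2, ?_⟩⟩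
  -- The coordinate functional is continuous on ℋ, so it may be applied term by term to the
  -- unconditionally convergent series.
  have h1 := (D.pairing j).hasSum (hg k).1
  rw [(D.wellDefined ha0 ha1).pairing j] at h1
  convert! h1 using 1
  funext i
  simp only [PlanarDomain.Eigensystem.calcTerm, PlanarDomain.Eigensystem.cPlus,
    PlanarDomain.Eigensystem.cMinus, Matrix.of_apply, map_add, map_smul, smul_eq_mul]
  ring
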